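/- Notation. Let $\alpha=\sqrt5$, $\omega=(\alpha+1)/2$, $\beta=\omega^{-1}$, $\mathbb K=\mathbb Q(\sqrt5)$, and $\mathbf u_m=(\cos\frac{2\pi m}5,\sin\frac{2\pi m}5)$, $m=0,\dots,4$; points of the plane are written in the coordinates $(\mathbf u_0\cdot x,\mathbf u_1\cdot x)$, in which $\mathbf u_0,\dots,\mathbf u_4$ become $(1,0),(0,1),(-1,\beta),(-\beta,-\beta),(\beta,-1)$. A tile $[(m_i),(\epsilon_i),(b_i)]$ is the set of $x$ with $\mathbf u_{m_i}\cdot x<b_i$ if $\epsilon_i=1$ (excluded edge) and $\mathbf u_{m_i}\cdot x\ge b_i$ if $\epsilon_i=-1$ (included edge), for all $i$. $\mathtt R_k$ is the rotation by $2\pi k/5$, $\mathtt T_d$ the translation by $d$. A dressed domain is a finite family of disjoint tiles (atoms; empty atoms are allowed in limiting cases) with an isometry $\mathtt T_d\mathtt R_k$ on each; its domain is the union of the atoms. Two dressed domains are similar if a product of symmetries of the regular pentagon, a translation and a positive scaling carries atoms to atoms and conjugates the isometries. Merging atoms means replacing atoms that carry the same isometry by a single tile that is their union. A dressed sub-domain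 $\mathcal Y\triangleleft\mathcal X$ is a sub-domain with the first-return map induced by $\mathcal X$, each atom of $\mathcal Y$ moving rigidly through atoms of $\mathcal X$ until it returns (its return path); sub-domains recursively tile $\mathcal X$ if the return orbits of their atoms, together with the orbits of finitely many periodic tiles, form a partition of the domain of $\mathcal X$. A dressed domain is self-similar if a finite chain of inductions (each a recursively tiling dressed sub-domain, possibly after merging) leads to a non-empty dressed domain that is similar, with scaling factor $<1$, to an earlier one; it is renormalizable if after finitely many inductions and mergers it is recursively tiled by self-similar dressed sub-domains. A parametric dressed domain has fixed $m_i,\epsilon_i$ and rotations, while the $b_i$ and translations are affine functions of $(s,t)$ over $\mathbb K$. Its bifurcation-free set is the interior of the set of parameters for which all edges of its atoms have non-zero length; for a dressed sub-domain (or a periodic tile) one requires in addition that the tiles of the return orbits are included in the atoms prescribed by the return paths. The base triangle $\mathcal B(\tau)$ has the atoms $B_1=[(0,2,3),(1,1,1),(0,0,\omega-\omega\tau)]$, $B_2=[(1,4,0,3,2),(-1,1,1,-1,1),(\tau-\omega^2,\omega^2-\omega\tau,0,\omega-\omega\tau,0)]$, $B_3=[(1,0,4),(-1,1,-1),(\tau-\omega^2,0,\omega^2-\omega\tau)]$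 with the isometries $\mathtt T_{(\omega\tau-\omega,-\omega^2+\omega^2\tau)}\mathtt R_2$, $\mathtt T_{(0,\omega^2\tau-\omega^3)}\mathtt R_3$, $\mathtt T_{(\omega\tau-2\omega,\omega^2\tau-2\omega^2)}\mathtt R_2$; $\tilde{\mathcal B}(\tau)$ is obtained by changing the sign of all $b_i$, $\epsilon_i$ and translation vectors. Let $r(\tau)=\omega^2\tau$ for $0\le\tau<\beta^2$, $\omega^3(\beta-\tau)$ for $\beta^2<\tau<\beta$, $\omega^2(1-\tau)$ for $\beta<\tau<1$, and $r(\beta^2)=r(\beta)=0$. For real $s,t$ let $\mathcal R=\mathcal R(s,t)$ be the four-atom, three-parameter rhombus map restricted to $u=\beta$: its atoms are $R_1=[(0,1,2,1),(-1,-1,-1,1),(-t,-t,-s,1-s)]$, $R_2=[(0,1,2,1),(1,1,1,-1),(1-t,1-s,-s,-t)]$, $R_3=[(0,1,2,1),(-1,-1,-1,1),(-t,-s,-1-s+u,-t)]$, $R_4=[(0,1,2,1),(1,1,1,-1),(1-t,-t,-1-s+u,-s)]$ with isometries $\mathtt R_4,\ \mathtt T_{(0,1)}\mathtt R_4,\ \mathtt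 T_{(1,1-u)}\mathtt R_4,\ \mathtt T_{(1,2-u)}\mathtt R_4$, $u=\beta$. Let $\Pi^*$ be the open quadrilateral with vertices $(\beta^2,0)$, $(\beta^2+\beta^6/\alpha,\beta^6/\alpha)$, $(\beta^2+\beta^6/\alpha,\beta^4/\alpha)$, $(\beta^2,\beta^4/\alpha)$. Theorem. There are parametric dressed domains $\mathcal F(s,t)$ (eight atoms), $\mathcal F_1(s,t),\mathcal F_2(s,t)$ (three atoms), $\mathcal F_3(s,t)$ (four atoms) and parametric tiles $\mathcal P_1,\dots,\mathcal P_7$, with fixed return paths, such that $\bigcap_{i\le3}\Pi(\mathcal F_i)\cap\bigcap_{i\le7}\Pi(\mathcal P_i)=\Pi^*$, where $\Pi$ denotes bifurcation-free sets in $\mathcal F$; $\Pi^*$ is contained in the bifurcation-free sets of $\mathcal R$ and of $\mathcal F\triangleleft\mathcal R$; and for all $(s,t)\in\Pi^*$: (a) $R_1,\dots,R_4$ tile the rhombus $[(0,1,0,1),(-1,-1,1,1),(-t,-s,1-t,1-s)]$; $\mathcal F$ is the dressed sub-domain induced on the atom $R_1$, its eight atoms have distinct return paths, and their return orbits tile the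 rhombus. (b) $\mathcal F_1,\mathcal F_2,\mathcal F_3$ are dressed sub-domains of $\mathcal F$, $\mathcal P_1,\dots,\mathcal P_7$ are periodic tiles of $\mathcal F$ (five regular pentagons, one trapezoid, one rhombus), and the return orbits of the atoms of $\mathcal F_1,\mathcal F_2,\mathcal F_3$ together with the orbits of the $\mathcal P_i$ tile $\mathcal F$. (c) $\mathcal F_1\sim\mathcal B(\tau_1)$ and $\mathcal F_2\sim\mathcal B(\tau_2)$ with $\tau_1=\omega^6\sqrt5\,(s-\beta^2)$ and $\tau_2=\omega^4\sqrt5\,t$. Two atoms of $\mathcal F_3$, with five and four sides, carry the same isometry, although they have different return paths and different return times on the rhombus; after merging them $\mathcal F_3$ becomes a dressed domain $\mathcal C_3\sim\mathcal B(\tau_3)$ with $\tau_3=\omega^4\sqrt5\,(s-\beta^2)$. One further induction on $\mathcal C_3$ yields a recursively tiling dressed sub-domain similar to $\mathcal B(\omega^6\sqrt5\,(s-\beta^2))$. (d) $s,t\in\mathbb K$ if and only if $\tau_1,\tau_2,\tau_3$ are all eventually periodic under $r$. If $(s,t)\in\Pi^*\cap\mathbb K^2$, then $\mathcal F_1,\mathcal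 F_2,\mathcal C_3$ are self-similar, and $\mathcal F$ and $\mathcal R$ are renormalizable. (e) Let $E$ be the set of points of the rhombus that are not periodic under the map of $\mathcal R$, and $E_i$ the set of points of $E$ whose orbit visits $\mathcal F_i$. Then $E$ is the disjoint union of the invariant sets $E_1,E_2,E_3$. If $(s,t)\in\mathbb K^2$, each $E_i$ is non-empty and carries an ergodic invariant probability measure, so that the exceptional set $E$ has at least three ergodic components. Moreover $r$ is the renormalization function of the base triangles: $r$ maps $[0,1)$ to itself; for $0\le\tau<1$, $\mathcal B(\tau)$ has (up to merging) a recursively tiling dressed sub-domain similar, with scaling factor $<1$, to $\mathcal B(r(\tau))$ or $\tilde{\mathcal B}(r(\tau))$, and so does $\tilde{\mathcal B}(\tau)$ for $0<\tau<1$. -/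

import Mathlib

open Real Set MeasureTheory

namespace RhombusPWI

noncomputable section

/-! ### Arithmetic -/

/-- `ω = (√5 + 1)/2`. -/
def ω : ℝ := (√5 + 1) / 2

/-- `β = ω⁻¹ = (√5 - 1)/2`. -/
def β : ℝ := (√5 - 1) / 2

/-- The quadratic field `ℚ(√5)`, as a set of real numbers. -/
def Q5 : Set ℝ := {z | ∃ x y : ℚ, z = x + y * √5}

/-! ### Planar objects

The plane carries the coordinates `(u₀ · x, u₁ · x)`, where `u_m` is the unit vector with
argument `2πm/5`.  In these coordinates the rhombus is a square, and the linear form `x ↦ u_m · x`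
is given by the dot product with `dir m` below. -/

/-- The plane, in the coordinates above. -/
abbrev Plane := ℝ × ℝ

/-- The vectors `u_m`. -/
def dir : Fin 5 → Plane := ![(1, 0), (0, 1), (-1, β), (-β, -β), (β, -1)]

/-- The linear form `x ↦ u_m · x`. -/
def form (m : Fin 5) (x : Plane) : ℝ := (dir m).1 * x.1 + (dir m).2 * x.2

/-- A half-plane condition: `u_m · x ≥ b` if the edge is included (`ε = -1`), and
`u_m · x < b` if it is excluded (`ε = 1`). -/
structure Edge where
  m : Fin 5
  included : Bool
  b : ℝ

def Edge.Holds (e : Edge) (x : Plane) : Prop :=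
  if e.included then e.b ≤ form e.m x else form e.m x < e.b

def Edge.HoldsClosed (e : Edge) (x : Plane) : Prop :=
  if e.included then e.b ≤ form e.m x else form e.m x ≤ e.b

/-- A tile, given by finitely many half-plane conditions. -/
abbrev Tile := List Edge

/-- The tile `[(m₁,…,mₙ), (ε₁,…,εₙ), (b₁,…,bₙ)]`; `true` stands for `ε = -1` (included edge) and
`false` for `ε = 1` (excluded edge). -/
def mkTile (m : List (Fin 5)) (ε : List Bool) (b : List ℝ) : Tile :=
  List.zipWith (fun (q : Fin 5 × Bool) b => ⟨q.1, q.2, b⟩) (List.zip m ε) b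

/-- The set of points of a tile. -/
def Tile.region (X : Tile) : Set Plane := {x | ∀ e ∈ X, e.Holds x}

/-- The closed polygon of a tile. -/
def Tile.closedRegion (X : Tile) : Set Plane := {x | ∀ e ∈ X, e.HoldsClosed x}

/-- All edges of the polygon have non-zero length. -/
def Tile.Nondegenerate (X : Tile) : Prop :=
  ∀ e ∈ X, {x ∈ X.closedRegion | form e.m x = e.b}.Nontrivial

/-- Regular pentagon (up to the choice of included edges): the five edges have the same distance
`r` from the centre `c`. -/
def Tile.IsRegularPentagon (X : Tile) : Prop :=
  ∃ (c : Plane) (r σ : ℝ), 0 < r ∧ (σ = 1 ∨ σ = -1) ∧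
    X.closedRegion = {x | ∀ m, σ * (form m x - form m c) ≤ r}

/-- Rhombus: the intersection of two non-parallel strips of the same width. -/
def Tile.IsRhombus (X : Tile) : Prop :=
  ∃ (m m' : Fin 5) (a a' w : ℝ), m ≠ m' ∧ 0 < w ∧
    X.closedRegion = {x | (a ≤ form m x ∧ form m x ≤ a + w) ∧
      (a' ≤ form m' x ∧ form m' x ≤ a' + w)}

/-- Trapezoid: a quadrilateral whose four edges have three distinct directions. -/
def Tile.IsTrapezoid (X : Tile) : Prop :=
  X.length = 4 ∧ X.Nondegenerate ∧ (X.map Edge.m).toFinset.card = 3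

/-! ### Isometries and similarities -/

/-- Rotation by `2π/5`. -/
def rot (x : Plane) : Plane := (β * x.1 - x.2, x.1)

/-- Reflection about the line generated by `u₀`. -/
def reflect (x : Plane) : Plane := (x.1, β * x.1 - x.2)

/-- The orientation-preserving isometry `T_d R_k`. -/
structure RotTrans where
  k : Fin 5
  d : Plane

def RotTrans.apply (g : RotTrans) (x : Plane) : Plane := rot^[(g.k : ℕ)] x + g.d

/-- `G` is an element with scaling factor `η` of the group generated by the symmetries of the
regular pentagon, the translations and the scalings by positive numbers. -/
def IsSimilarity (η : ℝ) (G : Plane → Plane) : Prop :=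
  0 < η ∧ ∃ (k : Fin 5) (flip : Bool) (d : Plane),
    ∀ x, G x = η • rot^[(k : ℕ)] (if flip then reflect x else x) + d

/-! ### Dressed domains -/

/-- A dressed domain with `n` atoms: tiles, and isometries acting on them. -/
structure DressedDomain (n : ℕ) where
  tile : Fin n → Tile
  iso : Fin n → RotTrans

namespace DressedDomain

variable {n m : ℕ}

/-- The domain: the union of the atoms. -/
def domain (X : DressedDomain n) : Set Plane := ⋃ i, (X.tile i).region

/-- The atoms are pairwise disjoint. -/
def AtomsDisjoint (X : DressedDomain n) : Prop :=
  Pairwise fun i j => Disjoint (X.tile i).region (X.tile j).region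

open Classical in
/-- The piecewise isometry (extended by the identity outside the domain). -/
def map (X : DressedDomain n) (x : Plane) : Plane :=
  if h : ∃ i, x ∈ (X.tile i).region then (X.iso h.choose).apply x else x

/-- `Y` is similar to `X`, by a similarity with scaling factor `η` that carries atoms to atoms and
conjugates the isometries. -/
def IsSimilar (η : ℝ) (X : DressedDomain n) (Y : DressedDomain m) : Prop :=
  ∃ G, IsSimilarity η G ∧ ∃ e : Fin n ≃ Fin m, ∀ i,
    (Y.tile (e i)).region = G '' (X.tile i).region ∧
    ∀ x, G ((X.iso i).apply x) = (Y.iso (e i)).apply (G x)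

/-- `Z` is obtained from `X` by merging atoms on which the isometry is the same. -/
def IsMerger (Z : DressedDomain m) (X : DressedDomain n) : Prop :=
  Z.AtomsDisjoint ∧ Z.domain = X.domain ∧
    ∀ i, ∃ j, (X.tile i).region ⊆ (Z.tile j).region ∧
      ∀ x, (X.iso i).apply x = (Z.iso j).apply x

/-- The set `S` moves rigidly under `X`, visiting the atoms listed in `w`. -/
def FollowsPath (X : DressedDomain n) : Set Plane → List (Fin n) → Prop
  | _, [] => True
  | S, i :: w => S ⊆ (X.tile i).region ∧ FollowsPath X ((X.iso i).apply '' S) w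

end DressedDomain

/-- `f^[k] x` is the first return of `x` to `D`. -/
def IsFirstReturn (f : Plane → Plane) (D : Set Plane) (x : Plane) (k : ℕ) : Prop :=
  0 < k ∧ f^[k] x ∈ D ∧ ∀ j, 0 < j → j < k → f^[j] x ∉ D

/-- A dressed domain together with a path (a list of atoms of an ambient dressed domain with `n`
atoms) for each of its atoms. -/
structure SubDomain (n : ℕ) where
  m : ℕ
  dd : DressedDomain m
  path : Fin m → List (Fin n)

/-- `Y` is a dressed sub-domain of `X`: `Y` carries the first-return map induced by `X`, and
`Y.path` lists the return paths of its atoms. -/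
def SubDomain.IsInduced {n : ℕ} (X : DressedDomain n) (Y : SubDomain n) : Prop :=
  Y.dd.AtomsDisjoint ∧ Y.dd.domain ⊆ X.domain ∧
    ∀ j, X.FollowsPath (Y.dd.tile j).region (Y.path j) ∧
      ∀ x ∈ (Y.dd.tile j).region,
        IsFirstReturn X.map Y.dd.domain x (Y.path j).length ∧
        X.map^[(Y.path j).length] x = (Y.dd.iso j).apply x

/-- A tile together with a path in an ambient dressed domain with `n` atoms. -/
structure PathTile (n : ℕ) where
  tile : Tile
  path : List (Fin n)

/-- A periodic tile: it moves rigidly and comes back to itself at the end of the path. -/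
def PathTile.IsPeriodic {n : ℕ} (X : DressedDomain n) (Q : PathTile n) : Prop :=
  Q.tile.region.Nonempty ∧ Q.path ≠ [] ∧ X.FollowsPath Q.tile.region Q.path ∧
    X.map^[Q.path.length] '' Q.tile.region = Q.tile.region

/-- The sets `f^k(S)`, for `(S, h)` in the list and `0 ≤ k < h`, are subsets of `D`, and every
point of `D` belongs to exactly one of them. -/
def TiledByOrbits (f : Plane → Plane) (D : Set Plane) (L : List (Set Plane × ℕ)) : Prop :=
  (∀ c ∈ L, ∀ k < c.2, f^[k] '' c.1 ⊆ D) ∧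
    ∀ z ∈ D, ∃! q : Fin L.length × ℕ, q.2 < (L.get q.1).2 ∧ z ∈ f^[q.2] '' (L.get q.1).1

/-- Recursive tiling: the return orbits of the atoms of the dressed sub-domains `Ys`, together with
the orbits of the finitely many periodic tiles `Qs`, tile the domain of `X`. -/
def RecursivelyTiles {n : ℕ} (X : DressedDomain n) (Ys : List (SubDomain n))
    (Qs : List (PathTile n)) : Prop :=
  (∀ Y ∈ Ys, Y.IsInduced X) ∧ (∀ Q ∈ Qs, Q.IsPeriodic X) ∧
    TiledByOrbits X.map X.domain
      (Ys.flatMap (fun Y => List.ofFn fun j => ((Y.dd.tile j).region, (Y.path j).length)) ++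
        Qs.map (fun Q => (Q.tile.region, Q.path.length)))

/-! ### Renormalizability -/

/-- `Z` is, up to merging of atoms, a dressed sub-domain of `X` which (with finitely many periodic
tiles) recursively tiles `X`. -/
def Induces {n m : ℕ} (X : DressedDomain n) (Z : DressedDomain m) : Prop :=
  ∃ (Y : SubDomain n) (Qs : List (PathTile n)), RecursivelyTiles X [Y] Qs ∧ Z.IsMerger Y.dd

/-- Self-similarity: a finite chain of inductions leads to a dressed domain which is a
smaller copy of an earlier one. -/
def SelfSimilar {n : ℕ} (X : DressedDomain n) : Prop :=
  ∃ (N : ℕ) (Z : ℕ → Σ n, DressedDomain n), Z 0 = ⟨n, X⟩ ∧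
    (∀ i < N, Induces (Z i).2 (Z (i + 1)).2) ∧ (Z N).2.domain.Nonempty ∧
    ∃ k < N, ∃ η < 1, DressedDomain.IsSimilar η (Z k).2 (Z N).2

/-- Renormalizability of a dressed domain: after finitely many inductions (and mergers of atoms), it
is recursively tiled by self-similar dressed sub-domains. -/
inductive Renormalizable : ∀ {n : ℕ}, DressedDomain n → Prop
  | selfSimilar {n : ℕ} (X : DressedDomain n) : SelfSimilar X → Renormalizable X
  | merger {n m : ℕ} (X : DressedDomain n) (Z : DressedDomain m) :
      Z.IsMerger X → Renormalizable Z → Renormalizable X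
  | tiled {n : ℕ} (X : DressedDomain n) (Ys : List (SubDomain n)) (Qs : List (PathTile n)) :
      Ys ≠ [] → RecursivelyTiles X Ys Qs → (∀ Y ∈ Ys, Renormalizable Y.dd) → Renormalizable X

/-! ### Parametric dressed domains -/

/-- Affine functions of `(s, t)` with coefficients in `ℚ(√5)`. -/
def AffineQ5 (f : ℝ → ℝ → ℝ) : Prop :=
  ∃ a ∈ Q5, ∃ b ∈ Q5, ∃ c ∈ Q5, ∀ s t, f s t = a + b * s + c * t

/-- A tile that depends on the parameters only via the coefficients `b_i`, in an affine way. -/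
def IsParametricTile (X : ℝ → ℝ → Tile) : Prop :=
  ∃ L : List (Fin 5 × Bool × (ℝ → ℝ → ℝ)), (∀ e ∈ L, AffineQ5 e.2.2) ∧
    ∀ s t, X s t = L.map fun e => ⟨e.1, e.2.1, e.2.2 s t⟩

/-- A parametric dressed domain: the tiles and their images are parametric tiles. -/
def IsParametric {n : ℕ} (X : ℝ → ℝ → DressedDomain n) : Prop :=
  ∀ i, IsParametricTile (fun s t => (X s t).tile i) ∧
    ∃ (k : Fin 5) (d₁ d₂ : ℝ → ℝ → ℝ), AffineQ5 d₁ ∧ AffineQ5 d₂ ∧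
      ∀ s t, (X s t).iso i = ⟨k, (d₁ s t, d₂ s t)⟩

/-- The bifurcation-free set of a parametric dressed domain. -/
def bifurcationFree {n : ℕ} (X : ℝ → ℝ → DressedDomain n) : Set (ℝ × ℝ) :=
  interior {p | ∀ i, ((X p.1 p.2).tile i).Nondegenerate}

/-- The bifurcation-free set of a dressed sub-domain `Y` of `X` with return paths `w`: the edges of
the atoms have non-zero length, and the tiles of the return orbits are included in the atoms of `X`
prescribed by the paths. -/
def bifurcationFreeSub {n m : ℕ} (X : ℝ → ℝ → DressedDomain n) (Y : ℝ → ℝ → DressedDomain m)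
    (w : Fin m → List (Fin n)) : Set (ℝ × ℝ) :=
  interior {p | ∀ j, ((Y p.1 p.2).tile j).Nondegenerate ∧
    (X p.1 p.2).FollowsPath ((Y p.1 p.2).tile j).region (w j)}

/-- The bifurcation-free set of a periodic tile `Q` of `X` with path `w`. -/
def bifurcationFreeTile {n : ℕ} (X : ℝ → ℝ → DressedDomain n) (Q : ℝ → ℝ → Tile)
    (w : List (Fin n)) : Set (ℝ × ℝ) :=
  interior {p | (Q p.1 p.2).Nondegenerate ∧
    (X p.1 p.2).FollowsPath (Q p.1 p.2).region w}

/-! ### The base triangle -/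

/-- The base triangle with shape parameter `τ`. -/
def baseTriangle (τ : ℝ) : DressedDomain 3 where
  tile := ![
    mkTile [0, 2, 3] [false, false, false] [0, 0, ω - ω * τ],
    mkTile [1, 4, 0, 3, 2] [true, false, false, true, false]
      [τ - ω ^ 2, ω ^ 2 - ω * τ, 0, ω - ω * τ, 0],
    mkTile [1, 0, 4] [true, false, true] [τ - ω ^ 2, 0, ω ^ 2 - ω * τ]]
  iso := ![
    ⟨2, (ω * τ - ω, -ω ^ 2 + ω ^ 2 * τ)⟩,
    ⟨3, (0, ω ^ 2 * τ - ω ^ 3)⟩,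
    ⟨2, (ω * τ - 2 * ω, ω ^ 2 * τ - 2 * ω ^ 2)⟩]

/-- Change of sign of all edge coordinates and translation vectors, and of all `ε`. -/
def opposite {n : ℕ} (X : DressedDomain n) : DressedDomain n where
  tile i := (X.tile i).map fun e => ⟨e.m, !e.included, -e.b⟩
  iso i := ⟨(X.iso i).k, -(X.iso i).d⟩

/-- The renormalization function of the base triangles. -/
def renorm (τ : ℝ) : ℝ :=
  if τ < β ^ 2 then ω ^ 2 * τ
  else if β ^ 2 < τ ∧ τ < β then ω ^ 3 * (β - τ)
  else if β < τ ∧ τ < 1 then ω ^ 2 * (1 - τ)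
  else 0

/-- `X` has, up to merging, a recursively tiling dressed sub-domain which is similar, with a scaling
factor `< 1`, to one of the two base triangles with shape parameter `τ`. -/
def InducesBase {n : ℕ} (X : DressedDomain n) (τ : ℝ) : Prop :=
  ∃ Z : DressedDomain 3, Induces X Z ∧ ∃ η < 1,
    DressedDomain.IsSimilar η (baseTriangle τ) Z ∨
      DressedDomain.IsSimilar η (opposite (baseTriangle τ)) Z

def EventuallyPeriodic (f : ℝ → ℝ) (x : ℝ) : Prop :=
  ∃ k l : ℕ, k < l ∧ f^[k] x = f^[l] x

/-! ### The rhombus -/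

/-- The rhombus, as a tile. -/
def rhombusTile (s t : ℝ) : Tile :=
  mkTile [0, 1, 0, 1] [true, true, false, false] [-t, -s, 1 - t, 1 - s]

/-- The four-atom, three-parameter piecewise isometry of the rhombus. -/
def rhombus (s t u : ℝ) : DressedDomain 4 where
  tile := ![
    mkTile [0, 1, 2, 1] [true, true, true, false] [-t, -t, -s, 1 - s],
    mkTile [0, 1, 2, 1] [false, false, false, true] [1 - t, 1 - s, -s, -t],
    mkTile [0, 1, 2, 1] [true, true, true, false] [-t, -s, -1 - s + u, -t],
    mkTile [0, 1, 2, 1] [false, false, false, true] [1 - t, -t, -1 - s + u, -s]]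
  iso := ![⟨4, (0, 0)⟩, ⟨4, (0, 1)⟩, ⟨4, (1, 1 - u)⟩, ⟨4, (1, 2 - u)⟩]

/-- The restriction to the plane `u = β`. -/
def rhombusβ (s t : ℝ) : DressedDomain 4 := rhombus s t β

/-- The open quadrilateral of parameters. -/
def PiStar : Set (ℝ × ℝ) :=
  interior (convexHull ℝ {(β ^ 2, 0), (β ^ 2 + β ^ 6 / √5, β ^ 6 / √5),
    (β ^ 2 + β ^ 6 / √5, β ^ 4 / √5), (β ^ 2, β ^ 4 / √5)})

/-! ### The exceptional set -/

/-- The complement of the periodic points in the domain. -/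
def exceptionalSet {n : ℕ} (X : DressedDomain n) : Set Plane :=
  X.domain \ Function.periodicPts X.map

/-- The part of the exceptional set formed by the orbits that visit `D`. -/
def component {n : ℕ} (X : DressedDomain n) (D : Set Plane) : Set Plane :=
  {x ∈ exceptionalSet X | ∃ k, X.map^[k] x ∈ D}

end

end RhombusPWI

/-! Over `PiStar` every edge coefficient and every translation is affine in the parameters, and
`PiStar` is the interior of the hull of four points over ℚ(√5). Each of its points is a combination
of these vertices with strictly positive weights (`star_rep`), so an affine function that is
non-negative at all vertices and positive at one of them is positive on all of `PiStar`. All edges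
are normal to one of ten directions, and an edge implied by a tile is sought as a positive
combination of at most two edges of the tile. Inclusion, disjointness, exact covers, first returns
and non-degeneracy thus become sign tests in ℤ[ω] at the vertices, carried out by kernel evaluation;
`cover_spec`, `chkRT_spec` and `nondegenerate_of_chkEdge` turn a successful test into a statement
about all parameters. The same tests on the intervals cut out by 0, β², β, 1 give the
renormalization of the base triangles (`base_step`).

That `PiStar` is the whole bifurcation-free set needs only four conditions, one for each side of the
quadrilateral (`bifurcation_eq`).

The renormalization function r is piecewise affine over ℚ(√5) and expanding. An eventually periodic
shape parameter solves a non-trivial affine equation over the field, hence belongs to it. Conversely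
the conjugate slopes are smaller than one in modulus; an orbit in the field keeps its denominator
and has bounded conjugates, so it is finite (`eventuallyPeriodic_iff`). A repeated shape parameter
and a pigeonhole argument for the sign of the triangle give self-similarity (`selfSimilar_base`).

The exact tiling by return orbits forces each non-periodic orbit into precisely one of the three
sub-domains (`rhombus_components`).

For the ergodic measures, a periodic chain of inductions is closed up to a dressed domain that
induces a smaller copy of itself (`exists_selfInduced`). The elements of its return orbits form a
graph-directed system of contractions. The law of a point with a random address, weighted by a
Perron eigenvector of the visit matrix, is invariant by a telescoping argument and ergodic by a
zero-one law (`SelfInduced.exists_ergodic`). Building a tower over the induced map lifts it to the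
rhombus (`exists_ergodic_lift`). -/

namespace RhombusPWI

/-! ### Exact arithmetic in `ℤ[ω]` -/

/-- The number `a + b ω`. -/
structure ZW where
  a : ℤ
  b : ℤ
deriving DecidableEq

namespace ZW

def add (x y : ZW) : ZW := ⟨x.a + y.a, x.b + y.b⟩
def neg (x : ZW) : ZW := ⟨-x.a, -x.b⟩
def mul (x y : ZW) : ZW := ⟨x.a * y.a + x.b * y.b, x.a * y.b + x.b * y.a + x.b * y.b⟩

instance : Add ZW := ⟨add⟩
instance : Neg ZW := ⟨neg⟩
instance : Mul ZW := ⟨mul⟩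

noncomputable def val (x : ZW) : ℝ := x.a + x.b * ω

/-- Since a + bω = (u + b√5)/2 with u = 2a + b, the sign is visible from u and b, or from u² against
5b² when their signs differ. Only integers are compared. -/
def nonneg (x : ZW) : Bool :=
  let u := 2 * x.a + x.b
  if 0 ≤ u then decide (0 ≤ x.b) || decide (5 * (x.b * x.b) ≤ u * u)
  else decide (0 ≤ x.b) && decide (u * u ≤ 5 * (x.b * x.b))

def pos (x : ZW) : Bool :=
  let u := 2 * x.a + x.b
  if 0 < u then decide (0 ≤ x.b) || decide (5 * (x.b * x.b) < u * u)
  else decide (0 < x.b) && decide (u * u < 5 * (x.b * x.b))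

end ZW

theorem omega_sq : ω ^ 2 = ω + 1 := by
  have h : √5 * √5 = 5 := Real.mul_self_sqrt (by norm_num)
  unfold ω; linear_combination h / 4

theorem beta_eq : β = ω - 1 := by unfold β ω; ring

theorem sqrt5_eq : √5 = 2 * ω - 1 := by unfold ω; ring

theorem sqrt5_pos : 0 < √5 := Real.sqrt_pos.2 (by norm_num)

theorem omega_gt_one : 1 < ω := by
  have h : √5 * √5 = 5 := Real.mul_self_sqrt (by norm_num)
  have := sqrt5_pos
  unfold ω; nlinarith

theorem beta_pos : 0 < β := by have := omega_gt_one; rw [beta_eq]; linarith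

theorem beta_mul_omega : β * ω = 1 := by rw [beta_eq]; linear_combination omega_sq

theorem beta_sq : β ^ 2 = 1 - β := by rw [beta_eq]; linear_combination omega_sq

theorem beta_lt_one : β < 1 := by
  have := beta_pos; have := beta_sq; nlinarith

namespace ZW

@[simp] theorem val_add (x y : ZW) : (x + y).val = x.val + y.val := by
  change ((x.a + y.a : ℤ) : ℝ) + ((x.b + y.b : ℤ) : ℝ) * ω = _
  unfold val; push_cast; ring

@[simp] theorem val_neg (x : ZW) : (-x).val = -x.val := by
  change ((-x.a : ℤ) : ℝ) + ((-x.b : ℤ) : ℝ) * ω = _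
  unfold val; push_cast; ring

@[simp] theorem val_mul (x y : ZW) : (x * y).val = x.val * y.val := by
  change ((x.a * y.a + x.b * y.b : ℤ) : ℝ) +
    ((x.a * y.b + x.b * y.a + x.b * y.b : ℤ) : ℝ) * ω = _
  unfold val; push_cast
  linear_combination (-(x.b * y.b : ℝ)) * omega_sq

theorem val_eq (x : ZW) : x.val = ((2 * x.a + x.b : ℤ) + (x.b : ℝ) * √5) / 2 := by
  unfold val ω; push_cast; ring

theorem val_nonneg {x : ZW} (h : x.nonneg = true) : 0 ≤ x.val := by
  have h5 : √5 * √5 = 5 := Real.mul_self_sqrt (by norm_num)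
  have hp := sqrt5_pos
  rw [val_eq]
  unfold nonneg at h
  generalize 2 * x.a + x.b = u at *
  generalize x.b = v at *
  dsimp only at h
  split_ifs at h with hu
  · have hu' : (0 : ℝ) ≤ u := by exact_mod_cast hu
    rw [Bool.or_eq_true, decide_eq_true_iff, decide_eq_true_iff] at h
    rcases h with h | h
    · have : (0 : ℝ) ≤ v := by exact_mod_cast h
      positivity
    · have h' : 5 * ((v : ℝ) * v) ≤ u * u := by exact_mod_cast h
      have := abs_le_of_sq_le_sq' (a := (v : ℝ) * √5) (b := u) (by nlinarith) hu'
      linarith [this.1]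
  · rw [Bool.and_eq_true, decide_eq_true_iff, decide_eq_true_iff] at h
    have h1 : (0 : ℝ) ≤ v := by exact_mod_cast h.1
    have h' : (u : ℝ) * u ≤ 5 * (v * v) := by exact_mod_cast h.2
    have := abs_le_of_sq_le_sq' (a := (u : ℝ)) (b := v * √5) (by nlinarith) (by positivity)
    linarith [this.1]

theorem val_pos {x : ZW} (h : x.pos = true) : 0 < x.val := by
  have h5 : √5 * √5 = 5 := Real.mul_self_sqrt (by norm_num)
  have hp := sqrt5_pos
  rw [val_eq]
  unfold pos at h
  generalize 2 * x.a + x.b = u at *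
  generalize x.b = v at *
  dsimp only at h
  split_ifs at h with hu
  · have hu' : (0 : ℝ) < u := by exact_mod_cast hu
    rw [Bool.or_eq_true, decide_eq_true_iff, decide_eq_true_iff] at h
    rcases h with h | h
    · have : (0 : ℝ) ≤ v := by exact_mod_cast h
      positivity
    · have h' : 5 * ((v : ℝ) * v) < u * u := by exact_mod_cast h
      have := abs_lt_of_sq_lt_sq' (a := (v : ℝ) * √5) (b := u) (by nlinarith) hu'.le
      linarith [this.1]
  · rw [Bool.and_eq_true, decide_eq_true_iff, decide_eq_true_iff] at h
    have h1 : (0 : ℝ) < v := by exact_mod_cast h.1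
    have h' : (u : ℝ) * u < 5 * (v * v) := by exact_mod_cast h.2
    have := abs_lt_of_sq_lt_sq' (a := (u : ℝ)) (b := v * √5) (by nlinarith) (by positivity)
    linarith [this.1]

end ZW

/-! ### Parametric numbers, given by their values at (at most) four vertices -/

/-- The values of an affine function at the vertices of a polygon of parameters. -/
structure Vec where
  x0 : ZW
  x1 : ZW
  x2 : ZW
  x3 : ZW
deriving DecidableEq

/-- Positive weights of the four vertices. -/
structure Wt where
  w0 : ℝ
  w1 : ℝ
  w2 : ℝ
  w3 : ℝ
  p0 : 0 < w0
  p1 : 0 < w1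
  p2 : 0 < w2
  p3 : 0 < w3

namespace Vec

def add (c d : Vec) : Vec := ⟨c.x0 + d.x0, c.x1 + d.x1, c.x2 + d.x2, c.x3 + d.x3⟩
def neg (c : Vec) : Vec := ⟨-c.x0, -c.x1, -c.x2, -c.x3⟩
def smul (l : ZW) (c : Vec) : Vec := ⟨l * c.x0, l * c.x1, l * c.x2, l * c.x3⟩

instance : Add Vec := ⟨add⟩
instance : Neg Vec := ⟨neg⟩

noncomputable def ev (w : Wt) (c : Vec) : ℝ :=
  w.w0 * c.x0.val + w.w1 * c.x1.val + w.w2 * c.x2.val + w.w3 * c.x3.val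

def nonneg (c : Vec) : Bool := c.x0.nonneg && c.x1.nonneg && c.x2.nonneg && c.x3.nonneg
def somePos (c : Vec) : Bool := c.x0.pos || c.x1.pos || c.x2.pos || c.x3.pos

@[simp] theorem ev_add (w : Wt) (c d : Vec) : (c + d).ev w = c.ev w + d.ev w := by
  change ev w ⟨c.x0 + d.x0, c.x1 + d.x1, c.x2 + d.x2, c.x3 + d.x3⟩ = _
  simp only [ev, ZW.val_add]; ring

@[simp] theorem ev_neg (w : Wt) (c : Vec) : (-c).ev w = -c.ev w := by
  change ev w ⟨-c.x0, -c.x1, -c.x2, -c.x3⟩ = _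
  simp only [ev, ZW.val_neg]; ring

@[simp] theorem ev_smul (w : Wt) (l : ZW) (c : Vec) : (smul l c).ev w = l.val * c.ev w := by
  simp only [smul, ev, ZW.val_mul]; ring

theorem ev_nonneg (w : Wt) {c : Vec} (h : c.nonneg = true) : 0 ≤ c.ev w := by
  simp only [nonneg, Bool.and_eq_true] at h
  obtain ⟨⟨⟨h0, h1⟩, h2⟩, h3⟩ := h
  have := mul_nonneg w.p0.le (ZW.val_nonneg h0)
  have := mul_nonneg w.p1.le (ZW.val_nonneg h1)
  have := mul_nonneg w.p2.le (ZW.val_nonneg h2)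
  have := mul_nonneg w.p3.le (ZW.val_nonneg h3)
  unfold ev; linarith

/-- The weights are strictly positive, so a single positive vertex value is enough; this is what
working in the open polygon buys. -/
theorem ev_pos (w : Wt) {c : Vec} (h : c.nonneg = true) (h' : c.somePos = true) :
    0 < c.ev w := by
  simp only [nonneg, Bool.and_eq_true] at h
  obtain ⟨⟨⟨h0, h1⟩, h2⟩, h3⟩ := h
  have := mul_nonneg w.p0.le (ZW.val_nonneg h0)
  have := mul_nonneg w.p1.le (ZW.val_nonneg h1)
  have := mul_nonneg w.p2.le (ZW.val_nonneg h2)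
  have := mul_nonneg w.p3.le (ZW.val_nonneg h3)
  simp only [somePos, Bool.or_eq_true] at h'
  unfold ev
  rcases h' with ((h' | h') | h') | h'
  · have := mul_pos w.p0 (ZW.val_pos h'); linarith
  · have := mul_pos w.p1 (ZW.val_pos h'); linarith
  · have := mul_pos w.p2 (ZW.val_pos h'); linarith
  · have := mul_pos w.p3 (ZW.val_pos h'); linarith

end Vec

/-! ### Half-plane constraints -/

/-- The unit vectors with argument `2πj/10`, in the coordinates `(u₀ · x, u₁ · x)`. -/
def sdZ (j : Fin 10) : ZW × ZW :=
  match j with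
  | 0 => (⟨1, 0⟩, ⟨0, 0⟩)
  | 1 => (⟨-1, 1⟩, ⟨-1, 1⟩)
  | 2 => (⟨0, 0⟩, ⟨1, 0⟩)
  | 3 => (⟨1, -1⟩, ⟨1, 0⟩)
  | 4 => (⟨-1, 0⟩, ⟨-1, 1⟩)
  | 5 => (⟨-1, 0⟩, ⟨0, 0⟩)
  | 6 => (⟨1, -1⟩, ⟨1, -1⟩)
  | 7 => (⟨0, 0⟩, ⟨-1, 0⟩)
  | 8 => (⟨-1, 1⟩, ⟨-1, 0⟩)
  | 9 => (⟨1, 0⟩, ⟨1, -1⟩)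

/-- The linear form defined by the unit vector with argument `2πj/10`. -/
noncomputable def sform (j : Fin 10) (x : Plane) : ℝ := (sdZ j).1.val * x.1 + (sdZ j).2.val * x.2

def jOut (m : Fin 5) : Fin 10 := match m with | 0 => 0 | 1 => 2 | 2 => 4 | 3 => 6 | 4 => 8
def jIn (m : Fin 5) : Fin 10 := match m with | 0 => 5 | 1 => 7 | 2 => 9 | 3 => 1 | 4 => 3

theorem dir_eq (m : Fin 5) : dir m = ((sdZ (jOut m)).1.val, (sdZ (jOut m)).2.val) := by
  fin_cases m <;> simp [dir, jOut, sdZ, ZW.val, beta_eq] <;> ring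

theorem form_eq_sform (m : Fin 5) (x : Plane) : form m x = sform (jOut m) x := by
  rw [form, dir_eq, sform]

theorem neg_form_eq_sform (m : Fin 5) (x : Plane) : -form m x = sform (jIn m) x := by
  have h : ∀ m, (sdZ (jIn m)).1 = -(sdZ (jOut m)).1 ∧ (sdZ (jIn m)).2 = -(sdZ (jOut m)).2 := by
    decide
  rw [form_eq_sform, sform, sform, (h m).1, (h m).2, ZW.val_neg, ZW.val_neg]; ring

theorem sform_opp (j : Fin 10) (x : Plane) : sform (j + 5) x = -sform j x := by
  have h : ∀ j : Fin 10, (sdZ (j + 5)).1 = -(sdZ j).1 ∧ (sdZ (j + 5)).2 = -(sdZ j).2 := by decide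
  rw [sform, (h j).1, (h j).2, sform, ZW.val_neg, ZW.val_neg]; ring

/-- The constraint `u · x < c` or `u · x ≤ c`. -/
structure Con where
  j : Fin 10
  s : Bool
  c : Vec

namespace Con

def Holds (w : Wt) (e : Con) (x : Plane) : Prop :=
  if e.s then sform e.j x < e.c.ev w else sform e.j x ≤ e.c.ev w

def neg (e : Con) : Con := ⟨e.j + 5, !e.s, -e.c⟩

/-- The complement of a half-plane is the opposite half-plane with strictness exchanged, so regions
can be cut along an edge without leaving the class of constraint lists. -/
theorem holds_neg (w : Wt) (e : Con) (x : Plane) : e.neg.Holds w x ↔ ¬ e.Holds w x := by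
  unfold neg Holds
  rw [Vec.ev_neg, sform_opp]
  cases e.s <;> simp

theorem Holds.le {w : Wt} {e : Con} {x : Plane} (h : e.Holds w x) : sform e.j x ≤ e.c.ev w := by
  unfold Holds at h
  split_ifs at h
  · exact h.le
  · exact h

theorem Holds.lt {w : Wt} {e : Con} {x : Plane} (h : e.Holds w x) (hs : e.s = true) :
    sform e.j x < e.c.ev w := by
  unfold Holds at h
  rwa [if_pos hs] at h

end Con

/-- `u_j = l₁ u_{j-a} + l₂ u_{j+b}`. -/
def lamOf : ℕ → ℕ → Option (ZW × ZW)
  | 1, 1 => some (⟨-1, 1⟩, ⟨-1, 1⟩)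
  | 1, 2 => some (⟨1, 0⟩, ⟨-1, 1⟩)
  | 2, 1 => some (⟨-1, 1⟩, ⟨1, 0⟩)
  | 1, 3 => some (⟨0, 1⟩, ⟨1, 0⟩)
  | 3, 1 => some (⟨1, 0⟩, ⟨0, 1⟩)
  | 2, 2 => some (⟨0, 1⟩, ⟨0, 1⟩)
  | _, _ => none

/-- In units of π/5 the two gaps add up to at most four. Hence `u_j` lies inside an angle smaller
than π and both coefficients are positive. The identities are checked for all triples of directions.
-/
theorem lamOf_spec : ∀ j₁ j j₂ : Fin 10, ∀ l ∈ lamOf (j - j₁).val (j₂ - j).val,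
    l.1 * (sdZ j₁).1 + l.2 * (sdZ j₂).1 = (sdZ j).1 ∧
    l.1 * (sdZ j₁).2 + l.2 * (sdZ j₂).2 = (sdZ j).2 ∧
    l.1.pos = true ∧ l.2.pos = true := by
  decide +kernel

/-- `d ≥ 0`, with strict inequality if this is needed and not known. -/
def okd (d : Vec) (need have_ : Bool) : Bool := d.nonneg && (!need || have_ || d.somePos)

theorem holds_of_okd {w : Wt} {e : Con} {x : Plane} {d : Vec} {h : Bool} {r : ℝ}
    (hd : okd d e.s h = true) (hr : d.ev w = e.c.ev w - r) (hle : sform e.j x ≤ r)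
    (hlt : h = true → sform e.j x < r) : e.Holds w x := by
  unfold okd at hd
  rw [Bool.and_eq_true] at hd
  have h0 := Vec.ev_nonneg w hd.1
  unfold Con.Holds
  split_ifs with hs
  · rw [hs] at hd
    simp only [Bool.not_true, Bool.false_or, Bool.or_eq_true] at hd
    rcases hd.2 with h' | h'
    · linarith [hlt h']
    · linarith [Vec.ev_pos w hd.1 h']
  · linarith

/-- Farkas' lemma in the plane suggests looking for a positive combination of two edges. The
directions determine the coefficients, so only the constants remain to be compared; the combination
is strict as soon as one of the two edges is. -/
def implied₂ (e₁ e₂ e : Con) : Bool :=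
  match lamOf (e.j - e₁.j).val (e₂.j - e.j).val with
  | none => false
  | some l => okd (e.c + -(Vec.smul l.1 e₁.c + Vec.smul l.2 e₂.c)) e.s (e₁.s || e₂.s)

/-- `e` follows from one or two of the constraints `P`. -/
def implied (P : List Con) (e : Con) : Bool :=
  P.any fun e₁ => (decide (e₁.j = e.j) && okd (e.c + -e₁.c) e.s e₁.s) ||
    P.any fun e₂ => implied₂ e₁ e₂ e

/-- The region defined by a list of constraints. -/
def reg (w : Wt) (P : List Con) : Set Plane := {x | ∀ e ∈ P, e.Holds w x}

theorem holds_of_implied {w : Wt} {P : List Con} {e : Con} (h : implied P e = true) {x : Plane}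
    (hx : x ∈ reg w P) : e.Holds w x := by
  unfold implied at h
  rw [List.any_eq_true] at h
  obtain ⟨e₁, h₁, h⟩ := h
  rw [Bool.or_eq_true, Bool.and_eq_true, decide_eq_true_iff] at h
  rcases h with ⟨hj, h⟩ | h
  · refine holds_of_okd h (r := e₁.c.ev w) (by simp; ring) ?_ ?_
    · rw [← hj]; exact (hx _ h₁).le
    · intro hs; rw [← hj]; exact (hx _ h₁).lt hs
  · rw [List.any_eq_true] at h
    obtain ⟨e₂, h₂, h⟩ := h
    unfold implied₂ at h
    split at h
    · exact absurd h (by simp)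
    · rename_i l hl
      obtain ⟨q1, q2, q3, q4⟩ := lamOf_spec _ _ _ l hl
      have p3 := ZW.val_pos q3
      have p4 := ZW.val_pos q4
      have key : sform e.j x = l.1.val * sform e₁.j x + l.2.val * sform e₂.j x := by
        simp only [sform, ← q1, ← q2, ZW.val_add, ZW.val_mul]; ring
      refine holds_of_okd h (r := l.1.val * e₁.c.ev w + l.2.val * e₂.c.ev w)
        (by simp; ring) ?_ ?_
      · rw [key]
        exact add_le_add (mul_le_mul_of_nonneg_left (hx _ h₁).le p3.le)
          (mul_le_mul_of_nonneg_left (hx _ h₂).le p4.le)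
      · intro hs
        rw [key]
        rw [Bool.or_eq_true] at hs
        rcases hs with hs | hs
        · exact add_lt_add_of_lt_of_le (mul_lt_mul_of_pos_left ((hx _ h₁).lt hs) p3)
            (mul_le_mul_of_nonneg_left (hx _ h₂).le p4.le)
        · exact add_lt_add_of_le_of_lt (mul_le_mul_of_nonneg_left (hx _ h₁).le p3.le)
            (mul_lt_mul_of_pos_left ((hx _ h₂).lt hs) p4)

/-- A sufficient test for emptiness: the constraints refute one of their own members. -/
def infeas (P : List Con) : Bool := P.any fun e => implied P e.neg

theorem reg_eq_empty_of_infeas {w : Wt} {P : List Con} (h : infeas P = true) : reg w P = ∅ := by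
  unfold infeas at h
  rw [List.any_eq_true] at h
  obtain ⟨e, he, h⟩ := h
  refine Set.eq_empty_of_forall_notMem fun x hx => ?_
  exact (Con.holds_neg w e x).1 (holds_of_implied h hx) (hx e he)

/-- Looks for a separating line among the edges of the two tiles. -/
def disj (P T : List Con) : Bool :=
  (T.any fun e => implied P e.neg) || (P.any fun e => implied T e.neg)

theorem disjoint_of_disj {w : Wt} {P T : List Con} (h : disj P T = true) :
    Disjoint (reg w P) (reg w T) := by
  unfold disj at h
  rw [Set.disjoint_left]
  intro x hP hT
  rw [Bool.or_eq_true, List.any_eq_true, List.any_eq_true] at h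
  rcases h with ⟨e, he, h⟩ | ⟨e, he, h⟩
  · exact (Con.holds_neg w e x).1 (holds_of_implied h hP) (hT e he)
  · exact (Con.holds_neg w e x).1 (holds_of_implied h hT) (hP e he)

/-- An empty tile is contained in everything even if its edges do not imply those of `T`, hence the
second alternative. -/
def sub (P T : List Con) : Bool := (T.all fun e => implied P e) || infeas P

theorem subset_of_sub {w : Wt} {P T : List Con} (h : sub P T = true) : reg w P ⊆ reg w T := by
  unfold sub at h
  rw [Bool.or_eq_true, List.all_eq_true] at h
  rcases h with h | h
  · exact fun x hx e he => holds_of_implied (h e he) hx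
  · rw [reg_eq_empty_of_infeas h]; exact Set.empty_subset _

/-! ### Exact covers -/

/-- Auxiliary recursion on the edges of the first tile. -/
def coverStep (f : List Con → Bool) (g : List Con → Bool) : List Con → List Con → Bool
  | P, [] => g P
  | P, e :: es => if implied P e then coverStep f g P es
      else f (e.neg :: P) && coverStep f g (e :: P) es

/-- Every point of the region `P` belongs to exactly one of the tiles `Ts`. -/
def cover : List (List Con) → List Con → Bool
  | [], P => infeas P
  | T :: Ts, P => infeas P || if disj P T then cover Ts P
      else coverStep (cover Ts) (fun Q => infeas Q || Ts.all (disj Q)) P T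

/-- Each piece handed to `f` satisfies some initial edges of the tile and violates the next one.
These convex pieces partition the part of the region outside the tile, and what reaches `g` is the
part inside. -/
theorem coverStep_spec {w : Wt} {f g : List Con → Bool} {A B : Plane → Prop}
    (hf : ∀ P, f P = true → ∀ x ∈ reg w P, A x) (hg : ∀ P, g P = true → ∀ x ∈ reg w P, B x) :
    ∀ (T P : List Con), coverStep f g P T = true → ∀ x ∈ reg w P,
      (x ∈ reg w T ∧ B x) ∨ (x ∉ reg w T ∧ A x)
  | [], P, h, x, hx => Or.inl ⟨by simp [reg], hg P h x hx⟩
  | e :: es, P, h, x, hx => by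
    unfold coverStep at h
    have cons_iff : x ∈ reg w (e :: es) ↔ e.Holds w x ∧ x ∈ reg w es := by simp [reg]
    split_ifs at h with hi
    · have he := holds_of_implied hi hx
      rw [cons_iff]
      simpa [he] using coverStep_spec hf hg es P h x hx
    · rw [Bool.and_eq_true] at h
      by_cases he : e.Holds w x
      · rw [cons_iff]
        have hx' : x ∈ reg w (e :: P) := by
          intro e' he'
          rcases List.mem_cons.1 he' with rfl | he'
          exacts [he, hx _ he']
        simpa [he] using coverStep_spec hf hg es _ h.2 x hx'
      · right
        refine ⟨fun hh => he (cons_iff.1 hh).1, hf _ h.1 x ?_⟩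
        intro e' he'
        rcases List.mem_cons.1 he' with rfl | he'
        exacts [(Con.holds_neg w e x).2 he, hx _ he']

open Classical in
/-- Exactly one entry of the list contains `x`. -/
def ExactlyOne {α : Type*} (f : α → Set Plane) (L : List α) (x : Plane) : Prop :=
  ∃ a, L.filter (fun a => x ∈ f a) = [a]

theorem cover_spec {w : Wt} {α : Type*} (f : α → List Con) :
    ∀ (L : List α) (P : List Con), cover (L.map f) P = true → ∀ x ∈ reg w P,
      ExactlyOne (fun a => reg w (f a)) L x
  | [], P, h, x, hx => by
    rw [List.map_nil, cover] at h
    rw [reg_eq_empty_of_infeas h] at hx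
    exact absurd hx (by simp)
  | a :: L, P, h, x, hx => by
    rw [List.map_cons, cover, Bool.or_eq_true] at h
    rcases h with h | h
    · rw [reg_eq_empty_of_infeas h] at hx
      exact absurd hx (by simp)
    split_ifs at h with hd
    · obtain ⟨b, hb⟩ := cover_spec f L P h x hx
      refine ⟨b, ?_⟩
      rw [List.filter_cons_of_neg, hb]
      simpa using Set.disjoint_left.1 (disjoint_of_disj (w := w) hd) hx
    -- Outside the first tile the remaining ones must cover exactly once; inside it none of them may
    -- occur.
    · have key := coverStep_spec (w := w) (A := fun x => ExactlyOne (fun a => reg w (f a)) L x)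
        (B := fun x => ∀ b ∈ L, x ∉ reg w (f b)) (fun P hP x hx => cover_spec f L P hP x hx)
        (fun P hP x hx b hb => by
          rw [Bool.or_eq_true] at hP
          rcases hP with hP | hP
          · rw [reg_eq_empty_of_infeas hP] at hx
            exact absurd hx (by simp)
          · rw [List.all_eq_true] at hP
            exact Set.disjoint_left.1 (disjoint_of_disj (w := w)
              (hP _ (List.mem_map_of_mem hb))) hx) _ _ h x hx
      rcases key with ⟨h1, h2⟩ | ⟨h1, b, hb⟩
      · refine ⟨a, ?_⟩
        rw [List.filter_cons_of_pos (by simpa using h1)]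
        rw [List.filter_eq_nil_iff.2]
        simpa using h2
      · refine ⟨b, ?_⟩
        rw [List.filter_cons_of_neg (by simpa using h1), hb]

/-! ### Rotations -/

theorem rot_add (x y : Plane) : rot (x + y) = rot x + rot y := by
  simp only [rot, Prod.fst_add, Prod.snd_add, Prod.mk_add_mk]; congr 1; ring

theorem rot_iter_add (k : ℕ) (x y : Plane) : rot^[k] (x + y) = rot^[k] x + rot^[k] y := by
  induction k generalizing x y with
  | zero => rfl
  | succ k ih => rw [Function.iterate_succ_apply, rot_add, ih]; rfl

theorem rot_five (x : Plane) : rot^[5] x = x := by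
  have h := beta_sq
  simp only [Function.iterate_succ, Function.iterate_zero, Function.comp, id, rot]
  ext
  · simp only []
    -- The cofactor is the quotient of a division by β² + β − 1.
    linear_combination (β ^ 3 * x.1 - β ^ 2 * x.1 - β ^ 2 * x.2 - 2 * β * x.1 + β * x.2 + x.1 + x.2) * h
  · simp only []
    linear_combination (β ^ 2 * x.1 - β * x.1 - β * x.2 - x.1 + x.2) * h

theorem rot_iter_mod (k : ℕ) (x : Plane) : rot^[k % 5] x = rot^[k] x := by
  conv_rhs => rw [← Nat.mod_add_div k 5, Function.iterate_add_apply, Function.iterate_mul]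
  rw [Function.iterate_fixed (rot_five x)]

theorem rot_iter_fin_add (k l : Fin 5) (x : Plane) :
    rot^[((k + l : Fin 5) : ℕ)] x = rot^[(k : ℕ)] (rot^[(l : ℕ)] x) := by
  rw [Fin.val_add, rot_iter_mod, Function.iterate_add_apply]

theorem rot_iter_neg_left (k : Fin 5) (x : Plane) :
    rot^[((-k : Fin 5) : ℕ)] (rot^[(k : ℕ)] x) = x := by
  rw [← rot_iter_fin_add, neg_add_cancel]; rfl

theorem rot_iter_neg_right (k : Fin 5) (x : Plane) :
    rot^[(k : ℕ)] (rot^[((-k : Fin 5) : ℕ)] x) = x := by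
  rw [← rot_iter_fin_add, add_neg_cancel]; rfl

namespace RotTrans

/-- The inverse isometry. -/
noncomputable def symm (g : RotTrans) : RotTrans := ⟨-g.k, -(rot^[((-g.k : Fin 5) : ℕ)] g.d)⟩

theorem symm_apply_apply (g : RotTrans) (x : Plane) : g.symm.apply (g.apply x) = x := by
  simp only [apply, symm, rot_iter_add, rot_iter_neg_left]; abel

theorem rot_iter_neg (k : ℕ) (x : Plane) : rot^[k] (-x) = -(rot^[k] x) := by
  have h0 : rot^[k] (0 : Plane) = 0 := by
    have := rot_iter_add k 0 0
    simpa using this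
  have := rot_iter_add k (-x) x
  rw [neg_add_cancel, h0] at this
  exact eq_neg_of_add_eq_zero_left this.symm

theorem apply_symm_apply (g : RotTrans) (x : Plane) : g.apply (g.symm.apply x) = x := by
  simp only [apply, symm, rot_iter_add, rot_iter_neg, rot_iter_neg_right]; abel

theorem injective (g : RotTrans) : Function.Injective g.apply :=
  Function.LeftInverse.injective g.symm_apply_apply

end RotTrans

/-- A rotation by 2π/5 shifts the ten directions by two places, so the image of a tile is described
by constraints of the same kind. -/
theorem sform_rot (j : Fin 10) (x : Plane) : sform (j + 2) (rot x) = sform j x := by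
  have h : ∀ j : Fin 10, (sdZ (j + 2)).1 * ⟨-1, 1⟩ + (sdZ (j + 2)).2 = (sdZ j).1 ∧
      -(sdZ (j + 2)).1 = (sdZ j).2 := by decide
  have hb : (ZW.mk (-1) 1).val = β := by rw [beta_eq, ZW.val]; push_cast; ring
  rw [sform, sform, ← (h j).1, ← (h j).2, ZW.val_add, ZW.val_mul, ZW.val_neg, hb, rot]
  ring

theorem sform_rot_iter (j : Fin 10) (k : Fin 5) (x : Plane) :
    sform (j + jOut k) (rot^[(k : ℕ)] x) = sform j x := by
  fin_cases k
  · simp [jOut]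
  all_goals
    simp only [jOut]
    simp only [Function.iterate_succ_apply', Function.iterate_zero, id]
  · exact sform_rot _ _
  · rw [← sform_rot j, ← sform_rot (j + 2)]; congr 1; rw [add_assoc]; rfl
  · rw [← sform_rot j, ← sform_rot (j + 2), ← sform_rot (j + 2 + 2)]
    congr 1; rw [add_assoc, add_assoc]; rfl
  · rw [← sform_rot j, ← sform_rot (j + 2), ← sform_rot (j + 2 + 2),
      ← sform_rot (j + 2 + 2 + 2)]
    congr 1; rw [add_assoc, add_assoc, add_assoc]; rfl

theorem sform_add (j : Fin 10) (x y : Plane) : sform j (x + y) = sform j x + sform j y := by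
  simp only [sform, Prod.fst_add, Prod.snd_add]; ring

/-! ### Dressed domains with computable coefficients -/

/-- A half-plane condition with coefficient of type `α`. -/
structure DEdge (α : Type*) where
  m : Fin 5
  inc : Bool
  b : α

/-- A dressed domain with coefficients of type `α`. -/
structure DDom (α : Type*) (n : ℕ) where
  tile : Fin n → List (DEdge α)
  k : Fin n → Fin 5
  d : Fin n → α × α

/-- The tile defined by a list of half-plane conditions. -/
def realTile {α : Type*} (f : α → ℝ) (T : List (DEdge α)) : Tile :=
  T.map fun e => ⟨e.m, e.inc, f e.b⟩

/-- The dressed domain obtained by evaluating the coefficients. -/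
def DDom.real {α : Type*} {n : ℕ} (f : α → ℝ) (X : DDom α n) : DressedDomain n where
  tile i := realTile f (X.tile i)
  iso i := ⟨X.k i, (f (X.d i).1, f (X.d i).2)⟩

def DEdge.map {α β : Type*} (f : α → β) (e : DEdge α) : DEdge β := ⟨e.m, e.inc, f e.b⟩

def DDom.map {α β : Type*} {n : ℕ} (f : α → β) (X : DDom α n) : DDom β n where
  tile i := (X.tile i).map (DEdge.map f)
  k := X.k
  d i := (f (X.d i).1, f (X.d i).2)

theorem realTile_map {α β : Type*} (f : α → β) (g : β → ℝ) (T : List (DEdge α)) :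
    realTile g (T.map (DEdge.map f)) = realTile (fun a => g (f a)) T := by
  simp [realTile, DEdge.map, Function.comp_def]

theorem DDom.real_map {α β : Type*} {n : ℕ} (f : α → β) (g : β → ℝ) (X : DDom α n) :
    (X.map f).real g = X.real fun a => g (f a) := by
  simp only [DDom.real, DDom.map, realTile_map]

/-- Included edges are turned around, so that every constraint is an upper bound, strict exactly for
excluded edges. -/
def conOf (e : DEdge Vec) : Con := if e.inc then ⟨jIn e.m, false, -e.b⟩ else ⟨jOut e.m, true, e.b⟩

def cons (T : List (DEdge Vec)) : List Con := T.map conOf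

theorem conOf_holds (w : Wt) (e : DEdge Vec) (x : Plane) :
    (conOf e).Holds w x ↔ Edge.Holds ⟨e.m, e.inc, e.b.ev w⟩ x := by
  unfold conOf Con.Holds Edge.Holds
  cases e.inc
  · simp [form_eq_sform]
  · simp [← neg_form_eq_sform]

theorem region_realTile (w : Wt) (T : List (DEdge Vec)) :
    (realTile (Vec.ev w) T).region = reg w (cons T) := by
  ext x
  simp [Tile.region, reg, cons, realTile, conOf_holds]

/-- An isometry `T_d R_k` with computable translation vector. -/
abbrev DIso := Fin 5 × Vec × Vec

noncomputable def DIso.real (w : Wt) (g : DIso) : RotTrans := ⟨g.1, (g.2.1.ev w, g.2.2.ev w)⟩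

def DDom.iso {n : ℕ} (X : DDom Vec n) (i : Fin n) : DIso := (X.k i, X.d i)

/-- The normal turns with the rotation, and the bound increases by the component of the translation
along the new normal. -/
def moveCon (g : DIso) (e : Con) : Con :=
  let j := e.j + jOut g.1
  ⟨j, e.s, e.c + (Vec.smul (sdZ j).1 g.2.1 + Vec.smul (sdZ j).2 g.2.2)⟩

def move (g : DIso) (P : List Con) : List Con := P.map (moveCon g)

theorem moveCon_holds (w : Wt) (g : DIso) (e : Con) (x : Plane) :
    (moveCon g e).Holds w ((g.real w).apply x) ↔ e.Holds w x := by
  unfold moveCon Con.Holds RotTrans.apply DIso.real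
  simp only [sform_add, sform_rot_iter, Vec.ev_add, Vec.ev_smul]
  cases e.s <;> simp [sform]

theorem image_reg (w : Wt) (g : DIso) (P : List Con) :
    (g.real w).apply '' reg w P = reg w (move g P) := by
  ext z
  constructor
  · rintro ⟨x, hx, rfl⟩ e he
    obtain ⟨e', he', rfl⟩ := List.mem_map.1 he
    exact (moveCon_holds w g e' x).2 (hx e' he')
  · intro hz
    refine ⟨(g.real w).symm.apply z, fun e he => ?_, RotTrans.apply_symm_apply _ _⟩
    rw [← moveCon_holds w g, RotTrans.apply_symm_apply]
    exact hz _ (List.mem_map_of_mem he)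

def rotV (v : Vec × Vec) : Vec × Vec := (Vec.smul ⟨-1, 1⟩ v.1 + -v.2, v.1)

noncomputable def evP (w : Wt) (v : Vec × Vec) : Plane := (v.1.ev w, v.2.ev w)

theorem evP_rotV (w : Wt) (v : Vec × Vec) : evP w (rotV v) = rot (evP w v) := by
  have hb : (ZW.mk (-1) 1).val = β := by rw [beta_eq, ZW.val]; push_cast; ring
  simp [evP, rotV, rot, hb]; ring

theorem evP_rotV_iter (w : Wt) (k : ℕ) (v : Vec × Vec) :
    evP w (rotV^[k] v) = rot^[k] (evP w v) := by
  induction k generalizing v with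
  | zero => rfl
  | succ k ih => rw [Function.iterate_succ_apply, ih, evP_rotV]; rfl

/-- The composition `g h`. -/
def DIso.comp (g h : DIso) : DIso :=
  let r := rotV^[(g.1 : ℕ)] h.2
  (g.1 + h.1, r.1 + g.2.1, r.2 + g.2.2)

theorem DIso.comp_apply (w : Wt) (g h : DIso) (x : Plane) :
    ((g.comp h).real w).apply x = (g.real w).apply ((h.real w).apply x) := by
  simp only [DIso.comp, DIso.real, RotTrans.apply, rot_iter_fin_add, rot_iter_add, add_assoc]
  congr 1
  have := evP_rotV_iter w g.1 h.2
  simp only [evP] at this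
  rw [← this]
  simp

def DIso.id : DIso := (0, ⟨⟨0, 0⟩, ⟨0, 0⟩, ⟨0, 0⟩, ⟨0, 0⟩⟩, ⟨⟨0, 0⟩, ⟨0, 0⟩, ⟨0, 0⟩, ⟨0, 0⟩⟩)

theorem DIso.id_apply (w : Wt) (x : Plane) : (DIso.id.real w).apply x = x := by
  simp [DIso.id, DIso.real, RotTrans.apply, Vec.ev, ZW.val]

/-- The isometry along a path. -/
def pathIso {n : ℕ} (X : DDom Vec n) : List (Fin n) → DIso
  | [] => DIso.id
  | i :: p => (pathIso X p).comp (X.iso i)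

/-! ### The maps -/

namespace DressedDomain

variable {n : ℕ} {X : DressedDomain n}

/-- The map selects some atom containing the point by choice; disjointness makes the selection
unambiguous. -/
theorem map_of_mem (hX : X.AtomsDisjoint) {i : Fin n} {x : Plane} (hx : x ∈ (X.tile i).region) :
    X.map x = (X.iso i).apply x := by
  have h : ∃ i, x ∈ (X.tile i).region := ⟨i, hx⟩
  rw [map, dif_pos h]
  have : h.choose = i := by
    by_contra hne
    exact Set.disjoint_left.1 (hX hne) h.choose_spec hx
  rw [this]

theorem map_of_notMem {x : Plane} (hx : x ∉ X.domain) : X.map x = x := by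
  rw [map, dif_neg]
  simpa [domain] using hx

theorem mem_domain {i : Fin n} {x : Plane} (hx : x ∈ (X.tile i).region) : x ∈ X.domain :=
  Set.mem_iUnion.2 ⟨i, hx⟩

theorem image_map_of_subset (hX : X.AtomsDisjoint) {i : Fin n} {S : Set Plane}
    (hS : S ⊆ (X.tile i).region) : X.map '' S = (X.iso i).apply '' S :=
  Set.image_congr fun _ hx => map_of_mem hX (hS hx)

theorem FollowsPath.mono {S S' : Set Plane} {p : List (Fin n)} (h : S' ⊆ S)
    (hS : X.FollowsPath S p) : X.FollowsPath S' p := by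
  induction p generalizing S S' with
  | nil => trivial
  | cons i p ih => exact ⟨h.trans hS.1, ih (Set.image_mono h) hS.2⟩

end DressedDomain

theorem real_tile_region {n : ℕ} (w : Wt) (X : DDom Vec n) (i : Fin n) :
    ((X.real (Vec.ev w)).tile i).region = reg w (cons (X.tile i)) := region_realTile w _

theorem real_iso {n : ℕ} (w : Wt) (X : DDom Vec n) (i : Fin n) :
    (X.real (Vec.ev w)).iso i = (X.iso i).real w := rfl

/-! ### Exact covers of a domain by atoms -/

theorem ExactlyOne.exists {α : Type*} {f : α → Set Plane} {L : List α} {x : Plane}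
    (h : ExactlyOne f L x) : ∃ a ∈ L, x ∈ f a := by
  classical
  obtain ⟨a, ha⟩ := h
  have : a ∈ L.filter (fun a => x ∈ f a) := by rw [ha]; simp
  rw [List.mem_filter] at this
  exact ⟨a, this.1, by simpa using this.2⟩

theorem ExactlyOne.unique {α : Type*} {f : α → Set Plane} {L : List α} {x : Plane}
    (h : ExactlyOne f L x) {a b : α} (ha : a ∈ L) (hb : b ∈ L) (hxa : x ∈ f a) (hxb : x ∈ f b) :
    a = b := by
  classical
  obtain ⟨c, hc⟩ := h
  have h1 : a ∈ L.filter (fun a => x ∈ f a) := List.mem_filter.2 ⟨ha, by simpa using hxa⟩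
  have h2 : b ∈ L.filter (fun a => x ∈ f a) := List.mem_filter.2 ⟨hb, by simpa using hxb⟩
  rw [hc, List.mem_singleton] at h1 h2
  rw [h1, h2]

/-- The regions `D` and `T i` form an exact cover. -/
def covers {n : ℕ} (D : List Con) (T : Fin n → List Con) : Bool :=
  cover ((List.finRange n).map T) D && (List.finRange n).all fun i => sub (T i) D

theorem covers_spec {n : ℕ} {w : Wt} {D : List Con} {T : Fin n → List Con}
    (h : covers D T = true) :
    (⋃ i, reg w (T i)) = reg w D ∧ Pairwise fun i j => Disjoint (reg w (T i)) (reg w (T j)) := by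
  unfold covers at h
  rw [Bool.and_eq_true, List.all_eq_true] at h
  have key := cover_spec (w := w) T _ D h.1
  have hs : ∀ i, reg w (T i) ⊆ reg w D := fun i => subset_of_sub (h.2 i (List.mem_finRange i))
  constructor
  · refine Set.Subset.antisymm (Set.iUnion_subset hs) fun x hx => ?_
    obtain ⟨i, -, hi⟩ := (key x hx).exists
    exact Set.mem_iUnion.2 ⟨i, hi⟩
  · intro i j hij
    rw [Set.disjoint_left]
    intro x hi hj
    exact hij ((key x (hs i hi)).unique (List.mem_finRange i) (List.mem_finRange j) hi hj)

/-- The atoms of `X`, and their images, tile `D`. -/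
def chkDom {n : ℕ} (X : DDom Vec n) (D : List Con) : Bool :=
  covers D (fun i => cons (X.tile i))

def chkBij {n : ℕ} (X : DDom Vec n) (D : List Con) : Bool :=
  covers D (fun i => move (X.iso i) (cons (X.tile i)))

theorem chkDom_spec {n : ℕ} {X : DDom Vec n} {D : List Con} (h : chkDom X D = true) (w : Wt) :
    (X.real (Vec.ev w)).AtomsDisjoint ∧ (X.real (Vec.ev w)).domain = reg w D := by
  obtain ⟨h1, h2⟩ := covers_spec (w := w) h
  simp only [DressedDomain.AtomsDisjoint, DressedDomain.domain, real_tile_region]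
  exact ⟨h2, h1⟩

/-- The atoms and their images partition the same region, and on each atom the map is an injective
isometry. -/
theorem chkBij_spec {n : ℕ} {X : DDom Vec n} {D : List Con} (h : chkDom X D = true)
    (h' : chkBij X D = true) (w : Wt) :
    Set.BijOn (X.real (Vec.ev w)).map (X.real (Vec.ev w)).domain
      (X.real (Vec.ev w)).domain := by
  obtain ⟨hd, hD⟩ := chkDom_spec h w
  obtain ⟨h1, h2⟩ := covers_spec (w := w) h'
  set Y := X.real (Vec.ev w) with hY
  have him : ∀ i, (Y.iso i).apply '' (Y.tile i).region
      = reg w (move (X.iso i) (cons (X.tile i))) := fun i => by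
    rw [← image_reg, hY, real_tile_region, real_iso]
  refine ⟨fun x hx => ?_, fun x hx y hy hxy => ?_, fun z hz => ?_⟩
  · obtain ⟨i, hi⟩ := Set.mem_iUnion.1 hx
    rw [DressedDomain.map_of_mem hd hi, hD, ← h1]
    exact Set.mem_iUnion.2 ⟨i, him i ▸ Set.mem_image_of_mem _ hi⟩
  · obtain ⟨i, hi⟩ := Set.mem_iUnion.1 hx
    obtain ⟨j, hj⟩ := Set.mem_iUnion.1 hy
    rw [DressedDomain.map_of_mem hd hi, DressedDomain.map_of_mem hd hj] at hxy
    have hi' := him i ▸ Set.mem_image_of_mem (Y.iso i).apply hi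
    have hj' := him j ▸ Set.mem_image_of_mem (Y.iso j).apply hj
    by_cases hij : i = j
    · subst hij; exact RotTrans.injective _ hxy
    · rw [hxy] at hi'
      exact absurd hj' (Set.disjoint_left.1 (h2 hij) hi')
  · rw [hD, ← h1] at hz
    obtain ⟨i, hi⟩ := Set.mem_iUnion.1 hz
    rw [← him i] at hi
    obtain ⟨x, hx, rfl⟩ := hi
    exact ⟨x, DressedDomain.mem_domain hx, DressedDomain.map_of_mem hd hx⟩

/-! ### Return paths -/

/-- The tile `T` moves along the path. -/
def follow {n : ℕ} (X : DDom Vec n) : List (Fin n) → List Con → Bool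
  | [], _ => true
  | i :: p, T => sub T (cons (X.tile i)) && follow X p (move (X.iso i) T)

/-- The positions of a tile along a path. -/
def floors {n : ℕ} (X : DDom Vec n) : List (Fin n) → List Con → List (Fin n × List Con)
  | [], _ => []
  | i :: p, T => (i, T) :: floors X p (move (X.iso i) T)

/-- The final position. -/
def final {n : ℕ} (X : DDom Vec n) : List (Fin n) → List Con → List Con
  | [], T => T
  | i :: p, T => final X p (move (X.iso i) T)

theorem follow_spec {n : ℕ} {X : DDom Vec n} {w : Wt} :
    ∀ {p : List (Fin n)} {T : List Con}, follow X p T = true →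
      (X.real (Vec.ev w)).FollowsPath (reg w T) p
  | [], _, _ => trivial
  | i :: p, T, h => by
    unfold follow at h
    rw [Bool.and_eq_true] at h
    refine ⟨?_, ?_⟩
    · rw [real_tile_region]; exact subset_of_sub h.1
    · rw [real_iso, image_reg]; exact follow_spec h.2

theorem floors_length {n : ℕ} {X : DDom Vec n} :
    ∀ (p : List (Fin n)) (T : List Con), (floors X p T).length = p.length
  | [], _ => rfl
  | i :: p, T => by simp [floors, floors_length p]

theorem follow_step {n : ℕ} {X : DDom Vec n} {w : Wt} (hd : (X.real (Vec.ev w)).AtomsDisjoint)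
    {i : Fin n} {T : List Con} (h : sub T (cons (X.tile i)) = true) :
    (X.real (Vec.ev w)).map '' reg w T = reg w (move (X.iso i) T) := by
  rw [DressedDomain.image_map_of_subset hd (i := i), real_iso, image_reg]
  rw [real_tile_region]; exact subset_of_sub h

theorem floors_spec {n : ℕ} {X : DDom Vec n} {w : Wt} (hd : (X.real (Vec.ev w)).AtomsDisjoint) :
    ∀ {p : List (Fin n)} {T : List Con}, follow X p T = true →
      ∀ (k : ℕ) (a : Fin n × List Con), (floors X p T)[k]? = some a →
        (X.real (Vec.ev w)).map^[k] '' reg w T = reg w a.2 ∧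
          reg w a.2 ⊆ ((X.real (Vec.ev w)).tile a.1).region
  | [], _, _, k, a, ha => by simp [floors] at ha
  | i :: p, T, h, k, a, ha => by
    unfold follow at h
    rw [Bool.and_eq_true] at h
    cases k with
    | zero =>
      simp only [floors, List.getElem?_cons_zero, Option.some.injEq] at ha
      subst ha
      refine ⟨by simp, ?_⟩
      rw [real_tile_region]; exact subset_of_sub h.1
    | succ k =>
      simp only [floors, List.getElem?_cons_succ] at ha
      have := floors_spec hd h.2 k a ha
      rw [Function.iterate_succ, Set.image_comp, follow_step hd h.1]
      exact this

theorem final_spec {n : ℕ} {X : DDom Vec n} {w : Wt} (hd : (X.real (Vec.ev w)).AtomsDisjoint) :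
    ∀ {p : List (Fin n)} {T : List Con}, follow X p T = true →
      (X.real (Vec.ev w)).map^[p.length] '' reg w T = reg w (final X p T)
  | [], T, _ => by simp [final]
  | i :: p, T, h => by
    unfold follow at h
    rw [Bool.and_eq_true] at h
    rw [List.length_cons, Function.iterate_succ, Set.image_comp, follow_step hd h.1]
    exact final_spec hd h.2

theorem pathIso_spec {n : ℕ} {X : DDom Vec n} {w : Wt} (hd : (X.real (Vec.ev w)).AtomsDisjoint) :
    ∀ {p : List (Fin n)} {T : List Con}, follow X p T = true → ∀ x ∈ reg w T,
      (X.real (Vec.ev w)).map^[p.length] x = ((pathIso X p).real w).apply x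
  | [], T, _, x, _ => by simp [pathIso, DIso.id_apply]
  | i :: p, T, h, x, hx => by
    unfold follow at h
    rw [Bool.and_eq_true] at h
    have hx' : x ∈ ((X.real (Vec.ev w)).tile i).region := by
      rw [real_tile_region]; exact subset_of_sub h.1 hx
    rw [List.length_cons, Function.iterate_succ_apply, pathIso, DIso.comp_apply,
      DressedDomain.map_of_mem hd hx', real_iso]
    refine pathIso_spec hd h.2 _ ?_
    rw [← image_reg]; exact Set.mem_image_of_mem _ hx

/-- A dressed sub-domain with computable coefficients, with its domain. -/
structure DSub (n : ℕ) where
  m : ℕ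
  dd : DDom Vec m
  path : Fin m → List (Fin n)
  dom : List Con

/-- A periodic tile with computable coefficients, and a point of it. -/
structure DPer (n : ℕ) where
  tile : List (DEdge Vec)
  path : List (Fin n)
  wit : Vec × Vec

noncomputable def DSub.real {n : ℕ} (w : Wt) (Y : DSub n) : SubDomain n :=
  ⟨Y.m, Y.dd.real (Vec.ev w), Y.path⟩

noncomputable def DPer.real {n : ℕ} (w : Wt) (Q : DPer n) : PathTile n :=
  ⟨realTile (Vec.ev w) Q.tile, Q.path⟩

/-- All positions after the initial one must avoid `D`, which makes the end of the path a first
return. Isometries are compared through their vertex data, so the equality holds for all weights at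
once. -/
def chkPath {n : ℕ} (X : DDom Vec n) (p : List (Fin n)) (T D : List Con) (g : DIso) : Bool :=
  decide (p ≠ []) && follow X p T && ((floors X p T).drop 1).all (fun a => disj a.2 D) &&
    sub (final X p T) D && decide (pathIso X p = g)

def chkSub {n : ℕ} (X : DDom Vec n) (Y : DSub n) : Bool :=
  chkDom Y.dd Y.dom && (List.finRange Y.m).all fun j =>
    chkPath X (Y.path j) (cons (Y.dd.tile j)) Y.dom (Y.dd.iso j)

theorem reg_subset_domain_of_follow {n : ℕ} {X : DDom Vec n} {w : Wt} {p : List (Fin n)}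
    {T : List Con} (hp : p ≠ []) (h : follow X p T = true) :
    reg w T ⊆ (X.real (Vec.ev w)).domain := by
  cases p with
  | nil => exact absurd rfl hp
  | cons i p =>
    unfold follow at h
    rw [Bool.and_eq_true] at h
    intro x hx
    refine DressedDomain.mem_domain (i := i) ?_
    rw [real_tile_region]; exact subset_of_sub h.1 hx

theorem chkSub_spec {n : ℕ} {X : DDom Vec n} {Y : DSub n} {w : Wt}
    (hd : (X.real (Vec.ev w)).AtomsDisjoint) (h : chkSub X Y = true) :
    (Y.real w).IsInduced (X.real (Vec.ev w)) := by
  unfold chkSub at h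
  rw [Bool.and_eq_true, List.all_eq_true] at h
  obtain ⟨h1, h2⟩ := chkDom_spec h.1 w
  have h3 : ∀ j, chkPath X (Y.path j) (cons (Y.dd.tile j)) Y.dom (Y.dd.iso j) = true :=
    fun j => h.2 j (List.mem_finRange j)
  simp only [chkPath, Bool.and_eq_true, decide_eq_true_iff, List.all_eq_true] at h3
  refine ⟨h1, ?_, fun (j : Fin Y.m) => ?_⟩
  · refine Set.iUnion_subset fun (j : Fin Y.m) => ?_
    change ((Y.dd.real (Vec.ev w)).tile j).region ⊆ _
    rw [real_tile_region]
    exact reg_subset_domain_of_follow (h3 j).1.1.1.1 (h3 j).1.1.1.2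
  · obtain ⟨⟨⟨⟨hp, hf⟩, hr⟩, hs⟩, hi⟩ := h3 j
    change (X.real (Vec.ev w)).FollowsPath ((Y.dd.real (Vec.ev w)).tile j).region (Y.path j) ∧
      ∀ x ∈ ((Y.dd.real (Vec.ev w)).tile j).region,
        IsFirstReturn (X.real (Vec.ev w)).map (Y.dd.real (Vec.ev w)).domain x (Y.path j).length ∧
        (X.real (Vec.ev w)).map^[(Y.path j).length] x = ((Y.dd.real (Vec.ev w)).iso j).apply x
    rw [h2, real_tile_region]
    refine ⟨follow_spec hf, fun x hx => ⟨⟨List.length_pos_of_ne_nil hp, ?_, fun k hk hkp => ?_⟩, ?_⟩⟩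
    · refine subset_of_sub hs ?_
      rw [← final_spec hd hf]
      exact Set.mem_image_of_mem _ hx
    · have hlt : k < (floors X (Y.path j) (cons (Y.dd.tile j))).length := by
        rwa [floors_length]
      have hget := List.getElem?_eq_getElem hlt
      obtain ⟨e1, -⟩ := floors_spec (w := w) hd hf k _ hget
      -- Position `k` along the path is entry `k - 1` of the list without its head.
      have hm := hr ((floors X (Y.path j) (cons (Y.dd.tile j)))[1 + (k - 1)]'(by omega)) (by
        rw [List.mem_iff_getElem]
        exact ⟨k - 1, by rw [List.length_drop]; omega, by rw [List.getElem_drop]⟩)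
      have hk1 : 1 + (k - 1) = k := by omega
      simp only [hk1] at hm
      refine Set.disjoint_left.1 (disjoint_of_disj (w := w) hm) ?_
      rw [← e1]
      exact Set.mem_image_of_mem _ hx
    · rw [pathIso_spec hd hf x hx, hi, real_iso]

/-- The constraint holds at the point `v`. -/
def conAt (v : Vec × Vec) (e : Con) : Bool :=
  okd (e.c + -(Vec.smul (sdZ e.j).1 v.1 + Vec.smul (sdZ e.j).2 v.2)) e.s false

theorem mem_reg_of_conAt {w : Wt} {v : Vec × Vec} {T : List Con}
    (h : T.all (conAt v) = true) : evP w v ∈ reg w T := by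
  rw [List.all_eq_true] at h
  intro e he
  refine holds_of_okd (h e he) (r := sform e.j (evP w v)) ?_ le_rfl (by simp)
  simp [sform, evP]; ring

/-- The tile may come back rotated, with its edges in another order; equality is therefore tested by
two inclusions. The witness shows that the tile is non-empty. -/
def chkPer {n : ℕ} (X : DDom Vec n) (Q : DPer n) : Bool :=
  let T := cons Q.tile
  decide (Q.path ≠ []) && follow X Q.path T && T.all (conAt Q.wit) &&
    sub (final X Q.path T) T && sub T (final X Q.path T)

theorem chkPer_spec {n : ℕ} {X : DDom Vec n} {Q : DPer n} {w : Wt}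
    (hd : (X.real (Vec.ev w)).AtomsDisjoint) (h : chkPer X Q = true) :
    (Q.real w).IsPeriodic (X.real (Vec.ev w)) := by
  simp only [chkPer, Bool.and_eq_true, decide_eq_true_iff] at h
  obtain ⟨⟨⟨⟨hp, hf⟩, hw⟩, h1⟩, h2⟩ := h
  unfold PathTile.IsPeriodic DPer.real
  simp only [region_realTile]
  exact ⟨⟨_, mem_reg_of_conAt hw⟩, hp, follow_spec hf,
    (final_spec hd hf).trans (Set.Subset.antisymm (subset_of_sub h1) (subset_of_sub h2))⟩

/-! ### Recursive tiling -/

/-- All the tiles of the orbits of the tiles in the list, with their labels. -/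
def allFloors {n : ℕ} (X : DDom Vec n) (L : List (List Con × List (Fin n))) :
    List ((ℕ × ℕ) × Fin n × List Con) :=
  L.zipIdx.flatMap fun c => (floors X c.1.2 c.1.1).zipIdx.map fun a => ((c.2, a.2), a.1)

/-- Each position on a return orbit lies in the atom prescribed by the path, so the exact cover can
be tested one atom at a time. -/
def chkTiles {n : ℕ} (X : DDom Vec n) (L : List (List Con × List (Fin n))) : Bool :=
  (List.finRange n).all fun i =>
    cover (((allFloors X L).filter fun a => decide (a.2.1 = i)).map fun a => a.2.2)
      (cons (X.tile i))

theorem mem_allFloors {n : ℕ} {X : DDom Vec n} {L : List (List Con × List (Fin n))} {q k : ℕ}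
    {a : Fin n × List Con} : ((q, k), a) ∈ allFloors X L ↔
      ∃ c, L[q]? = some c ∧ (floors X c.2 c.1)[k]? = some a := by
  simp only [allFloors, List.mem_flatMap, List.mem_map, Prod.exists, List.mem_zipIdx_iff_getElem?,
    Prod.mk.injEq]
  constructor
  · rintro ⟨c, d, q', h1, b, b', k', h2, ⟨rfl, rfl⟩, rfl⟩
    exact ⟨c, d, h1, h2⟩
  · rintro ⟨c, d, h1, h2⟩
    exact ⟨c, d, q, h1, a.1, a.2, k, h2, ⟨rfl, rfl⟩, rfl⟩

/-- The label (tile, time) is part of each entry, so equal sets at different times remain different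
entries. Exactly one entry containing the point therefore means exactly one pair in `TiledByOrbits`.
-/
theorem chkTiles_spec {n : ℕ} {X : DDom Vec n} {L : List (List Con × List (Fin n))} {w : Wt}
    (hd : (X.real (Vec.ev w)).AtomsDisjoint) (hf : ∀ c ∈ L, follow X c.2 c.1 = true)
    (h : chkTiles X L = true) :
    TiledByOrbits (X.real (Vec.ev w)).map (X.real (Vec.ev w)).domain
      (L.map fun c => (reg w c.1, c.2.length)) := by
  set Y := X.real (Vec.ev w) with hY
  have key : ∀ (q : ℕ) (c : List Con × List (Fin n)) (k : ℕ), L[q]? = some c → k < c.2.length →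
      ∃ a, ((q, k), a) ∈ allFloors X L ∧ Y.map^[k] '' reg w c.1 = reg w a.2 ∧
        reg w a.2 ⊆ (Y.tile a.1).region := by
    intro q c k hc hk
    have hlt : k < (floors X c.2 c.1).length := by rwa [floors_length]
    have hget := List.getElem?_eq_getElem hlt
    exact ⟨_, mem_allFloors.2 ⟨c, hc, hget⟩,
      floors_spec hd (hf c (List.mem_of_getElem? hc)) k _ hget⟩
  unfold chkTiles at h
  rw [List.all_eq_true] at h
  constructor
  · intro c hc k hk
    obtain ⟨c', hc', rfl⟩ := List.mem_map.1 hc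
    obtain ⟨q, hq⟩ := List.mem_iff_getElem?.1 hc'
    obtain ⟨a, -, e, hs⟩ := key q c' k hq hk
    rw [e]
    exact hs.trans fun x hx => DressedDomain.mem_domain hx
  · intro z hz
    obtain ⟨i, hi⟩ := Set.mem_iUnion.1 hz
    have hi' := hi
    rw [hY, real_tile_region] at hi'
    have hx := cover_spec (w := w) (fun a : (ℕ × ℕ) × Fin n × List Con => a.2.2) _ _
      (h i (List.mem_finRange i)) z hi'
    -- A position that contains `z` lies in the atom of `z`, by disjointness of the atoms, so it has
    -- survived the filter.
    have hmem : ∀ q : Fin (L.map fun c => (reg w c.1, c.2.length)).length × ℕ,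
        (q.2 < ((L.map fun c => (reg w c.1, c.2.length)).get q.1).2 ∧
          z ∈ Y.map^[q.2] '' ((L.map fun c => (reg w c.1, c.2.length)).get q.1).1) →
        ∃ a : Fin n × List Con, ((q.1.val, q.2), a) ∈
          (allFloors X L).filter (fun a => decide (a.2.1 = i)) ∧ z ∈ reg w a.2 := by
      rintro ⟨⟨q, hq⟩, k⟩ ⟨h1, h2⟩
      have hq' : q < L.length := by simpa using hq
      simp only [List.get_eq_getElem, List.getElem_map] at h1 h2
      obtain ⟨a, ha, e, hs⟩ := key q _ k (List.getElem?_eq_getElem hq') h1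
      rw [e] at h2
      refine ⟨a, List.mem_filter.2 ⟨ha, ?_⟩, h2⟩
      rw [decide_eq_true_iff]
      by_contra hne
      exact Set.disjoint_left.1 (hd hne) (hs h2) hi
    obtain ⟨⟨⟨q, k⟩, a⟩, ha, hza⟩ := hx.exists
    obtain ⟨c, hc, hk⟩ := mem_allFloors.1 (List.mem_filter.1 ha).1
    obtain ⟨hq', hc'⟩ := List.getElem?_eq_some_iff.1 hc
    have hlt : k < c.2.length := by
      rw [← floors_length (X := X) c.2 c.1]
      exact (List.getElem?_eq_some_iff.1 hk).1
    have hsp := (floors_spec (w := w) hd (hf c (List.mem_of_getElem? hc)) k _ hk).1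
    refine ⟨(⟨q, by simpa using hq'⟩, k), ?_, ?_⟩
    · simp only [List.get_eq_getElem, List.getElem_map, hc']
      refine ⟨hlt, ?_⟩
      rw [← hY] at hsp
      rw [hsp]; exact hza
    · intro q' hq''
      obtain ⟨b, hb, hzb⟩ := hmem q' hq''
      have e := hx.unique ha hb hza hzb
      simp only [Prod.mk.injEq] at e
      exact Prod.ext (Fin.ext e.1.1.symm) e.1.2.symm

def tilesOf {n : ℕ} (Ys : List (DSub n)) (Qs : List (DPer n)) : List (List Con × List (Fin n)) :=
  (Ys.flatMap fun Y => List.ofFn fun j => (cons (Y.dd.tile j), Y.path j)) ++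
    Qs.map fun Q => (cons Q.tile, Q.path)

/-- Checks recursive tiling. -/
def chkRT {n : ℕ} (X : DDom Vec n) (Ys : List (DSub n)) (Qs : List (DPer n)) : Bool :=
  Ys.all (chkSub X) && Qs.all (chkPer X) && chkTiles X (tilesOf Ys Qs)

theorem chkRT_spec {n : ℕ} {X : DDom Vec n} {Ys : List (DSub n)} {Qs : List (DPer n)} {w : Wt}
    (hd : (X.real (Vec.ev w)).AtomsDisjoint) (h : chkRT X Ys Qs = true) :
    RecursivelyTiles (X.real (Vec.ev w)) (Ys.map (DSub.real w)) (Qs.map (DPer.real w)) := by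
  simp only [chkRT, Bool.and_eq_true, List.all_eq_true] at h
  obtain ⟨⟨h1, h2⟩, h3⟩ := h
  refine ⟨?_, ?_, ?_⟩
  · intro Y hY
    obtain ⟨Y', hY', rfl⟩ := List.mem_map.1 hY
    exact chkSub_spec hd (h1 _ hY')
  · intro Q hQ
    obtain ⟨Q', hQ', rfl⟩ := List.mem_map.1 hQ
    exact chkPer_spec hd (h2 _ hQ')
  · have hf : ∀ c ∈ tilesOf Ys Qs, follow X c.2 c.1 = true := by
      intro c hc
      simp only [tilesOf, List.mem_append, List.mem_flatMap, List.mem_map, List.mem_ofFn] at hc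
      rcases hc with ⟨Y, hY, j, rfl⟩ | ⟨Q, hQ, rfl⟩
      · have := h1 Y hY
        simp only [chkSub, Bool.and_eq_true, List.all_eq_true] at this
        have := this.2 j (List.mem_finRange j)
        simp only [chkPath, Bool.and_eq_true] at this
        exact this.1.1.1.2
      · have := h2 Q hQ
        simp only [chkPer, Bool.and_eq_true] at this
        exact this.1.1.1.2
    have := chkTiles_spec (w := w) hd hf h3
    convert this using 1
    simp only [tilesOf, List.map_append, List.map_map, List.map_flatMap, List.flatMap_map,
      List.map_ofFn, Function.comp_def, DSub.real, DPer.real, region_realTile, real_tile_region]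

/-! ### Similarities -/

theorem form_add (m : Fin 5) (x y : Plane) : form m (x + y) = form m x + form m y := by
  simp only [form_eq_sform, sform_add]

theorem form_smul (m : Fin 5) (a : ℝ) (x : Plane) : form m (a • x) = a * form m x := by
  simp only [form, Prod.smul_fst, Prod.smul_snd, smul_eq_mul]; ring

theorem form_rot_iter (m k : Fin 5) (x : Plane) :
    form (m + k) (rot^[(k : ℕ)] x) = form m x := by
  have h : ∀ m k : Fin 5, jOut (m + k) = jOut m + jOut k := by decide
  rw [form_eq_sform, form_eq_sform, h, sform_rot_iter]

theorem form_reflect (m : Fin 5) (x : Plane) : form (-m) (reflect x) = form m x := by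
  have h := beta_sq
  have key : ∀ m : Fin 5, (dir (-m)).1 + β * (dir (-m)).2 = (dir m).1 ∧
      -(dir (-m)).2 = (dir m).2 := by
    have e1 : (-1 : Fin 5) = 4 := rfl
    have e2 : (-2 : Fin 5) = 3 := rfl
    have e3 : (-3 : Fin 5) = 2 := rfl
    have e4 : (-4 : Fin 5) = 1 := rfl
    intro m
    fin_cases m <;> simp [dir, e1, e2, e3, e4] <;> linarith
  simp only [form, reflect]
  rw [← (key m).1, ← (key m).2]; ring

theorem rot_smul (a : ℝ) (x : Plane) : rot (a • x) = a • rot x := by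
  ext <;> simp [rot]; ring

theorem rot_iter_smul (k : ℕ) (a : ℝ) (x : Plane) : rot^[k] (a • x) = a • rot^[k] x := by
  induction k generalizing x with
  | zero => rfl
  | succ k ih => rw [Function.iterate_succ_apply, rot_smul, ih]; rfl

theorem reflect_add (x y : Plane) : reflect (x + y) = reflect x + reflect y := by
  ext <;> simp [reflect]; ring

theorem reflect_smul (a : ℝ) (x : Plane) : reflect (a • x) = a • reflect x := by
  ext <;> simp [reflect]; ring

theorem reflect_reflect (x : Plane) : reflect (reflect x) = x := by
  ext <;> simp [reflect]

theorem rot_reflect_rot (x : Plane) : rot (reflect (rot x)) = reflect x := by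
  ext <;> simp [reflect, rot]

theorem rot_iter_reflect (k : ℕ) (x : Plane) : rot^[k] (reflect (rot^[k] x)) = reflect x := by
  induction k generalizing x with
  | zero => rfl
  | succ k ih =>
    rw [Function.iterate_succ_apply', Function.iterate_succ_apply, ih, rot_reflect_rot]

theorem reflect_rot_iter (k : Fin 5) (x : Plane) :
    reflect (rot^[(k : ℕ)] x) = rot^[((-k : Fin 5) : ℕ)] (reflect x) := by
  rw [← rot_iter_reflect k x, rot_iter_neg_left]

/-- A similarity, with scaling factor `η`. -/
structure Sim where
  η : ℝ
  k : Fin 5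
  flip : Bool
  d : Plane
  η_pos : 0 < η

namespace Sim

noncomputable def lin (S : Sim) (x : Plane) : Plane := rot^[(S.k : ℕ)] (if S.flip then reflect x else x)

noncomputable def apply (S : Sim) (x : Plane) : Plane := S.η • S.lin x + S.d

theorem isSimilarity (S : Sim) : IsSimilarity S.η S.apply :=
  ⟨S.η_pos, S.k, S.flip, S.d, fun _ => rfl⟩

theorem lin_add (S : Sim) (x y : Plane) : S.lin (x + y) = S.lin x + S.lin y := by
  unfold lin; split_ifs <;> simp [rot_iter_add, reflect_add]

theorem lin_smul (S : Sim) (a : ℝ) (x : Plane) : S.lin (a • x) = a • S.lin x := by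
  unfold lin; split_ifs <;> simp only [rot_iter_smul, reflect_smul]

/-- The index of the image of a direction. -/
def dirIdx (S : Sim) (m : Fin 5) : Fin 5 := (if S.flip then -m else m) + S.k

theorem form_lin (S : Sim) (m : Fin 5) (x : Plane) : form (S.dirIdx m) (S.lin x) = form m x := by
  unfold dirIdx lin
  rw [form_rot_iter]
  split_ifs
  · exact form_reflect m x
  · rfl

theorem form_apply (S : Sim) (m : Fin 5) (x : Plane) :
    form (S.dirIdx m) (S.apply x) = S.η * form m x + form (S.dirIdx m) S.d := by
  rw [apply, form_add, form_smul, form_lin]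

def rotIdx (S : Sim) (k : Fin 5) : Fin 5 := if S.flip then -k else k

theorem lin_rot (S : Sim) (k : Fin 5) (x : Plane) :
    S.lin (rot^[(k : ℕ)] x) = rot^[(S.rotIdx k : ℕ)] (S.lin x) := by
  unfold lin rotIdx
  split_ifs
  · rw [reflect_rot_iter, ← rot_iter_fin_add, ← rot_iter_fin_add, add_comm]
  · rw [← rot_iter_fin_add, ← rot_iter_fin_add, add_comm]

/-- The inverse linear map. -/
noncomputable def linInv (S : Sim) (x : Plane) : Plane :=
  if S.flip then reflect (rot^[((-S.k : Fin 5) : ℕ)] x) else rot^[((-S.k : Fin 5) : ℕ)] x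

theorem lin_linInv (S : Sim) (x : Plane) : S.lin (S.linInv x) = x := by
  unfold lin linInv
  split_ifs <;> simp [reflect_reflect, rot_iter_neg_right]

theorem linInv_lin (S : Sim) (x : Plane) : S.linInv (S.lin x) = x := by
  unfold lin linInv
  split_ifs <;> simp [reflect_reflect, rot_iter_neg_left]

noncomputable def inv (S : Sim) (x : Plane) : Plane := S.linInv (S.η⁻¹ • (x - S.d))

theorem inv_apply (S : Sim) (x : Plane) : S.inv (S.apply x) = x := by
  rw [inv, apply, add_sub_cancel_right, smul_smul, inv_mul_cancel₀ S.η_pos.ne', one_smul,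
    linInv_lin]

theorem apply_inv (S : Sim) (x : Plane) : S.apply (S.inv x) = x := by
  rw [inv, apply, lin_linInv, smul_smul, mul_inv_cancel₀ S.η_pos.ne', one_smul, sub_add_cancel]

theorem injective (S : Sim) : Function.Injective S.apply :=
  Function.LeftInverse.injective S.inv_apply

/-- Composition. -/
noncomputable def comp (S T : Sim) : Sim where
  η := S.η * T.η
  k := S.k + if S.flip then -T.k else T.k
  flip := xor S.flip T.flip
  d := S.apply T.d
  η_pos := mul_pos S.η_pos T.η_pos

theorem comp_lin (S T : Sim) (x : Plane) : (S.comp T).lin x = S.lin (T.lin x) := by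
  unfold lin comp
  simp only
  cases S.flip <;> cases T.flip <;>
    simp [rot_iter_fin_add, reflect_rot_iter, reflect_reflect]

theorem comp_apply (S T : Sim) (x : Plane) : (S.comp T).apply x = S.apply (T.apply x) := by
  rw [apply, comp_lin, apply, apply, lin_add, lin_smul, smul_add, smul_smul, add_assoc]
  rfl

/-- The inverse similarity. -/
noncomputable def symm (S : Sim) : Sim where
  η := S.η⁻¹
  k := if S.flip then S.k else -S.k
  flip := S.flip
  d := S.inv 0
  η_pos := inv_pos.2 S.η_pos

theorem symm_apply (S : Sim) (x : Plane) : S.symm.apply x = S.inv x := by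
  have h : S.symm.lin x = S.linInv x := by
    unfold lin linInv symm
    simp only
    cases S.flip
    · simp
    · simp [reflect_rot_iter]
  have hl : ∀ a b : Plane, S.linInv (a + b) = S.linInv a + S.linInv b := fun a b => by
    unfold linInv; split_ifs <;> simp [rot_iter_add, reflect_add]
  have hs : ∀ (a : ℝ) (b : Plane), S.linInv (a • b) = a • S.linInv b := fun a b => by
    unfold linInv; split_ifs <;> simp only [rot_iter_smul, reflect_smul]
  rw [apply, h]
  change S.η⁻¹ • _ + S.linInv (S.η⁻¹ • (0 - S.d)) = S.linInv (S.η⁻¹ • (x - S.d))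
  rw [← hs, ← hl, ← smul_add]
  congr 2; abel

end Sim

/-- The image of a tile. -/
noncomputable def Tile.sim (S : Sim) (T : Tile) : Tile :=
  T.map fun e => ⟨S.dirIdx e.m, e.included, S.η * e.b + form (S.dirIdx e.m) S.d⟩

theorem Tile.region_sim (S : Sim) (T : Tile) : (T.sim S).region = S.apply '' T.region := by
  have key : ∀ (e : Edge) (x : Plane), Edge.Holds ⟨S.dirIdx e.m, e.included,
      S.η * e.b + form (S.dirIdx e.m) S.d⟩ (S.apply x) ↔ e.Holds x := by
    intro e x
    unfold Edge.Holds
    simp only [Sim.form_apply]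
    have := S.η_pos
    split_ifs
    · rw [add_le_add_iff_right, mul_le_mul_iff_right₀ this]
    · rw [add_lt_add_iff_right, mul_lt_mul_iff_right₀ this]
  ext z
  constructor
  · intro hz
    refine ⟨S.inv z, fun e he => ?_, S.apply_inv z⟩
    rw [← key, S.apply_inv]
    exact hz _ (List.mem_map_of_mem he)
  · rintro ⟨x, hx, rfl⟩ e he
    obtain ⟨e', he', rfl⟩ := List.mem_map.1 he
    exact (key e' x).2 (hx e' he')

/-- The conjugate isometry. -/
noncomputable def RotTrans.sim (S : Sim) (g : RotTrans) : RotTrans :=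
  ⟨S.rotIdx g.k, S.η • S.lin g.d + S.d - rot^[(S.rotIdx g.k : ℕ)] S.d⟩

theorem RotTrans.sim_apply (S : Sim) (g : RotTrans) (x : Plane) :
    (g.sim S).apply (S.apply x) = S.apply (g.apply x) := by
  simp only [apply, sim, Sim.apply, rot_iter_add, rot_iter_smul, Sim.lin_add, Sim.lin_rot,
    smul_add]
  abel

namespace DressedDomain

/-- The image of a dressed domain. -/
noncomputable def sim {n : ℕ} (S : Sim) (X : DressedDomain n) : DressedDomain n where
  tile i := (X.tile i).sim S
  iso i := (X.iso i).sim S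

/-- `G` conjugates `X` to `Y`, atom by atom. -/
structure Conj {n : ℕ} (G : Plane → Plane) (X Y : DressedDomain n) : Prop where
  inj : Function.Injective G
  region : ∀ i, (Y.tile i).region = G '' (X.tile i).region
  iso : ∀ i x, G ((X.iso i).apply x) = (Y.iso i).apply (G x)

theorem conj_sim {n : ℕ} (S : Sim) (X : DressedDomain n) : Conj S.apply X (X.sim S) :=
  ⟨S.injective, fun _ => Tile.region_sim S _, fun _ x => (RotTrans.sim_apply S _ x).symm⟩

theorem isSimilar_sim {n : ℕ} (S : Sim) (X : DressedDomain n) : IsSimilar S.η X (X.sim S) :=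
  ⟨S.apply, S.isSimilarity, Equiv.refl _, fun i => ⟨(conj_sim S X).region i, (conj_sim S X).iso i⟩⟩

namespace Conj

variable {n m : ℕ} {G : Plane → Plane} {X Y : DressedDomain n}

theorem domain (h : Conj G X Y) : Y.domain = G '' X.domain := by
  simp only [DressedDomain.domain, h.region, Set.image_iUnion]

theorem mem (h : Conj G X Y) {i : Fin n} {x : Plane} :
    G x ∈ (Y.tile i).region ↔ x ∈ (X.tile i).region := by
  rw [h.region, h.inj.mem_set_image]

theorem mem_domain (h : Conj G X Y) {x : Plane} : G x ∈ Y.domain ↔ x ∈ X.domain := by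
  rw [h.domain, h.inj.mem_set_image]

/-- Both maps choose an atom by the same predicate on the indices, so the choices agree even if the
atoms are not disjoint. -/
theorem map (h : Conj G X Y) (x : Plane) : Y.map (G x) = G (X.map x) := by
  have e : (fun i => G x ∈ (Y.tile i).region) = fun i => x ∈ (X.tile i).region :=
    funext fun i => propext h.mem
  unfold DressedDomain.map
  by_cases hx : ∃ i, x ∈ (X.tile i).region
  · have hy : ∃ i, G x ∈ (Y.tile i).region := by simpa only [h.mem] using hx
    rw [dif_pos hx, dif_pos hy, h.iso]
    congr 2
    simp only [e]
  · have hy : ¬ ∃ i, G x ∈ (Y.tile i).region := by simpa only [h.mem] using hx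
    rw [dif_neg hx, dif_neg hy]

theorem map_iter (h : Conj G X Y) (k : ℕ) (x : Plane) : Y.map^[k] (G x) = G (X.map^[k] x) :=
  ((show Function.Semiconj G X.map Y.map from fun x => (h.map x).symm).iterate_right k x).symm

theorem image_map_iter (h : Conj G X Y) (k : ℕ) (S : Set Plane) :
    Y.map^[k] '' (G '' S) = G '' (X.map^[k] '' S) := by
  simp only [Set.image_image, h.map_iter]

theorem atomsDisjoint (h : Conj G X Y) (hX : X.AtomsDisjoint) : Y.AtomsDisjoint := by
  intro i j hij
  rw [h.region, h.region]
  exact (Set.disjoint_image_iff h.inj).2 (hX hij)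

theorem bijOn (h : Conj G X Y) (hX : Set.BijOn X.map X.domain X.domain) :
    Set.BijOn Y.map Y.domain Y.domain := by
  rw [h.domain]
  refine ⟨?_, ?_, ?_⟩
  · rintro _ ⟨x, hx, rfl⟩
    rw [h.map]; exact Set.mem_image_of_mem _ (hX.1 hx)
  · rintro _ ⟨x, hx, rfl⟩ _ ⟨y, hy, rfl⟩ hxy
    rw [h.map, h.map] at hxy
    rw [hX.2.1 hx hy (h.inj hxy)]
  · rintro _ ⟨x, hx, rfl⟩
    obtain ⟨y, hy, rfl⟩ := hX.2.2 hx
    exact ⟨G y, Set.mem_image_of_mem _ hy, h.map y⟩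

theorem followsPath (h : Conj G X Y) {S : Set Plane} {p : List (Fin n)}
    (hS : X.FollowsPath S p) : Y.FollowsPath (G '' S) p := by
  induction p generalizing S with
  | nil => trivial
  | cons i p ih =>
    refine ⟨?_, ?_⟩
    · rw [h.region]; exact Set.image_mono hS.1
    · have : (Y.iso i).apply '' (G '' S) = G '' ((X.iso i).apply '' S) := by
        simp only [Set.image_image, h.iso]
      rw [this]; exact ih hS.2

theorem isInduced (h : Conj G X Y) {Z W : DressedDomain m} (h' : Conj G Z W)
    {p : Fin m → List (Fin n)} (hZ : SubDomain.IsInduced X ⟨m, Z, p⟩) :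
    SubDomain.IsInduced Y ⟨m, W, p⟩ := by
  refine ⟨h'.atomsDisjoint hZ.1, ?_, fun (j : Fin m) => ⟨?_, ?_⟩⟩
  · change W.domain ⊆ _
    rw [h'.domain, h.domain]; exact Set.image_mono hZ.2.1
  · change Y.FollowsPath (W.tile j).region (p j)
    rw [h'.region]; exact h.followsPath (hZ.2.2 j).1
  · change ∀ x ∈ (W.tile j).region, IsFirstReturn Y.map W.domain x (p j).length ∧
        Y.map^[(p j).length] x = (W.iso j).apply x
    rw [h'.region]
    rintro _ ⟨x, hx, rfl⟩
    obtain ⟨⟨h1, h2, h3⟩, h4⟩ := (hZ.2.2 j).2 x hx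
    refine ⟨⟨h1, ?_, fun k hk hk' => ?_⟩, ?_⟩
    · rw [h.map_iter, h'.mem_domain]; exact h2
    · rw [h.map_iter, h'.mem_domain]; exact h3 k hk hk'
    · rw [h.map_iter]
      rw [h4, ← h'.iso]

end Conj

end DressedDomain

/-- The image of a dressed sub-domain. -/
noncomputable def SubDomain.sim {n : ℕ} (S : Sim) (Y : SubDomain n) : SubDomain n :=
  ⟨Y.m, Y.dd.sim S, Y.path⟩

noncomputable def PathTile.sim {n : ℕ} (S : Sim) (Q : PathTile n) : PathTile n :=
  ⟨Q.tile.sim S, Q.path⟩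

open DressedDomain

theorem TiledByOrbits.image {G f g : Plane → Plane} (hG : Function.Injective G)
    (hfg : ∀ k x, g^[k] (G x) = G (f^[k] x)) {D : Set Plane} {L : List (Set Plane × ℕ)}
    (h : TiledByOrbits f D L) :
    TiledByOrbits g (G '' D) (L.map fun c => (G '' c.1, c.2)) := by
  have him : ∀ k (S : Set Plane), g^[k] '' (G '' S) = G '' (f^[k] '' S) := fun k S => by
    simp only [Set.image_image, hfg]
  refine ⟨?_, ?_⟩
  · intro c hc k hk
    obtain ⟨c', hc', rfl⟩ := List.mem_map.1 hc
    rw [him]; exact Set.image_mono (h.1 c' hc' k hk)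
  · rintro _ ⟨z, hz, rfl⟩
    obtain ⟨⟨q, k⟩, ⟨h1, h2⟩, h3⟩ := h.2 z hz
    refine ⟨(⟨q.1, by simp⟩, k), ⟨?_, ?_⟩, ?_⟩
    · simpa using h1
    · simp only [List.get_eq_getElem, List.getElem_map]
      rw [him]; exact Set.mem_image_of_mem _ h2
    · rintro ⟨⟨q', hq'⟩, k'⟩ ⟨h1', h2'⟩
      have hq : q' < L.length := by simpa using hq'
      simp only [List.get_eq_getElem, List.getElem_map] at h1' h2'
      rw [him, hG.mem_set_image] at h2'
      have := h3 (⟨q', hq⟩, k') ⟨h1', h2'⟩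
      exact Prod.ext (Fin.ext (congrArg (fun a => a.1.val) this)) (congrArg (fun a => a.2) this)

theorem RecursivelyTiles.sim {n : ℕ} {X : DressedDomain n} {Ys : List (SubDomain n)}
    {Qs : List (PathTile n)} (h : RecursivelyTiles X Ys Qs) (S : Sim) :
    RecursivelyTiles (X.sim S) (Ys.map (SubDomain.sim S)) (Qs.map (PathTile.sim S)) := by
  have hc := conj_sim S X
  refine ⟨?_, ?_, ?_⟩
  · intro Y hY
    obtain ⟨Y', hY', rfl⟩ := List.mem_map.1 hY
    exact hc.isInduced (conj_sim S Y'.dd) (h.1 Y' hY')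
  · intro Q hQ
    obtain ⟨Q', hQ', rfl⟩ := List.mem_map.1 hQ
    obtain ⟨h1, h2, h3, h4⟩ := h.2.1 Q' hQ'
    unfold PathTile.IsPeriodic PathTile.sim
    simp only [Tile.region_sim]
    exact ⟨h1.image _, h2, hc.followsPath h3, by rw [hc.image_map_iter, h4]⟩
  · have := h.2.2.image hc.inj hc.map_iter
    rw [← hc.domain] at this
    convert this using 1
    simp only [List.map_append, List.map_map, List.map_flatMap, List.flatMap_map, List.map_ofFn,
      Function.comp_def, SubDomain.sim, PathTile.sim, Tile.region_sim, (conj_sim S _).region]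

theorem DressedDomain.IsMerger.conj {n m : ℕ} {G : Plane → Plane} {Z Z' : DressedDomain m}
    {X X' : DressedDomain n} (h : Z.IsMerger X) (hZ : Conj G Z Z') (hX : Conj G X X')
    (hG : Function.Surjective G) : Z'.IsMerger X' := by
  refine ⟨hZ.atomsDisjoint h.1, by rw [hZ.domain, hX.domain, h.2.1], fun i => ?_⟩
  obtain ⟨j, h1, h2⟩ := h.2.2 i
  refine ⟨j, ?_, fun x => ?_⟩
  · rw [hZ.region, hX.region]; exact Set.image_mono h1
  · obtain ⟨x, rfl⟩ := hG x
    rw [← hX.iso, ← hZ.iso, h2]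

theorem Sim.surjective (S : Sim) : Function.Surjective S.apply := fun x => ⟨_, S.apply_inv x⟩

/-- Inductions proved for base triangles in standard position can thus be stacked inside one
another. -/
theorem Induces.sim {n m : ℕ} {X : DressedDomain n} {Z : DressedDomain m} (h : Induces X Z)
    (S : Sim) : Induces (X.sim S) (Z.sim S) := by
  obtain ⟨Y, Qs, h1, h2⟩ := h
  exact ⟨Y.sim S, _, h1.sim S, h2.conj (conj_sim S Z) (conj_sim S Y.dd) S.surjective⟩

/-! ### Affine functions of the parameters -/

/-- The affine function `c0 / 5 + c1 p + c2 q`. -/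
structure Aff where
  c0 : ZW
  c1 : ZW
  c2 : ZW

namespace Aff

def add (x y : Aff) : Aff := ⟨x.c0 + y.c0, x.c1 + y.c1, x.c2 + y.c2⟩
def neg (x : Aff) : Aff := ⟨-x.c0, -x.c1, -x.c2⟩
def smul (l : ZW) (x : Aff) : Aff := ⟨l * x.c0, l * x.c1, l * x.c2⟩

instance : Add Aff := ⟨add⟩
instance : Neg Aff := ⟨neg⟩

/-- The constant `a + b ω`. -/
def K (a b : ℤ) : Aff := ⟨⟨5 * a, 5 * b⟩, ⟨0, 0⟩, ⟨0, 0⟩⟩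

noncomputable def eval (p q : ℝ) (x : Aff) : ℝ := x.c0.val / 5 + x.c1.val * p + x.c2.val * q

@[simp] theorem eval_add (p q : ℝ) (x y : Aff) : (x + y).eval p q = x.eval p q + y.eval p q := by
  change eval p q ⟨x.c0 + y.c0, x.c1 + y.c1, x.c2 + y.c2⟩ = _
  simp only [eval, ZW.val_add]; ring

@[simp] theorem eval_neg (p q : ℝ) (x : Aff) : (-x).eval p q = -x.eval p q := by
  change eval p q ⟨-x.c0, -x.c1, -x.c2⟩ = _
  simp only [eval, ZW.val_neg]; ring

@[simp] theorem eval_smul (p q : ℝ) (l : ZW) (x : Aff) :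
    (smul l x).eval p q = l.val * x.eval p q := by
  simp only [smul, eval, ZW.val_mul]; ring

@[simp] theorem eval_K (p q : ℝ) (a b : ℤ) : (K a b).eval p q = a + b * ω := by
  simp only [K, eval, ZW.val]; push_cast; ring

end Aff

/-- Four points `(5p, 5q)` of the parameter plane. -/
structure Verts where
  v0 : ZW × ZW
  v1 : ZW × ZW
  v2 : ZW × ZW
  v3 : ZW × ZW

/-- Vertices are stored as `(5p, 5q)`, and this is five times the value of the function. The scaling
clears the denominators of the vertices of the quadrilateral and keeps all data in ℤ[ω]. -/
def Aff.at (x : Aff) (v : ZW × ZW) : ZW := x.c0 + (x.c1 * v.1 + x.c2 * v.2)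

def Aff.vec (V : Verts) (x : Aff) : Vec := ⟨x.at V.v0, x.at V.v1, x.at V.v2, x.at V.v3⟩

/-- The weights `w` represent the point `(p, q)`. -/
def Verts.Rep (V : Verts) (w : Wt) (p q : ℝ) : Prop :=
  w.w0 + w.w1 + w.w2 + w.w3 = 1 / 5 ∧
  w.w0 * V.v0.1.val + w.w1 * V.v1.1.val + w.w2 * V.v2.1.val + w.w3 * V.v3.1.val = p ∧
  w.w0 * V.v0.2.val + w.w1 * V.v1.2.val + w.w2 * V.v2.2.val + w.w3 * V.v3.2.val = q

/-- The weights add up to 1/5, which compensates for the factor five in `Aff.at`. -/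
theorem Verts.Rep.ev_vec {V : Verts} {w : Wt} {p q : ℝ} (h : V.Rep w p q) (x : Aff) :
    (x.vec V).ev w = x.eval p q := by
  obtain ⟨h0, h1, h2⟩ := h
  simp only [Vec.ev, Aff.vec, Aff.at, ZW.val_add, ZW.val_mul, Aff.eval]
  linear_combination x.c0.val * h0 + x.c1.val * h1 + x.c2.val * h2

theorem Verts.Rep.real {V : Verts} {w : Wt} {p q : ℝ} (h : V.Rep w p q) {n : ℕ}
    (X : DDom Aff n) : (X.map (Aff.vec V)).real (Vec.ev w) = X.real (Aff.eval p q) := by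
  rw [DDom.real_map]
  congr 1
  exact funext h.ev_vec

theorem Verts.Rep.realTile {V : Verts} {w : Wt} {p q : ℝ} (h : V.Rep w p q)
    (T : List (DEdge Aff)) :
    realTile (Vec.ev w) (T.map (DEdge.map (Aff.vec V))) = realTile (Aff.eval p q) T := by
  rw [realTile_map]
  congr 1
  exact funext h.ev_vec

/-! ### Similarities with computable coefficients -/

def rotA (v : Aff × Aff) : Aff × Aff := (Aff.smul ⟨-1, 1⟩ v.1 + -v.2, v.1)

def reflectA (v : Aff × Aff) : Aff × Aff := (v.1, Aff.smul ⟨-1, 1⟩ v.1 + -v.2)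

noncomputable def evA (p q : ℝ) (v : Aff × Aff) : Plane := (v.1.eval p q, v.2.eval p q)

theorem evA_rotA (p q : ℝ) (v : Aff × Aff) : evA p q (rotA v) = rot (evA p q v) := by
  have hb : (ZW.mk (-1) 1).val = β := by rw [beta_eq, ZW.val]; push_cast; ring
  simp [evA, rotA, rot, hb]; ring

theorem evA_rotA_iter (p q : ℝ) (k : ℕ) (v : Aff × Aff) :
    evA p q (rotA^[k] v) = rot^[k] (evA p q v) := by
  induction k generalizing v with
  | zero => rfl
  | succ k ih => rw [Function.iterate_succ_apply, ih, evA_rotA]; rfl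

theorem evA_reflectA (p q : ℝ) (v : Aff × Aff) : evA p q (reflectA v) = reflect (evA p q v) := by
  have hb : (ZW.mk (-1) 1).val = β := by rw [beta_eq, ZW.val]; push_cast; ring
  simp [evA, reflectA, reflect, hb]; ring

/-- A similarity with computable coefficients. -/
structure DSim where
  η : ZW
  k : Fin 5
  flip : Bool
  d : Aff × Aff
  pos : η.pos = true

namespace DSim

noncomputable def real (p q : ℝ) (S : DSim) : Sim :=
  ⟨S.η.val, S.k, S.flip, evA p q S.d, ZW.val_pos S.pos⟩

def dirIdx (S : DSim) (m : Fin 5) : Fin 5 := (if S.flip then -m else m) + S.k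

def formA (m : Fin 5) (d : Aff × Aff) : Aff :=
  Aff.smul (sdZ (jOut m)).1 d.1 + Aff.smul (sdZ (jOut m)).2 d.2

theorem eval_formA (p q : ℝ) (m : Fin 5) (d : Aff × Aff) :
    (formA m d).eval p q = form m (evA p q d) := by
  simp [formA, form, dir_eq, evA]

def tile (S : DSim) (T : List (DEdge Aff)) : List (DEdge Aff) :=
  T.map fun e => ⟨S.dirIdx e.m, e.inc, Aff.smul S.η e.b + formA (S.dirIdx e.m) S.d⟩

def isoD (S : DSim) (k : Fin 5) (d : Aff × Aff) : Aff × Aff :=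
  let r := rotA^[(S.k : ℕ)] (if S.flip then reflectA d else d)
  let r' := rotA^[((if S.flip then -k else k : Fin 5) : ℕ)] S.d
  (Aff.smul S.η r.1 + S.d.1 + -r'.1, Aff.smul S.η r.2 + S.d.2 + -r'.2)

def dom {n : ℕ} (S : DSim) (X : DDom Aff n) : DDom Aff n where
  tile i := S.tile (X.tile i)
  k i := if S.flip then -X.k i else X.k i
  d i := S.isoD (X.k i) (X.d i)

theorem real_tile (S : DSim) (T : List (DEdge Aff)) (p q : ℝ) :
    realTile (Aff.eval p q) (S.tile T) = (realTile (Aff.eval p q) T).sim (S.real p q) := by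
  simp only [realTile, tile, Tile.sim, List.map_map, Function.comp_def, Aff.eval_add,
    Aff.eval_smul, eval_formA]
  rfl

theorem evA_isoD (S : DSim) (k : Fin 5) (d : Aff × Aff) (p q : ℝ) :
    evA p q (S.isoD k d) = (RotTrans.sim (S.real p q) ⟨k, evA p q d⟩).d := by
  have h1 := evA_rotA_iter p q S.k (if S.flip then reflectA d else d)
  have h2 := evA_rotA_iter p q ((if S.flip then -k else k : Fin 5) : ℕ) S.d
  have h3 : evA p q (if S.flip then reflectA d else d) =
      if S.flip then reflect (evA p q d) else evA p q d := by
    split_ifs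
    · exact evA_reflectA p q d
    · rfl
  rw [h3] at h1
  change _ = S.η.val • rot^[(S.k : ℕ)] (if S.flip then reflect (evA p q d) else evA p q d) +
    evA p q S.d - rot^[((if S.flip then -k else k : Fin 5) : ℕ)] (evA p q S.d)
  rw [← h1, ← h2]
  ext <;> simp [evA, isoD] <;> ring

theorem real_dom {n : ℕ} (S : DSim) (X : DDom Aff n) (p q : ℝ) :
    (S.dom X).real (Aff.eval p q) = (X.real (Aff.eval p q)).sim (S.real p q) := by
  unfold DDom.real DressedDomain.sim
  congr 1
  · funext i; exact S.real_tile _ p q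
  · funext i
    have := S.evA_isoD (X.k i) (X.d i) p q
    simp only [evA] at this
    simp only [dom, this]
    rfl

end DSim

/-! ### Base triangles -/

def omegaA (x : Aff) : Aff := Aff.smul ⟨0, 1⟩ x

/-- The base triangle. -/
def baseD (τ : Aff) : DDom Aff 3 where
  tile := ![
    [⟨0, false, .K 0 0⟩, ⟨2, false, .K 0 0⟩, ⟨3, false, .K 0 1 + -omegaA τ⟩],
    [⟨1, true, τ + .K (-1) (-1)⟩, ⟨4, false, .K 1 1 + -omegaA τ⟩, ⟨0, false, .K 0 0⟩,
      ⟨3, true, .K 0 1 + -omegaA τ⟩, ⟨2, false, .K 0 0⟩],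
    [⟨1, true, τ + .K (-1) (-1)⟩, ⟨0, false, .K 0 0⟩, ⟨4, true, .K 1 1 + -omegaA τ⟩]]
  k := ![2, 3, 2]
  d := ![(omegaA τ + .K 0 (-1), omegaA (omegaA τ) + .K (-1) (-1)),
    (.K 0 0, omegaA (omegaA τ) + .K (-1) (-2)),
    (omegaA τ + .K 0 (-2), omegaA (omegaA τ) + .K (-2) (-2))]

/-- The domain of the base triangle. -/
def triD (τ : Aff) : List (DEdge Aff) :=
  [⟨1, true, τ + .K (-1) (-1)⟩, ⟨0, false, .K 0 0⟩, ⟨2, false, .K 0 0⟩]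

def oppT {α : Type*} [Neg α] (T : List (DEdge α)) : List (DEdge α) :=
  T.map fun e => ⟨e.m, !e.inc, -e.b⟩

def oppD {α : Type*} [Neg α] {n : ℕ} (X : DDom α n) : DDom α n where
  tile i := oppT (X.tile i)
  k := X.k
  d i := (-(X.d i).1, -(X.d i).2)

theorem real_oppD {n : ℕ} (X : DDom Aff n) (p q : ℝ) :
    (oppD X).real (Aff.eval p q) = opposite (X.real (Aff.eval p q)) := by
  simp [oppD, oppT, DDom.real, opposite, realTile, Function.comp_def]

theorem real_baseD (τ : Aff) (p q : ℝ) :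
    (baseD τ).real (Aff.eval p q) = baseTriangle (τ.eval p q) := by
  have h := omega_sq
  have hω : ∀ x, (omegaA x).eval p q = ω * x.eval p q := fun x => by simp [omegaA, ZW.val]
  unfold DDom.real baseTriangle
  congr 1
  · funext i
    fin_cases i <;> simp [baseD, realTile, mkTile, hω] <;> (try constructor) <;> (try constructor) <;>
      first | ring1 | linear_combination h | linear_combination -h
  · funext i
    fin_cases i <;> simp [baseD, hω] <;> (try constructor) <;>
      first | ring1 | linear_combination h | linear_combination -h |
        linear_combination (ω + 1) * h | linear_combination 2 * h

/-! ### Periodic tiles -/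

/-- Integer division. It only enters candidates for fixed points, which are tested afterwards, so
soundness does not depend on divisibility. -/
def ZW.div5 (x : ZW) : ZW := ⟨x.a / 5, x.b / 5⟩
def Vec.div5 (c : Vec) : Vec := ⟨c.x0.div5, c.x1.div5, c.x2.div5, c.x3.div5⟩

/-- The fixed point of a rotation. -/
def DIso.fixPt (g : DIso) : Vec × Vec :=
  let r := fun j : ℕ => rotV^[j * (g.1 : ℕ)] (Vec.div5 (-g.2.1), Vec.div5 (-g.2.2))
  -- For a non-trivial rotation R of order five, (1 − R)(R + 2R² + 3R³ + 4R⁴) = −5, because the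
  -- powers of R add up to zero. This inverts 1 − R.
  let s := fun f : Vec × Vec → Vec => f (r 1) + Vec.smul ⟨2, 0⟩ (f (r 2)) +
    Vec.smul ⟨3, 0⟩ (f (r 3)) + Vec.smul ⟨4, 0⟩ (f (r 4))
  (s Prod.fst, s Prod.snd)

/-- A dressed sub-domain which is a similar copy of `T`. -/
def mkSub (V : Verts) {n m : ℕ} (S : DSim) (T : DDom Aff m) (D : List (DEdge Aff))
    (p : Fin m → List (Fin n)) : DSub n :=
  ⟨m, (S.dom T).map (Aff.vec V), p, cons ((S.tile D).map (DEdge.map (Aff.vec V)))⟩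

def τ' : Aff := ⟨⟨0, 0⟩, ⟨1, 0⟩, ⟨0, 0⟩⟩

/-- The interval from `a` to `b`. -/
def seg (a b : ZW) : Verts :=
  let f : ZW → ZW × ZW := fun x => (⟨5, 0⟩ * x, ⟨0, 0⟩)
  ⟨f a, f b, f a, f b⟩

def S1 : DSim := ⟨⟨2, -1⟩, 0, false, (.K 0 0, .K 0 0), rfl⟩

def T1 : Aff := omegaA (omegaA τ')

/-! ### Renormalization of the base triangles: finite verification -/

abbrev vecDom {n : ℕ} (V : Verts) (X : DDom Aff n) : DDom Vec n := X.map (Aff.vec V)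
abbrev vecTile (V : Verts) (T : List (DEdge Aff)) : List (DEdge Vec) :=
  T.map (DEdge.map (Aff.vec V))

def sgD (σ : Bool) {n : ℕ} (X : DDom Aff n) : DDom Aff n := if σ then oppD X else X

def sgT (σ : Bool) (T : List (DEdge Aff)) : List (DEdge Aff) := if σ then oppT T else T

def DSim.sg (σ : Bool) (S : DSim) : DSim :=
  ⟨S.η, S.k, S.flip, if σ then (-S.d.1, -S.d.2) else S.d, S.pos⟩

/-- The first two atoms of the base triangle with shape parameter zero; the third one is empty. -/
def zeroD : DDom Aff 2 where
  tile := ![(baseD (.K 0 0)).tile 0, (baseD (.K 0 0)).tile 1]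
  k := ![2, 3]
  d := ![(baseD (.K 0 0)).d 0, (baseD (.K 0 0)).d 1]

def baseV (V : Verts) (σ : Bool) : DDom Vec 3 := vecDom V (sgD σ (baseD τ'))

def baseDom (V : Verts) (σ : Bool) : List Con := cons (vecTile V (sgT σ (triD τ')))

def stepSub (V : Verts) (σ : Bool) (S : DSim) (T : Aff) (w : Fin 3 → List (Fin 3)) : DSub 3 :=
  mkSub V S (sgD σ (baseD T)) (sgT σ (triD T)) w

def zeroSub (V : Verts) {n : ℕ} (S : DSim) (w : Fin 2 → List (Fin n)) : DSub n :=
  mkSub V S zeroD (triD (.K 0 0)) w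

/-- A periodic tile, its path, and one of its points. -/
abbrev PerData := List (DEdge Aff) × List (Fin 3) × Vec × Vec

def mkPer (V : Verts) (Q : PerData) : DPer 3 := ⟨vecTile V Q.1, Q.2.1, Q.2.2⟩

def per1 (σ : Bool) : List PerData :=
  if σ then
    [([⟨1, false, ⟨⟨5, 5⟩, ⟨-1, 0⟩, ⟨0, 0⟩⟩⟩, ⟨3, false, ⟨⟨0, -5⟩, ⟨0, 1⟩, ⟨0, 0⟩⟩⟩, ⟨0, false, ⟨⟨5, 0⟩, ⟨0, 0⟩, ⟨0, 0⟩⟩⟩, ⟨2, false, ⟨⟨5, 0⟩, ⟨0, 0⟩, ⟨0, 0⟩⟩⟩, ⟨4, false, ⟨⟨0, -5⟩, ⟨0, 1⟩, ⟨0, 0⟩⟩⟩],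
      [1], (⟨⟨2, 1⟩, ⟨6, -2⟩, ⟨2, 1⟩, ⟨6, -2⟩⟩, ⟨⟨2, 6⟩, ⟨-4, 8⟩, ⟨2, 6⟩, ⟨-4, 8⟩⟩)),
    ([⟨0, true, ⟨⟨0, 0⟩, ⟨0, 0⟩, ⟨0, 0⟩⟩⟩, ⟨2, true, ⟨⟨0, 0⟩, ⟨0, 0⟩, ⟨0, 0⟩⟩⟩, ⟨3, true, ⟨⟨0, -5⟩, ⟨0, 1⟩, ⟨0, 0⟩⟩⟩, ⟨1, true, ⟨⟨5, 0⟩, ⟨-1, 0⟩, ⟨0, 0⟩⟩⟩, ⟨4, true, ⟨⟨0, -5⟩, ⟨0, 1⟩, ⟨0, 0⟩⟩⟩],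
      [0], (⟨⟨-1, 2⟩, ⟨3, -1⟩, ⟨-1, 2⟩, ⟨3, -1⟩⟩, ⟨⟨4, 2⟩, ⟨-2, 4⟩, ⟨4, 2⟩, ⟨-2, 4⟩⟩))]
  else
    [([⟨1, true, ⟨⟨-5, -5⟩, ⟨1, 0⟩, ⟨0, 0⟩⟩⟩, ⟨3, true, ⟨⟨0, 5⟩, ⟨0, -1⟩, ⟨0, 0⟩⟩⟩, ⟨0, true, ⟨⟨-5, 0⟩, ⟨0, 0⟩, ⟨0, 0⟩⟩⟩, ⟨2, true, ⟨⟨-5, 0⟩, ⟨0, 0⟩, ⟨0, 0⟩⟩⟩, ⟨4, true, ⟨⟨0, 5⟩, ⟨0, -1⟩, ⟨0, 0⟩⟩⟩],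
      [1], (⟨⟨-2, -1⟩, ⟨-6, 2⟩, ⟨-2, -1⟩, ⟨-6, 2⟩⟩, ⟨⟨-2, -6⟩, ⟨4, -8⟩, ⟨-2, -6⟩, ⟨4, -8⟩⟩)),
    ([⟨0, false, ⟨⟨0, 0⟩, ⟨0, 0⟩, ⟨0, 0⟩⟩⟩, ⟨2, false, ⟨⟨0, 0⟩, ⟨0, 0⟩, ⟨0, 0⟩⟩⟩, ⟨3, false, ⟨⟨0, 5⟩, ⟨0, -1⟩, ⟨0, 0⟩⟩⟩, ⟨1, false, ⟨⟨-5, 0⟩, ⟨1, 0⟩, ⟨0, 0⟩⟩⟩, ⟨4, false, ⟨⟨0, 5⟩, ⟨0, -1⟩, ⟨0, 0⟩⟩⟩],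
      [0], (⟨⟨1, -2⟩, ⟨-3, 1⟩, ⟨1, -2⟩, ⟨-3, 1⟩⟩, ⟨⟨-4, -2⟩, ⟨2, -4⟩, ⟨-4, -2⟩, ⟨2, -4⟩⟩))]

def per2 (σ : Bool) : List PerData :=
  if σ then
    [([⟨1, false, ⟨⟨5, 5⟩, ⟨-1, 0⟩, ⟨0, 0⟩⟩⟩, ⟨4, true, ⟨⟨-5, -5⟩, ⟨0, 1⟩, ⟨0, 0⟩⟩⟩, ⟨0, true, ⟨⟨0, 0⟩, ⟨0, 0⟩, ⟨0, 0⟩⟩⟩, ⟨3, false, ⟨⟨0, -5⟩, ⟨0, 1⟩, ⟨0, 0⟩⟩⟩, ⟨2, true, ⟨⟨0, 0⟩, ⟨0, 0⟩, ⟨0, 0⟩⟩⟩, ⟨1, true, ⟨⟨0, 5⟩, ⟨-1, 0⟩, ⟨0, 0⟩⟩⟩, ⟨0, false, ⟨⟨5, 0⟩, ⟨0, 0⟩, ⟨0, 0⟩⟩⟩, ⟨3, true, ⟨⟨-5, -5⟩, ⟨0, 1⟩, ⟨0, 0⟩⟩⟩, ⟨2, false, ⟨⟨5, 0⟩, ⟨0,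 0⟩, ⟨0, 0⟩⟩⟩, ⟨4, false, ⟨⟨0, -5⟩, ⟨0, 1⟩, ⟨0, 0⟩⟩⟩],
      [1], (⟨⟨6, -2⟩, ⟨-1, 2⟩, ⟨6, -2⟩, ⟨-1, 2⟩⟩, ⟨⟨-4, 8⟩, ⟨4, 2⟩, ⟨-4, 8⟩, ⟨4, 2⟩⟩)),
    ([⟨0, true, ⟨⟨0, 0⟩, ⟨0, 0⟩, ⟨0, 0⟩⟩⟩, ⟨2, true, ⟨⟨0, 0⟩, ⟨0, 0⟩, ⟨0, 0⟩⟩⟩, ⟨3, true, ⟨⟨0, -5⟩, ⟨0, 1⟩, ⟨0, 0⟩⟩⟩, ⟨1, true, ⟨⟨5, 0⟩, ⟨-1, 0⟩, ⟨0, 0⟩⟩⟩, ⟨4, true, ⟨⟨0, -5⟩, ⟨0, 1⟩, ⟨0, 0⟩⟩⟩],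
      [0], (⟨⟨3, -1⟩, ⟨-4, 3⟩, ⟨3, -1⟩, ⟨-4, 3⟩⟩, ⟨⟨-2, 4⟩, ⟨6, -2⟩, ⟨-2, 4⟩, ⟨6, -2⟩⟩)),
    ([⟨0, true, ⟨⟨0, 0⟩, ⟨0, 0⟩, ⟨0, 0⟩⟩⟩, ⟨3, true, ⟨⟨0, -5⟩, ⟨0, 1⟩, ⟨0, 0⟩⟩⟩, ⟨2, true, ⟨⟨-5, 5⟩, ⟨0, 0⟩, ⟨0, 0⟩⟩⟩, ⟨4, true, ⟨⟨-10, 0⟩, ⟨0, 1⟩, ⟨0, 0⟩⟩⟩, ⟨1, true, ⟨⟨0, 5⟩, ⟨-1, 0⟩, ⟨0, 0⟩⟩⟩],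
      [0, 0, 1, 1, 1], (⟨⟨7, -4⟩, ⟨0, 0⟩, ⟨7, -4⟩, ⟨0, 0⟩⟩, ⟨⟨-3, 6⟩, ⟨5, 0⟩, ⟨-3, 6⟩, ⟨5, 0⟩⟩))]
  else
    [([⟨1, true, ⟨⟨-5, -5⟩, ⟨1, 0⟩, ⟨0, 0⟩⟩⟩, ⟨4, false, ⟨⟨5, 5⟩, ⟨0, -1⟩, ⟨0, 0⟩⟩⟩, ⟨0, false, ⟨⟨0, 0⟩, ⟨0, 0⟩, ⟨0, 0⟩⟩⟩, ⟨3, true, ⟨⟨0, 5⟩, ⟨0, -1⟩, ⟨0, 0⟩⟩⟩, ⟨2, false, ⟨⟨0, 0⟩, ⟨0, 0⟩, ⟨0, 0⟩⟩⟩, ⟨1, false, ⟨⟨0, -5⟩, ⟨1, 0⟩, ⟨0, 0⟩⟩⟩, ⟨0, true, ⟨⟨-5, 0⟩, ⟨0, 0⟩, ⟨0, 0⟩⟩⟩, ⟨3, false, ⟨⟨5, 5⟩, ⟨0, -1⟩, ⟨0, 0⟩⟩⟩, ⟨2, true, ⟨⟨-5, 0⟩, ⟨0, 0⟩, ⟨0,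 0⟩⟩⟩, ⟨4, true, ⟨⟨0, 5⟩, ⟨0, -1⟩, ⟨0, 0⟩⟩⟩],
      [1], (⟨⟨-6, 2⟩, ⟨1, -2⟩, ⟨-6, 2⟩, ⟨1, -2⟩⟩, ⟨⟨4, -8⟩, ⟨-4, -2⟩, ⟨4, -8⟩, ⟨-4, -2⟩⟩)),
    ([⟨0, false, ⟨⟨0, 0⟩, ⟨0, 0⟩, ⟨0, 0⟩⟩⟩, ⟨2, false, ⟨⟨0, 0⟩, ⟨0, 0⟩, ⟨0, 0⟩⟩⟩, ⟨3, false, ⟨⟨0, 5⟩, ⟨0, -1⟩, ⟨0, 0⟩⟩⟩, ⟨1, false, ⟨⟨-5, 0⟩, ⟨1, 0⟩, ⟨0, 0⟩⟩⟩, ⟨4, false, ⟨⟨0, 5⟩, ⟨0, -1⟩, ⟨0, 0⟩⟩⟩],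
      [0], (⟨⟨-3, 1⟩, ⟨4, -3⟩, ⟨-3, 1⟩, ⟨4, -3⟩⟩, ⟨⟨2, -4⟩, ⟨-6, 2⟩, ⟨2, -4⟩, ⟨-6, 2⟩⟩)),
    ([⟨0, false, ⟨⟨0, 0⟩, ⟨0, 0⟩, ⟨0, 0⟩⟩⟩, ⟨3, false, ⟨⟨0, 5⟩, ⟨0, -1⟩, ⟨0, 0⟩⟩⟩, ⟨2, false, ⟨⟨5, -5⟩, ⟨0, 0⟩, ⟨0, 0⟩⟩⟩, ⟨4, false, ⟨⟨10, 0⟩, ⟨0, -1⟩, ⟨0, 0⟩⟩⟩, ⟨1, false, ⟨⟨0, -5⟩, ⟨1, 0⟩, ⟨0, 0⟩⟩⟩],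
      [0, 0, 1, 1, 1], (⟨⟨-7, 4⟩, ⟨0, 0⟩, ⟨-7, 4⟩, ⟨0, 0⟩⟩, ⟨⟨3, -6⟩, ⟨-5, 0⟩, ⟨3, -6⟩, ⟨-5, 0⟩⟩))]

def per3 (σ : Bool) : List PerData :=
  if σ then
    [([⟨4, true, ⟨⟨-5, -5⟩, ⟨0, 1⟩, ⟨0, 0⟩⟩⟩, ⟨0, true, ⟨⟨0, 0⟩, ⟨0, 0⟩, ⟨0, 0⟩⟩⟩, ⟨2, true, ⟨⟨0, 0⟩, ⟨0, 0⟩, ⟨0, 0⟩⟩⟩, ⟨1, true, ⟨⟨0, 5⟩, ⟨-1, 0⟩, ⟨0, 0⟩⟩⟩, ⟨3, true, ⟨⟨-5, -5⟩, ⟨0, 1⟩, ⟨0, 0⟩⟩⟩],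
      [1], (⟨⟨-1, 2⟩, ⟨3, -1⟩, ⟨-1, 2⟩, ⟨3, -1⟩⟩, ⟨⟨4, 2⟩, ⟨-2, 4⟩, ⟨4, 2⟩, ⟨-2, 4⟩⟩)),
    ([⟨0, true, ⟨⟨0, 0⟩, ⟨0, 0⟩, ⟨0, 0⟩⟩⟩, ⟨2, true, ⟨⟨0, 0⟩, ⟨0, 0⟩, ⟨0, 0⟩⟩⟩, ⟨3, true, ⟨⟨0, -5⟩, ⟨0, 1⟩, ⟨0, 0⟩⟩⟩, ⟨1, true, ⟨⟨5, 0⟩, ⟨-1, 0⟩, ⟨0, 0⟩⟩⟩, ⟨4, true, ⟨⟨0, -5⟩, ⟨0, 1⟩, ⟨0, 0⟩⟩⟩],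
      [0], (⟨⟨-4, 3⟩, ⟨0, 0⟩, ⟨-4, 3⟩, ⟨0, 0⟩⟩, ⟨⟨6, -2⟩, ⟨0, 0⟩, ⟨6, -2⟩, ⟨0, 0⟩⟩))]
  else
    [([⟨4, false, ⟨⟨5, 5⟩, ⟨0, -1⟩, ⟨0, 0⟩⟩⟩, ⟨0, false, ⟨⟨0, 0⟩, ⟨0, 0⟩, ⟨0, 0⟩⟩⟩, ⟨2, false, ⟨⟨0, 0⟩, ⟨0, 0⟩, ⟨0, 0⟩⟩⟩, ⟨1, false, ⟨⟨0, -5⟩, ⟨1, 0⟩, ⟨0, 0⟩⟩⟩, ⟨3, false, ⟨⟨5, 5⟩, ⟨0, -1⟩, ⟨0, 0⟩⟩⟩],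
      [1], (⟨⟨1, -2⟩, ⟨-3, 1⟩, ⟨1, -2⟩, ⟨-3, 1⟩⟩, ⟨⟨-4, -2⟩, ⟨2, -4⟩, ⟨-4, -2⟩, ⟨2, -4⟩⟩)),
    ([⟨0, false, ⟨⟨0, 0⟩, ⟨0, 0⟩, ⟨0, 0⟩⟩⟩, ⟨2, false, ⟨⟨0, 0⟩, ⟨0, 0⟩, ⟨0, 0⟩⟩⟩, ⟨3, false, ⟨⟨0, 5⟩, ⟨0, -1⟩, ⟨0, 0⟩⟩⟩, ⟨1, false, ⟨⟨-5, 0⟩, ⟨1, 0⟩, ⟨0, 0⟩⟩⟩, ⟨4, false, ⟨⟨0, 5⟩, ⟨0, -1⟩, ⟨0, 0⟩⟩⟩],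
      [0], (⟨⟨4, -3⟩, ⟨0, 0⟩, ⟨4, -3⟩, ⟨0, 0⟩⟩, ⟨⟨-6, 2⟩, ⟨0, 0⟩, ⟨-6, 2⟩, ⟨0, 0⟩⟩))]

def per0 : List PerData :=
    [([⟨1, true, ⟨⟨-5, -5⟩, ⟨0, 0⟩, ⟨0, 0⟩⟩⟩, ⟨3, true, ⟨⟨0, 5⟩, ⟨0, 0⟩, ⟨0, 0⟩⟩⟩, ⟨0, true, ⟨⟨-5, 0⟩, ⟨0, 0⟩, ⟨0, 0⟩⟩⟩, ⟨2, true, ⟨⟨-5, 0⟩, ⟨0, 0⟩, ⟨0, 0⟩⟩⟩, ⟨4, true, ⟨⟨0, 5⟩, ⟨0, 0⟩, ⟨0, 0⟩⟩⟩],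
      [1], (⟨⟨-2, -1⟩, ⟨-2, -1⟩, ⟨-2, -1⟩, ⟨-2, -1⟩⟩, ⟨⟨-2, -6⟩, ⟨-2, -6⟩, ⟨-2, -6⟩, ⟨-2, -6⟩⟩)),
    ([⟨0, false, ⟨⟨0, 0⟩, ⟨0, 0⟩, ⟨0, 0⟩⟩⟩, ⟨2, false, ⟨⟨0, 0⟩, ⟨0, 0⟩, ⟨0, 0⟩⟩⟩, ⟨3, false, ⟨⟨0, 5⟩, ⟨0, 0⟩, ⟨0, 0⟩⟩⟩, ⟨1, false, ⟨⟨-5, 0⟩, ⟨0, 0⟩, ⟨0, 0⟩⟩⟩, ⟨4, false, ⟨⟨0, 5⟩, ⟨0, 0⟩, ⟨0, 0⟩⟩⟩],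
      [0], (⟨⟨1, -2⟩, ⟨1, -2⟩, ⟨1, -2⟩, ⟨1, -2⟩⟩, ⟨⟨-4, -2⟩, ⟨-4, -2⟩, ⟨-4, -2⟩, ⟨-4, -2⟩⟩))]

def perB2 (σ : Bool) : List PerData :=
  if σ then
    [([⟨1, false, ⟨⟨5, 5⟩, ⟨-1, 0⟩, ⟨0, 0⟩⟩⟩, ⟨3, false, ⟨⟨0, -5⟩, ⟨0, 1⟩, ⟨0, 0⟩⟩⟩, ⟨0, false, ⟨⟨5, 0⟩, ⟨0, 0⟩, ⟨0, 0⟩⟩⟩, ⟨2, false, ⟨⟨5, 0⟩, ⟨0, 0⟩, ⟨0, 0⟩⟩⟩, ⟨4, false, ⟨⟨0, -5⟩, ⟨0, 1⟩, ⟨0, 0⟩⟩⟩],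
      [1], (⟨⟨6, -2⟩, ⟨6, -2⟩, ⟨6, -2⟩, ⟨6, -2⟩⟩, ⟨⟨-4, 8⟩, ⟨-4, 8⟩, ⟨-4, 8⟩, ⟨-4, 8⟩⟩)),
    ([⟨0, true, ⟨⟨0, 0⟩, ⟨0, 0⟩, ⟨0, 0⟩⟩⟩, ⟨2, true, ⟨⟨0, 0⟩, ⟨0, 0⟩, ⟨0, 0⟩⟩⟩, ⟨3, true, ⟨⟨0, -5⟩, ⟨0, 1⟩, ⟨0, 0⟩⟩⟩, ⟨1, true, ⟨⟨5, 0⟩, ⟨-1, 0⟩, ⟨0, 0⟩⟩⟩, ⟨4, true, ⟨⟨0, -5⟩, ⟨0, 1⟩, ⟨0, 0⟩⟩⟩],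
      [0], (⟨⟨3, -1⟩, ⟨3, -1⟩, ⟨3, -1⟩, ⟨3, -1⟩⟩, ⟨⟨-2, 4⟩, ⟨-2, 4⟩, ⟨-2, 4⟩, ⟨-2, 4⟩⟩)),
    ([⟨0, true, ⟨⟨0, 0⟩, ⟨0, 0⟩, ⟨0, 0⟩⟩⟩, ⟨3, true, ⟨⟨0, -5⟩, ⟨0, 1⟩, ⟨0, 0⟩⟩⟩, ⟨2, true, ⟨⟨-5, 5⟩, ⟨0, 0⟩, ⟨0, 0⟩⟩⟩, ⟨4, true, ⟨⟨-10, 0⟩, ⟨0, 1⟩, ⟨0, 0⟩⟩⟩, ⟨1, true, ⟨⟨0, 5⟩, ⟨-1, 0⟩, ⟨0, 0⟩⟩⟩],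
      [0, 0, 1, 1, 1], (⟨⟨7, -4⟩, ⟨7, -4⟩, ⟨7, -4⟩, ⟨7, -4⟩⟩, ⟨⟨-3, 6⟩, ⟨-3, 6⟩, ⟨-3, 6⟩, ⟨-3, 6⟩⟩)),
    ([⟨4, true, ⟨⟨5, -10⟩, ⟨0, 1⟩, ⟨0, 0⟩⟩⟩, ⟨2, true, ⟨⟨5, 0⟩, ⟨0, 0⟩, ⟨0, 0⟩⟩⟩, ⟨0, true, ⟨⟨0, 0⟩, ⟨0, 0⟩, ⟨0, 0⟩⟩⟩],
      [0, 0, 1], (⟨⟨0, 0⟩, ⟨0, 0⟩, ⟨0, 0⟩, ⟨0, 0⟩⟩, ⟨⟨0, 5⟩, ⟨0, 5⟩, ⟨0, 5⟩, ⟨0, 5⟩⟩))]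
  else
    [([⟨1, true, ⟨⟨-5, -5⟩, ⟨1, 0⟩, ⟨0, 0⟩⟩⟩, ⟨4, false, ⟨⟨5, 5⟩, ⟨0, -1⟩, ⟨0, 0⟩⟩⟩, ⟨0, false, ⟨⟨0, 0⟩, ⟨0, 0⟩, ⟨0, 0⟩⟩⟩, ⟨3, true, ⟨⟨0, 5⟩, ⟨0, -1⟩, ⟨0, 0⟩⟩⟩, ⟨2, false, ⟨⟨0, 0⟩, ⟨0, 0⟩, ⟨0, 0⟩⟩⟩, ⟨1, false, ⟨⟨0, -5⟩, ⟨1, 0⟩, ⟨0, 0⟩⟩⟩, ⟨0, true, ⟨⟨-5, 0⟩, ⟨0, 0⟩, ⟨0, 0⟩⟩⟩, ⟨3, false, ⟨⟨5, 5⟩, ⟨0, -1⟩, ⟨0, 0⟩⟩⟩, ⟨2, true, ⟨⟨-5, 0⟩, ⟨0, 0⟩, ⟨0, 0⟩⟩⟩, ⟨4, true, ⟨⟨0, 5⟩, ⟨0, -1⟩, ⟨0, 0⟩⟩⟩],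
      [1], (⟨⟨-6, 2⟩, ⟨-6, 2⟩, ⟨-6, 2⟩, ⟨-6, 2⟩⟩, ⟨⟨4, -8⟩, ⟨4, -8⟩, ⟨4, -8⟩, ⟨4, -8⟩⟩)),
    ([⟨0, false, ⟨⟨0, 0⟩, ⟨0, 0⟩, ⟨0, 0⟩⟩⟩, ⟨2, false, ⟨⟨0, 0⟩, ⟨0, 0⟩, ⟨0, 0⟩⟩⟩, ⟨3, false, ⟨⟨0, 5⟩, ⟨0, -1⟩, ⟨0, 0⟩⟩⟩, ⟨1, false, ⟨⟨-5, 0⟩, ⟨1, 0⟩, ⟨0, 0⟩⟩⟩, ⟨4, false, ⟨⟨0, 5⟩, ⟨0, -1⟩, ⟨0, 0⟩⟩⟩],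
      [0], (⟨⟨-3, 1⟩, ⟨-3, 1⟩, ⟨-3, 1⟩, ⟨-3, 1⟩⟩, ⟨⟨2, -4⟩, ⟨2, -4⟩, ⟨2, -4⟩, ⟨2, -4⟩⟩)),
    ([⟨2, true, ⟨⟨-5, 0⟩, ⟨0, 0⟩, ⟨0, 0⟩⟩⟩, ⟨4, true, ⟨⟨5, 5⟩, ⟨0, -1⟩, ⟨0, 0⟩⟩⟩, ⟨1, true, ⟨⟨-5, -5⟩, ⟨1, 0⟩, ⟨0, 0⟩⟩⟩],
      [2, 1, 1], (⟨⟨-10, 5⟩, ⟨-10, 5⟩, ⟨-10, 5⟩, ⟨-10, 5⟩⟩, ⟨⟨5, -10⟩, ⟨5, -10⟩, ⟨5, -10⟩, ⟨5, -10⟩⟩))]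

def perB (σ : Bool) : List PerData :=
  if σ then
    [([⟨1, false, ⟨⟨5, 5⟩, ⟨-1, 0⟩, ⟨0, 0⟩⟩⟩, ⟨4, true, ⟨⟨-5, -5⟩, ⟨0, 1⟩, ⟨0, 0⟩⟩⟩, ⟨0, true, ⟨⟨0, 0⟩, ⟨0, 0⟩, ⟨0, 0⟩⟩⟩, ⟨3, false, ⟨⟨0, -5⟩, ⟨0, 1⟩, ⟨0, 0⟩⟩⟩, ⟨2, true, ⟨⟨0, 0⟩, ⟨0, 0⟩, ⟨0, 0⟩⟩⟩, ⟨1, true, ⟨⟨0, 5⟩, ⟨-1, 0⟩, ⟨0, 0⟩⟩⟩, ⟨0, false, ⟨⟨5, 0⟩, ⟨0, 0⟩, ⟨0, 0⟩⟩⟩, ⟨3, true, ⟨⟨-5, -5⟩, ⟨0, 1⟩, ⟨0, 0⟩⟩⟩, ⟨2, false, ⟨⟨5, 0⟩, ⟨0, 0⟩, ⟨0, 0⟩⟩⟩, ⟨4, false, ⟨⟨0, -5⟩, ⟨0, 1⟩, ⟨0, 0⟩⟩⟩],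
      [1], (⟨⟨-1, 2⟩, ⟨-1, 2⟩, ⟨-1, 2⟩, ⟨-1, 2⟩⟩, ⟨⟨4, 2⟩, ⟨4, 2⟩, ⟨4, 2⟩, ⟨4, 2⟩⟩)),
    ([⟨0, true, ⟨⟨0, 0⟩, ⟨0, 0⟩, ⟨0, 0⟩⟩⟩, ⟨2, true, ⟨⟨0, 0⟩, ⟨0, 0⟩, ⟨0, 0⟩⟩⟩, ⟨3, true, ⟨⟨0, -5⟩, ⟨0, 1⟩, ⟨0, 0⟩⟩⟩, ⟨1, true, ⟨⟨5, 0⟩, ⟨-1, 0⟩, ⟨0, 0⟩⟩⟩, ⟨4, true, ⟨⟨0, -5⟩, ⟨0, 1⟩, ⟨0, 0⟩⟩⟩],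
      [0], (⟨⟨-4, 3⟩, ⟨-4, 3⟩, ⟨-4, 3⟩, ⟨-4, 3⟩⟩, ⟨⟨6, -2⟩, ⟨6, -2⟩, ⟨6, -2⟩, ⟨6, -2⟩⟩)),
    ([⟨1, true, ⟨⟨0, 5⟩, ⟨-1, 0⟩, ⟨0, 0⟩⟩⟩, ⟨3, true, ⟨⟨0, -5⟩, ⟨0, 1⟩, ⟨0, 0⟩⟩⟩, ⟨0, true, ⟨⟨0, 0⟩, ⟨0, 0⟩, ⟨0, 0⟩⟩⟩],
      [0, 0, 1, 1, 1], (⟨⟨0, 0⟩, ⟨0, 0⟩, ⟨0, 0⟩, ⟨0, 0⟩⟩, ⟨⟨5, 0⟩, ⟨5, 0⟩, ⟨5, 0⟩, ⟨5, 0⟩⟩))]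
  else
    [([⟨4, false, ⟨⟨5, 5⟩, ⟨0, -1⟩, ⟨0, 0⟩⟩⟩, ⟨0, false, ⟨⟨0, 0⟩, ⟨0, 0⟩, ⟨0, 0⟩⟩⟩, ⟨2, false, ⟨⟨0, 0⟩, ⟨0, 0⟩, ⟨0, 0⟩⟩⟩, ⟨1, false, ⟨⟨0, -5⟩, ⟨1, 0⟩, ⟨0, 0⟩⟩⟩, ⟨3, false, ⟨⟨5, 5⟩, ⟨0, -1⟩, ⟨0, 0⟩⟩⟩],
      [1], (⟨⟨1, -2⟩, ⟨1, -2⟩, ⟨1, -2⟩, ⟨1, -2⟩⟩, ⟨⟨-4, -2⟩, ⟨-4, -2⟩, ⟨-4, -2⟩, ⟨-4, -2⟩⟩)),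
    ([⟨0, true, ⟨⟨5, -5⟩, ⟨0, 0⟩, ⟨0, 0⟩⟩⟩, ⟨3, true, ⟨⟨5, 5⟩, ⟨0, -1⟩, ⟨0, 0⟩⟩⟩, ⟨1, true, ⟨⟨-5, -5⟩, ⟨1, 0⟩, ⟨0, 0⟩⟩⟩],
      [2], (⟨⟨5, -5⟩, ⟨5, -5⟩, ⟨5, -5⟩, ⟨5, -5⟩⟩, ⟨⟨-10, 0⟩, ⟨-10, 0⟩, ⟨-10, 0⟩, ⟨-10, 0⟩⟩))]

def rtOK (V : Verts) (σ : Bool) (Y : DSub 3) (Qs : List PerData) : Bool :=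
  chkRT (baseV V σ) [Y] (Qs.map (mkPer V))

def rB2 : ZW := ⟨2, -1⟩
def rB : ZW := ⟨-1, 1⟩

/-- The numbers ⟨1, 2⟩ and ⟨1, 1⟩ are ω³ and ω², and `.K (-1) 1` is β: these are the two decreasing
branches of `renorm`. -/
def T2 : Aff := Aff.smul ⟨1, 2⟩ (.K (-1) 1 + -τ')
def T3 : Aff := Aff.smul ⟨1, 1⟩ (.K 1 0 + -τ')

/-- The ratios β³ here and β² in `S3` are inverse to the moduli of the slopes of the corresponding
branches of `renorm`. -/
def S2 : DSim := ⟨⟨-3, 2⟩, 1, true, (-τ', τ' + .K (-1) (-1)), rfl⟩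
def S3 : DSim := ⟨⟨2, -1⟩, 4, false, (-τ', τ' + .K (-1) (-1)), rfl⟩

/-- The return paths depend only on the branch of `renorm`, neither on the shape parameter within
the branch nor on the sign of the triangle. -/
def w1 : Fin 3 → List (Fin 3) := ![[0, 1, 0], [0, 1, 1, 1, 0], [0, 1, 2, 1, 0]]
def w2 : Fin 3 → List (Fin 3) :=
  ![[2, 1, 1], [2, 1, 0, 0, 1], [2, 1, 0, 0, 1, 1, 1, 0, 0, 1, 1, 1, 0, 0, 1]]
def w3 : Fin 3 → List (Fin 3) := ![[2], [2, 1, 1], [2, 1, 0, 0, 1]]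
def w0 : Fin 2 → List (Fin 2) := ![[0, 1, 0], [0, 1, 1, 1, 0]]
def w0' : Fin 2 → List (Fin 3) := ![[0, 1, 0], [0, 1, 1, 1, 0]]

/-- The similarities and the return paths for `τ = β²` and `τ = β`. -/
def SB2 (σ : Bool) : DSim :=
  if σ then ⟨⟨5, -3⟩, 1, false, (.K 2 (-1), .K (-2) 2), rfl⟩
  else ⟨⟨-3, 2⟩, 2, true, (.K 0 0, .K 0 0), rfl⟩

def wB2 (σ : Bool) : Fin 2 → List (Fin 3) :=
  if σ then ![[1, 2, 1, 0, 0], [1, 2, 1, 0, 0, 1, 1, 1, 0, 0, 1, 1, 1, 0, 0]]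
  else ![[0, 1, 1, 1, 0], [0, 1, 2, 1, 0]]

def SB (σ : Bool) : DSim :=
  if σ then ⟨⟨-3, 2⟩, 3, true, (.K 0 0, .K 1 0), rfl⟩
  else ⟨⟨2, -1⟩, 0, false, (.K 0 0, .K 0 0), rfl⟩

def wB (σ : Bool) : Fin 2 → List (Fin 3) :=
  if σ then ![[1, 2, 1], [1, 2, 1, 0, 0]] else ![[0], [1, 2, 1]]

/-- Each of these tests looks only at the end points of an interval of shape parameters; positivity
of the weights carries it over to the interior. A segment `seg a a` stands for a single parameter.
-/
theorem dom_base : ∀ σ, chkDom (baseV (seg ⟨0, 0⟩ ⟨1, 0⟩) σ) (baseDom (seg ⟨0, 0⟩ ⟨1, 0⟩) σ) = true := by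
  decide +kernel

theorem bij_base : chkBij (baseV (seg ⟨0, 0⟩ ⟨1, 0⟩) false) (baseDom (seg ⟨0, 0⟩ ⟨1, 0⟩) false) = true := by
  decide +kernel

theorem dom_base_zero : chkDom (baseV (seg ⟨0, 0⟩ ⟨0, 0⟩) false) (baseDom (seg ⟨0, 0⟩ ⟨0, 0⟩) false) = true := by
  decide +kernel

theorem dom_zero : chkDom (vecDom (seg ⟨0, 0⟩ ⟨0, 0⟩) zeroD) (baseDom (seg ⟨0, 0⟩ ⟨0, 0⟩) false) = true := by
  decide +kernel

theorem rt1 : ∀ σ, rtOK (seg ⟨0, 0⟩ rB2) σ (stepSub (seg ⟨0, 0⟩ rB2) σ S1 T1 w1) (per1 σ) = true := by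
  decide +kernel

theorem rt2 : ∀ σ, rtOK (seg rB2 rB) σ (stepSub (seg rB2 rB) (!σ) (S2.sg σ) T2 w2)
    (per2 σ) = true := by
  decide +kernel

theorem rt3 : ∀ σ, rtOK (seg rB ⟨1, 0⟩) σ (stepSub (seg rB ⟨1, 0⟩) (!σ) (S3.sg σ) T3 w3)
    (per3 σ) = true := by
  decide +kernel

/-- The induced copy has shape zero, so it is recorded with two atoms, the third being empty. -/
theorem rt0 : rtOK (seg ⟨0, 0⟩ ⟨0, 0⟩) false (zeroSub (seg ⟨0, 0⟩ ⟨0, 0⟩) S1 w0') per0 = true := by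
  decide +kernel

/-- The two-atom triangle also induces itself. This version serves the construction of measures,
where every atom has to be non-empty. -/
theorem sub0 : chkSub (vecDom (seg ⟨0, 0⟩ ⟨0, 0⟩) zeroD) (zeroSub (seg ⟨0, 0⟩ ⟨0, 0⟩) S1 w0) = true := by
  decide +kernel

theorem rtB2 : ∀ σ, rtOK (seg rB2 rB2) σ (zeroSub (seg rB2 rB2) (SB2 σ) (wB2 σ))
    (perB2 σ) = true := by
  decide +kernel

theorem rtB : ∀ σ, rtOK (seg rB rB) σ (zeroSub (seg rB rB) (SB σ) (wB σ))
    (perB σ) = true := by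
  decide +kernel

/-! ### The rhombus map and its sub-domains -/

/-- The rhombus map. -/
def rhombusD : DDom Aff 4 where
  tile := ![
    [⟨0, true, ⟨⟨0, 0⟩, ⟨0, 0⟩, ⟨-1, 0⟩⟩⟩,
      ⟨1, true, ⟨⟨0, 0⟩, ⟨0, 0⟩, ⟨-1, 0⟩⟩⟩,
      ⟨2, true, ⟨⟨-10, 5⟩, ⟨-1, 0⟩, ⟨0, 0⟩⟩⟩,
      ⟨1, false, ⟨⟨-5, 5⟩, ⟨-1, 0⟩, ⟨0, 0⟩⟩⟩],
    [⟨0, false, ⟨⟨5, 0⟩, ⟨0, 0⟩, ⟨-1, 0⟩⟩⟩,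
      ⟨1, false, ⟨⟨-5, 5⟩, ⟨-1, 0⟩, ⟨0, 0⟩⟩⟩,
      ⟨2, false, ⟨⟨-10, 5⟩, ⟨-1, 0⟩, ⟨0, 0⟩⟩⟩,
      ⟨1, true, ⟨⟨0, 0⟩, ⟨0, 0⟩, ⟨-1, 0⟩⟩⟩],
    [⟨0, true, ⟨⟨0, 0⟩, ⟨0, 0⟩, ⟨-1, 0⟩⟩⟩,
      ⟨1, true, ⟨⟨-10, 5⟩, ⟨-1, 0⟩, ⟨0, 0⟩⟩⟩,
      ⟨2, true, ⟨⟨-20, 10⟩, ⟨-1, 0⟩, ⟨0, 0⟩⟩⟩,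
      ⟨1, false, ⟨⟨0, 0⟩, ⟨0, 0⟩, ⟨-1, 0⟩⟩⟩],
    [⟨0, false, ⟨⟨5, 0⟩, ⟨0, 0⟩, ⟨-1, 0⟩⟩⟩,
      ⟨1, false, ⟨⟨0, 0⟩, ⟨0, 0⟩, ⟨-1, 0⟩⟩⟩,
      ⟨2, false, ⟨⟨-20, 10⟩, ⟨-1, 0⟩, ⟨0, 0⟩⟩⟩,
      ⟨1, true, ⟨⟨-10, 5⟩, ⟨-1, 0⟩, ⟨0, 0⟩⟩⟩]]
  k := ![4, 4, 4, 4]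
  d := ![(⟨⟨0, 0⟩, ⟨0, 0⟩, ⟨0, 0⟩⟩, ⟨⟨0, 0⟩, ⟨0, 0⟩, ⟨0, 0⟩⟩),
    (⟨⟨0, 0⟩, ⟨0, 0⟩, ⟨0, 0⟩⟩, ⟨⟨5, 0⟩, ⟨0, 0⟩, ⟨0, 0⟩⟩),
    (⟨⟨5, 0⟩, ⟨0, 0⟩, ⟨0, 0⟩⟩, ⟨⟨10, -5⟩, ⟨0, 0⟩, ⟨0, 0⟩⟩),
    (⟨⟨5, 0⟩, ⟨0, 0⟩, ⟨0, 0⟩⟩, ⟨⟨15, -5⟩, ⟨0, 0⟩, ⟨0, 0⟩⟩)]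

/-- The map induced on the first atom of the rhombus. -/
def returnD : DDom Aff 8 where
  tile := ![
    [⟨2, true, ⟨⟨0, 0⟩, ⟨0, 0⟩, ⟨-1, 0⟩⟩⟩,
      ⟨3, true, ⟨⟨-10, 5⟩, ⟨-1, 0⟩, ⟨0, 0⟩⟩⟩,
      ⟨1, false, ⟨⟨-5, 5⟩, ⟨-1, 0⟩, ⟨0, 0⟩⟩⟩,
      ⟨0, true, ⟨⟨0, 0⟩, ⟨0, 0⟩, ⟨-1, 0⟩⟩⟩,
      ⟨1, true, ⟨⟨0, 0⟩, ⟨0, 0⟩, ⟨-1, 0⟩⟩⟩],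
    [⟨1, false, ⟨⟨-5, 5⟩, ⟨-1, 0⟩, ⟨0, 0⟩⟩⟩,
      ⟨3, false, ⟨⟨-10, 5⟩, ⟨-1, 0⟩, ⟨0, 0⟩⟩⟩,
      ⟨2, true, ⟨⟨0, 0⟩, ⟨0, 0⟩, ⟨-1, 0⟩⟩⟩],
    [⟨1, false, ⟨⟨-5, 5⟩, ⟨-1, 0⟩, ⟨0, 0⟩⟩⟩,
      ⟨3, false, ⟨⟨-20, 10⟩, ⟨-1, 0⟩, ⟨0, 0⟩⟩⟩,
      ⟨2, true, ⟨⟨-10, 5⟩, ⟨-1, 0⟩, ⟨0, 0⟩⟩⟩],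
    [⟨2, false, ⟨⟨0, 0⟩, ⟨0, 0⟩, ⟨-1, 0⟩⟩⟩,
      ⟨1, true, ⟨⟨0, 0⟩, ⟨0, 0⟩, ⟨-1, 0⟩⟩⟩,
      ⟨2, true, ⟨⟨-10, 5⟩, ⟨-1, 0⟩, ⟨0, 0⟩⟩⟩,
      ⟨3, true, ⟨⟨-10, 5⟩, ⟨0, 0⟩, ⟨-1, 0⟩⟩⟩],
    [⟨1, false, ⟨⟨-5, 5⟩, ⟨-1, 0⟩, ⟨0, 0⟩⟩⟩,
      ⟨0, true, ⟨⟨-5, 5⟩, ⟨-1, 0⟩, ⟨0, 0⟩⟩⟩,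
      ⟨4, false, ⟨⟨0, 0⟩, ⟨-1, 0⟩, ⟨0, 0⟩⟩⟩,
      ⟨2, true, ⟨⟨-10, 5⟩, ⟨-1, 0⟩, ⟨0, 0⟩⟩⟩,
      ⟨3, true, ⟨⟨-20, 10⟩, ⟨-1, 0⟩, ⟨0, 0⟩⟩⟩],
    [⟨1, true, ⟨⟨10, -5⟩, ⟨-1, 0⟩, ⟨0, 0⟩⟩⟩,
      ⟨2, true, ⟨⟨-10, 5⟩, ⟨-1, 0⟩, ⟨0, 0⟩⟩⟩,
      ⟨4, true, ⟨⟨0, 0⟩, ⟨-1, 0⟩, ⟨0, 0⟩⟩⟩],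
    [⟨2, false, ⟨⟨0, 0⟩, ⟨0, 0⟩, ⟨-1, 0⟩⟩⟩,
      ⟨3, false, ⟨⟨-10, 5⟩, ⟨0, 0⟩, ⟨-1, 0⟩⟩⟩,
      ⟨4, false, ⟨⟨0, 0⟩, ⟨-1, 0⟩, ⟨0, 0⟩⟩⟩,
      ⟨0, false, ⟨⟨-5, 5⟩, ⟨-1, 0⟩, ⟨0, 0⟩⟩⟩,
      ⟨1, false, ⟨⟨-5, 5⟩, ⟨-1, 0⟩, ⟨0, 0⟩⟩⟩],
    [⟨3, false, ⟨⟨-10, 5⟩, ⟨0, 0⟩, ⟨-1, 0⟩⟩⟩,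
      ⟨2, true, ⟨⟨-10, 5⟩, ⟨-1, 0⟩, ⟨0, 0⟩⟩⟩,
      ⟨1, false, ⟨⟨10, -5⟩, ⟨-1, 0⟩, ⟨0, 0⟩⟩⟩,
      ⟨4, true, ⟨⟨0, 0⟩, ⟨-1, 0⟩, ⟨0, 0⟩⟩⟩]]
  k := ![4, 3, 3, 2, 2, 1, 1, 0]
  d := ![(⟨⟨0, 0⟩, ⟨0, 0⟩, ⟨0, 0⟩⟩, ⟨⟨0, 0⟩, ⟨0, 0⟩, ⟨0, 0⟩⟩),
    (⟨⟨0, 0⟩, ⟨0, 0⟩, ⟨0, 0⟩⟩, ⟨⟨5, 0⟩, ⟨0, 0⟩, ⟨0, 0⟩⟩),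
    (⟨⟨5, 0⟩, ⟨0, 0⟩, ⟨0, 0⟩⟩, ⟨⟨15, -5⟩, ⟨0, 0⟩, ⟨0, 0⟩⟩),
    (⟨⟨10, -5⟩, ⟨0, 0⟩, ⟨0, 0⟩⟩, ⟨⟨-15, 10⟩, ⟨0, 0⟩, ⟨0, 0⟩⟩),
    (⟨⟨15, -5⟩, ⟨0, 0⟩, ⟨0, 0⟩⟩, ⟨⟨-5, 5⟩, ⟨0, 0⟩, ⟨0, 0⟩⟩),
    (⟨⟨-5, 5⟩, ⟨0, 0⟩, ⟨0, 0⟩⟩, ⟨⟨15, -10⟩, ⟨0, 0⟩, ⟨0, 0⟩⟩),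
    (⟨⟨-5, 5⟩, ⟨0, 0⟩, ⟨0, 0⟩⟩, ⟨⟨0, 0⟩, ⟨0, 0⟩, ⟨0, 0⟩⟩),
    (⟨⟨15, -10⟩, ⟨0, 0⟩, ⟨0, 0⟩⟩, ⟨⟨-15, 10⟩, ⟨0, 0⟩, ⟨0, 0⟩⟩)]

/-- The third sub-domain, with its four atoms. -/
def thirdD : DDom Aff 4 where
  tile := ![
    [⟨3, false, ⟨⟨-10, 5⟩, ⟨-1, 0⟩, ⟨0, 0⟩⟩⟩,
      ⟨4, false, ⟨⟨-10, 5⟩, ⟨-1, 0⟩, ⟨0, 0⟩⟩⟩,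
      ⟨1, false, ⟨⟨-5, 5⟩, ⟨-1, 0⟩, ⟨0, 0⟩⟩⟩],
    [⟨4, false, ⟨⟨-10, 5⟩, ⟨0, 0⟩, ⟨-1, 0⟩⟩⟩,
      ⟨3, true, ⟨⟨-10, 5⟩, ⟨-1, 0⟩, ⟨0, 0⟩⟩⟩,
      ⟨1, false, ⟨⟨-5, 5⟩, ⟨-1, 0⟩, ⟨0, 0⟩⟩⟩,
      ⟨2, false, ⟨⟨10, -5⟩, ⟨-1, 0⟩, ⟨0, 0⟩⟩⟩,
      ⟨0, true, ⟨⟨0, 0⟩, ⟨-1, 0⟩, ⟨0, 0⟩⟩⟩],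
    [⟨2, true, ⟨⟨10, -5⟩, ⟨-1, 0⟩, ⟨0, 0⟩⟩⟩,
      ⟨1, false, ⟨⟨-5, 5⟩, ⟨-1, 0⟩, ⟨0, 0⟩⟩⟩,
      ⟨0, true, ⟨⟨0, 0⟩, ⟨-1, 0⟩, ⟨0, 0⟩⟩⟩],
    [⟨4, false, ⟨⟨-10, 5⟩, ⟨-1, 0⟩, ⟨0, 0⟩⟩⟩,
      ⟨3, true, ⟨⟨-10, 5⟩, ⟨-1, 0⟩, ⟨0, 0⟩⟩⟩,
      ⟨4, true, ⟨⟨-10, 5⟩, ⟨0, 0⟩, ⟨-1, 0⟩⟩⟩,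
      ⟨0, true, ⟨⟨0, 0⟩, ⟨-1, 0⟩, ⟨0, 0⟩⟩⟩]]
  k := ![3, 2, 3, 2]
  d := ![(⟨⟨0, 0⟩, ⟨0, 0⟩, ⟨0, 0⟩⟩, ⟨⟨5, 0⟩, ⟨0, 0⟩, ⟨0, 0⟩⟩),
    (⟨⟨10, -5⟩, ⟨0, 0⟩, ⟨0, 0⟩⟩, ⟨⟨5, 0⟩, ⟨0, 0⟩, ⟨0, 0⟩⟩),
    (⟨⟨-10, 5⟩, ⟨0, 0⟩, ⟨0, 0⟩⟩, ⟨⟨20, -10⟩, ⟨0, 0⟩, ⟨0, 0⟩⟩),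
    (⟨⟨10, -5⟩, ⟨0, 0⟩, ⟨0, 0⟩⟩, ⟨⟨5, 0⟩, ⟨0, 0⟩, ⟨0, 0⟩⟩)]

def perD0 : List (DEdge Aff) :=
    [⟨3, false, ⟨⟨-10, 5⟩, ⟨0, 0⟩, ⟨-1, 0⟩⟩⟩,
      ⟨4, false, ⟨⟨0, 0⟩, ⟨0, 0⟩, ⟨-1, 0⟩⟩⟩,
      ⟨0, false, ⟨⟨-5, 5⟩, ⟨0, 0⟩, ⟨-1, 0⟩⟩⟩,
      ⟨1, false, ⟨⟨-5, 5⟩, ⟨0, 0⟩, ⟨-1, 0⟩⟩⟩,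
      ⟨2, false, ⟨⟨0, 0⟩, ⟨0, 0⟩, ⟨-1, 0⟩⟩⟩]

def perD1 : List (DEdge Aff) :=
    [⟨1, true, ⟨⟨-15, 10⟩, ⟨-1, 0⟩, ⟨0, 0⟩⟩⟩,
      ⟨2, true, ⟨⟨0, 0⟩, ⟨-1, 0⟩, ⟨0, 0⟩⟩⟩,
      ⟨3, true, ⟨⟨-10, 5⟩, ⟨-1, 0⟩, ⟨0, 0⟩⟩⟩,
      ⟨4, true, ⟨⟨-10, 5⟩, ⟨-1, 0⟩, ⟨0, 0⟩⟩⟩,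
      ⟨0, true, ⟨⟨0, 0⟩, ⟨-1, 0⟩, ⟨0, 0⟩⟩⟩]

def perD2 : List (DEdge Aff) :=
    [⟨1, true, ⟨⟨-30, 20⟩, ⟨-1, 0⟩, ⟨0, 0⟩⟩⟩,
      ⟨2, true, ⟨⟨-10, 5⟩, ⟨-1, 0⟩, ⟨0, 0⟩⟩⟩,
      ⟨3, true, ⟨⟨-20, 10⟩, ⟨-1, 0⟩, ⟨0, 0⟩⟩⟩,
      ⟨4, true, ⟨⟨-25, 15⟩, ⟨-1, 0⟩, ⟨0, 0⟩⟩⟩,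
      ⟨0, true, ⟨⟨-5, 5⟩, ⟨-1, 0⟩, ⟨0, 0⟩⟩⟩]

def perD3 : List (DEdge Aff) :=
    [⟨1, true, ⟨⟨0, 0⟩, ⟨0, 0⟩, ⟨-1, 0⟩⟩⟩,
      ⟨2, true, ⟨⟨0, 0⟩, ⟨0, 0⟩, ⟨-1, 0⟩⟩⟩,
      ⟨3, true, ⟨⟨0, 0⟩, ⟨0, 0⟩, ⟨-1, 0⟩⟩⟩,
      ⟨4, true, ⟨⟨0, 0⟩, ⟨0, 0⟩, ⟨-1, 0⟩⟩⟩,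
      ⟨0, true, ⟨⟨0, 0⟩, ⟨0, 0⟩, ⟨-1, 0⟩⟩⟩]

def perD4 : List (DEdge Aff) :=
    [⟨1, true, ⟨⟨10, -5⟩, ⟨-1, 0⟩, ⟨0, 0⟩⟩⟩,
      ⟨2, true, ⟨⟨-10, 5⟩, ⟨-1, 0⟩, ⟨0, 0⟩⟩⟩,
      ⟨3, true, ⟨⟨5, -5⟩, ⟨-1, 0⟩, ⟨0, 0⟩⟩⟩,
      ⟨4, true, ⟨⟨0, 0⟩, ⟨-1, 0⟩, ⟨0, 0⟩⟩⟩,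
      ⟨0, true, ⟨⟨-5, 5⟩, ⟨-1, 0⟩, ⟨0, 0⟩⟩⟩]

def perD5 : List (DEdge Aff) :=
    [⟨4, false, ⟨⟨-10, 5⟩, ⟨0, 0⟩, ⟨-1, 0⟩⟩⟩,
      ⟨0, false, ⟨⟨0, 0⟩, ⟨-1, 0⟩, ⟨0, 0⟩⟩⟩,
      ⟨1, false, ⟨⟨-5, 5⟩, ⟨0, 0⟩, ⟨-1, 0⟩⟩⟩,
      ⟨0, true, ⟨⟨0, 0⟩, ⟨0, 0⟩, ⟨-1, 0⟩⟩⟩]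

def perD6 : List (DEdge Aff) :=
    [⟨4, false, ⟨⟨-10, 5⟩, ⟨-1, 0⟩, ⟨0, 0⟩⟩⟩,
      ⟨0, false, ⟨⟨0, 0⟩, ⟨-1, 0⟩, ⟨0, 0⟩⟩⟩,
      ⟨4, true, ⟨⟨-10, 5⟩, ⟨0, 0⟩, ⟨-1, 0⟩⟩⟩,
      ⟨0, true, ⟨⟨0, 0⟩, ⟨0, 0⟩, ⟨-1, 0⟩⟩⟩]

/-- The inverse of the determinant of `u_m` and `u_m'`. -/
def detInv (m m' : Fin 5) : ZW := match m' - m with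
  | 0 => ⟨0, 0⟩ | 1 => ⟨1, 0⟩ | 2 => ⟨0, 1⟩ | 3 => ⟨0, -1⟩ | 4 => ⟨-1, 0⟩

/-- The intersection of the lines that bound two half-planes. -/
def corner (e f : DEdge Vec) : Vec × Vec :=
  let l := detInv e.m f.m
  let a := sdZ (jOut e.m)
  let b := sdZ (jOut f.m)
  (Vec.smul (l * b.2) e.b + Vec.smul (l * -a.2) f.b,
    Vec.smul (l * -b.1) e.b + Vec.smul (l * a.1) f.b)

/-- The vertices of `Π*`. -/
def starV : Verts :=
  ⟨(⟨0, 0⟩, ⟨0, 0⟩), (⟨-29, 18⟩, ⟨-29, 18⟩), (⟨-29, 18⟩, ⟨-11, 7⟩), (⟨0, 0⟩, ⟨-11, 7⟩)⟩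

/-- The letter 0 occurs only at the start, as it must for a first return to the atom with that
index. -/
def returnPath : Fin 8 → List (Fin 4) :=
  ![[0], [0, 1], [0, 3], [0, 2, 1], [0, 2, 3], [0, 2, 2, 3], [0, 2, 3, 1], [0, 2, 2, 3, 1]]

def path₁ : Fin 3 → List (Fin 8) := ![[2], [4, 4, 2], [4, 5, 4, 2]]
def path₂ : Fin 3 → List (Fin 8) := ![[3], [3, 3, 0], [3, 3, 0, 0]]
def path₃ : Fin 4 → List (Fin 8) := ![[1], [0, 7, 1], [0, 5, 7, 1], [0, 3, 0, 3, 0, 3, 0, 3, 1]]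

/-- `ω⁶ √5 p`, `ω⁴ √5 q`, `ω⁴ √5 p`. -/
def tauA₁ : Aff := ⟨⟨0, 0⟩, ⟨11, 18⟩, ⟨0, 0⟩⟩
def tauA₂ : Aff := ⟨⟨0, 0⟩, ⟨0, 0⟩, ⟨4, 7⟩⟩
def tauA₃ : Aff := ⟨⟨0, 0⟩, ⟨4, 7⟩, ⟨0, 0⟩⟩

/-- The ratio ⟨13, −8⟩ is β⁶, and ⟨5, −3⟩ in the next two similarities is β⁴. They cancel the powers
of ω in the respective shape parameters. -/
def sim₁ : DSim := ⟨⟨13, -8⟩, 1, true,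
  (⟨⟨20, -10⟩, ⟨0, -2⟩, ⟨0, 0⟩⟩, ⟨⟨-5, 5⟩, ⟨-1, 0⟩, ⟨0, 0⟩⟩), rfl⟩
def sim₂ : DSim := ⟨⟨5, -3⟩, 0, false,
  (⟨⟨-15, 10⟩, ⟨0, 0⟩, ⟨-1, 0⟩⟩, ⟨⟨10, -5⟩, ⟨0, 0⟩, ⟨0, -2⟩⟩), rfl⟩
def sim₃ : DSim := ⟨⟨5, -3⟩, 1, true,
  (⟨⟨10, -5⟩, ⟨0, -2⟩, ⟨0, 0⟩⟩, ⟨⟨-5, 5⟩, ⟨-1, 0⟩, ⟨0, 0⟩⟩), rfl⟩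

/-- The domain is described as the triangle of the merged map, so the four atoms and the three
merged ones are measured against the same region. -/
def sub₃ (V : Verts) : DSub 8 :=
  ⟨4, vecDom V thirdD, path₃, cons (vecTile V (sim₃.tile (triD tauA₃)))⟩

def rhombusTileD : List (DEdge Aff) :=
  [⟨0, true, ⟨⟨0, 0⟩, ⟨0, 0⟩, ⟨-1, 0⟩⟩⟩, ⟨1, true, ⟨⟨-10, 5⟩, ⟨-1, 0⟩, ⟨0, 0⟩⟩⟩,
    ⟨0, false, ⟨⟨5, 0⟩, ⟨0, 0⟩, ⟨-1, 0⟩⟩⟩, ⟨1, false, ⟨⟨-5, 5⟩, ⟨-1, 0⟩, ⟨0, 0⟩⟩⟩]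

def perD : Fin 7 → List (DEdge Aff) := ![perD0, perD1, perD2, perD3, perD4, perD5, perD6]

def perPath : Fin 7 → List (Fin 8) :=
  ![[6], [0, 3], [4], [0], [5], [0, 6, 6, 6, 1], [0, 3, 0, 3, 0, 3, 1, 0, 6, 6, 1]]

/-- The weights are β and β², which add up to one. -/
def mid (x y : Vec × Vec) : Vec × Vec :=
  (Vec.smul ⟨-1, 1⟩ x.1 + Vec.smul ⟨2, -1⟩ y.1, Vec.smul ⟨-1, 1⟩ x.2 + Vec.smul ⟨2, -1⟩ y.2)

/-- A pentagon is centred at the fixed point of its return rotation; for the two quadrilaterals a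
point between two corners is taken. -/
def perWit (V : Verts) (i : Fin 7) : Vec × Vec :=
  if i < 5 then (pathIso (vecDom V returnD) (perPath i)).fixPt
  else match vecTile V (perD i) with
    | [a, b, c, d] => mid (corner a b) (corner c d)
    | _ => (⟨⟨0, 0⟩, ⟨0, 0⟩, ⟨0, 0⟩, ⟨0, 0⟩⟩, ⟨⟨0, 0⟩, ⟨0, 0⟩, ⟨0, 0⟩, ⟨0, 0⟩⟩)

def perV (V : Verts) (i : Fin 7) : DPer 8 := ⟨vecTile V (perD i), perPath i, perWit V i⟩

/-! ### Finite verification for the rhombus map and the eight-atom map -/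

theorem chk_rhombus : chkDom (vecDom starV rhombusD) (cons (vecTile starV rhombusTileD)) = true := by
  decide +kernel

theorem chk_return : chkSub (vecDom starV rhombusD)
    ⟨8, vecDom starV returnD, returnPath, cons ((vecDom starV rhombusD).tile 0)⟩ = true := by
  decide +kernel

theorem chk_rhombus_return : chkTiles (vecDom starV rhombusD) (tilesOf [
    ⟨8, vecDom starV returnD, returnPath, cons ((vecDom starV rhombusD).tile 0)⟩] []) = true := by
  decide +kernel

theorem chk₁ : chkSub (vecDom starV returnD)
    (mkSub starV sim₁ (baseD tauA₁) (triD tauA₁) path₁) = true := by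
  decide +kernel

theorem chk₂ : chkSub (vecDom starV returnD)
    (mkSub starV sim₂ (baseD tauA₂) (triD tauA₂) path₂) = true := by
  decide +kernel

theorem chk₃ : chkSub (vecDom starV returnD) (sub₃ starV) = true := by
  decide +kernel

theorem chk_per : (List.finRange 7).all (fun i => chkPer (vecDom starV returnD) (perV starV i))
    = true := by
  decide +kernel

theorem chk_return_tiles : chkTiles (vecDom starV returnD)
    (tilesOf [mkSub starV sim₁ (baseD tauA₁) (triD tauA₁) path₁,
      mkSub starV sim₂ (baseD tauA₂) (triD tauA₂) path₂, sub₃ starV]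
      (List.ofFn (perV starV))) = true := by
  decide +kernel

/-! ### Renormalization of the base triangles -/

theorem Sim.dirIdx_comp (G S : Sim) (m : Fin 5) :
    (G.comp S).dirIdx m = G.dirIdx (S.dirIdx m) := by
  unfold dirIdx comp
  cases G.flip <;> cases S.flip <;> simp <;> abel

theorem Sim.rotIdx_comp (G S : Sim) (m : Fin 5) :
    (G.comp S).rotIdx m = G.rotIdx (S.rotIdx m) := by
  unfold rotIdx comp
  cases G.flip <;> cases S.flip <;> simp

theorem RotTrans.ext_apply {g h : RotTrans} (hk : g.k = h.k) (hx : g.apply 0 = h.apply 0) :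
    g = h := by
  cases g; cases h
  simp only at hk
  subst hk
  simpa [apply] using hx

theorem DressedDomain.sim_sim {n : ℕ} (G S : Sim) (X : DressedDomain n) :
    (X.sim S).sim G = X.sim (G.comp S) := by
  unfold DressedDomain.sim
  congr 1
  · funext i
    simp only [Tile.sim, List.map_map, Function.comp_def, Sim.dirIdx_comp]
    refine List.map_congr_left fun e _ => ?_
    congr 1
    change _ = G.η * S.η * e.b + form _ (G.apply S.d)
    rw [Sim.form_apply]; ring
  · funext i
    refine RotTrans.ext_apply ?_ ?_
    · simp only [RotTrans.sim, Sim.rotIdx_comp]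
    -- The conjugate isometry is only described on images of the similarity, so the origin is
    -- written as such an image.
    · obtain ⟨x, hx⟩ := (G.comp S).surjective 0
      rw [← hx, RotTrans.sim_apply, Sim.comp_apply, RotTrans.sim_apply, RotTrans.sim_apply,
        Sim.comp_apply]

/-- The base triangle, or its opposite. -/
noncomputable def baseS (σ : Bool) (τ : ℝ) : DressedDomain 3 :=
  if σ then opposite (baseTriangle τ) else baseTriangle τ

/-- The base triangle with shape parameter zero, without its empty atom. -/
noncomputable def zeroT : DressedDomain 2 := zeroD.real (Aff.eval 0 0)

theorem seg_rep {a b : ZW} {τ : ℝ} (h1 : a.val < τ) (h2 : τ < b.val) :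
    ∃ w, (seg a b).Rep w τ 0 := by
  have hab : 0 < b.val - a.val := by linarith
  -- Each end point fills two of the four vertex slots, which turns the factor 5 into 10.
  refine ⟨⟨(b.val - τ) / (10 * (b.val - a.val)), (τ - a.val) / (10 * (b.val - a.val)),
    (b.val - τ) / (10 * (b.val - a.val)), (τ - a.val) / (10 * (b.val - a.val)),
    div_pos (by linarith) (by linarith), div_pos (by linarith) (by linarith),
    div_pos (by linarith) (by linarith), div_pos (by linarith) (by linarith)⟩, ?_, ?_, ?_⟩
  · field_simp; ring
  · simp only [seg, ZW.val_mul]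
    have : (ZW.mk 5 0).val = 5 := by simp [ZW.val]
    rw [this]; field_simp; ring
  · simp [seg, ZW.val]

theorem seg_rep_self (a : ZW) : ∃ w, (seg a a).Rep w a.val 0 := by
  refine ⟨⟨1 / 20, 1 / 20, 1 / 20, 1 / 20, by norm_num, by norm_num, by norm_num, by norm_num⟩,
    by norm_num, ?_, ?_⟩
  · simp only [seg, ZW.val_mul]
    have : (ZW.mk 5 0).val = 5 := by simp [ZW.val]
    rw [this]; ring
  · simp [seg, ZW.val]

theorem real_sgD (σ : Bool) (T : Aff) (p q : ℝ) :
    (sgD σ (baseD T)).real (Aff.eval p q) = baseS σ (T.eval p q) := by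
  cases σ
  · simp [sgD, baseS, real_baseD]
  · simp [sgD, baseS, real_oppD, real_baseD]

theorem eval_tau (τ : ℝ) : τ'.eval τ 0 = τ := by simp [τ', Aff.eval, ZW.val]

theorem real_baseV {V : Verts} {w : Wt} {τ : ℝ} (h : V.Rep w τ 0) (σ : Bool) :
    (baseV V σ).real (Vec.ev w) = baseS σ τ := by
  rw [baseV, h.real, real_sgD, eval_tau]

theorem real_stepSub {V : Verts} {w : Wt} {τ : ℝ} (h : V.Rep w τ 0) (σ : Bool) (S : DSim) (T : Aff)
    (p : Fin 3 → List (Fin 3)) :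
    (stepSub V σ S T p).real w = ⟨3, (baseS σ (T.eval τ 0)).sim (S.real τ 0), p⟩ := by
  change SubDomain.mk 3 ((vecDom V (S.dom (sgD σ (baseD T)))).real (Vec.ev w)) p = _
  rw [h.real, DSim.real_dom, real_sgD]

theorem real_zeroD (p q : ℝ) : zeroD.real (Aff.eval p q) = zeroT := by
  unfold zeroT DDom.real
  congr 1 <;> funext i <;> fin_cases i <;>
    simp [zeroD, baseD, realTile, omegaA]

theorem real_zeroSub {V : Verts} {w : Wt} {τ : ℝ} (h : V.Rep w τ 0) {n : ℕ} (S : DSim)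
    (p : Fin 2 → List (Fin n)) :
    (zeroSub V S p).real w = ⟨2, zeroT.sim (S.real τ 0), p⟩ := by
  change SubDomain.mk 2 ((vecDom V (S.dom zeroD)).real (Vec.ev w)) p = _
  rw [h.real, DSim.real_dom, real_zeroD]

theorem val_zero : (ZW.mk 0 0).val = 0 := by simp [ZW.val]
theorem val_one : (ZW.mk 1 0).val = 1 := by simp [ZW.val]
theorem val_rB : rB.val = β := by rw [beta_eq]; simp [rB, ZW.val]; ring
theorem val_rB2 : rB2.val = β ^ 2 := by rw [beta_sq, beta_eq]; simp [rB2, ZW.val]; ring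

theorem base_disjoint {σ : Bool} {τ : ℝ} (h0 : 0 < τ) (h1 : τ < 1) :
    (baseS σ τ).AtomsDisjoint := by
  obtain ⟨w, hw⟩ := seg_rep (τ := τ) (a := ⟨0, 0⟩) (b := ⟨1, 0⟩) (by rwa [val_zero]) (by rwa [val_one])
  rw [← real_baseV hw]
  exact (chkDom_spec (dom_base σ) w).1

theorem base_bijOn {τ : ℝ} (h0 : 0 < τ) (h1 : τ < 1) :
    Set.BijOn (baseS false τ).map (baseS false τ).domain (baseS false τ).domain := by
  obtain ⟨w, hw⟩ := seg_rep (τ := τ) (a := ⟨0, 0⟩) (b := ⟨1, 0⟩) (by rwa [val_zero]) (by rwa [val_one])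
  rw [← real_baseV hw]
  exact chkBij_spec (dom_base false) bij_base w

theorem zero_rep : ∃ w, (seg ⟨0, 0⟩ ⟨0, 0⟩).Rep w 0 0 := by
  have := seg_rep_self ⟨0, 0⟩
  rwa [val_zero] at this

theorem base_zero_disjoint : (baseS false 0).AtomsDisjoint := by
  obtain ⟨w, hw⟩ := zero_rep
  rw [← real_baseV hw]
  exact (chkDom_spec dom_base_zero w).1

theorem zeroT_disjoint : zeroT.AtomsDisjoint := by
  obtain ⟨w, hw⟩ := zero_rep
  have := (chkDom_spec dom_zero w).1
  rwa [hw.real, real_zeroD] at this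

/-- Puts the empty third atom back. A merger asks each old atom to lie in a new one, but no new atom
has to contain an old one. -/
theorem merger_zeroT : (baseS false 0).IsMerger zeroT := by
  obtain ⟨w, hw⟩ := zero_rep
  refine ⟨base_zero_disjoint, ?_, ?_⟩
  · have h1 := (chkDom_spec dom_zero w).2
    have h2 := (chkDom_spec dom_base_zero w).2
    rw [hw.real, real_zeroD] at h1
    rw [real_baseV hw] at h2
    rw [h1, h2]
  · have h : baseS false 0 = (baseD (.K 0 0)).real (Aff.eval 0 0) := by
      rw [real_baseD]; simp [baseS]
    intro i
    rw [h]
    fin_cases i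
    · exact ⟨0, subset_rfl, fun x => rfl⟩
    · exact ⟨1, subset_rfl, fun x => rfl⟩

theorem tiles_of_rtOK {V : Verts} {w : Wt} {σ : Bool} {τ : ℝ} (h : V.Rep w τ 0)
    (hd : (baseS σ τ).AtomsDisjoint) {Y : DSub 3} {Qs : List PerData}
    (hY : rtOK V σ Y Qs = true) :
    RecursivelyTiles (baseS σ τ) [Y.real w] ((Qs.map (mkPer V)).map (DPer.real w)) := by
  rw [← real_baseV h] at hd ⊢
  exact chkRT_spec hd hY

theorem tiles₁ (σ : Bool) {τ : ℝ} (h0 : 0 < τ) (h1 : τ < β ^ 2) :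
    ∃ (S : Sim) (Qs : List (PathTile 3)), S.η = β ^ 2 ∧
      RecursivelyTiles (baseS σ τ) [⟨3, (baseS σ (ω ^ 2 * τ)).sim S, w1⟩] Qs := by
  have hb := beta_sq
  have hb' := beta_pos
  obtain ⟨w, hw⟩ := seg_rep (τ := τ) (a := ⟨0, 0⟩) (b := rB2) (by rwa [val_zero]) (by rwa [val_rB2])
  have := tiles_of_rtOK hw (base_disjoint h0 (by linarith)) (rt1 σ)
  rw [real_stepSub hw] at this
  have hT : T1.eval τ 0 = ω ^ 2 * τ := by simp [T1, omegaA, eval_tau, ZW.val]; ring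
  rw [hT] at this
  exact ⟨_, _, val_rB2, this⟩

theorem val_beta_cube : (ZW.mk (-3) 2).val = β ^ 3 := by
  rw [pow_succ, beta_sq, beta_eq]; simp [ZW.val]; linear_combination omega_sq

theorem tiles₂ (σ : Bool) {τ : ℝ} (h0 : β ^ 2 < τ) (h1 : τ < β) :
    ∃ (S : Sim) (Qs : List (PathTile 3)), S.η = β ^ 3 ∧
      RecursivelyTiles (baseS σ τ) [⟨3, (baseS (!σ) (ω ^ 3 * (β - τ))).sim S, w2⟩] Qs := by
  have hb := beta_lt_one
  have hb' := beta_pos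
  obtain ⟨w, hw⟩ := seg_rep (τ := τ) (a := rB2) (b := rB) (by rwa [val_rB2]) (by rwa [val_rB])
  have := tiles_of_rtOK hw (base_disjoint ((pow_pos hb' 2).trans h0) (by linarith)) (rt2 σ)
  rw [real_stepSub hw] at this
  have hT : T2.eval τ 0 = ω ^ 3 * (β - τ) := by
    simp [T2, eval_tau, ZW.val]; rw [beta_eq]
    linear_combination (-(ω - 1 - τ) * (ω + 1)) * omega_sq
  rw [hT] at this
  exact ⟨_, _, val_beta_cube, this⟩

theorem tiles₃ (σ : Bool) {τ : ℝ} (h0 : β < τ) (h1 : τ < 1) :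
    ∃ (S : Sim) (Qs : List (PathTile 3)), S.η = β ^ 2 ∧
      RecursivelyTiles (baseS σ τ) [⟨3, (baseS (!σ) (ω ^ 2 * (1 - τ))).sim S, w3⟩] Qs := by
  obtain ⟨w, hw⟩ := seg_rep (τ := τ) (a := rB) (b := ⟨1, 0⟩) (by rwa [val_rB]) (by rwa [val_one])
  have := tiles_of_rtOK hw (base_disjoint (beta_pos.trans h0) h1) (rt3 σ)
  rw [real_stepSub hw] at this
  have hT : T3.eval τ 0 = ω ^ 2 * (1 - τ) := by
    simp [T3, eval_tau, ZW.val]; linear_combination (-(1 - τ)) * omega_sq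
  rw [hT] at this
  exact ⟨_, _, val_rB2, this⟩

theorem tiles_betaSq (σ : Bool) :
    ∃ (S : Sim) (Qs : List (PathTile 3)), S.η < 1 ∧
      RecursivelyTiles (baseS σ (β ^ 2)) [⟨2, zeroT.sim S, wB2 σ⟩] Qs := by
  have h1 := beta_sq
  have h2 := beta_pos
  have h3 := beta_lt_one
  obtain ⟨w, hw⟩ := seg_rep_self rB2
  rw [val_rB2] at hw
  have := tiles_of_rtOK hw (base_disjoint (by positivity) (by linarith)) (rtB2 σ)
  rw [real_zeroSub hw] at this
  refine ⟨_, _, ?_, this⟩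
  change (SB2 σ).η.val < 1
  cases σ
  · change (ZW.mk (-3) 2).val < 1
    rw [val_beta_cube]; exact pow_lt_one₀ h2.le h3 (by norm_num)
  · change (ZW.mk 5 (-3)).val < 1
    have : (ZW.mk 5 (-3)).val = β ^ 4 := by
      rw [show β ^ 4 = (β ^ 2) ^ 2 by ring, beta_sq, beta_eq]; simp [ZW.val]
      linear_combination -omega_sq
    rw [this]; exact pow_lt_one₀ h2.le h3 (by norm_num)

theorem tiles_beta (σ : Bool) :
    ∃ (S : Sim) (Qs : List (PathTile 3)), S.η < 1 ∧
      RecursivelyTiles (baseS σ β) [⟨2, zeroT.sim S, wB σ⟩] Qs := by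
  have h2 := beta_pos
  have h3 := beta_lt_one
  obtain ⟨w, hw⟩ := seg_rep_self rB
  rw [val_rB] at hw
  have := tiles_of_rtOK hw (base_disjoint h2 h3) (rtB σ)
  rw [real_zeroSub hw] at this
  refine ⟨_, _, ?_, this⟩
  change (SB σ).η.val < 1
  cases σ
  · change rB2.val < 1
    rw [val_rB2]; exact pow_lt_one₀ h2.le h3 (by norm_num)
  · change (ZW.mk (-3) 2).val < 1
    rw [val_beta_cube]; exact pow_lt_one₀ h2.le h3 (by norm_num)

theorem tiles_zero :
    ∃ (S : Sim) (Qs : List (PathTile 3)), S.η < 1 ∧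
      RecursivelyTiles (baseS false 0) [⟨2, zeroT.sim S, w0'⟩] Qs := by
  obtain ⟨w, hw⟩ := zero_rep
  have := tiles_of_rtOK hw base_zero_disjoint rt0
  rw [real_zeroSub hw] at this
  refine ⟨_, _, ?_, this⟩
  change rB2.val < 1
  rw [val_rB2]; exact pow_lt_one₀ beta_pos.le beta_lt_one (by norm_num)

theorem induced_zero :
    ∃ S : Sim, S.η = β ^ 2 ∧ SubDomain.IsInduced zeroT ⟨2, zeroT.sim S, w0⟩ := by
  obtain ⟨w, hw⟩ := zero_rep
  have h := zeroT_disjoint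
  have hz : (vecDom (seg ⟨0, 0⟩ ⟨0, 0⟩) zeroD).real (Vec.ev w) = zeroT := by
    rw [hw.real, real_zeroD]
  rw [← hz] at h
  have := chkSub_spec h sub0
  rw [real_zeroSub hw, hz] at this
  exact ⟨_, val_rB2, this⟩

/-- The shape parameters and signs that occur in renormalization. -/
def Good (σ : Bool) (τ : ℝ) : Prop := 0 ≤ τ ∧ τ < 1 ∧ (τ = 0 → σ = false)

theorem induces_of_tiles {n m : ℕ} {X : DressedDomain n} {Z : DressedDomain m}
    {w : Fin m → List (Fin n)} {Qs : List (PathTile n)} (h : RecursivelyTiles X [⟨m, Z, w⟩] Qs) :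
    Induces X Z :=
  ⟨_, Qs, h, (h.1 _ (List.mem_singleton_self _)).1, rfl, fun i => ⟨i, subset_rfl, fun _ => rfl⟩⟩

theorem induces_of_tiles_zero {n : ℕ} {X : DressedDomain n} {S : Sim}
    {w : Fin 2 → List (Fin n)} {Qs : List (PathTile n)}
    (h : RecursivelyTiles X [⟨2, zeroT.sim S, w⟩] Qs) : Induces X ((baseS false 0).sim S) :=
  ⟨_, Qs, h, merger_zeroT.conj (conj_sim S _) (conj_sim S _) S.surjective⟩

/-- There are three open intervals and the three special values 0, β², β. The first interval keeps
the sign of the triangle and the other two reverse it; the special values lead to shape zero, always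
with the unreversed sign. -/
theorem base_step {σ : Bool} {τ : ℝ} (h : Good σ τ) :
    ∃ (σ' : Bool) (S : Sim), S.η < 1 ∧ Good σ' (renorm τ) ∧
      Induces (baseS σ τ) ((baseS σ' (renorm τ)).sim S) := by
  obtain ⟨h0, h1, hσ⟩ := h
  have hb := beta_sq
  have hb0 := beta_pos
  have hb1 := beta_lt_one
  have hw := omega_sq
  have hw1 := omega_gt_one
  have hbw := beta_mul_omega
  have hβ2 : β ^ 2 < β := by nlinarith
  have hsq : β ^ 2 * ω ^ 2 = 1 := by rw [← mul_pow, hbw, one_pow]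
  have hη2 : β ^ 2 < 1 := by linarith
  have hη3 : β ^ 3 < 1 := pow_lt_one₀ hb0.le hb1 (by norm_num)
  have good0 : Good false 0 := ⟨le_rfl, one_pos, fun _ => rfl⟩
  have hω2 : 0 < ω ^ 2 := by positivity
  rcases h0.eq_or_lt with rfl | h0'
  · rw [hσ rfl]
    obtain ⟨S, Qs, hS, hQ⟩ := tiles_zero
    have e : renorm 0 = 0 := by
      unfold renorm; rw [if_pos (by positivity), mul_zero]
    rw [e]
    exact ⟨false, S, hS, good0, induces_of_tiles_zero hQ⟩
  rcases lt_trichotomy τ (β ^ 2) with h2 | h2 | h2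
  · obtain ⟨S, Qs, hS, hQ⟩ := tiles₁ σ h0' h2
    have e : renorm τ = ω ^ 2 * τ := by unfold renorm; rw [if_pos h2]
    rw [e]
    have : 0 < ω ^ 2 * τ := by positivity
    exact ⟨σ, S, hS ▸ hη2, ⟨this.le, by nlinarith, fun h => absurd h this.ne'⟩,
      induces_of_tiles hQ⟩
  · subst h2
    obtain ⟨S, Qs, hS, hQ⟩ := tiles_betaSq σ
    have e : renorm (β ^ 2) = 0 := by
      unfold renorm
      rw [if_neg (lt_irrefl _), if_neg (fun h => lt_irrefl _ h.1), if_neg]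
      exact fun h => absurd h.1 (by linarith)
    rw [e]
    exact ⟨false, S, hS, good0, induces_of_tiles_zero hQ⟩
  rcases lt_trichotomy τ β with h3 | h3 | h3
  · obtain ⟨S, Qs, hS, hQ⟩ := tiles₂ σ h2 h3
    have e : renorm τ = ω ^ 3 * (β - τ) := by
      unfold renorm; rw [if_neg h2.not_gt, if_pos ⟨h2, h3⟩]
    rw [e]
    have h4 : 0 < ω ^ 3 * (β - τ) := mul_pos (by positivity) (by linarith)
    refine ⟨!σ, S, hS ▸ hη3, ⟨h4.le, ?_, fun h => absurd h h4.ne'⟩, induces_of_tiles hQ⟩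
    -- The branch stretches the interval from β² to β to unit length.
    have h5 : ω ^ 3 * (β - β ^ 2) = 1 := by
      have : ω ^ 3 * (β - β ^ 2) = (β * ω) * (ω ^ 2 * (1 - β)) := by ring
      rw [this, hbw, ← hb]; linarith
    have : ω ^ 3 * (β - τ) < ω ^ 3 * (β - β ^ 2) :=
      mul_lt_mul_of_pos_left (by linarith) (by positivity)
    linarith
  · subst h3
    obtain ⟨S, Qs, hS, hQ⟩ := tiles_beta σ
    have e : renorm β = 0 := by
      unfold renorm
      rw [if_neg hβ2.not_gt, if_neg (fun h => lt_irrefl _ h.2),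
        if_neg (fun h => lt_irrefl _ h.1)]
    rw [e]
    exact ⟨false, S, hS, good0, induces_of_tiles_zero hQ⟩
  · obtain ⟨S, Qs, hS, hQ⟩ := tiles₃ σ h3 h1
    have e : renorm τ = ω ^ 2 * (1 - τ) := by
      unfold renorm
      rw [if_neg h2.not_gt, if_neg (fun h => absurd h.2 h3.not_gt), if_pos ⟨h3, h1⟩]
    rw [e]
    have h4 : 0 < ω ^ 2 * (1 - τ) := mul_pos (by positivity) (by linarith)
    exact ⟨!σ, S, hS ▸ hη2, ⟨h4.le, by nlinarith, fun h => absurd h h4.ne'⟩, induces_of_tiles hQ⟩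

theorem inducesBase {σ : Bool} {τ : ℝ} (h : Good σ τ) : InducesBase (baseS σ τ) (renorm τ) := by
  obtain ⟨σ', S, hS, -, hI⟩ := base_step h
  refine ⟨_, hI, S.η, hS, ?_⟩
  cases σ'
  · exact Or.inl (isSimilar_sim S _)
  · exact Or.inr (isSimilar_sim S _)

theorem renorm_mem {τ : ℝ} (h0 : 0 ≤ τ) (h1 : τ < 1) : 0 ≤ renorm τ ∧ renorm τ < 1 := by
  obtain ⟨σ', S, -, h, -⟩ := base_step (σ := false) ⟨h0, h1, fun _ => rfl⟩
  exact ⟨h.1, h.2.1⟩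

/-- A point of the base triangle. -/
def baseWit (σ : Bool) : Vec × Vec :=
  let u : Vec := ⟨⟨5, -5⟩, ⟨-10, 5⟩, ⟨5, -5⟩, ⟨-10, 5⟩⟩
  let v : Vec := ⟨⟨0, -5⟩, ⟨-5, 0⟩, ⟨0, -5⟩, ⟨-5, 0⟩⟩
  if σ then (-u, -v) else (u, v)

theorem baseWit_mem : ∀ σ, (baseDom (seg ⟨0, 0⟩ ⟨1, 0⟩) σ).all (conAt (baseWit σ)) = true := by
  decide +kernel

theorem baseWit_mem_zero : (baseDom (seg ⟨0, 0⟩ ⟨0, 0⟩) false).all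
    (conAt (⟨⟨5, -5⟩, ⟨5, -5⟩, ⟨5, -5⟩, ⟨5, -5⟩⟩, ⟨⟨0, -5⟩, ⟨0, -5⟩, ⟨0, -5⟩, ⟨0, -5⟩⟩)) = true := by
  decide +kernel

theorem base_domain_nonempty {σ : Bool} {τ : ℝ} (h : Good σ τ) :
    (baseS σ τ).domain.Nonempty := by
  obtain ⟨h0, h1, hσ⟩ := h
  rcases h0.eq_or_lt with rfl | h0'
  · rw [hσ rfl]
    obtain ⟨w, hw⟩ := zero_rep
    rw [← real_baseV hw, (chkDom_spec dom_base_zero w).2]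
    exact ⟨_, mem_reg_of_conAt baseWit_mem_zero⟩
  · obtain ⟨w, hw⟩ := seg_rep (τ := τ) (a := ⟨0, 0⟩) (b := ⟨1, 0⟩) (by rwa [val_zero])
      (by rwa [val_one])
    rw [← real_baseV hw, (chkDom_spec (dom_base σ) w).2]
    exact ⟨_, mem_reg_of_conAt (baseWit_mem σ)⟩

theorem zeroT_domain_nonempty : zeroT.domain.Nonempty := by
  obtain ⟨w, hw⟩ := zero_rep
  have := (chkDom_spec dom_zero w).2
  rw [hw.real, real_zeroD] at this
  rw [this]
  exact ⟨_, mem_reg_of_conAt baseWit_mem_zero⟩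

/-! ### Self-similarity -/

/-- A pair of a sign and a shape parameter. -/
abbrev BaseState := {x : Bool × ℝ // Good x.1 x.2}

theorem exists_next (x : BaseState) : ∃ (y : BaseState) (S : Sim), y.1.2 = renorm x.1.2 ∧
    S.η < 1 ∧ Induces (baseS x.1.1 x.1.2) ((baseS y.1.1 y.1.2).sim S) := by
  obtain ⟨σ', S, h1, h2, h3⟩ := base_step x.2
  exact ⟨⟨(σ', renorm x.1.2), h2⟩, S, rfl, h1, h3⟩

/-- The value of `t` is the same at the times k, l and 2l − k, and two of these three times share
the value of the two-valued `s`. -/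
theorem exists_iterate_eq {α : Type*} {f : ℝ → ℝ} {g : α → α} {t : α → ℝ} {s : α → Bool}
    (hinj : ∀ x y, t x = t y → s x = s y → x = y) (hg : ∀ x, t (g x) = f (t x)) {x : α}
    (h : EventuallyPeriodic f (t x)) : ∃ k l, k < l ∧ g^[k] x = g^[l] x := by
  obtain ⟨k, l, hkl, h⟩ := h
  have ht : ∀ n, t (g^[n] x) = f^[n] (t x) := fun n => by
    induction n with
    | zero => rfl
    | succ n ih => rw [Function.iterate_succ_apply', hg, ih, Function.iterate_succ_apply']
  have e1 : t (g^[k] x) = t (g^[l] x) := by rw [ht, ht, h]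
  have e2 : t (g^[l] x) = t (g^[(l - k) + l] x) := by
    rw [ht, ht, Function.iterate_add_apply, ← h, ← Function.iterate_add_apply,
      Nat.sub_add_cancel hkl.le, h]
  by_cases h1 : s (g^[k] x) = s (g^[l] x)
  · exact ⟨k, l, hkl, hinj _ _ e1 h1⟩
  by_cases h2 : s (g^[l] x) = s (g^[(l - k) + l] x)
  · exact ⟨l, (l - k) + l, by omega, hinj _ _ e2 h2⟩
  · refine ⟨k, (l - k) + l, by omega, hinj _ _ (e1.trans e2) ?_⟩
    revert h1 h2
    cases s (g^[k] x) <;> cases s (g^[l] x) <;> cases s (g^[(l - k) + l] x) <;> simp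

/-- Sign and shape parameter determine the triangle up to position, so a repeated state in the chain
of inductions is a similar copy, smaller because every step contracts. -/
theorem selfSimilar_base {σ : Bool} {τ : ℝ} (h : Good σ τ) (hτ : EventuallyPeriodic renorm τ)
    (S : Sim) : SelfSimilar ((baseS σ τ).sim S) := by
  choose next T hn hT hI using exists_next
  let x : ℕ → BaseState := fun i => next^[i] ⟨(σ, τ), h⟩
  have hx : ∀ i, x (i + 1) = next (x i) := fun i => Function.iterate_succ_apply' _ _ _
  obtain ⟨k, N, hkN, hper⟩ := exists_iterate_eq (f := renorm) (g := next) (t := fun x => x.1.2)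
    (s := fun x => x.1.1) (fun x y h1 h2 => Subtype.ext (Prod.ext h2 h1)) hn
    (x := ⟨(σ, τ), h⟩) hτ
  -- The accumulated similarity, which carries the standard triangle of stage `i` to its place in
  -- the original one.
  let G : ℕ → Sim := fun i => Nat.rec S (fun i g => g.comp (T (x i))) i
  have hG : ∀ i, G (i + 1) = (G i).comp (T (x i)) := fun i => rfl
  have hη : ∀ i j, (G (i + j)).η ≤ (G i).η := by
    intro i j
    induction j with
    | zero => exact le_rfl
    | succ j ih =>
      rw [← add_assoc, hG]
      refine le_trans ?_ ih
      exact mul_le_of_le_one_right (G (i + j)).η_pos.le (hT _).le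
  refine ⟨N, fun i => ⟨3, (baseS (x i).1.1 (x i).1.2).sim (G i)⟩, rfl, fun i hi => ?_, ?_, k, hkN,
    (G N).η * (G k).η⁻¹, ?_, ((G N).comp (G k).symm).apply, ((G N).comp (G k).symm).isSimilarity,
    Equiv.refl _, fun i => ?_⟩
  · have := (hI (x i)).sim (G i)
    rw [DressedDomain.sim_sim] at this
    simp only [hx, hG]
    exact this
  · simp only
    rw [(conj_sim (G N) _).domain]
    exact (base_domain_nonempty (x N).2).image _
  · rw [← div_eq_mul_inv, div_lt_one (G k).η_pos]
    have h1 : (G (k + 1)).η < (G k).η := by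
      rw [hG]; exact mul_lt_of_lt_one_right (G k).η_pos (hT _)
    have h2 := hη (k + 1) (N - (k + 1))
    rw [show k + 1 + (N - (k + 1)) = N by omega] at h2
    linarith
  · have hxe : x k = x N := hper
    have hc : ∀ y, ((G N).comp (G k).symm).apply ((G k).apply y) = (G N).apply y := fun y => by
      rw [Sim.comp_apply, Sim.symm_apply, Sim.inv_apply]
    have h1 := conj_sim (G N) (baseS (x k).1.1 (x k).1.2)
    have h2 := conj_sim (G k) (baseS (x k).1.1 (x k).1.2)
    simp only [Equiv.refl_apply]
    rw [← hxe]
    refine ⟨?_, fun y => ?_⟩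
    · rw [h1.region, h2.region, Set.image_image]
      simp only [hc]
    · obtain ⟨y, rfl⟩ := (G k).surjective y
      rw [← h2.iso, hc, hc, h1.iso]

/-! ### The parameter domain -/

theorem star_bounds : 0 < β ^ 6 / √5 ∧ β ^ 6 / √5 < β ^ 4 / √5 := by
  have h1 := beta_pos
  have h2 := sqrt5_pos
  refine ⟨by positivity, div_lt_div_of_pos_right ?_ h2⟩
  exact pow_lt_pow_right_of_lt_one₀ h1 beta_lt_one (by norm_num)

/-- The closed quadrilateral. -/
def starClosed : Set (ℝ × ℝ) :=
  {x | 0 ≤ x.1 - β ^ 2 ∧ x.1 - β ^ 2 ≤ β ^ 6 / √5 ∧ x.1 - β ^ 2 ≤ x.2 ∧ x.2 ≤ β ^ 4 / √5}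

theorem convexHull_star : convexHull ℝ {(β ^ 2, 0), (β ^ 2 + β ^ 6 / √5, β ^ 6 / √5),
    (β ^ 2 + β ^ 6 / √5, β ^ 4 / √5), (β ^ 2, β ^ 4 / √5)} = starClosed := by
  obtain ⟨hb, hc⟩ := star_bounds
  unfold starClosed
  generalize β ^ 6 / √5 = b' at hb hc ⊢
  generalize β ^ 4 / √5 = c at hc ⊢
  generalize β ^ 2 = e
  refine Set.Subset.antisymm (convexHull_min ?_ ?_) ?_
  · rintro x (rfl | rfl | rfl | rfl) <;> refine ⟨?_, ?_, ?_, ?_⟩ <;> dsimp only <;> linarith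
  · rintro x ⟨h1, h2, h3, h4⟩ y ⟨k1, k2, k3, k4⟩ a d ha hd had
    have : a = 1 - d := by linarith
    subst this
    simp only [Set.mem_ofPred_eq, Prod.fst_add, Prod.snd_add, Prod.smul_fst, Prod.smul_snd,
      smul_eq_mul]
    refine ⟨?_, ?_, ?_, ?_⟩
    · nlinarith [mul_nonneg ha h1, mul_nonneg hd k1]
    · nlinarith [mul_nonneg ha (sub_nonneg.2 h2), mul_nonneg hd (sub_nonneg.2 k2)]
    · nlinarith [mul_nonneg ha (sub_nonneg.2 h3), mul_nonneg hd (sub_nonneg.2 k3)]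
    · nlinarith [mul_nonneg ha (sub_nonneg.2 h4), mul_nonneg hd (sub_nonneg.2 k4)]
  · rintro ⟨s, t⟩ ⟨h1, h2, h3, h4⟩
    simp only at h1 h2 h3 h4
    have hcv := convex_convexHull ℝ ({(e, 0), (e + b', b'), (e + b', c), (e, c)} : Set (ℝ × ℝ))
    have hm := subset_convexHull ℝ ({(e, 0), (e + b', b'), (e + b', c), (e, c)} : Set (ℝ × ℝ))
    -- Interpolation along the lower and the upper side at the abscissa of the point, then between
    -- the two points obtained.
    have hx0 : 0 ≤ (s - e) / b' := by positivity
    have hx1 : (s - e) / b' ≤ 1 := (div_le_one hb).2 h2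
    have hxb : (s - e) / b' * b' = s - e := div_mul_cancel₀ _ hb.ne'
    have hA := hcv (hm (show (e, (0 : ℝ)) ∈ _ by simp)) (hm (show (e + b', b') ∈ _ by simp))
      (sub_nonneg.2 hx1) hx0 (by ring)
    have hB := hcv (hm (show (e, c) ∈ _ by simp)) (hm (show (e + b', c) ∈ _ by simp))
      (sub_nonneg.2 hx1) hx0 (by ring)
    have hcp : 0 < c - (s - e) := by linarith
    have hy0 : 0 ≤ (t - (s - e)) / (c - (s - e)) := div_nonneg (by linarith) hcp.le
    have hy1 : (t - (s - e)) / (c - (s - e)) ≤ 1 := (div_le_one hcp).2 (by linarith)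
    have hyc : (t - (s - e)) / (c - (s - e)) * (c - (s - e)) = t - (s - e) :=
      div_mul_cancel₀ _ hcp.ne'
    have := hcv hA hB (sub_nonneg.2 hy1) hy0 (by ring)
    convert this using 1
    generalize (s - e) / b' = x at *
    generalize (t - (s - e)) / (c - (s - e)) = y at *
    ext
    · simp; linear_combination -hxb
    · simp; linear_combination -hyc - (1 - y) * hxb

/-- A point of the interior may be moved by ε/2 along either axis within the closed quadrilateral,
which makes each weak inequality strict. -/
theorem piStar_strict {s t : ℝ} (h : (s, t) ∈ PiStar) :
    0 < s - β ^ 2 ∧ s - β ^ 2 < β ^ 6 / √5 ∧ s - β ^ 2 < t ∧ t < β ^ 4 / √5 := by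
  rw [PiStar, convexHull_star, mem_interior_iff_mem_nhds, Metric.mem_nhds_iff] at h
  obtain ⟨ε, hε, hball⟩ := h
  have key : ∀ a b : ℝ, |a| < ε → |b| < ε → (s + a, t + b) ∈ starClosed := by
    intro a b ha hb
    refine hball ?_
    rw [Metric.mem_ball, Prod.dist_eq]
    simpa [Real.dist_eq] using ⟨ha, hb⟩
  have h0 : |(0 : ℝ)| < ε := by simpa using hε
  have h1 : |ε / 2| < ε := by rw [abs_of_pos (by linarith)]; linarith
  have h2 : |-(ε / 2)| < ε := by rwa [abs_neg]
  have a1 := (key _ _ h2 h0).1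
  have a2 := (key _ _ h1 h0).2.1
  have a3 := (key _ _ h1 h0).2.2.1
  have a4 := (key _ _ h0 h1).2.2.2
  simp only at a1 a2 a3 a4
  refine ⟨?_, ?_, ?_, ?_⟩ <;> linarith

theorem val_b6 : (ZW.mk (-29) 18).val / 5 = β ^ 6 / √5 := by
  have h5 : √5 * √5 = 5 := Real.mul_self_sqrt (by norm_num)
  have h6 : β ^ 6 = 13 - 8 * ω := by
    rw [show β ^ 6 = (β ^ 2) ^ 3 by ring, beta_sq, beta_eq]
    linear_combination (-ω + 5) * omega_sq
  have h0 : √5 ≠ 0 := sqrt5_pos.ne'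
  rw [eq_div_iff h0, h6, div_mul_eq_mul_div, div_eq_iff (by norm_num)]
  simp only [ZW.val, sqrt5_eq]; push_cast
  linear_combination 36 * omega_sq

theorem val_b4 : (ZW.mk (-11) 7).val / 5 = β ^ 4 / √5 := by
  have h5 : √5 * √5 = 5 := Real.mul_self_sqrt (by norm_num)
  have h6 : β ^ 4 = 5 - 3 * ω := by
    rw [show β ^ 4 = (β ^ 2) ^ 2 by ring, beta_sq, beta_eq]
    linear_combination omega_sq
  have h0 : √5 ≠ 0 := sqrt5_pos.ne'
  rw [eq_div_iff h0, h6, div_mul_eq_mul_div, div_eq_iff (by norm_num)]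
  simp only [ZW.val, sqrt5_eq]; push_cast
  linear_combination 14 * omega_sq

theorem star_rep {s t : ℝ} (h : (s, t) ∈ PiStar) :
    ∃ w, starV.Rep w (s - β ^ 2) t := by
  obtain ⟨h1, h2, h3, h4⟩ := piStar_strict h
  rw [← val_b6] at h2
  rw [← val_b4] at h4
  have hb := star_bounds.1
  rw [← val_b6] at hb
  unfold starV Verts.Rep
  simp only [val_zero]
  generalize (ZW.mk (-29) 18).val = b at *
  generalize (ZW.mk (-11) 7).val = c at *
  generalize s - β ^ 2 = p at *
  have hc : 0 < c - 5 * p := by linarith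
  have hb' : 0 < b := by linarith
  have hx0 : 0 < 5 * p / b := by positivity
  have hx1 : 0 < 1 - 5 * p / b := by rw [sub_pos, div_lt_one hb']; linarith
  have hy0 : 0 < (5 * t - 5 * p) / (c - 5 * p) := div_pos (by linarith) hc
  have hy1 : 0 < 1 - (5 * t - 5 * p) / (c - 5 * p) := by
    rw [sub_pos, div_lt_one hc]; linarith
  have hxb : 5 * p / b * b = 5 * p := div_mul_cancel₀ _ hb'.ne'
  have hyc : (5 * t - 5 * p) / (c - 5 * p) * (c - 5 * p) = 5 * t - 5 * p :=
    div_mul_cancel₀ _ hc.ne'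
  generalize 5 * p / b = x at *
  generalize (5 * t - 5 * p) / (c - 5 * p) = y at *
  -- Bilinear weights: `x` is the position between the vertical sides, `y` the relative height in
  -- the vertical chord, whose length before division by five is `c - 5 * p`.
  refine ⟨⟨(1 - x) * (1 - y) / 5, x * (1 - y) / 5, x * y / 5, (1 - x) * y / 5,
    by positivity, by positivity, by positivity, by positivity⟩, ?_, ?_, ?_⟩
  · ring
  · simp only; linear_combination hxb / 5
  · simp only; linear_combination hxb * (1 - y) / 5 + hyc / 5

/-! ### Non-degenerate tiles -/

def closedAt (v : Vec × Vec) (e : DEdge Vec) : Bool :=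
  ((conOf e).c + -(Vec.smul (sdZ (conOf e).j).1 v.1 + Vec.smul (sdZ (conOf e).j).2 v.2)).nonneg

def formV (m : Fin 5) (v : Vec × Vec) : Vec :=
  Vec.smul (sdZ (jOut m)).1 v.1 + Vec.smul (sdZ (jOut m)).2 v.2

def posV (c : Vec) : Bool := c.nonneg && c.somePos

def differ (v v' : Vec × Vec) : Bool :=
  posV (v.1 + -v'.1) || posV (v'.1 + -v.1) || posV (v.2 + -v'.2) || posV (v'.2 + -v.2)

/-- An edge has non-zero length if two different corners on its line belong to the closed tile. For
parallel lines `corner` has no meaning, but the candidate still has to lie on the line and in the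
closed tile, so the test is sound. -/
def chkEdge (T : List (DEdge Vec)) (e : DEdge Vec) : Bool :=
  T.any fun f => let x := corner e f
    decide (formV e.m x = e.b) && T.all (closedAt x) && T.any fun g => let y := corner e g
      differ x y && decide (formV e.m y = e.b) && T.all (closedAt y)

theorem ev_formV (w : Wt) (m : Fin 5) (v : Vec × Vec) : (formV m v).ev w = form m (evP w v) := by
  simp [formV, form_eq_sform, sform, evP]

theorem holdsClosed_of_closedAt {w : Wt} {v : Vec × Vec} {e : DEdge Vec}
    (h : closedAt v e = true) : Edge.HoldsClosed ⟨e.m, e.inc, e.b.ev w⟩ (evP w v) := by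
  have h0 := Vec.ev_nonneg w h
  have h1 : sform (conOf e).j (evP w v) = (sdZ (conOf e).j).1.val * v.1.ev w +
    (sdZ (conOf e).j).2.val * v.2.ev w := rfl
  rw [Vec.ev_add, Vec.ev_neg, Vec.ev_add, Vec.ev_smul, Vec.ev_smul, ← h1] at h0
  unfold Edge.HoldsClosed
  unfold conOf at h0
  cases hi : e.inc
  · rw [hi] at h0
    simp only [Bool.false_eq_true, if_false] at h0 ⊢
    rw [form_eq_sform]; linarith
  · rw [hi] at h0
    simp only [if_true, Vec.ev_neg] at h0 ⊢
    rw [← neg_form_eq_sform] at h0; linarith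

theorem differ_spec {w : Wt} {v v' : Vec × Vec} (h : differ v v' = true) :
    evP w v ≠ evP w v' := by
  have key : ∀ c d : Vec, posV (c + -d) = true → c.ev w ≠ d.ev w := by
    intro c d hc
    unfold posV at hc
    rw [Bool.and_eq_true] at hc
    have := Vec.ev_pos w hc.1 hc.2
    rw [Vec.ev_add, Vec.ev_neg] at this
    intro e; linarith
  intro e
  have e1 : v.1.ev w = v'.1.ev w := congrArg Prod.fst e
  have e2 : v.2.ev w = v'.2.ev w := congrArg Prod.snd e
  simp only [differ, Bool.or_eq_true] at h
  rcases h with ((h | h) | h) | h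
  · exact key _ _ h e1
  · exact key _ _ h e1.symm
  · exact key _ _ h e2
  · exact key _ _ h e2.symm

theorem nondegenerate_of_chkEdge {w : Wt} {T : List (DEdge Vec)}
    (h : T.all (chkEdge T) = true) : (realTile (Vec.ev w) T).Nondegenerate := by
  rw [List.all_eq_true] at h
  intro e he
  obtain ⟨e, he₁, rfl⟩ := List.mem_map.1 he
  have h := h e he₁
  simp only [chkEdge, List.any_eq_true, Bool.and_eq_true, decide_eq_true_iff,
    List.all_eq_true] at h
  obtain ⟨f, -, ⟨hf1, hf2⟩, g, -, ⟨hd, hg1⟩, hg2⟩ := h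
  have key : ∀ v : Vec × Vec, formV e.m v = e.b → (∀ x ∈ T, closedAt v x = true) →
      evP w v ∈ {x ∈ (realTile (Vec.ev w) T).closedRegion | form e.m x = e.b.ev w} := by
    intro v h1 h2
    refine ⟨fun e' he' => ?_, by rw [← ev_formV, h1]⟩
    obtain ⟨e', he₂, rfl⟩ := List.mem_map.1 he'
    exact holdsClosed_of_closedAt (h2 _ he₂)
  exact ⟨_, key _ hf1 hf2, _, key _ hg1 hg2, differ_spec hd⟩

/-! ### Regular pentagons -/

def chkPent (T : List (DEdge Vec)) (c : Vec × Vec) (inc : Bool) (r : Vec) : Bool :=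
  let b := fun m : Fin 5 => if inc then formV m c + -r else formV m c + r
  posV r && T.all (fun e => decide (e.inc = inc) && decide (e.b = b e.m)) &&
    (List.finRange 5).all fun m => T.any fun e => decide (e.m = m)

theorem isRegularPentagon_of_chkPent {w : Wt} {T : List (DEdge Vec)} {c : Vec × Vec} {inc : Bool}
    {r : Vec} (h : chkPent T c inc r = true) : (realTile (Vec.ev w) T).IsRegularPentagon := by
  simp only [chkPent, posV, Bool.and_eq_true, decide_eq_true_iff, List.all_eq_true,
    List.any_eq_true] at h
  obtain ⟨⟨⟨h1, h2⟩, h3⟩, h4⟩ := h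
  refine ⟨evP w c, r.ev w, if inc then -1 else 1, Vec.ev_pos w h1 h2, by cases inc <;> simp, ?_⟩
  have key : ∀ e ∈ T, ∀ x, Edge.HoldsClosed ⟨e.m, e.inc, e.b.ev w⟩ x ↔
      (if inc then -1 else 1 : ℝ) * (form e.m x - form e.m (evP w c)) ≤ r.ev w := by
    intro e he x
    unfold Edge.HoldsClosed
    simp only [(h3 e he).1, (h3 e he).2]
    cases inc
    · simp [ev_formV, add_comm]
    · simp only [if_true, Vec.ev_add, Vec.ev_neg, ev_formV]
      constructor <;> intro h <;> linarith
  ext x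
  simp only [Tile.closedRegion, realTile, List.mem_map, Set.mem_ofPred_eq]
  constructor
  · intro hx m
    obtain ⟨e, he, rfl⟩ := h4 m (List.mem_finRange m)
    exact (key e he x).1 (hx _ ⟨e, he, rfl⟩)
  · rintro hx _ ⟨e, he, rfl⟩
    exact (key e he x).2 (hx e.m)

/-! ### Finite verification -/

theorem edges_rhombus : (List.finRange 4).all (fun i =>
    ((vecDom starV rhombusD).tile i).all (chkEdge ((vecDom starV rhombusD).tile i))) = true := by
  decide +kernel

theorem edges_return : (List.finRange 8).all (fun i =>
    ((vecDom starV returnD).tile i).all (chkEdge ((vecDom starV returnD).tile i))) = true := by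
  decide +kernel

theorem edges₁ : (List.finRange 3).all (fun i =>
    ((vecDom starV (sim₁.dom (baseD tauA₁))).tile i).all
      (chkEdge ((vecDom starV (sim₁.dom (baseD tauA₁))).tile i))) = true := by
  decide +kernel

theorem edges₂ : (List.finRange 3).all (fun i =>
    ((vecDom starV (sim₂.dom (baseD tauA₂))).tile i).all
      (chkEdge ((vecDom starV (sim₂.dom (baseD tauA₂))).tile i))) = true := by
  decide +kernel

theorem edges₃ : (List.finRange 4).all (fun i =>
    ((vecDom starV thirdD).tile i).all (chkEdge ((vecDom starV thirdD).tile i))) = true := by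
  decide +kernel

theorem edges_per : (List.finRange 7).all (fun i =>
    (vecTile starV (perD i)).all (chkEdge (vecTile starV (perD i)))) = true := by
  decide +kernel

/-- The inradius of a pentagon with a given centre. -/
def inradius (T : List (DEdge Vec)) (c : Vec × Vec) : Vec := match T with
  | e :: _ => if e.inc then formV e.m c + -e.b else e.b + -formV e.m c
  | [] => c.1

/-- The first pentagon excludes all its edges and the other four include them, whence the flag `i ≠
0`. -/
theorem pentagons : (List.finRange 7).all (fun i => decide (5 ≤ i.val) ||
    chkPent (vecTile starV (perD i)) (perWit starV i) (decide (i ≠ 0))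
      (inradius (vecTile starV (perD i)) (perWit starV i))) = true := by
  decide +kernel

/-- The second and the fourth atom carry the same isometry and together make up the middle atom of a
base triangle. -/
def mergeIdx : Fin 4 → Fin 3 := ![0, 1, 2, 1]

theorem merge_dom : chkDom (vecDom starV (sim₃.dom (baseD tauA₃)))
    (cons (vecTile starV (sim₃.tile (triD tauA₃)))) = true := by
  decide +kernel

theorem merge_tiles : (List.finRange 4).all (fun i =>
    sub (cons ((vecDom starV thirdD).tile i))
      (cons ((vecDom starV (sim₃.dom (baseD tauA₃))).tile (mergeIdx i))) &&
    decide ((vecDom starV thirdD).iso i = (vecDom starV (sim₃.dom (baseD tauA₃))).iso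
      (mergeIdx i))) = true := by
  decide +kernel

/-! ### The parametric dressed domains -/

noncomputable def mapF (s t : ℝ) : DressedDomain 8 := returnD.real (Aff.eval (s - β ^ 2) t)
noncomputable def mapF₁ (s t : ℝ) : DressedDomain 3 :=
  (sim₁.dom (baseD tauA₁)).real (Aff.eval (s - β ^ 2) t)
noncomputable def mapF₂ (s t : ℝ) : DressedDomain 3 :=
  (sim₂.dom (baseD tauA₂)).real (Aff.eval (s - β ^ 2) t)
noncomputable def mapF₃ (s t : ℝ) : DressedDomain 4 := thirdD.real (Aff.eval (s - β ^ 2) t)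
noncomputable def mapC₃ (s t : ℝ) : DressedDomain 3 :=
  (sim₃.dom (baseD tauA₃)).real (Aff.eval (s - β ^ 2) t)
noncomputable def tileP (i : Fin 7) (s t : ℝ) : Tile :=
  realTile (Aff.eval (s - β ^ 2) t) (perD i)

theorem val_mem_Q5 (x : ZW) : x.val ∈ Q5 := by
  refine ⟨x.a + x.b / 2, x.b / 2, ?_⟩
  rw [ZW.val, ω]; push_cast; ring

theorem Q5_add {x y : ℝ} (hx : x ∈ Q5) (hy : y ∈ Q5) : x + y ∈ Q5 := by
  obtain ⟨a, b, rfl⟩ := hx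
  obtain ⟨c, d, rfl⟩ := hy
  exact ⟨a + c, b + d, by push_cast; ring⟩

theorem Q5_neg {x : ℝ} (hx : x ∈ Q5) : -x ∈ Q5 := by
  obtain ⟨a, b, rfl⟩ := hx
  exact ⟨-a, -b, by push_cast; ring⟩

theorem Q5_mul {x y : ℝ} (hx : x ∈ Q5) (hy : y ∈ Q5) : x * y ∈ Q5 := by
  have h : √5 * √5 = 5 := Real.mul_self_sqrt (by norm_num)
  obtain ⟨a, b, rfl⟩ := hx
  obtain ⟨c, d, rfl⟩ := hy
  exact ⟨a * c + 5 * b * d, a * d + b * c, by push_cast; linear_combination (b * d : ℝ) * h⟩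

theorem Q5_ratCast (r : ℚ) : (r : ℝ) ∈ Q5 := ⟨r, 0, by simp⟩

theorem affineQ5_eval (a : Aff) : AffineQ5 fun s t => a.eval (s - β ^ 2) t := by
  have h5 : (1 / 5 : ℝ) ∈ Q5 := by
    have := Q5_ratCast (1 / 5)
    push_cast at this; exact this
  refine ⟨a.c0.val * (1 / 5) + -(a.c1.val * rB2.val),
    Q5_add (Q5_mul (val_mem_Q5 _) h5) (Q5_neg (Q5_mul (val_mem_Q5 _) (val_mem_Q5 _))),
    a.c1.val, val_mem_Q5 _, a.c2.val, val_mem_Q5 _, fun s t => ?_⟩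
  simp only [val_rB2, Aff.eval]; ring

theorem isParametricTile_real (T : List (DEdge Aff)) :
    IsParametricTile fun s t => realTile (Aff.eval (s - β ^ 2) t) T := by
  refine ⟨T.map fun e => (e.m, e.inc, fun s t => e.b.eval (s - β ^ 2) t), ?_, fun s t => ?_⟩
  · intro e he
    obtain ⟨e, -, rfl⟩ := List.mem_map.1 he
    exact affineQ5_eval e.b
  · simp [realTile, Function.comp_def]

theorem isParametric_real {n : ℕ} (X : DDom Aff n) :
    IsParametric fun s t => X.real (Aff.eval (s - β ^ 2) t) := fun i =>
  ⟨isParametricTile_real _, X.k i, _, _, affineQ5_eval (X.d i).1, affineQ5_eval (X.d i).2,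
    fun _ _ => rfl⟩

theorem tau₁_eq (p q : ℝ) : tauA₁.eval p q = ω ^ 6 * √5 * p := by
  have h : ω ^ 6 = 8 * ω + 5 := by
    linear_combination (ω ^ 4 + ω ^ 3 + 2 * ω ^ 2 + 3 * ω + 5) * omega_sq
  rw [h, sqrt5_eq]; simp only [tauA₁, Aff.eval, ZW.val]; push_cast
  linear_combination (-16 * p) * omega_sq

theorem tau₂_eq (p q : ℝ) : tauA₂.eval p q = ω ^ 4 * √5 * q := by
  have h : ω ^ 4 = 3 * ω + 2 := by linear_combination (ω ^ 2 + ω + 2) * omega_sq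
  rw [h, sqrt5_eq]; simp only [tauA₂, Aff.eval, ZW.val]; push_cast
  linear_combination (-6 * q) * omega_sq

theorem tau₃_eq (p q : ℝ) : tauA₃.eval p q = ω ^ 4 * √5 * p := by
  have h : ω ^ 4 = 3 * ω + 2 := by linear_combination (ω ^ 2 + ω + 2) * omega_sq
  rw [h, sqrt5_eq]; simp only [tauA₃, Aff.eval, ZW.val]; push_cast
  linear_combination (-6 * p) * omega_sq

theorem mapF₁_eq (s t : ℝ) : mapF₁ s t =
    (baseS false (ω ^ 6 * √5 * (s - β ^ 2))).sim (sim₁.real (s - β ^ 2) t) := by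
  rw [mapF₁, DSim.real_dom, real_baseD, tau₁_eq]; rfl

theorem mapF₂_eq (s t : ℝ) : mapF₂ s t =
    (baseS false (ω ^ 4 * √5 * t)).sim (sim₂.real (s - β ^ 2) t) := by
  rw [mapF₂, DSim.real_dom, real_baseD, tau₂_eq]; rfl

theorem mapC₃_eq (s t : ℝ) : mapC₃ s t =
    (baseS false (ω ^ 4 * √5 * (s - β ^ 2))).sim (sim₃.real (s - β ^ 2) t) := by
  rw [mapC₃, DSim.real_dom, real_baseD, tau₃_eq]; rfl

theorem real_rhombusD (s t : ℝ) : rhombusD.real (Aff.eval (s - β ^ 2) t) = rhombusβ s t := by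
  have hb := beta_eq
  have hb2 := beta_sq
  unfold DDom.real rhombusβ rhombus
  congr 1
  · funext i
    fin_cases i <;> simp [rhombusD, realTile, mkTile, Aff.eval, ZW.val] <;>
      (try constructor) <;> (try constructor) <;> linarith
  · funext i
    fin_cases i <;> simp [rhombusD, Aff.eval, ZW.val] <;> linarith

theorem real_rhombusTileD (s t : ℝ) :
    realTile (Aff.eval (s - β ^ 2) t) rhombusTileD = rhombusTile s t := by
  have hb := beta_eq
  have hb2 := beta_sq
  simp [rhombusTileD, rhombusTile, realTile, mkTile, Aff.eval, ZW.val]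
  refine ⟨?_, ?_, ?_⟩ <;> linarith

/-! ### Tilings -/

section tilings

variable {s t : ℝ} (h : (s, t) ∈ PiStar)
include h

theorem rhombus_tiled : (rhombusβ s t).AtomsDisjoint ∧
    (rhombusβ s t).domain = (rhombusTile s t).region := by
  obtain ⟨w, hw⟩ := star_rep h
  have := chkDom_spec chk_rhombus w
  rwa [hw.real, real_rhombusD, ← region_realTile, hw.realTile, real_rhombusTileD] at this

theorem rhombus_recursivelyTiles :
    RecursivelyTiles (rhombusβ s t) [⟨8, mapF s t, returnPath⟩] [] := by
  obtain ⟨w, hw⟩ := star_rep h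
  have hd := (rhombus_tiled h).1
  have e : (vecDom starV rhombusD).real (Vec.ev w) = rhombusβ s t := by
    rw [hw.real, real_rhombusD]
  rw [← e] at hd
  have := chkRT_spec (w := w) (Ys := [⟨8, vecDom starV returnD, returnPath,
    cons ((vecDom starV rhombusD).tile 0)⟩]) (Qs := []) hd
    (by simp [chkRT, chk_return, chk_rhombus_return])
  rw [e] at this
  change RecursivelyTiles _ [⟨8, (vecDom starV returnD).real (Vec.ev w), returnPath⟩] [] at this
  rwa [hw.real] at this

theorem mapF_domain : (mapF s t).domain = ((rhombusβ s t).tile 0).region := by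
  obtain ⟨w, hw⟩ := star_rep h
  have hc := chk_return
  rw [chkSub, Bool.and_eq_true] at hc
  have := (chkDom_spec hc.1 w).2
  change ((vecDom starV returnD).real (Vec.ev w)).domain = _ at this
  rw [hw.real, ← real_tile_region, hw.real, real_rhombusD] at this
  exact this

theorem mapF_disjoint : (mapF s t).AtomsDisjoint :=
  ((rhombus_recursivelyTiles h).1 _ (List.mem_singleton_self _)).1

theorem mapF_recursivelyTiles : RecursivelyTiles (mapF s t)
    [⟨3, mapF₁ s t, path₁⟩, ⟨3, mapF₂ s t, path₂⟩, ⟨4, mapF₃ s t, path₃⟩]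
    (List.ofFn fun i => ⟨tileP i s t, perPath i⟩) := by
  obtain ⟨w, hw⟩ := star_rep h
  have hd := mapF_disjoint h
  have e : (vecDom starV returnD).real (Vec.ev w) = mapF s t := hw.real _
  rw [← e] at hd
  have hper := chk_per
  rw [List.all_eq_true] at hper
  have := chkRT_spec (w := w) (Ys := [mkSub starV sim₁ (baseD tauA₁) (triD tauA₁) path₁,
    mkSub starV sim₂ (baseD tauA₂) (triD tauA₂) path₂, sub₃ starV])
    (Qs := List.ofFn (perV starV)) hd (by
      simp only [chkRT, Bool.and_eq_true, chk_return_tiles, List.all_eq_true, List.mem_ofFn]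
      refine ⟨⟨?_, ?_⟩, trivial⟩
      · intro Y hY
        simp only [List.mem_cons, List.not_mem_nil, or_false] at hY
        rcases hY with rfl | rfl | rfl
        exacts [chk₁, chk₂, chk₃]
      · rintro _ ⟨i, rfl⟩
        exact hper i (List.mem_finRange i))
  rw [e] at this
  convert this using 1
  · simp only [List.map_cons, List.map_nil]
    congr 1
    · change SubDomain.mk 3 _ path₁ = ⟨3, (vecDom starV _).real (Vec.ev w), path₁⟩
      rw [hw.real]; rfl
    congr 1
    · change SubDomain.mk 3 _ path₂ = ⟨3, (vecDom starV _).real (Vec.ev w), path₂⟩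
      rw [hw.real]; rfl
    congr 1
    · change SubDomain.mk 4 _ path₃ = ⟨4, (vecDom starV _).real (Vec.ev w), path₃⟩
      rw [hw.real]; rfl
  · rw [List.map_ofFn]
    congr 1
    funext i
    change PathTile.mk _ _ = ⟨realTile (Vec.ev w) (vecTile starV (perD i)), perPath i⟩
    rw [hw.realTile]; rfl

theorem rhombus_nondegenerate (i : Fin 4) : ((rhombusβ s t).tile i).Nondegenerate := by
  obtain ⟨w, hw⟩ := star_rep h
  have := List.all_eq_true.1 edges_rhombus i (List.mem_finRange i)
  have := nondegenerate_of_chkEdge (w := w) this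
  rw [← real_rhombusD, ← hw.real]; exact this

theorem mapF_nondegenerate (i : Fin 8) : ((mapF s t).tile i).Nondegenerate := by
  obtain ⟨w, hw⟩ := star_rep h
  have := List.all_eq_true.1 edges_return i (List.mem_finRange i)
  have := nondegenerate_of_chkEdge (w := w) this
  rw [mapF, ← hw.real]; exact this

theorem mapF₁_nondegenerate (i : Fin 3) : ((mapF₁ s t).tile i).Nondegenerate := by
  obtain ⟨w, hw⟩ := star_rep h
  have := List.all_eq_true.1 edges₁ i (List.mem_finRange i)
  have := nondegenerate_of_chkEdge (w := w) this
  rw [mapF₁, ← hw.real]; exact this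

theorem mapF₂_nondegenerate (i : Fin 3) : ((mapF₂ s t).tile i).Nondegenerate := by
  obtain ⟨w, hw⟩ := star_rep h
  have := List.all_eq_true.1 edges₂ i (List.mem_finRange i)
  have := nondegenerate_of_chkEdge (w := w) this
  rw [mapF₂, ← hw.real]; exact this

theorem mapF₃_nondegenerate (i : Fin 4) : ((mapF₃ s t).tile i).Nondegenerate := by
  obtain ⟨w, hw⟩ := star_rep h
  have := List.all_eq_true.1 edges₃ i (List.mem_finRange i)
  have := nondegenerate_of_chkEdge (w := w) this
  rw [mapF₃, ← hw.real]; exact this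

theorem tileP_nondegenerate (i : Fin 7) : (tileP i s t).Nondegenerate := by
  obtain ⟨w, hw⟩ := star_rep h
  have := List.all_eq_true.1 edges_per i (List.mem_finRange i)
  have := nondegenerate_of_chkEdge (w := w) this
  rw [tileP, ← hw.realTile]; exact this

theorem tileP_pentagon (i : Fin 7) (hi : i.val < 5) : (tileP i s t).IsRegularPentagon := by
  obtain ⟨w, hw⟩ := star_rep h
  have := List.all_eq_true.1 pentagons i (List.mem_finRange i)
  rw [Bool.or_eq_true, decide_eq_true_iff] at this
  rcases this with h' | h'
  · omega
  · rw [tileP, ← hw.realTile]; exact isRegularPentagon_of_chkPent h'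

theorem tileP_trapezoid : (tileP 5 s t).IsTrapezoid := by
  refine ⟨rfl, tileP_nondegenerate h 5, ?_⟩
  have : (tileP 5 s t).map Edge.m = [4, 0, 1, 0] := rfl
  rw [this]; rfl

theorem tileP_rhombus : (tileP 6 s t).IsRhombus := by
  obtain ⟨-, -, h3, -⟩ := piStar_strict h
  refine ⟨4, 0, -2 + ω - t, -t, t - (s - β ^ 2), by decide, by linarith, ?_⟩
  ext x
  simp [tileP, perD, perD6, realTile, Tile.closedRegion, Edge.HoldsClosed, Aff.eval, ZW.val]
  constructor
  · rintro ⟨h1, h2, h3, h4⟩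
    refine ⟨⟨?_, ?_⟩, ?_, ?_⟩ <;> linarith
  · rintro ⟨⟨h1, h2⟩, h3, h4⟩
    refine ⟨?_, ?_, ?_, ?_⟩ <;> linarith

theorem merger_mapC₃ : (mapC₃ s t).IsMerger (mapF₃ s t) := by
  obtain ⟨w, hw⟩ := star_rep h
  have h1 := chkDom_spec merge_dom w
  have hc := chk₃
  rw [chkSub, Bool.and_eq_true] at hc
  have h2 := (chkDom_spec hc.1 w).2
  change ((vecDom starV thirdD).real (Vec.ev w)).domain =
    reg w (cons (vecTile starV (sim₃.tile (triD tauA₃)))) at h2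
  have e1 : (vecDom starV thirdD).real (Vec.ev w) = mapF₃ s t := hw.real _
  have e2 : (vecDom starV (sim₃.dom (baseD tauA₃))).real (Vec.ev w) = mapC₃ s t := hw.real _
  rw [← e1, ← e2]
  refine ⟨h1.1, h1.2.trans h2.symm, fun i => ⟨mergeIdx i, ?_⟩⟩
  have := List.all_eq_true.1 merge_tiles i (List.mem_finRange i)
  rw [Bool.and_eq_true, decide_eq_true_iff] at this
  refine ⟨?_, fun x => ?_⟩
  · rw [real_tile_region, real_tile_region]; exact subset_of_sub this.1
  · rw [real_iso, real_iso, this.2]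

/-- In terms of shape parameters the sides of the quadrilateral bound τ₁ and τ₂ by 0 and 1. Since τ₁
= ω²τ₃, the third parameter stays below β², inside the first branch of `renorm`. -/
theorem tau_bounds : (0 < ω ^ 6 * √5 * (s - β ^ 2) ∧ ω ^ 6 * √5 * (s - β ^ 2) < 1) ∧
    (0 < ω ^ 4 * √5 * t ∧ ω ^ 4 * √5 * t < 1) ∧
    (0 < ω ^ 4 * √5 * (s - β ^ 2) ∧ ω ^ 4 * √5 * (s - β ^ 2) < β ^ 2) := by
  obtain ⟨h1, h2, h3, h4⟩ := piStar_strict h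
  have h5 := sqrt5_pos
  have hw : 0 < ω := by have := omega_gt_one; linarith
  have hb : ∀ n, β ^ n * ω ^ n = 1 := fun n => by rw [← mul_pow, beta_mul_omega, one_pow]
  rw [lt_div_iff₀ h5] at h2 h4
  have h0 : 0 < t := by linarith
  refine ⟨⟨by positivity, ?_⟩, ⟨by positivity, ?_⟩, by positivity, ?_⟩
  · have := mul_lt_mul_of_pos_left h2 (pow_pos hw 6)
    nlinarith [hb 6]
  · have := mul_lt_mul_of_pos_left h4 (pow_pos hw 4)
    nlinarith [hb 4]
  · have := mul_lt_mul_of_pos_left h2 (pow_pos hw 4)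
    have e : ω ^ 4 * β ^ 6 = β ^ 2 * (β ^ 4 * ω ^ 4) := by ring
    rw [e, hb 4] at this
    linarith

/-- The first branch of the renormalization multiplies the shape by ω², and ω²τ₃ = τ₁. -/
theorem induces_mapC₃ : ∃ Z : DressedDomain 3, Induces (mapC₃ s t) Z ∧
    ∃ η, IsSimilar η (baseTriangle (ω ^ 6 * √5 * (s - β ^ 2))) Z := by
  obtain ⟨-, -, h1, h2⟩ := tau_bounds h
  obtain ⟨S, Qs, -, hQ⟩ := tiles₁ false h1 h2
  have e : ω ^ 2 * (ω ^ 4 * √5 * (s - β ^ 2)) = ω ^ 6 * √5 * (s - β ^ 2) := by ring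
  rw [e] at hQ
  have := (induces_of_tiles hQ).sim (sim₃.real (s - β ^ 2) t)
  rw [← mapC₃_eq, sim_sim] at this
  exact ⟨_, this, _, isSimilar_sim _ _⟩

end tilings

/-! ### Bifurcation-free sets -/

theorem Tile.holdsClosed_sim (S : Sim) (e : Edge) (x : Plane) :
    Edge.HoldsClosed ⟨S.dirIdx e.m, e.included, S.η * e.b + form (S.dirIdx e.m) S.d⟩ (S.apply x) ↔
      e.HoldsClosed x := by
  unfold Edge.HoldsClosed
  simp only [Sim.form_apply]
  have := S.η_pos
  split_ifs
  · rw [add_le_add_iff_right, mul_le_mul_iff_right₀ this]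
  · rw [add_le_add_iff_right, mul_le_mul_iff_right₀ this]

theorem Tile.closedRegion_of_sim {S : Sim} {T : Tile} (h : (T.sim S).Nondegenerate)
    (hT : T ≠ []) : ∃ x, x ∈ T.closedRegion := by
  obtain ⟨e, he⟩ := List.exists_mem_of_ne_nil _ hT
  obtain ⟨x, hx, -⟩ := h _ (List.mem_map_of_mem he)
  refine ⟨S.inv x, fun e he => ?_⟩
  rw [← Tile.holdsClosed_sim S, S.apply_inv]
  exact hx.1 _ (List.mem_map_of_mem he)

/-- The first two edges of the atom give βy ≤ x ≤ 0, so the form of the third edge is non-negative,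
while it is at most ω(1 − τ). -/
theorem shape_le_one {S : Sim} {τ : ℝ}
    (h : (((baseS false τ).sim S).tile 0).Nondegenerate) : τ ≤ 1 := by
  obtain ⟨x, hx⟩ := Tile.closedRegion_of_sim h (by simp [baseS, baseTriangle, mkTile])
  simp [baseS, baseTriangle, mkTile, Tile.closedRegion, Edge.HoldsClosed, form, dir] at hx
  obtain ⟨h1, h2, h3⟩ := hx
  have hw := omega_gt_one
  have hb := beta_eq
  have hb2 := beta_sq
  have hb0 := beta_pos
  have : 0 ≤ ω * (1 - τ) := by nlinarith
  nlinarith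

/-- The first two edges of the atom bound u₄ = βu₀ − u₁ from above by ω² − τ, and the third bounds
it from below by ω² − ωτ; hence (ω − 1)τ ≥ 0. -/
theorem shape_nonneg {S : Sim} {τ : ℝ}
    (h : (((baseS false τ).sim S).tile 2).Nondegenerate) : 0 ≤ τ := by
  obtain ⟨x, hx⟩ := Tile.closedRegion_of_sim h (by simp [baseS, baseTriangle, mkTile])
  simp [baseS, baseTriangle, mkTile, Tile.closedRegion, Edge.HoldsClosed, form, dir] at hx
  obtain ⟨h1, h2, h3⟩ := hx
  have hw := omega_gt_one
  have hb0 := beta_pos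
  nlinarith [mul_nonneg hb0.le (neg_nonneg.2 h2)]

/-- The first and the third atom of the first sub-domain force 0 ≤ τ₁ ≤ 1, the first atom of the
second one forces τ₂ ≤ 1, and the periodic rhombus forces s − β² ≤ t. These are the sides of the
closed quadrilateral. The intersection is open, so it lies in the interior; conversely all
conditions hold on the open set `PiStar`. -/
theorem bifurcation_eq : bifurcationFreeSub mapF mapF₁ path₁ ∩ bifurcationFreeSub mapF mapF₂ path₂ ∩
    bifurcationFreeSub mapF mapF₃ path₃ ∩ (⋂ i, bifurcationFreeTile mapF (tileP i) (perPath i)) =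
      PiStar := by
  refine Set.Subset.antisymm ?_ ?_
  · refine interior_maximal ?_ (((isOpen_interior.inter isOpen_interior).inter
      isOpen_interior).inter (isOpen_iInter_of_finite fun _ => isOpen_interior))
    rw [convexHull_star]
    rintro ⟨s, t⟩ ⟨⟨⟨h1, h2⟩, -⟩, h4⟩
    have h1 := interior_subset h1
    have h2 := interior_subset h2
    have h4 := interior_subset (Set.mem_iInter.1 h4 6)
    have a0 := (h1 0).1
    have a2 := (h1 2).1
    have b0 := (h2 0).1
    simp only at a0 a2 b0
    rw [mapF₁_eq] at a0 a2
    rw [mapF₂_eq] at b0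
    have a0 := shape_le_one a0
    have a2 := shape_nonneg a2
    have b0 := shape_le_one b0
    obtain ⟨x, hx, -⟩ := h4.1 _ (List.mem_cons_self)
    have hx := hx.1
    simp [tileP, perD, perD6, realTile, Tile.closedRegion, Edge.HoldsClosed, Aff.eval,
      ZW.val] at hx
    have h5 := sqrt5_pos
    have hw : 0 < ω := by have := omega_gt_one; linarith
    have hb : ∀ n, β ^ n * ω ^ n = 1 := fun n => by rw [← mul_pow, beta_mul_omega, one_pow]
    refine ⟨?_, ?_, ?_, ?_⟩
    · simp only
      by_contra hn
      rw [not_le] at hn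
      have := mul_pos (mul_pos (pow_pos hw 6) h5) (neg_pos.2 hn)
      linarith
    · simp only
      rw [le_div_iff₀ h5]
      have := mul_le_mul_of_nonneg_left a0 (pow_nonneg beta_pos.le 6)
      have e : β ^ 6 * (ω ^ 6 * √5 * (s - β ^ 2)) = (β ^ 6 * ω ^ 6) * ((s - β ^ 2) * √5) := by
        ring
      rw [e, hb] at this
      linarith
    · simp only
      linarith [hx.2.1, hx.2.2.2]
    · simp only
      rw [le_div_iff₀ h5]
      have := mul_le_mul_of_nonneg_left b0 (pow_nonneg beta_pos.le 4)
      have e : β ^ 4 * (ω ^ 4 * √5 * t) = (β ^ 4 * ω ^ 4) * (t * √5) := by ring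
      rw [e, hb] at this
      linarith
  · refine Set.subset_inter (Set.subset_inter (Set.subset_inter ?_ ?_) ?_) ?_
    · refine interior_maximal ?_ isOpen_interior
      rintro ⟨s, t⟩ h j
      exact ⟨mapF₁_nondegenerate h j,
        (((mapF_recursivelyTiles h).1 ⟨3, mapF₁ s t, path₁⟩ (by simp)).2.2 j).1⟩
    · refine interior_maximal ?_ isOpen_interior
      rintro ⟨s, t⟩ h j
      exact ⟨mapF₂_nondegenerate h j,
        (((mapF_recursivelyTiles h).1 ⟨3, mapF₂ s t, path₂⟩ (by simp)).2.2 j).1⟩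
    · refine interior_maximal ?_ isOpen_interior
      rintro ⟨s, t⟩ h j
      exact ⟨mapF₃_nondegenerate h j,
        (((mapF_recursivelyTiles h).1 ⟨4, mapF₃ s t, path₃⟩ (by simp)).2.2 j).1⟩
    · refine Set.subset_iInter fun i => interior_maximal ?_ isOpen_interior
      rintro ⟨s, t⟩ h
      exact ⟨tileP_nondegenerate h i, ((mapF_recursivelyTiles h).2.1 ⟨tileP i s t, perPath i⟩
        (by rw [List.mem_ofFn]; exact ⟨i, rfl⟩)).2.2.1⟩

theorem piStar_subset_mapF : PiStar ⊆ bifurcationFreeSub rhombusβ mapF returnPath := by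
  refine interior_maximal ?_ isOpen_interior
  rintro ⟨s, t⟩ h j
  exact ⟨mapF_nondegenerate h j,
    (((rhombus_recursivelyTiles h).1 _ (List.mem_singleton_self _)).2.2 j).1⟩

theorem piStar_subset_rhombus : PiStar ⊆ bifurcationFree rhombusβ := by
  refine interior_maximal ?_ isOpen_interior
  rintro ⟨s, t⟩ h j
  exact rhombus_nondegenerate h j

/-! ### Arithmetic of the renormalization function -/

theorem sqrt5_mem_Q5 : √5 ∈ Q5 := ⟨0, 1, by simp⟩
theorem one_mem_Q5 : (1 : ℝ) ∈ Q5 := ⟨1, 0, by simp⟩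

theorem omega_mem_Q5 : ω ∈ Q5 := ⟨1 / 2, 1 / 2, by rw [ω]; push_cast; ring⟩
theorem beta_mem_Q5 : β ∈ Q5 := ⟨-1 / 2, 1 / 2, by rw [β]; push_cast; ring⟩

theorem Q5_pow {x : ℝ} (hx : x ∈ Q5) (n : ℕ) : x ^ n ∈ Q5 := by
  induction n with
  | zero => simpa using one_mem_Q5
  | succ n ih => rw [pow_succ]; exact Q5_mul ih hx

theorem Q5_sub {x y : ℝ} (hx : x ∈ Q5) (hy : y ∈ Q5) : x - y ∈ Q5 := by
  rw [sub_eq_add_neg]; exact Q5_add hx (Q5_neg hy)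

theorem Q5_inv {x : ℝ} (hx : x ∈ Q5) : x⁻¹ ∈ Q5 := by
  obtain ⟨a, b, rfl⟩ := hx
  have h5 : √5 * √5 = 5 := Real.mul_self_sqrt (by norm_num)
  by_cases h0 : (a : ℝ) + b * √5 = 0
  · rw [h0, inv_zero]; exact ⟨0, 0, by simp⟩
  -- If the conjugate vanishes, the number itself is rational. Treating this case avoids an appeal
  -- to the irrationality of √5.
  by_cases h1 : (a : ℝ) - b * √5 = 0
  · have : (a : ℝ) + b * √5 = ((2 * a : ℚ) : ℝ) := by push_cast; linarith
    rw [this, ← Rat.cast_inv]; exact Q5_ratCast _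
  · refine ⟨a / (a ^ 2 - 5 * b ^ 2), -b / (a ^ 2 - 5 * b ^ 2), ?_⟩
    have h2 : ((a : ℝ) ^ 2 - 5 * b ^ 2) = (a + b * √5) * (a - b * √5) := by
      linear_combination (b : ℝ) ^ 2 * h5
    push_cast
    rw [h2]; field_simp; ring

theorem Q5_mul_iff {x y : ℝ} (hx : x ∈ Q5) (h0 : x ≠ 0) : x * y ∈ Q5 ↔ y ∈ Q5 := by
  refine ⟨fun h => ?_, Q5_mul hx⟩
  have := Q5_mul (Q5_inv hx) h
  rwa [inv_mul_cancel_left₀ h0] at this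

theorem renorm_iterate_mem {τ : ℝ} (h0 : 0 ≤ τ) (h1 : τ < 1) (n : ℕ) :
    0 ≤ renorm^[n] τ ∧ renorm^[n] τ < 1 := by
  induction n with
  | zero => exact ⟨h0, h1⟩
  | succ n ih => rw [Function.iterate_succ_apply']; exact renorm_mem ih.1 ih.2

/-- The branches of `renorm`. -/
theorem renorm_cases {τ : ℝ} (_ : 0 ≤ τ) (h1 : τ < 1) :
    renorm τ = ω ^ 2 * τ ∨ renorm τ = ω ^ 3 * (β - τ) ∨ renorm τ = ω ^ 2 * (1 - τ) ∨
      (renorm τ = 0 ∧ (τ = β ^ 2 ∨ τ = β)) := by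
  unfold renorm
  split_ifs with a b c
  · simp
  · simp
  · simp
  · refine .inr (.inr (.inr ⟨rfl, ?_⟩))
    by_contra! hne
    have hb : β ^ 2 < τ := lt_of_le_of_ne (not_lt.1 a) hne.1.symm
    have hc : β ≤ τ := not_lt.1 fun h => b ⟨hb, h⟩
    exact c ⟨lt_of_le_of_ne hc hne.2.symm, h1⟩

/-- An iterate is a composition of affine branches with slopes ±ω² or −ω³, unless the orbit meets β²
or β. In that case the affine relation obtained so far can be solved for τ within the field. -/
theorem renorm_iterate_affine {τ : ℝ} (h0 : 0 ≤ τ) (h1 : τ < 1) (n : ℕ) :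
    τ ∈ Q5 ∨ ∃ a ∈ Q5, ∃ m ∈ Q5, renorm^[n] τ = a + m * τ ∧ 1 ≤ |m| ∧ (0 < n → 1 < |m|) := by
  have hw := omega_gt_one
  have hw0 : 0 < ω := by linarith
  have hQ := Q5_pow omega_mem_Q5
  have h2 : 1 < |ω ^ 2| := by rw [abs_of_pos (by positivity)]; exact one_lt_pow₀ hw (by norm_num)
  have h3 : 1 < |-ω ^ 3| := by
    rw [abs_neg, abs_of_pos (by positivity)]; exact one_lt_pow₀ hw (by norm_num)
  have h2' : 1 < |-ω ^ 2| := by rwa [abs_neg]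
  induction n with
  | zero => exact .inr ⟨0, ⟨0, 0, by simp⟩, 1, one_mem_Q5, by simp⟩
  | succ n ih =>
    obtain h | ⟨a, ha, m, hm, e, hm1, -⟩ := ih
    · exact .inl h
    have key : ∀ c d : ℝ, c ∈ Q5 → d ∈ Q5 → 1 < |c| →
        renorm^[n + 1] τ = d + c * renorm^[n] τ →
        ∃ a ∈ Q5, ∃ m ∈ Q5, renorm^[n + 1] τ = a + m * τ ∧ 1 ≤ |m| ∧ (0 < n + 1 → 1 < |m|) := by
      intro c d hc hd h1c hr
      have hlt : 1 < |c * m| := by rw [abs_mul]; nlinarith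
      exact ⟨d + c * a, Q5_add hd (Q5_mul hc ha), c * m, Q5_mul hc hm, by rw [hr, e]; ring, hlt.le,
        fun _ => hlt⟩
    obtain ⟨i0, i1⟩ := renorm_iterate_mem h0 h1 n
    rw [Function.iterate_succ_apply'] at key ⊢
    obtain h | h | h | ⟨-, h⟩ := renorm_cases i0 i1
    · exact .inr (key _ 0 (hQ 2) ⟨0, 0, by simp⟩ h2 (by rw [h]; ring))
    · exact .inr (key _ (ω ^ 3 * β) (Q5_neg (hQ 3)) (Q5_mul (hQ 3) beta_mem_Q5) h3 (by rw [h]; ring))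
    · exact .inr (key _ (ω ^ 2) (Q5_neg (hQ 2)) (hQ 2) h2' (by rw [h]; ring))
    · left
      have hm0 : m ≠ 0 := by rintro rfl; simp at hm1; linarith
      have hq : a + m * τ ∈ Q5 := by
        rw [← e]
        obtain h | h := h <;> rw [h]
        · exact Q5_pow beta_mem_Q5 2
        · exact beta_mem_Q5
      refine (Q5_mul_iff hm hm0).1 ?_
      simpa using Q5_sub hq ha

/-- A periodic value is the fixed point of an affine map over the field with slope different from
one, so it is in the field; τ is recovered from it by inverting another such map. -/
theorem mem_Q5_of_eventuallyPeriodic {τ : ℝ} (h0 : 0 ≤ τ) (h1 : τ < 1)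
    (h : EventuallyPeriodic renorm τ) : τ ∈ Q5 := by
  obtain ⟨k, l, hkl, e⟩ := h
  obtain ⟨n, rfl⟩ := Nat.exists_eq_add_of_lt hkl
  obtain ⟨i0, i1⟩ := renorm_iterate_mem h0 h1 k
  have hk : renorm^[k] τ ∈ Q5 := by
    obtain h | ⟨a, ha, m, hm, e', -, hm1⟩ := renorm_iterate_affine i0 i1 (n + 1)
    · exact h
    rw [← Function.iterate_add_apply, show n + 1 + k = k + n + 1 by ring, ← e] at e'
    have hm0 : 1 - m ≠ 0 := by
      intro h
      have : m = 1 := by linarith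
      rw [this] at hm1; simp at hm1
    refine (Q5_mul_iff (Q5_sub one_mem_Q5 hm) hm0).1 ?_
    convert ha using 1; linarith
  obtain h | ⟨a, ha, m, hm, e', hm1, -⟩ := renorm_iterate_affine h0 h1 k
  · exact h
  have hm0 : m ≠ 0 := by rintro rfl; simp at hm1; linarith
  refine (Q5_mul_iff hm hm0).1 ?_
  have := Q5_sub hk ha
  rw [e'] at this
  simpa using this

/-- The numbers in `[0, 1)` of the form `(a + b ω) / N` whose conjugate is at most `C / N`. -/
def boundedQ5 (N : ℕ) (C : ℝ) : Set ℝ :=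
  {x | 0 ≤ x ∧ x < 1 ∧ ∃ a b : ℤ, N * x = a + b * ω ∧ |(a : ℝ) + b * (1 - ω)| ≤ C}

/-- The numerator and its conjugate are both bounded. Their difference is b√5, which bounds b and
then a. -/
theorem boundedQ5_finite {N : ℕ} (hN : 0 < N) (C : ℝ) : (boundedQ5 N C).Finite := by
  have hN' : (0 : ℝ) < N := by exact_mod_cast hN
  obtain ⟨M, hM⟩ := exists_nat_gt (3 * (N + C))
  refine Set.Finite.subset (((Set.finite_Icc (-(M : ℤ)) M).prod (Set.finite_Icc (-(M : ℤ)) M)).image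
    fun q : ℤ × ℤ => ((q.1 : ℝ) + q.2 * ω) / N) ?_
  rintro x ⟨h0, h1, a, b, e, hc⟩
  have hw := omega_gt_one
  have hw2 := omega_sq
  have hwlt : ω < 2 := by nlinarith
  have hx0 : 0 ≤ (a : ℝ) + b * ω := by rw [← e]; positivity
  have hx1 : (a : ℝ) + b * ω ≤ N := by rw [← e]; nlinarith
  rw [abs_le] at hc
  have hb : |(b : ℝ)| ≤ N + C := by
    rw [abs_le]; constructor <;> by_contra! hh <;> nlinarith
  have ha : |(a : ℝ)| ≤ 3 * (N + C) := by
    rw [abs_le] at hb ⊢; constructor <;> nlinarith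
  rw [abs_le] at ha hb
  have hNC : (N : ℝ) + C ≤ 3 * (N + C) := by linarith
  refine ⟨(a, b), ⟨⟨?_, ?_⟩, ?_, ?_⟩, ?_⟩
  · exact_mod_cast (by push_cast; linarith : ((-(M : ℤ) : ℤ) : ℝ) ≤ a)
  · exact_mod_cast (by push_cast; linarith : (a : ℝ) ≤ ((M : ℤ) : ℝ))
  · exact_mod_cast (by push_cast; linarith : ((-(M : ℤ) : ℤ) : ℝ) ≤ b)
  · exact_mod_cast (by push_cast; linarith : (b : ℝ) ≤ ((M : ℤ) : ℝ))
  · simp only [← e]; field_simp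

/-- On conjugates the branches act with slopes 2 − ω and 3 − 2ω up to sign, of modulus at most 1/2
and 1/4. The constant terms are absorbed because N ≤ C. -/
theorem renorm_mem_boundedQ5 {N : ℕ} {C : ℝ} (hC : N ≤ C) {x : ℝ} (hx : x ∈ boundedQ5 N C) :
    renorm x ∈ boundedQ5 N C := by
  obtain ⟨h0, h1, a, b, e, hc⟩ := hx
  obtain ⟨i0, i1⟩ := renorm_mem h0 h1
  refine ⟨i0, i1, ?_⟩
  have hw := omega_gt_one
  have hw2 := omega_sq
  have hwlt : ω < 1.62 := by nlinarith
  have hwgt : 1.6 < ω := by nlinarith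
  have hbt := beta_eq
  have hN : (0 : ℝ) ≤ N := by positivity
  have hw3 : ω ^ 3 = 2 * ω + 1 := by linear_combination (ω + 1) * omega_sq
  set y := (a : ℝ) + b * (1 - ω) with hy
  have hsc : ∀ k z c : ℝ, |k| ≤ c → c * |z| ≤ C → |k * z| ≤ C := by
    intro k z c hk hz
    rw [abs_mul]
    exact (mul_le_mul_of_nonneg_right hk (abs_nonneg _)).trans hz
  have hyl := abs_le.1 hc
  have k2 : |2 - ω| ≤ 1 / 2 := by rw [abs_le]; constructor <;> linarith
  have k3 : |3 - 2 * ω| ≤ 1 / 4 := by rw [abs_le]; constructor <;> linarith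
  obtain h | h | h | ⟨h, -⟩ := renorm_cases h0 h1
  · refine ⟨a + b, a + 2 * b, ?_, ?_⟩
    · rw [h]; push_cast; linear_combination ω ^ 2 * e + (a + b * (ω + 1)) * hw2
    · convert hsc (2 - ω) y _ k2 (by linarith) using 2
      push_cast; rw [hy]; linear_combination -(b : ℝ) * hw2
  · refine ⟨N - a - 2 * b, N - 2 * a - 3 * b, ?_, ?_⟩
    · rw [h, hbt, hw3]; push_cast
      linear_combination -(2 * ω + 1) * e + (2 * N - 2 * b) * hw2
    -- The conjugate of β is −ω.
    · convert hsc (3 - 2 * ω) (-ω * N - y) _ k3 ?_ using 2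
      · push_cast; rw [hy]; linear_combination (2 * b - 2 * N : ℝ) * hw2
      · have hz : |-ω * N - y| ≤ 2 * N + C := by
          rw [abs_le]; constructor <;> nlinarith
        linarith
  · refine ⟨N - a - b, N - a - 2 * b, ?_, ?_⟩
    · rw [h]; push_cast; linear_combination -ω ^ 2 * e + (N - a - b * (ω + 1)) * hw2
    · convert hsc (2 - ω) (N - y) _ k2 ?_ using 2
      · push_cast; rw [hy]; linear_combination (b : ℝ) * hw2
      · have hz : |N - y| ≤ N + C := by rw [abs_le]; constructor <;> linarith
        linarith
  · exact ⟨0, 0, by rw [h]; simp, by simp; linarith⟩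

theorem eventuallyPeriodic_of_mem_Q5 {τ : ℝ} (h0 : 0 ≤ τ) (h1 : τ < 1) (h : τ ∈ Q5) :
    EventuallyPeriodic renorm τ := by
  obtain ⟨x, y, rfl⟩ := h
  set N : ℕ := x.den * y.den with hN
  have hNpos : 0 < N := Nat.mul_pos x.den_pos y.den_pos
  have hx : (x : ℝ) * x.den = x.num := by exact_mod_cast x.mul_den_eq_num
  have hy : (y : ℝ) * y.den = y.num := by exact_mod_cast y.mul_den_eq_num
  -- With √5 = 2ω − 1 the number is (x − y) + 2yω; both coefficients are multiplied by `N`.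
  set a : ℤ := x.num * y.den - y.num * x.den
  set b : ℤ := 2 * y.num * x.den
  set C : ℝ := max N |(a : ℝ) + b * (1 - ω)|
  have hmem : ∀ n, renorm^[n] (x + y * √5) ∈ boundedQ5 N C := by
    intro n
    induction n with
    | zero =>
      refine ⟨h0, h1, a, b, ?_, le_max_right _ _⟩
      simp only [Function.iterate_zero, id, a, b, hN, sqrt5_eq]; push_cast; rw [← hx, ← hy]; ring
    | succ n ih =>
      rw [Function.iterate_succ_apply']
      exact renorm_mem_boundedQ5 (le_max_left _ _) ih
  obtain ⟨k, l, hkl, e⟩ := (boundedQ5_finite hNpos C).exists_lt_map_eq_of_forall_mem hmem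
  exact ⟨k, l, hkl, e⟩

theorem eventuallyPeriodic_iff {τ : ℝ} (h0 : 0 ≤ τ) (h1 : τ < 1) :
    EventuallyPeriodic renorm τ ↔ τ ∈ Q5 :=
  ⟨mem_Q5_of_eventuallyPeriodic h0 h1, eventuallyPeriodic_of_mem_Q5 h0 h1⟩

/-! ### First returns -/

namespace SubDomain.IsInduced

variable {n : ℕ} {X : DressedDomain n} {Y : SubDomain n}

theorem map_eq (h : Y.IsInduced X) {j : Fin Y.m} {y : Plane} (hy : y ∈ (Y.dd.tile j).region) :
    Y.dd.map y = X.map^[(Y.path j).length] y := by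
  rw [map_of_mem h.1 hy, ((h.2.2 j).2 y hy).2]

theorem map_mem (h : Y.IsInduced X) {y : Plane} (hy : y ∈ Y.dd.domain) :
    Y.dd.map y ∈ Y.dd.domain := by
  obtain ⟨j, hj⟩ := mem_iUnion.1 hy
  rw [h.map_eq hj]
  exact ((h.2.2 j).2 y hj).1.2.1

theorem iterate_mem (h : Y.IsInduced X) {y : Plane} (hy : y ∈ Y.dd.domain) (q : ℕ) :
    Y.dd.map^[q] y ∈ Y.dd.domain := by
  induction q with
  | zero => exact hy
  | succ q ih => rw [Function.iterate_succ_apply']; exact h.map_mem ih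

/-- Every point of the orbit of a point of the sub-domain lies on the return orbit of an iterate of
the return map. -/
theorem exists_floor (h : Y.IsInduced X) {y : Plane} (hy : y ∈ Y.dd.domain) (m : ℕ) :
    ∃ q k j, Y.dd.map^[q] y ∈ (Y.dd.tile j).region ∧ k < (Y.path j).length ∧
      X.map^[m] y = X.map^[k] (Y.dd.map^[q] y) ∧ (q = 0 → k = m) ∧
      ∀ c, (∀ j, c ≤ (Y.path j).length) → c * q + k ≤ m := by
  induction m with
  | zero =>
    obtain ⟨j, hj⟩ := mem_iUnion.1 hy
    exact ⟨0, 0, j, hj, ((h.2.2 j).2 y hj).1.1, rfl, fun _ => rfl, fun _ _ => by simp⟩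
  | succ m ih =>
    obtain ⟨q, k, j, hj, hk, e, h0, hc⟩ := ih
    rw [Function.iterate_succ_apply', e, ← Function.iterate_succ_apply' X.map]
    by_cases hk' : k + 1 < (Y.path j).length
    · exact ⟨q, k + 1, j, hj, hk', rfl, fun hq => by rw [h0 hq],
        fun c h => by have := hc c h; omega⟩
    · have hk1 : k + 1 = (Y.path j).length := by omega
      obtain ⟨j', hj'⟩ := mem_iUnion.1 (h.iterate_mem hy (q + 1))
      refine ⟨q + 1, 0, j', hj', ((h.2.2 j').2 _ hj').1.1, ?_, by simp, fun c hcl => ?_⟩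
      · rw [Function.iterate_succ_apply' Y.dd.map, h.map_eq hj, ← hk1]; rfl
      · have := hc c hcl
        have := hcl j
        rw [Nat.mul_succ]; omega

/-- The orbit of a point of the sub-domain comes back to the sub-domain infinitely often. -/
theorem exists_return (h : Y.IsInduced X) {y : Plane} (hy : y ∈ Y.dd.domain) (m : ℕ) :
    ∃ m' ≥ m, X.map^[m'] y ∈ Y.dd.domain := by
  obtain ⟨q, k, j, hj, hk, e, -⟩ := h.exists_floor hy m
  refine ⟨(Y.path j).length - k + m, Nat.le_add_left _ _, ?_⟩
  rw [Function.iterate_add_apply, e, ← Function.iterate_add_apply, Nat.sub_add_cancel hk.le]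
  exact ((h.2.2 j).2 _ hj).1.2.1

/-- A visit of the sub-domain is an iterate of the return map. -/
theorem exists_iterate (h : Y.IsInduced X) {y : Plane} (hy : y ∈ Y.dd.domain) {m : ℕ}
    (hm : X.map^[m] y ∈ Y.dd.domain) : ∃ q, X.map^[m] y = Y.dd.map^[q] y ∧ (q = 0 → m = 0) ∧
      ∀ c, (∀ j, c ≤ (Y.path j).length) → c * q ≤ m := by
  obtain ⟨q, k, j, hj, hk, e, h0, hc⟩ := h.exists_floor hy m
  obtain rfl : k = 0 := by
    by_contra hk0
    exact ((h.2.2 j).2 _ hj).1.2.2 k (by omega) hk (e ▸ hm)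
  exact ⟨q, e, fun hq => (h0 hq).symm, hc⟩

theorem iterate_eq (h : Y.IsInduced X) {y : Plane} (hy : y ∈ Y.dd.domain) (q : ℕ) :
    ∃ m ≥ q, Y.dd.map^[q] y = X.map^[m] y := by
  induction q with
  | zero => exact ⟨0, le_rfl, rfl⟩
  | succ q ih =>
    obtain ⟨m, hm, e⟩ := ih
    obtain ⟨j, hj⟩ := mem_iUnion.1 (h.iterate_mem hy q)
    refine ⟨(Y.path j).length + m, ?_, ?_⟩
    · have := ((h.2.2 j).2 _ hj).1.1
      omega
    · rw [Function.iterate_succ_apply', h.map_eq hj, e, Function.iterate_add_apply]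

/-- Return times are positive, so a positive number of returns takes positive time, and a positive
recurrence time in the sub-domain contains at least one return. -/
theorem periodic (h : Y.IsInduced X) {y : Plane} (hy : y ∈ Y.dd.domain) :
    y ∈ Function.periodicPts Y.dd.map ↔ y ∈ Function.periodicPts X.map := by
  constructor
  · rintro ⟨q, hq, e⟩
    obtain ⟨m, hm, e'⟩ := h.iterate_eq hy q
    exact ⟨m, by omega, e'.symm.trans e⟩
  · rintro ⟨m, hm, e⟩
    obtain ⟨q, e', h0, -⟩ := h.exists_iterate hy (m := m) (by rw [e.eq]; exact hy)
    exact ⟨q, Nat.pos_of_ne_zero fun hq => by have := h0 hq; omega, e'.symm.trans e⟩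

end SubDomain.IsInduced

theorem TiledByOrbits.exists_floor {f : Plane → Plane} {D : Set Plane} {L : List (Set Plane × ℕ)}
    (h : TiledByOrbits f D L) {z : Plane} (hz : z ∈ D) :
    ∃ c ∈ L, ∃ k < c.2, ∃ y ∈ c.1, f^[k] y = z := by
  obtain ⟨q, ⟨hq, y, hy, e⟩, -⟩ := h.2 z hz
  exact ⟨_, List.get_mem L q.1, q.2, hq, y, hy, e⟩

theorem TiledByOrbits.disjoint {f : Plane → Plane} {D : Set Plane} {A B : List (Set Plane × ℕ)}
    (h : TiledByOrbits f D (A ++ B)) {c c' : Set Plane × ℕ} (hc : c ∈ A) (hc' : c' ∈ B) {k k' : ℕ}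
    (hk : k < c.2) (hk' : k' < c'.2) {z : Plane} (hz : z ∈ f^[k] '' c.1) (hz' : z ∈ f^[k'] '' c'.1) :
    False := by
  obtain ⟨a, ha, rfl⟩ := List.getElem_of_mem hc
  obtain ⟨b, hb, rfl⟩ := List.getElem_of_mem hc'
  have hzD : z ∈ D := h.1 _ (List.mem_append_left _ hc) k hk hz
  have h1 : (A ++ B)[a]'(by simp; omega) = A[a] := List.getElem_append_left ha
  have h2 : (A ++ B)[A.length + b]'(by simp; omega) = B[b] := by
    rw [List.getElem_append_right (by omega)]; simp
  have := (h.2 z hzD).unique (y₁ := (⟨a, by simp; omega⟩, k)) (y₂ := (⟨A.length + b, by simp; omega⟩, k'))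
    (by simp only [List.get_eq_getElem, h1]; exact ⟨hk, hz⟩)
    (by simp only [List.get_eq_getElem, h2]; exact ⟨hk', hz'⟩)
  simp only [Prod.mk.injEq, Fin.mk.injEq] at this
  omega

theorem RecursivelyTiles.exists_floor {n : ℕ} {X : DressedDomain n} {Ys : List (SubDomain n)}
    {Qs : List (PathTile n)} (h : RecursivelyTiles X Ys Qs) {z : Plane} (hz : z ∈ X.domain) :
    (∃ Y ∈ Ys, ∃ y ∈ Y.dd.domain, ∃ k, X.map^[k] y = z) ∨
      ∃ Q ∈ Qs, ∃ y ∈ Q.tile.region, ∃ k, X.map^[k] y = z := by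
  obtain ⟨c, hc, k, -, y, hy, e⟩ := h.2.2.exists_floor hz
  simp only [List.mem_append, List.mem_flatMap, List.mem_map, List.mem_ofFn] at hc
  rcases hc with ⟨Y, hY, j, rfl⟩ | ⟨Q, hQ, rfl⟩
  · exact .inl ⟨Y, hY, y, mem_domain hy, k, e⟩
  · exact .inr ⟨Q, hQ, y, hy, k, e⟩

/-! ### Components of the exceptional set -/

/-- An iterate of a bijection is injective, so `f^[k]` can be cancelled from the periodicity
relation. -/
theorem mem_periodicPts_of_iterate {f : Plane → Plane} {D : Set Plane} (hf : Set.BijOn f D D)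
    {x : Plane} (hx : x ∈ D) {k : ℕ} (h : f^[k] x ∈ Function.periodicPts f) :
    x ∈ Function.periodicPts f := by
  obtain ⟨p, hp, e⟩ := h
  refine ⟨p, hp, ?_⟩
  have hk := hf.iterate k
  refine hk.injOn ((hf.iterate p).mapsTo hx) hx ?_
  rw [← Function.iterate_add_apply, add_comm, Function.iterate_add_apply]
  exact e

theorem iterate_mem_periodicPts {f : Plane → Plane} {x : Plane} (h : x ∈ Function.periodicPts f)
    (k : ℕ) : f^[k] x ∈ Function.periodicPts f := by
  obtain ⟨p, hp, e⟩ := h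
  refine ⟨p, hp, ?_⟩
  change f^[p] (f^[k] x) = f^[k] x
  rw [← Function.iterate_add_apply, add_comm, Function.iterate_add_apply, e.eq]

/-- A visit at time zero is lost when passing to the image; recurrence of `D` supplies a later one.
-/
theorem image_component {n : ℕ} {X : DressedDomain n} (hf : Set.BijOn X.map X.domain X.domain)
    {D : Set Plane} (hD : ∀ y ∈ D, ∀ m, ∃ m' ≥ m, X.map^[m'] y ∈ D) :
    X.map '' component X D = component X D := by
  ext z
  constructor
  · rintro ⟨x, ⟨⟨hx, hp⟩, k, hk⟩, rfl⟩
    refine ⟨⟨hf.mapsTo hx, fun h => hp (mem_periodicPts_of_iterate hf hx (k := 1) h)⟩, ?_⟩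
    obtain ⟨m, hm, h⟩ := hD _ hk 1
    refine ⟨m - 1 + k, ?_⟩
    rw [← Function.iterate_succ_apply, show (m - 1 + k).succ = m + k by omega,
      Function.iterate_add_apply]
    exact h
  · rintro ⟨⟨hz, hp⟩, k, hk⟩
    obtain ⟨x, hx, rfl⟩ := hf.surjOn hz
    exact ⟨x, ⟨⟨hx, fun h => hp (iterate_mem_periodicPts h 1)⟩, k + 1, hk⟩, rfl⟩

theorem exists_visit {n m : ℕ} {X : DressedDomain n} {F : DressedDomain m}
    {w : Fin m → List (Fin n)} (hF : SubDomain.IsInduced X ⟨m, F, w⟩) {Y : SubDomain m}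
    (hY : Y.IsInduced F) {y : Plane} (hy : y ∈ Y.dd.domain) (k : ℕ) :
    ∃ k' ≥ k, X.map^[k'] y ∈ Y.dd.domain := by
  obtain ⟨q, hq, h⟩ := hY.exists_return hy k
  obtain ⟨k', hk', e⟩ := hF.iterate_eq (hY.2.1 hy) q
  exact ⟨k', hq.trans hk', by rw [← e]; exact h⟩

/-- Going backwards, a point lies on the return orbit of a point of `F`, which in turn lies on the
return orbit of a sub-domain or on the orbit of a periodic tile. The latter is impossible off the
periodic points, and in the former case the base point returns to its sub-domain arbitrarily late,
hence after passing through the given point. -/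
theorem exceptionalSet_eq_iUnion {n m : ℕ} {X : DressedDomain n} {F : DressedDomain m}
    {w : Fin m → List (Fin n)} (hX : RecursivelyTiles X [⟨m, F, w⟩] []) {Ys : List (SubDomain m)}
    {Qs : List (PathTile m)} (hF : RecursivelyTiles F Ys Qs)
    (hQ : ∀ Q ∈ Qs, Q.tile.region ⊆ Function.periodicPts F.map) :
    exceptionalSet X = ⋃ Y ∈ Ys, component X Y.dd.domain := by
  have hI : SubDomain.IsInduced X ⟨m, F, w⟩ := hX.1 _ (List.mem_singleton_self _)
  refine Set.Subset.antisymm ?_ (iUnion₂_subset fun Y _ x hx => hx.1)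
  rintro z hz
  obtain ⟨Y', hY', x, hx, k, rfl⟩ | ⟨Q, hQ, -⟩ := hX.exists_floor hz.1
  swap
  · simp at hQ
  obtain rfl := List.mem_singleton.1 hY'
  change x ∈ F.domain at hx
  obtain ⟨Y, hY, y, hy, q, rfl⟩ | ⟨Q, hQ', y, hy, q, rfl⟩ := hF.exists_floor hx
  · obtain ⟨k₀, -, e⟩ := hI.iterate_eq ((hF.1 Y hY).2.1 hy) q
    obtain ⟨k', hk', h⟩ := exists_visit hI (hF.1 Y hY) hy (k + k₀)
    refine mem_iUnion₂.2 ⟨Y, hY, hz, k' - (k + k₀), ?_⟩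
    rw [show F.map^[q] y = X.map^[k₀] y from e, ← Function.iterate_add_apply,
      ← Function.iterate_add_apply, Nat.add_assoc, Nat.sub_add_cancel hk']
    exact h
  · refine absurd (iterate_mem_periodicPts ?_ k) hz.2
    exact (hI.periodic hx).1 (iterate_mem_periodicPts (hQ Q hQ' hy) q)

/-- If an orbit visited both, some later visit to `Y'` would be an `F`-iterate of a point of `Y`.
That point would lie on a return orbit of `Y` and at the base of one of `Y'`, against the exactness
of the tiling. -/
theorem component_disjoint {n m : ℕ} {X : DressedDomain n} {F : DressedDomain m}
    {w : Fin m → List (Fin n)} (hI : SubDomain.IsInduced X ⟨m, F, w⟩) {As Bs : List (SubDomain m)}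
    {Qs : List (PathTile m)} (hF : RecursivelyTiles F (As ++ Bs) Qs) {Y Y' : SubDomain m}
    (hY : Y ∈ As) (hY' : Y' ∈ Bs) :
    Disjoint (component X Y.dd.domain) (component X Y'.dd.domain) := by
  rw [Set.disjoint_left]
  rintro z ⟨-, a, ha⟩ ⟨-, b, hb⟩
  have hYi := hF.1 Y (List.mem_append_left _ hY)
  have hYi' := hF.1 Y' (List.mem_append_right _ hY')
  obtain ⟨b', hb', h⟩ := exists_visit hI hYi' hb a
  rw [← Function.iterate_add_apply, show b' + b = (b' + b - a) + a by omega,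
    Function.iterate_add_apply] at h
  obtain ⟨q, e, -⟩ := hI.exists_iterate (hYi.2.1 ha) (hYi'.2.1 h)
  rw [e] at h
  obtain ⟨p, k, j, hj, hk, e', -⟩ := hYi.exists_floor ha q
  obtain ⟨j', hj'⟩ := mem_iUnion.1 h
  have hT := hF.2.2
  rw [List.flatMap_append, List.append_assoc] at hT
  refine hT.disjoint (c := ((Y.dd.tile j).region, (Y.path j).length))
    (c' := ((Y'.dd.tile j').region, (Y'.path j').length)) ?_ ?_ hk
    ((hYi'.2.2 j').2 _ hj').1.1 ⟨_, hj, e'.symm⟩ ⟨_, hj', rfl⟩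
  · exact List.mem_flatMap.2 ⟨Y, hY, List.mem_ofFn.2 ⟨j, rfl⟩⟩
  · exact List.mem_append_left _ (List.mem_flatMap.2 ⟨Y', hY', List.mem_ofFn.2 ⟨j', rfl⟩⟩)

/-! ### The rhombus -/

theorem bij_rhombus : chkBij (vecDom starV rhombusD) (cons (vecTile starV rhombusTileD)) = true := by
  decide +kernel

/-- The fifth powers of the isometries of the periodic tiles are trivial. -/
theorem perPath_iso : ∀ i, (let g := pathIso (vecDom starV returnD) (perPath i)
    g.comp (g.comp (g.comp (g.comp g))) = DIso.id) := by
  decide +kernel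

theorem rhombus_bijOn {s t : ℝ} (h : (s, t) ∈ PiStar) :
    Set.BijOn (rhombusβ s t).map (rhombusβ s t).domain (rhombusβ s t).domain := by
  obtain ⟨w, hw⟩ := star_rep h
  have := chkBij_spec chk_rhombus bij_rhombus w
  rwa [hw.real, real_rhombusD] at this

/-- Periodicity of a tile is a statement about sets. The fifth power of its return isometry is the
identity, so each point of the tile is periodic as well. -/
theorem tileP_periodic {s t : ℝ} (h : (s, t) ∈ PiStar) (i : Fin 7) :
    (tileP i s t).region ⊆ Function.periodicPts (mapF s t).map := by
  obtain ⟨w, hw⟩ := star_rep h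
  have hd := mapF_disjoint h
  have e : (vecDom starV returnD).real (Vec.ev w) = mapF s t := hw.real _
  have hp : PathTile.IsPeriodic (mapF s t) ⟨tileP i s t, perPath i⟩ :=
    (mapF_recursivelyTiles h).2.1 _ (List.mem_ofFn.2 ⟨i, rfl⟩)
  have hc := List.all_eq_true.1 chk_per i (List.mem_finRange i)
  simp only [chkPer, Bool.and_eq_true] at hc
  have hs := pathIso_spec (w := w) (by rw [e]; exact hd) hc.1.1.1.2
  have hr : reg w (cons (perV starV i).tile) = (tileP i s t).region := by
    rw [tileP, ← hw.realTile, region_realTile]; rfl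
  rw [e, hr] at hs
  set f := (mapF s t).map^[(perPath i).length] with hf
  set g := pathIso (vecDom starV returnD) (perPath i)
  have hs' : ∀ x ∈ (tileP i s t).region, f x = (g.real w).apply x := hs
  have hmem : ∀ x ∈ (tileP i s t).region, f x ∈ (tileP i s t).region := fun x hx => by
    have := hp.2.2.2
    exact this ▸ mem_image_of_mem _ hx
  intro x hx
  refine ⟨5 * (perPath i).length, Nat.mul_pos (by norm_num) (List.length_pos_iff.2 hp.2.1), ?_⟩
  change (mapF s t).map^[5 * (perPath i).length] x = x
  rw [Nat.mul_comm, Function.iterate_mul, ← hf]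
  have h1 := hmem _ hx
  have h2 := hmem _ h1
  have h3 := hmem _ h2
  have h4 := hmem _ h3
  change f (f (f (f (f x)))) = x
  rw [hs' _ h4, hs' _ h3, hs' _ h2, hs' _ h1, hs' _ hx]
  simp only [← DIso.comp_apply]
  have := perPath_iso i
  simp only at this
  rw [this, DIso.id_apply]

theorem rhombus_components {s t : ℝ} (h : (s, t) ∈ PiStar) (E : Fin 3 → Set Plane)
    (hE : E = ![component (rhombusβ s t) (mapF₁ s t).domain,
      component (rhombusβ s t) (mapF₂ s t).domain, component (rhombusβ s t) (mapF₃ s t).domain]) :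
    (⋃ i, E i) = exceptionalSet (rhombusβ s t) ∧ Pairwise (fun i j => Disjoint (E i) (E j)) ∧
      ∀ i, (rhombusβ s t).map '' E i = E i := by
  have hX := rhombus_recursivelyTiles h
  have hF := mapF_recursivelyTiles h
  have hI : SubDomain.IsInduced (rhombusβ s t) ⟨8, mapF s t, returnPath⟩ :=
    hX.1 _ (List.mem_singleton_self _)
  have hb := rhombus_bijOn h
  subst hE
  refine ⟨?_, ?_, ?_⟩
  · rw [exceptionalSet_eq_iUnion hX hF fun Q hQ => by
      obtain ⟨i, rfl⟩ := List.mem_ofFn.1 hQ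
      exact tileP_periodic h i]
    ext x
    simp [Fin.exists_fin_succ]
  · have h12 := component_disjoint hI (As := [⟨3, mapF₁ s t, path₁⟩])
      (Bs := [⟨3, mapF₂ s t, path₂⟩, ⟨4, mapF₃ s t, path₃⟩]) hF (List.mem_singleton_self _)
      (List.mem_cons_self ..)
    have h13 := component_disjoint hI (As := [⟨3, mapF₁ s t, path₁⟩])
      (Bs := [⟨3, mapF₂ s t, path₂⟩, ⟨4, mapF₃ s t, path₃⟩]) hF (List.mem_singleton_self _)
      (List.mem_cons_of_mem _ (List.mem_singleton_self _))
    have h23 := component_disjoint hI (As := [⟨3, mapF₁ s t, path₁⟩, ⟨3, mapF₂ s t, path₂⟩])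
      (Bs := [⟨4, mapF₃ s t, path₃⟩]) hF (List.mem_cons_of_mem _ (List.mem_singleton_self _))
      (List.mem_singleton_self _)
    intro i j hij
    fin_cases i <;> fin_cases j <;> first | exact absurd rfl hij | assumption | exact h12.symm | exact h13.symm | exact h23.symm
  · have hv := fun Y hY => image_component (D := Y.dd.domain) hb fun y hy m => exists_visit hI (hF.1 Y hY) hy m
    intro i
    fin_cases i
    · exact hv ⟨3, mapF₁ s t, path₁⟩ (by simp)
    · exact hv ⟨3, mapF₂ s t, path₂⟩ (by simp)
    · exact hv ⟨4, mapF₃ s t, path₃⟩ (by simp)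

/-! ### Renormalizability -/

theorem selfSimilar_maps {s t : ℝ} (h : (s, t) ∈ PiStar) (hs : s ∈ Q5) (ht : t ∈ Q5) :
    SelfSimilar (mapF₁ s t) ∧ SelfSimilar (mapF₂ s t) ∧ SelfSimilar (mapC₃ s t) := by
  obtain ⟨⟨a1, b1⟩, ⟨a2, b2⟩, a3, b3'⟩ := tau_bounds h
  have b3 := b3'.trans (pow_lt_one₀ beta_pos.le beta_lt_one two_ne_zero)
  have hp := Q5_sub hs (Q5_pow beta_mem_Q5 2)
  have hq : ∀ k, ω ^ k * √5 ∈ Q5 := fun k => Q5_mul (Q5_pow omega_mem_Q5 k) sqrt5_mem_Q5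
  have key : ∀ τ, 0 < τ → τ < 1 → τ ∈ Q5 → ∀ S, SelfSimilar ((baseS false τ).sim S) :=
    fun τ h0 h1 hτ S => selfSimilar_base ⟨h0.le, h1, fun _ => rfl⟩
      (eventuallyPeriodic_of_mem_Q5 h0.le h1 hτ) S
  rw [mapF₁_eq, mapF₂_eq, mapC₃_eq]
  exact ⟨key _ a1 b1 (Q5_mul (hq 6) hp) _, key _ a2 b2 (Q5_mul (hq 4) ht) _,
    key _ a3 b3 (Q5_mul (hq 4) hp) _⟩

theorem renormalizable_maps {s t : ℝ} (h : (s, t) ∈ PiStar) (hs : s ∈ Q5) (ht : t ∈ Q5) :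
    Renormalizable (mapF s t) ∧ Renormalizable (rhombusβ s t) := by
  obtain ⟨h1, h2, h3⟩ := selfSimilar_maps h hs ht
  have hF : Renormalizable (mapF s t) := by
    refine .tiled _ _ _ (List.cons_ne_nil _ _) (mapF_recursivelyTiles h) fun Y hY => ?_
    simp only [List.mem_cons, List.not_mem_nil, or_false] at hY
    rcases hY with rfl | rfl | rfl
    · exact .selfSimilar _ h1
    · exact .selfSimilar _ h2
    · exact .merger _ _ (merger_mapC₃ h) (.selfSimilar _ h3)
  refine ⟨hF, .tiled _ _ _ (List.cons_ne_nil _ _) (rhombus_recursivelyTiles h) fun Y hY => ?_⟩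
  obtain rfl := List.mem_singleton.1 hY
  exact hF

theorem mem_Q5_iff {s t : ℝ} (h : (s, t) ∈ PiStar) : (s ∈ Q5 ∧ t ∈ Q5) ↔
    EventuallyPeriodic renorm (ω ^ 6 * √5 * (s - β ^ 2)) ∧
    EventuallyPeriodic renorm (ω ^ 4 * √5 * t) ∧
    EventuallyPeriodic renorm (ω ^ 4 * √5 * (s - β ^ 2)) := by
  obtain ⟨⟨a1, b1⟩, ⟨a2, b2⟩, a3, b3'⟩ := tau_bounds h
  have b3 := b3'.trans (pow_lt_one₀ beta_pos.le beta_lt_one two_ne_zero)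
  have hq : ∀ k, ω ^ k * √5 ∈ Q5 := fun k => Q5_mul (Q5_pow omega_mem_Q5 k) sqrt5_mem_Q5
  have h0 : ∀ k, ω ^ k * √5 ≠ 0 := fun k =>
    (mul_pos (pow_pos (one_pos.trans omega_gt_one) k) sqrt5_pos).ne'
  have hb := Q5_pow beta_mem_Q5 2
  have hs : s - β ^ 2 ∈ Q5 ↔ s ∈ Q5 :=
    ⟨fun h => by simpa using Q5_add h hb, fun h => Q5_sub h hb⟩
  rw [eventuallyPeriodic_iff a1.le b1, eventuallyPeriodic_iff a2.le b2,
    eventuallyPeriodic_iff a3.le b3, Q5_mul_iff (hq _) (h0 _), Q5_mul_iff (hq _) (h0 _),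
    Q5_mul_iff (hq _) (h0 _), hs]
  tauto

theorem isSimilar_maps (s t : ℝ) :
    (∃ η, IsSimilar η (baseTriangle (ω ^ 6 * √5 * (s - β ^ 2))) (mapF₁ s t)) ∧
    (∃ η, IsSimilar η (baseTriangle (ω ^ 4 * √5 * t)) (mapF₂ s t)) ∧
    ∃ η, IsSimilar η (baseTriangle (ω ^ 4 * √5 * (s - β ^ 2))) (mapC₃ s t) := by
  rw [mapF₁_eq, mapF₂_eq, mapC₃_eq]
  exact ⟨⟨_, isSimilar_sim _ _⟩, ⟨_, isSimilar_sim _ _⟩, _, isSimilar_sim _ _⟩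

theorem mapF₃_iso (s t : ℝ) : (mapF₃ s t).iso 1 = (mapF₃ s t).iso 3 := rfl

section

open Filter Topology ENNReal

/-! ### Random addresses -/

section addresses

variable {Ω : Type*}

/-- The sequence with first letter `a` and tail `ω`. -/
def consSeq (a : Ω) (ω : ℕ → Ω) (n : ℕ) : Ω := Nat.casesOn n a ω

theorem consSeq_mem_pi {a : Ω} {ω : ℕ → Ω} {N : ℕ} {t : ℕ → Set Ω} :
    consSeq a ω ∈ Set.pi (Finset.range (N + 1) : Set ℕ) t ↔
      a ∈ t 0 ∧ ω ∈ Set.pi (Finset.range N : Set ℕ) fun n => t (n + 1) := by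
  simp only [Set.mem_pi, Finset.coe_range, Set.mem_Iio]
  constructor
  · exact fun h => ⟨h 0 (by omega), fun n hn => h (n + 1) (by omega)⟩
  · rintro ⟨h0, h⟩ (_ | n) hn
    · exact h0
    · exact h n (by omega)

variable [MeasurableSpace Ω]

theorem measurable_consSeq : Measurable fun p : Ω × (ℕ → Ω) => consSeq p.1 p.2 := by
  rw [measurable_pi_iff]
  rintro (_ | n)
  · exact measurable_fst
  · exact (measurable_pi_apply n).comp measurable_snd

/-- A cylinder over any finite set of coordinates becomes one over an initial segment after
inserting full factors. -/
theorem eq_infinitePi_of_range (ρ : Measure Ω) [IsProbabilityMeasure ρ] {ν : Measure (ℕ → Ω)}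
    (h : ∀ N t, ν (Set.pi (Finset.range N : Set ℕ) t) = ∏ n ∈ Finset.range N, ρ (t n)) :
    ν = Measure.infinitePi fun _ => ρ := by
  classical
  refine Measure.eq_infinitePi _ fun s t _ => ?_
  obtain ⟨N, hN⟩ : ∃ N, s ⊆ Finset.range N := s.exists_nat_subset_range
  have e : Set.pi (s : Set ℕ) t =
      Set.pi (Finset.range N : Set ℕ) fun n => if n ∈ s then t n else univ := by
    ext ω
    simp only [Set.mem_pi, Finset.mem_coe]
    constructor
    · intro h n _
      split_ifs with hn
      · exact h n hn
      · trivial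
    · intro h n hn
      simpa [hn] using h n (hN hn)
  rw [e, h, ← Finset.prod_subset hN]
  · exact Finset.prod_congr rfl fun n hn => by rw [if_pos hn]
  · intro n _ hn
    rw [if_neg hn, measure_univ]

variable [Fintype Ω] [MeasurableSingletonClass Ω]

/-- A fresh independent letter in front of an i.i.d. sequence gives an i.i.d. sequence. -/
theorem map_consSeq (ρ : Measure Ω) [IsProbabilityMeasure ρ] :
    (ρ.prod (Measure.infinitePi fun _ : ℕ => ρ)).map (fun p => consSeq p.1 p.2) =
      Measure.infinitePi fun _ => ρ := by
  refine eq_infinitePi_of_range ρ fun N t => ?_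
  have hm : ∀ N (t : ℕ → Set Ω), MeasurableSet (Set.pi (Finset.range N : Set ℕ) t) := fun N t =>
    MeasurableSet.pi (Finset.countable_toSet _) fun _ _ => Set.Finite.measurableSet (Set.toFinite _)
  rw [Measure.map_apply measurable_consSeq (hm _ _)]
  cases N with
  | zero => simp
  | succ N =>
    have : (fun p : Ω × (ℕ → Ω) => consSeq p.1 p.2) ⁻¹' Set.pi (Finset.range (N + 1) : Set ℕ) t =
        t 0 ×ˢ Set.pi (Finset.range N : Set ℕ) fun n => t (n + 1) := by
      ext p; exact consSeq_mem_pi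
    rw [this, Measure.prod_prod, Measure.infinitePi_pi _ fun _ _ => Set.Finite.measurableSet (Set.toFinite _),
      Finset.prod_range_succ', mul_comm]

theorem infinitePi_apply_cons (ρ : Measure Ω) [IsProbabilityMeasure ρ] {S : Set (ℕ → Ω)}
    (hS : MeasurableSet S) : (Measure.infinitePi fun _ : ℕ => ρ) S =
      ∑ a, ρ {a} * (Measure.infinitePi fun _ : ℕ => ρ) {ω | consSeq a ω ∈ S} := by
  conv_lhs => rw [← map_consSeq ρ, Measure.map_apply measurable_consSeq hS,
    Measure.prod_apply (measurable_consSeq hS), lintegral_fintype]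
  refine Finset.sum_congr rfl fun a _ => ?_
  rw [mul_comm]; rfl

variable {ι Y : Type*} [MeasurableSpace Y] {σ : ι → Ω → ι} {φ : ι → Ω → Y → Y} 

/-- The approximations of the points with a given address. -/
def approx (σ : ι → Ω → ι) (φ : ι → Ω → Y → Y) (x : ι → Y) : ℕ → ι → (ℕ → Ω) → Y
  | 0, i, _ => x i
  | n + 1, i, ω => φ i (ω 0) (approx σ φ x n (σ i (ω 0)) fun k => ω (k + 1))

/-- The contraction is measured by `d`, which only has to dominate the metric. Successive
approximations differ by at most Cηⁿ, where C is the largest first displacement over the finitely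
many states and letters. -/
theorem exists_coding [Finite ι] [MetricSpace Y] [CompleteSpace Y] [BorelSpace Y]
    (hφ : ∀ i a, Continuous (φ i a)) {d : Y → Y → ℝ} {η : ℝ} (hη0 : 0 ≤ η)
    (hη : η < 1) (hd : ∀ x y, dist x y ≤ d x y) (hd' : ∀ i a x y, d (φ i a x) (φ i a y) ≤ η * d x y)
    {A : ι → Set Y} (hA : ∀ i, (A i).Nonempty) (hφA : ∀ i a, MapsTo (φ i a) (A (σ i a)) (A i)) :
    ∃ pt : ι → (ℕ → Ω) → Y, (∀ i, Measurable (pt i)) ∧ (∀ i ω, pt i ω ∈ closure (A i)) ∧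
      ∀ i a ω, pt i (consSeq a ω) = φ i a (pt (σ i a) ω) := by
  choose x hx using hA
  cases nonempty_fintype ι
  obtain ⟨C, hC⟩ := (Set.finite_range fun p : ι × Ω => d (x p.1) (φ p.1 p.2 (x (σ p.1 p.2)))).bddAbove
  have hstep : ∀ n i ω, d (approx σ φ x n i ω) (approx σ φ x (n + 1) i ω) ≤ C * η ^ n := by
    intro n
    induction n with
    | zero => intro i ω; simpa [approx] using hC ⟨(i, ω 0), rfl⟩
    | succ n ih =>
      intro i ω
      calc _ ≤ η * _ := hd' i (ω 0) _ _
        _ ≤ η * (C * η ^ n) := mul_le_mul_of_nonneg_left (ih _ _) hη0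
        _ = _ := by ring
  have hmem : ∀ n i ω, approx σ φ x n i ω ∈ A i := by
    intro n
    induction n with
    | zero => exact fun i _ => hx i
    | succ n ih => exact fun i ω => hφA i _ (ih _ _)
  have hmeas : ∀ n i, Measurable (approx σ φ x n i) := by
    intro n
    induction n with
    | zero => exact fun i => measurable_const
    | succ n ih =>
      intro i
      have : Measurable fun p : Ω × (ℕ → Ω) => φ i p.1 (approx σ φ x n (σ i p.1) p.2) :=
        -- The alphabet is finite, so measurability can be checked with the first letter fixed.
        measurable_from_prod_countable_right fun a => (hφ i a).measurable.comp (ih (σ i a))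
      have hs : Measurable fun ω : ℕ → Ω => (ω 0, fun k => ω (k + 1)) :=
        (measurable_pi_apply 0).prodMk (measurable_pi_iff.2 fun k => measurable_pi_apply (k + 1))
      exact this.comp hs
  have hlim : ∀ i ω, ∃ y, Tendsto (fun n => approx σ φ x n i ω) atTop (𝓝 y) := fun i ω =>
    cauchySeq_tendsto_of_complete (cauchySeq_of_le_geometric η C hη fun n =>
      (hd _ _).trans (hstep n i ω))
  choose pt hpt using hlim
  refine ⟨pt, fun i => ?_, fun i ω => ?_, fun i a ω => ?_⟩
  · exact measurable_of_tendsto_metrizable (hmeas · i) (tendsto_pi_nhds.2 (hpt i))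
  · exact mem_closure_of_tendsto (hpt i ω) (Eventually.of_forall fun n => hmem n i ω)
  · have h1 := (tendsto_add_atTop_iff_nat 1).2 (hpt i (consSeq a ω))
    exact tendsto_nhds_unique h1 (((hφ i a).tendsto _).comp (hpt (σ i a) ω))

variable {ρ : Measure Ω} [IsProbabilityMeasure ρ] {pt : ι → (ℕ → Ω) → Y}

/-- The law of the point with a random address. -/
noncomputable def codeLaw (ρ : Measure Ω) (pt : (ℕ → Ω) → Y) : Measure Y :=
  (Measure.infinitePi fun _ : ℕ => ρ).map pt

theorem codeLaw_apply (hm : ∀ i, Measurable (pt i)) (hφ : ∀ i a, Measurable (φ i a))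
    (hpt : ∀ i a ω, pt i (consSeq a ω) = φ i a (pt (σ i a) ω)) {B : Set Y} (hB : MeasurableSet B)
    (i : ι) : codeLaw ρ (pt i) B = ∑ a, ρ {a} * codeLaw ρ (pt (σ i a)) (φ i a ⁻¹' B) := by
  rw [codeLaw, Measure.map_apply (hm i) hB, infinitePi_apply_cons ρ (hm i hB)]
  refine Finset.sum_congr rfl fun a _ => ?_
  rw [codeLaw, Measure.map_apply (hm _) (hφ i a hB)]
  simp only [Set.mem_preimage, hpt]
  rfl

/-- A zero-one law. -/
theorem codeLaw_zero_or_one (hm : ∀ i, Measurable (pt i))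
    (hpt : ∀ i a ω, pt i (consSeq a ω) = φ i a (pt (σ i a) ω)) {B : ℕ → Set Y}
    (hB : ∀ n, MeasurableSet (B n)) {c : ℝ≥0∞} (hc : ∀ n i, codeLaw ρ (pt i) (B n) = c)
    (hinv : ∀ n i a, ρ {a} ≠ 0 → φ i a ⁻¹' B n =ᵐ[codeLaw ρ (pt (σ i a))] B (n + 1)) [Nonempty ι] :
    c = 0 ∨ c = 1 := by
  set P := Measure.infinitePi fun _ : ℕ => ρ with hP
  have hpi : ∀ N (t : ℕ → Set Ω), MeasurableSet (Set.pi (Finset.range N : Set ℕ) t) := fun N t =>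
    MeasurableSet.pi (Finset.countable_toSet _) fun _ _ => Set.Finite.measurableSet (Set.toFinite _)
  -- The event is independent of every cylinder: reading one letter replaces `B n` by `B (n + 1)`,
  -- which has the same probability in every state.
  have key : ∀ N t n i, P (Set.pi (Finset.range N : Set ℕ) t ∩ pt i ⁻¹' B n) =
      c * ∏ k ∈ Finset.range N, ρ (t k) := by
    intro N
    induction N with
    | zero =>
      intro t n i
      rw [← hc n i, codeLaw, Measure.map_apply (hm i) (hB n)]
      simp [hP]
    | succ N ih =>
      intro t n i
      rw [hP, infinitePi_apply_cons ρ ((hpi _ _).inter (hm i (hB n))), Finset.prod_range_succ',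
        ← hP]
      have hs : ρ (t 0) = ∑ a, ρ {a} * (t 0).indicator 1 a := by
        rw [← lintegral_indicator_one (Set.toFinite _).measurableSet, lintegral_fintype]
        exact Finset.sum_congr rfl fun a _ => mul_comm _ _
      rw [hs, Finset.mul_sum, Finset.mul_sum]
      refine Finset.sum_congr rfl fun a _ => ?_
      by_cases h0 : ρ {a} = 0
      · simp [h0]
      by_cases ha : a ∈ t 0
      · rw [Set.indicator_of_mem ha, Pi.one_apply, mul_one, ← mul_assoc, mul_comm, ← ih _ (n + 1) (σ i a)]
        congr 1
        have hae : pt (σ i a) ⁻¹' (φ i a ⁻¹' B n) =ᵐ[P] pt (σ i a) ⁻¹' B (n + 1) := by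
          have := hinv n i a h0
          exact ae_of_ae_map (hm _).aemeasurable this
        refine measure_congr ?_
        have e : {ω | consSeq a ω ∈ Set.pi (Finset.range (N + 1) : Set ℕ) t ∩ pt i ⁻¹' B n} =
            (Set.pi (Finset.range N : Set ℕ) fun k => t (k + 1)) ∩
              pt (σ i a) ⁻¹' (φ i a ⁻¹' B n) := by
          ext ω
          simp only [Set.mem_ofPred_eq, Set.mem_inter_iff, consSeq_mem_pi, ha, true_and,
            Set.mem_preimage, hpt]
        rw [e]
        exact (ae_eq_refl _).inter hae
      · rw [Set.indicator_of_notMem ha]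
        have e : {ω | consSeq a ω ∈ Set.pi (Finset.range (N + 1) : Set ℕ) t ∩ pt i ⁻¹' B n} = ∅ := by
          ext ω
          simp only [Set.mem_ofPred_eq, Set.mem_inter_iff, consSeq_mem_pi, ha, false_and,
            Set.mem_empty_iff_false]
        rw [e]; simp
  by_cases h0 : c = 0
  · exact .inl h0
  right
  obtain ⟨i⟩ := ‹Nonempty ι›
  have hc1 : c ≠ ⊤ := by
    rw [← hc 0 i, codeLaw, Measure.map_apply (hm i) (hB 0)]; exact measure_ne_top _ _
  -- Conditioning on the event therefore leaves the law unchanged. Evaluated on the event itself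
  -- this reads c⁻¹c = c.
  have hr : c⁻¹ • P.restrict (pt i ⁻¹' B 0) = P := by
    refine eq_infinitePi_of_range ρ fun N t => ?_
    rw [Measure.smul_apply, Measure.restrict_apply (hpi _ _), key, smul_eq_mul, ← mul_assoc,
      ENNReal.inv_mul_cancel h0 hc1, one_mul]
  have h1 : P (pt i ⁻¹' B 0) = c := by
    rw [← hc 0 i, codeLaw, Measure.map_apply (hm i) (hB 0)]
  have h2 := congrArg (fun ν => ν (pt i ⁻¹' B 0)) hr
  simp only [Measure.smul_apply, Measure.restrict_apply (hm i (hB 0)), Set.inter_self, h1,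
    smul_eq_mul] at h2
  rw [← h2, ENNReal.inv_mul_cancel h0 hc1]

end addresses
end

/-! ### Positive matrices -/

section matrices

variable {ι : Type*} [Fintype ι] [Nonempty ι]

/-- A matrix with positive entries has a positive eigenvector. -/
theorem exists_pos_eigenvector {M : ι → ι → ℝ} (hM : ∀ i j, 0 < M i j) :
    ∃ (v : ι → ℝ) (r : ℝ), (∀ i, 0 < v i) ∧ ∑ i, v i = 1 ∧ 0 < r ∧
      ∀ i, ∑ j, M i j * v j = r * v i := by
  classical
  set K := ∑ i, ∑ j, M i j
  -- Collatz–Wielandt: t is maximised under t·x ≤ Mx with x in the simplex. The bound `K` on t makes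
  -- the set compact.
  set C : Set (ℝ × (ι → ℝ)) := (Set.Icc 0 K ×ˢ stdSimplex ℝ ι) ∩
    {p | ∀ i, p.1 * p.2 i ≤ ∑ j, M i j * p.2 j} with hC
  have hcl : IsClosed {p : ℝ × (ι → ℝ) | ∀ i, p.1 * p.2 i ≤ ∑ j, M i j * p.2 j} := by
    simp only [Set.ofPred_forall]
    exact isClosed_iInter fun i => isClosed_le (by fun_prop) (by fun_prop)
  have hcomp : IsCompact C := (isCompact_Icc.prod (isCompact_stdSimplex ℝ ι)).inter_right hcl
  have hK : 0 ≤ K := Finset.sum_nonneg fun i _ => Finset.sum_nonneg fun j _ => (hM i j).le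
  have hne : C.Nonempty := by
    obtain ⟨i₀⟩ := ‹Nonempty ι›
    refine ⟨(0, Pi.single i₀ 1), ⟨⟨le_rfl, hK⟩, single_mem_stdSimplex ℝ i₀⟩, fun i => ?_⟩
    rw [zero_mul]
    refine Finset.sum_nonneg fun j _ => mul_nonneg (hM i j).le ?_
    by_cases h : j = i₀
    · subst h; simp
    · simp [h]
  have hbound : ∀ t (x : ι → ℝ), x ∈ stdSimplex ℝ ι → (∀ i, t * x i ≤ ∑ j, M i j * x j) →
      t ≤ K := by
    intro t x hx h
    calc t = ∑ i, t * x i := by rw [← Finset.mul_sum, hx.2, mul_one]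
      _ ≤ ∑ i, ∑ j, M i j * x j := Finset.sum_le_sum fun i _ => h i
      _ ≤ K := by
        refine Finset.sum_le_sum fun i _ => Finset.sum_le_sum fun j _ => ?_
        have : x j ≤ 1 := by
          rw [← hx.2]; exact Finset.single_le_sum (fun i _ => hx.1 i) (Finset.mem_univ j)
        nlinarith [hM i j]
  obtain ⟨⟨t, x⟩, ⟨⟨ht, hx⟩, h⟩, hmax⟩ := hcomp.exists_isMaxOn hne continuous_fst.continuousOn
  simp only at ht hx
  set y : ι → ℝ := fun i => ∑ j, M i j * x j with hy
  have h' : ∀ i, t * x i ≤ y i := h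
  have hpos : ∀ z : ι → ℝ, (∀ j, 0 ≤ z j) → (∃ j, 0 < z j) → ∀ i, 0 < ∑ j, M i j * z j := by
    rintro z hz ⟨j, hj⟩ i
    exact Finset.sum_pos' (fun k _ => mul_nonneg (hM i k).le (hz k))
      ⟨j, Finset.mem_univ j, mul_pos (hM i j) hj⟩
  have hxpos : ∃ j, 0 < x j := by
    by_contra! hcon
    have : ∑ i, x i ≤ 0 := Finset.sum_nonpos fun i _ => hcon i
    rw [hx.2] at this; linarith
  have hypos : ∀ i, 0 < y i := hpos x hx.1 hxpos
  -- If one inequality were strict, positivity of M would make all of them strict for `y` = Mx, and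
  -- after normalization a larger t would be admissible.
  have heq : ∀ i, y i = t * x i := by
    by_contra! hcon
    obtain ⟨i₀, hi₀⟩ := hcon
    have hlt : ∀ i, t * y i < ∑ j, M i j * y j := by
      intro i
      have := hpos (fun j => y j - t * x j) (fun j => sub_nonneg.2 (h' j))
        ⟨i₀, sub_pos.2 (lt_of_le_of_ne (h' i₀) hi₀.symm)⟩ i
      simp only [mul_sub, Finset.sum_sub_distrib] at this
      have e : ∑ j, M i j * (t * x j) = t * y i := by
        rw [hy, Finset.mul_sum]; exact Finset.sum_congr rfl fun j _ => by ring
      linarith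
    obtain ⟨i₁, -, hi₁⟩ := Finset.exists_min_image Finset.univ
      (fun i => (∑ j, M i j * y j) / y i) Finset.univ_nonempty
    set t' := (∑ j, M i₁ j * y j) / y i₁ with ht'
    have htt' : t < t' := by rw [ht', lt_div_iff₀ (hypos i₁)]; exact hlt i₁
    set Y := ∑ i, y i with hY
    have hYpos : 0 < Y := Finset.sum_pos (fun i _ => hypos i) Finset.univ_nonempty
    have hz : (fun i => y i / Y) ∈ stdSimplex ℝ ι :=
      ⟨fun i => (div_pos (hypos i) hYpos).le, by rw [← Finset.sum_div, div_self hYpos.ne']⟩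
    have hle : ∀ i, t' * (y i / Y) ≤ ∑ j, M i j * (y j / Y) := by
      intro i
      have h1 := hi₁ i (Finset.mem_univ i)
      rw [le_div_iff₀ (hypos i)] at h1
      simp only [← mul_div_assoc, ← Finset.sum_div]
      gcongr
    have := hmax (a := (t', fun i => y i / Y))
      ⟨⟨⟨ht.1.trans htt'.le, hbound _ _ hz hle⟩, hz⟩, hle⟩
    exact absurd htt' (not_lt.2 this)
  have htx : ∀ i, 0 < t ∧ 0 < x i := by
    intro i
    have := hypos i
    rw [heq i] at this
    have hxi : 0 < x i := lt_of_le_of_ne (hx.1 i) fun h0 => by rw [← h0] at this; simp at this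
    exact ⟨pos_of_mul_pos_left this hxi.le, hxi⟩
  obtain ⟨i₀⟩ := ‹Nonempty ι›
  exact ⟨x, t, fun i => (htx i).2, hx.2, (htx i₀).1, heq⟩

/-- Averaging with respect to a positive stochastic matrix contracts oscillations. -/
theorem eq_of_averages {P : ι → ι → ℝ} (hP : ∀ i j, 0 < P i j) (hP1 : ∀ i, ∑ j, P i j = 1)
    {r : ℕ → ι → ℝ} (h0 : ∀ n i, 0 ≤ r n i) (h1 : ∀ n i, r n i ≤ 1)
    (hr : ∀ n i, r n i = ∑ j, P i j * r (n + 1) j) (n : ℕ) (i : ι) (n' : ℕ) (i' : ι) :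
    r n i = r n' i' := by
  classical
  obtain ⟨p, -, hp⟩ := Finset.exists_min_image (Finset.univ : Finset (ι × ι))
    (fun p => P p.1 p.2) Finset.univ_nonempty
  set δ := P p.1 p.2
  have hδ : 0 < δ := hP _ _
  have hδP : ∀ i j, δ ≤ P i j := fun i j => hp (i, j) (Finset.mem_univ _)
  have hδ1 : δ ≤ 1 := by
    rw [← hP1 p.1]
    exact Finset.single_le_sum (fun j _ => (hP p.1 j).le) (Finset.mem_univ p.2)
  -- A share of at least δ of every average falls on the minimum of the next row, so passing from
  -- row n + 1 to row n shrinks the oscillation by the factor 1 − δ.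
  have step : ∀ D n, (∀ i i', r (n + 1) i - r (n + 1) i' ≤ D) →
      ∀ i i', r n i - r n i' ≤ (1 - δ) * D := by
    intro D n hD i i'
    obtain ⟨j₀, -, hj₀⟩ := Finset.exists_min_image (Finset.univ : Finset ι)
      (fun j => r (n + 1) j) Finset.univ_nonempty
    set lo := r (n + 1) j₀
    have hlo : lo ≤ r n i' := by
      calc lo = ∑ j, P i' j * lo := by rw [← Finset.sum_mul, hP1, one_mul]
        _ ≤ _ := Finset.sum_le_sum fun j hj => mul_le_mul_of_nonneg_left (hj₀ j hj) (hP i' j).le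
        _ = _ := (hr n i').symm
    have hhi : r n i - lo ≤ (1 - δ) * D := by
      have hD0 : 0 ≤ D := by have := hD i i; linarith
      calc r n i - lo = ∑ j, P i j * (r (n + 1) j - lo) := by
            simp only [mul_sub, Finset.sum_sub_distrib, ← Finset.sum_mul, hP1, one_mul, ← hr]
        _ = ∑ j ∈ Finset.univ.erase j₀, P i j * (r (n + 1) j - lo) := by
            rw [← Finset.add_sum_erase _ _ (Finset.mem_univ j₀)]; simp [lo]
        _ ≤ ∑ j ∈ Finset.univ.erase j₀, P i j * D :=
            Finset.sum_le_sum fun j _ => mul_le_mul_of_nonneg_left (hD j j₀) (hP i j).le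
        _ = (1 - P i j₀) * D := by
            rw [← Finset.sum_mul, ← hP1 i, ← Finset.add_sum_erase _ _ (Finset.mem_univ j₀)]; ring
        _ ≤ _ := mul_le_mul_of_nonneg_right (by linarith [hδP i j₀]) hD0
    linarith
  have iter : ∀ k n i i', r n i - r n i' ≤ (1 - δ) ^ k := by
    intro k
    induction k with
    | zero => intro n i i'; have := h1 n i; have := h0 n i'; rw [pow_zero]; linarith
    | succ k ih => intro n i i'; rw [pow_succ']; exact step _ n (ih (n + 1)) i i'
  have hle : ∀ n i i', r n i ≤ r n i' := by
    intro n i i'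
    have : Filter.Tendsto (fun k : ℕ => (1 - δ) ^ k) Filter.atTop (nhds 0) :=
      tendsto_pow_atTop_nhds_zero_of_lt_one (by linarith) (by linarith)
    have := ge_of_tendsto' this fun k => iter k n i i'
    linarith
  have hconst : ∀ n i i', r n i = r n i' := fun n i i' => le_antisymm (hle n i i') (hle n i' i)
  have hnext : ∀ n i, r n i = r (n + 1) i := by
    intro n i
    rw [hr n i, Finset.sum_congr rfl fun j _ => by rw [hconst (n + 1) j i], ← Finset.sum_mul, hP1,
      one_mul]
  have hn : ∀ n i, r n i = r 0 i := by
    intro n i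
    induction n with
    | zero => rfl
    | succ n ih => rw [← hnext, ih]
  rw [hn n, hn n', hconst 0 i i']

end matrices

/-! ### The Euclidean norm -/

/-- A quadratic form that is invariant under the symmetries of the pentagon. -/
noncomputable def quad (x : Plane) : ℝ := x.1 ^ 2 + x.2 ^ 2 - β * x.1 * x.2

theorem quad_rot (x : Plane) : quad (rot x) = quad x := by
  simp only [quad, rot]; ring

theorem quad_reflect (x : Plane) : quad (reflect x) = quad x := by
  simp only [quad, reflect]; ring

theorem quad_rot_iter (k : ℕ) (x : Plane) : quad (rot^[k] x) = quad x := by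
  induction k generalizing x with
  | zero => rfl
  | succ k ih => rw [Function.iterate_succ_apply, ih, quad_rot]

/-- The factor two makes the invariant metric dominate the maximum metric of the plane in these
coordinates. -/
noncomputable def qdist (x y : Plane) : ℝ := 2 * √(quad (x - y))

theorem dist_le_qdist (x y : Plane) : dist x y ≤ qdist x y := by
  have hb := beta_pos
  have hb1 := beta_lt_one
  have key : ∀ a b : ℝ, a ^ 2 ≤ 4 * (a ^ 2 + b ^ 2 - β * a * b) := by
    intro a b; nlinarith [sq_nonneg (a - b), sq_nonneg (a + b), sq_nonneg a, sq_nonneg b, mul_nonneg hb.le (sq_nonneg (a-b))]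
  have h2 : ∀ a b : ℝ, a ^ 2 ≤ 4 * b → |a| ≤ 2 * √b := by
    intro a b h
    have : 2 * √b = √(4 * b) := by
      rw [Real.sqrt_mul (by norm_num), show (4 : ℝ) = 2 ^ 2 by norm_num, Real.sqrt_sq (by norm_num)]
    rw [this]; exact Real.abs_le_sqrt h
  rw [Prod.dist_eq, max_le_iff, Real.dist_eq, Real.dist_eq]
  refine ⟨h2 _ _ ?_, h2 _ _ ?_⟩
  · simpa [quad] using key (x.1 - y.1) (x.2 - y.2)
  · have := key (x.2 - y.2) (x.1 - y.1)
    simp only [quad, Prod.fst_sub, Prod.snd_sub]; linarith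

theorem rot_iter_sub (k : ℕ) (x y : Plane) : rot^[k] (x - y) = rot^[k] x - rot^[k] y := by
  rw [sub_eq_add_neg, rot_iter_add, RotTrans.rot_iter_neg, ← sub_eq_add_neg]

theorem RotTrans.qdist_apply (g : RotTrans) (x y : Plane) :
    qdist (g.apply x) (g.apply y) = qdist x y := by
  simp only [qdist, RotTrans.apply, add_sub_add_right_eq_sub, ← rot_iter_sub, quad_rot_iter]

theorem Sim.qdist_apply (S : Sim) (x y : Plane) :
    qdist (S.apply x) (S.apply y) = S.η * qdist x y := by
  have h : quad (S.lin x - S.lin y) = quad (x - y) := by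
    unfold Sim.lin
    rw [← rot_iter_sub, quad_rot_iter]
    split_ifs
    · rw [← quad_reflect (x - y)]; congr 1; simp only [reflect]; ext <;> simp; ring
    · rfl
  simp only [qdist, Sim.apply, add_sub_add_right_eq_sub, ← smul_sub]
  have : quad (S.η • (S.lin x - S.lin y)) = S.η ^ 2 * quad (x - y) := by
    rw [← h]; simp [quad]; ring
  rw [this, Real.sqrt_mul (sq_nonneg _), Real.sqrt_sq S.η_pos.le]; ring

section

open ENNReal

/-! ### Measures of graph-directed iterated function systems -/

section graph

variable {ι E Y : Type*} [Finite ι] [Nonempty ι] [Fintype E] [DecidableEq ι] [MetricSpace Y] [CompleteSpace Y]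
  [MeasurableSpace Y] [BorelSpace Y] {src tgt : E → ι} {φ : E → Y → Y}

/-- A random point of the vertex `i` is the image under φ e of a random point of the vertex `src e`,
where the edge `e` into `i` is drawn with probability `p e`. -/
theorem exists_graph_measure (hφ : ∀ e, Continuous (φ e)) {d : Y → Y → ℝ} {η : ℝ} (hη0 : 0 ≤ η)
    (hη : η < 1) (hd : ∀ x y, dist x y ≤ d x y) (hd' : ∀ e x y, d (φ e x) (φ e y) ≤ η * d x y)
    {A : ι → Set Y} (hA : ∀ i, (A i).Nonempty) (hφA : ∀ e, MapsTo (φ e) (A (src e)) (A (tgt e)))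
    {p : E → ℝ} (hp : ∀ e, 0 < p e) (hp1 : ∀ i, ∑ e with tgt e = i, p e = 1) :
    ∃ μ : ι → Measure Y, (∀ i, IsProbabilityMeasure (μ i)) ∧ (∀ i, μ i (closure (A i))ᶜ = 0) ∧
      (∀ i B, MeasurableSet B →
        μ i B = ∑ e with tgt e = i, ENNReal.ofReal (p e) * μ (src e) (φ e ⁻¹' B)) ∧
      ∀ (B : ℕ → Set Y) (c : ℝ≥0∞), (∀ n, MeasurableSet (B n)) → (∀ n i, μ i (B n) = c) →
        (∀ n e, φ e ⁻¹' B n =ᵐ[μ (src e)] B (n + 1)) → c = 0 ∨ c = 1 := by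
  classical
  cases nonempty_fintype ι
  let Ω := ∀ i, {e : E // tgt e = i}
  let _ : ∀ i, MeasurableSpace {e : E // tgt e = i} := fun _ => ⊤
  let q : ∀ i, Measure {e : E // tgt e = i} := fun i =>
    ∑ e, ENNReal.ofReal (p e.1) • Measure.dirac e
  have hq : ∀ i e, q i {e} = ENNReal.ofReal (p e.1) := by
    intro i e
    simp only [q, Measure.finsetSum_apply, Measure.smul_apply, smul_eq_mul]
    rw [Finset.sum_eq_single e]
    · simp
    · intro b _ hb
      simp [hb]
    · simp
  have hsum : ∀ i (g : E → ℝ≥0∞), ∑ e : {e : E // tgt e = i}, g e.1 = ∑ e with tgt e = i, g e := by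
    intro i g
    exact (Finset.sum_subtype _ (by simp) g).symm
  have hq1 : ∀ i, IsProbabilityMeasure (q i) := by
    intro i
    constructor
    have : q i univ = ∑ e : {e : E // tgt e = i}, ENNReal.ofReal (p e.1) := by
      simp [q, Measure.finsetSum_apply]
    rw [this, hsum i fun e => ENNReal.ofReal (p e), ← ENNReal.ofReal_sum_of_nonneg fun e _ => (hp e).le, hp1,
      ENNReal.ofReal_one]
  let ρ : Measure Ω := Measure.pi q
  let σ : ι → Ω → ι := fun i a => src (a i).1
  let Φ : ι → Ω → Y → Y := fun i a => φ (a i).1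
  have hΦA : ∀ i a, MapsTo (Φ i a) (A (σ i a)) (A i) := by
    intro i a
    have := hφA (a i).1
    rwa [(a i).2] at this
  obtain ⟨pt, hm, hcl, hpt⟩ := exists_coding (σ := σ) (φ := Φ) (fun i a => hφ _) hη0 hη hd
    (fun i a => hd' _) hA hΦA
  have hprob : ∀ i, IsProbabilityMeasure (codeLaw ρ (pt i)) := fun i =>
    Measure.isProbabilityMeasure_map (hm i).aemeasurable
  refine ⟨fun i => codeLaw ρ (pt i), hprob, fun i => ?_, fun i B hB => ?_, fun B c hB hc hinv => ?_⟩
  · change (Measure.map (pt i) _) _ = 0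
    rw [Measure.map_apply (hm i) isClosed_closure.measurableSet.compl]
    convert measure_empty (μ := Measure.infinitePi fun _ : ℕ => ρ)
    ext ω
    simpa using hcl i ω
  · change codeLaw ρ (pt i) B = _
    rw [codeLaw_apply hm (fun i a => (hφ _).measurable) hpt hB]
    have hmp : MeasurePreserving (Function.eval i) ρ (q i) := measurePreserving_eval q i
    have h1 := hmp.lintegral_comp (f := fun e => codeLaw ρ (pt (src e.1)) (φ e.1 ⁻¹' B))
      (measurable_of_finite _)
    rw [lintegral_fintype, lintegral_fintype] at h1
    rw [← hsum i fun e => ENNReal.ofReal (p e) * codeLaw ρ (pt (src e)) (φ e ⁻¹' B)]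
    refine (Finset.sum_congr rfl fun a _ => mul_comm _ _).trans (h1.trans ?_)
    exact Finset.sum_congr rfl fun e _ => by rw [hq, mul_comm]
  · exact codeLaw_zero_or_one hm hpt hB hc fun n i a _ => hinv n _

end graph
end

/-! ### Measurability and continuity -/

theorem continuous_form (m : Fin 5) : Continuous (form m) := by unfold form; fun_prop

theorem Tile.measurableSet_region (T : Tile) : MeasurableSet T.region := by
  have : T.region = ⋂ e ∈ T, {x | e.Holds x} := by ext; simp [Tile.region]
  rw [this]
  refine MeasurableSet.biInter (List.finite_toSet T).countable fun e _ => ?_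
  unfold Edge.Holds
  split_ifs
  · exact measurableSet_le measurable_const (continuous_form _).measurable
  · exact measurableSet_lt (continuous_form _).measurable measurable_const

theorem continuous_rot_iter (k : ℕ) : Continuous fun x : Plane => rot^[k] x := by
  have : Continuous rot := by unfold rot; fun_prop
  exact this.iterate k

theorem RotTrans.continuous_apply (g : RotTrans) : Continuous g.apply :=
  (continuous_rot_iter _).add continuous_const

theorem Sim.continuous_apply (S : Sim) : Continuous S.apply := by
  have hr : Continuous reflect := by unfold reflect; fun_prop
  have : Continuous fun x : Plane => if S.flip then reflect x else x := by
    cases S.flip <;> simp [hr, continuous_id']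
  exact (((continuous_rot_iter _).comp this).const_smul S.η).add continuous_const

namespace DressedDomain

variable {n : ℕ} {X : DressedDomain n}

theorem measurableSet_domain : MeasurableSet X.domain :=
  MeasurableSet.iUnion fun i => (X.tile i).measurableSet_region

theorem measurable_map (hX : X.AtomsDisjoint) : Measurable X.map := by
  intro B hB
  have : X.map ⁻¹' B = (⋃ i, (X.tile i).region ∩ (X.iso i).apply ⁻¹' B) ∪ (X.domainᶜ ∩ B) := by
    ext x
    simp only [Set.mem_preimage, Set.mem_union, Set.mem_iUnion, Set.mem_inter_iff,
      Set.mem_compl_iff]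
    by_cases hx : x ∈ X.domain
    · obtain ⟨i, hi⟩ := mem_iUnion.1 hx
      rw [map_of_mem hX hi]
      refine ⟨fun h => .inl ⟨i, hi, h⟩, ?_⟩
      rintro (⟨j, hj, h⟩ | ⟨h, -⟩)
      · rwa [← map_of_mem hX hj, map_of_mem hX hi] at h
      · exact absurd hx h
    · rw [map_of_notMem hx]
      refine ⟨fun h => .inr ⟨hx, h⟩, ?_⟩
      rintro (⟨j, hj, -⟩ | ⟨-, h⟩)
      · exact absurd (mem_domain hj) hx
      · exact h
  rw [this]
  exact (MeasurableSet.iUnion fun i => (X.tile i).measurableSet_region.inter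
    ((X.iso i).continuous_apply.measurable hB)).union (measurableSet_domain.compl.inter hB)

/-- The isometry along a path. -/
noncomputable def pathMap (X : DressedDomain n) : List (Fin n) → Plane → Plane
  | [], x => x
  | i :: p, x => pathMap X p ((X.iso i).apply x)

theorem continuous_pathMap (p : List (Fin n)) : Continuous (X.pathMap p) := by
  induction p with
  | nil => exact continuous_id
  | cons i p ih => exact ih.comp (X.iso i).continuous_apply

theorem qdist_pathMap (p : List (Fin n)) (x y : Plane) :
    qdist (X.pathMap p x) (X.pathMap p y) = qdist x y := by
  induction p generalizing x y with
  | nil => rfl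
  | cons i p ih => rw [pathMap, pathMap, ih, RotTrans.qdist_apply]

theorem FollowsPath.iterate (hX : X.AtomsDisjoint) {p : List (Fin n)} {S : Set Plane}
    (h : X.FollowsPath S p) {x : Plane} (hx : x ∈ S) {k : ℕ} (hk : k ≤ p.length) :
    X.map^[k] x = X.pathMap (p.take k) x := by
  induction p generalizing S x k with
  | nil =>
    obtain rfl : k = 0 := by simpa using hk
    rfl
  | cons i p ih =>
    cases k with
    | zero => rfl
    | succ k =>
      rw [Function.iterate_succ_apply, map_of_mem hX (h.1 hx), List.take_succ_cons, pathMap]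
      exact ih h.2 (mem_image_of_mem _ hx) (by simpa using hk)

theorem FollowsPath.iterate_mem (hX : X.AtomsDisjoint) {p : List (Fin n)} {S : Set Plane}
    (h : X.FollowsPath S p) {x : Plane} (hx : x ∈ S) {k : ℕ} (hk : k < p.length) :
    X.map^[k] x ∈ (X.tile p[k]).region := by
  induction p generalizing S x k with
  | nil => simp at hk
  | cons i p ih =>
    cases k with
    | zero => exact h.1 hx
    | succ k =>
      rw [Function.iterate_succ_apply, map_of_mem hX (h.1 hx)]
      exact ih h.2 (mem_image_of_mem _ hx) (by simpa using hk)

end DressedDomain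

/-! ### Self-induced maps -/

/-- The dressed domain `X` induces a smaller copy of itself, in such a way that every atom of the
copy visits all atoms, and every atom contains the closure of an element of a return orbit. -/
structure SelfInduced {m : ℕ} (X : DressedDomain m) (G : Sim) (w : Fin m → List (Fin m)) :
    Prop where
  two_le : 2 ≤ m
  disjoint : X.AtomsDisjoint
  nonempty : ∀ i, (X.tile i).region.Nonempty
  induced : SubDomain.IsInduced X ⟨m, X.sim G, w⟩
  contract : G.η < 1
  full : ∀ i j, i ∈ w j
  strict : ∀ i, ∃ j k, ∃ hk : k < (w j).length, (w j)[k] = i ∧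
    ∀ x ∈ closure (X.tile j).region, X.pathMap ((w j).take k) (G.apply x) ∈ (X.tile i).region

namespace SelfInduced

variable {m : ℕ} {X : DressedDomain m} {G : Sim} {w : Fin m → List (Fin m)}

theorem mem_sim {j : Fin m} {x : Plane} (hx : x ∈ (X.tile j).region) :
    G.apply x ∈ ((X.sim G).tile j).region := by
  rw [(conj_sim G X).region]; exact mem_image_of_mem _ hx

theorem iterate (h : SelfInduced X G w) {j : Fin m} {x : Plane} (hx : x ∈ (X.tile j).region)
    {k : ℕ} (hk : k ≤ (w j).length) :
    X.map^[k] (G.apply x) = X.pathMap ((w j).take k) (G.apply x) :=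
  FollowsPath.iterate h.disjoint (h.induced.2.2 j).1 (mem_sim hx) hk

theorem iterate_mem (h : SelfInduced X G w) {j : Fin m} {x : Plane} (hx : x ∈ (X.tile j).region)
    {k : ℕ} (hk : k < (w j).length) : X.map^[k] (G.apply x) ∈ (X.tile (w j)[k]).region :=
  FollowsPath.iterate_mem h.disjoint (h.induced.2.2 j).1 (mem_sim hx) hk

theorem return_eq (h : SelfInduced X G w) {j : Fin m} {x : Plane} (hx : x ∈ (X.tile j).region) :
    X.map^[(w j).length] (G.apply x) = G.apply (X.map x) := by
  rw [← (conj_sim G X).map]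
  exact (h.induced.map_eq (mem_sim hx)).symm

theorem map_mem (h : SelfInduced X G w) {x : Plane} (hx : x ∈ X.domain) : X.map x ∈ X.domain := by
  rw [← (conj_sim G X).mem_domain, ← (conj_sim G X).map]
  exact h.induced.map_mem ((conj_sim G X).mem_domain.2 hx)

theorem iterate_mem_iff (h : SelfInduced X G w) {B : Set Plane}
    (hB : ∀ x ∈ X.domain, (X.map x ∈ B ↔ x ∈ B)) {j : Fin m} {x : Plane}
    (hx : x ∈ (X.tile j).region) {k : ℕ} (hk : k ≤ (w j).length) :
    X.map^[k] (G.apply x) ∈ B ↔ G.apply x ∈ B := by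
  induction k with
  | zero => rfl
  | succ k ih =>
    rw [Function.iterate_succ_apply', hB _ (mem_domain (h.iterate_mem hx (by omega)))]
    exact ih (by omega)

/-- The first-return map of the copy is conjugate to the map itself by `G`, and an invariant set is
invariant under first returns. -/
theorem invariant_preimage (h : SelfInduced X G w) {B : Set Plane}
    (hB : ∀ x ∈ X.domain, (X.map x ∈ B ↔ x ∈ B)) :
    ∀ x ∈ X.domain, (X.map x ∈ G.apply ⁻¹' B ↔ x ∈ G.apply ⁻¹' B) := by
  intro x hx
  obtain ⟨j, hj⟩ := mem_iUnion.1 hx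
  rw [Set.mem_preimage, ← h.return_eq hj]
  exact h.iterate_mem_iff hB hj le_rfl

/-- Each return path visits two different atoms. -/
theorem two_le_length (h : SelfInduced X G w) (j : Fin m) : 2 ≤ (w j).length := by
  by_contra! hlt
  have h2 := h.two_le
  have a := h.full ⟨0, by omega⟩ j
  have b := h.full ⟨1, by omega⟩ j
  match hw : w j, hlt with
  | [], _ => simp [hw] at a
  | [c], _ =>
    rw [hw, List.mem_singleton] at a b
    have := a.trans b.symm
    simp at this

/-- Periodic points with period at most `p`. -/
def shortPeriodic (X : DressedDomain m) (p : ℕ) : Set Plane :=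
  {x | ∃ q, 0 < q ∧ q ≤ p ∧ X.map^[q] x = x}

/-- The period persists along the orbit up to the copy. There it is a sum of return times, each at
least two, so the number of returns is at most half of it; `G` turns returns into steps of the map.
-/
theorem shortPeriodic_half (h : SelfInduced X G w) {j : Fin m} {x : Plane}
    (hx : x ∈ (X.tile j).region) {k : ℕ} (hk : k < (w j).length) {p : ℕ}
    (hp : X.map^[k] (G.apply x) ∈ shortPeriodic X p) : X.map x ∈ shortPeriodic X (p / 2) := by
  obtain ⟨q, hq0, hqp, e⟩ := hp
  have e' : X.map^[q] (G.apply (X.map x)) = G.apply (X.map x) := by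
    have e2 : G.apply (X.map x) = X.map^[(w j).length - k] (X.map^[k] (G.apply x)) := by
      rw [← Function.iterate_add_apply, Nat.sub_add_cancel hk.le, h.return_eq hx]
    rw [e2, ← Function.iterate_add_apply, add_comm, Function.iterate_add_apply, e]
  have hd : G.apply (X.map x) ∈ (X.sim G).domain :=
    (conj_sim G X).mem_domain.2 (h.map_mem (mem_domain hx))
  obtain ⟨r, er, hr0, hr2⟩ := h.induced.exists_iterate hd (m := q) (by rw [e']; exact hd)
  have hr := hr2 2 h.two_le_length
  refine ⟨r, Nat.pos_of_ne_zero fun hr => by have := hr0 hr; omega, by omega, ?_⟩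
  rw [e'] at er
  change _ = (X.sim G).map^[r] _ at er
  rw [(conj_sim G X).map_iter] at er
  exact (G.injective er).symm

theorem measurableSet_shortPeriodic (hX : X.AtomsDisjoint) (p : ℕ) :
    MeasurableSet (shortPeriodic X p) := by
  have : shortPeriodic X p = ⋃ q ∈ {q | 0 < q ∧ q ≤ p}, {x | X.map^[q] x = x} := by
    ext x; simp [shortPeriodic, and_assoc]
  rw [this]
  exact MeasurableSet.biUnion (Set.to_countable _) fun q _ =>
    measurableSet_eq_fun ((measurable_map hX).iterate q) measurable_id

end SelfInduced

namespace SelfInduced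

variable {m : ℕ} {X : DressedDomain m} {G : Sim} {w : Fin m → List (Fin m)}

/-- The maps onto the elements of the return orbits. -/
noncomputable def edgeMap (X : DressedDomain m) (G : Sim) (w : Fin m → List (Fin m))
    (e : Σ j : Fin m, Fin (w j).length) (x : Plane) : Plane :=
  X.pathMap ((w e.1).take e.2) (G.apply x)

/-- The atom that contains an element of a return orbit. -/
def target (w : Fin m → List (Fin m)) (e : Σ j : Fin m, Fin (w j).length) : Fin m :=
  (w e.1)[e.2]

theorem edgeMap_eq (h : SelfInduced X G w) (e : Σ j : Fin m, Fin (w j).length) {x : Plane}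
    (hx : x ∈ (X.tile e.1).region) : edgeMap X G w e x = X.map^[(e.2 : ℕ)] (G.apply x) :=
  (h.iterate hx e.2.2.le).symm

theorem edgeMap_mem (h : SelfInduced X G w) (e : Σ j : Fin m, Fin (w j).length) :
    MapsTo (edgeMap X G w e) (X.tile e.1).region (X.tile (target w e)).region := fun x hx => by
  rw [h.edgeMap_eq e hx]; exact h.iterate_mem hx e.2.2

theorem continuous_edgeMap (e : Σ j : Fin m, Fin (w j).length) :
    Continuous (edgeMap X G w e) :=
  (continuous_pathMap _).comp G.continuous_apply

/-- The weights of a random address. -/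
theorem exists_weights (h : SelfInduced X G w) : ∃ (v : Fin m → ℝ) (r : ℝ), (∀ i, 0 < v i) ∧
    ∑ i, v i = 1 ∧ 1 < r ∧ ∀ i, ∑ e with target w e = i, v e.1 / (r * v i) = 1 := by
  have hm := h.two_le
  have : NeZero m := ⟨by omega⟩
  have hcard : ∀ i j, 1 ≤ ∑ k : Fin (w j).length, if (w j)[k] = i then (1 : ℝ) else 0 := by
    intro i j
    obtain ⟨k, hk, e⟩ := List.getElem_of_mem (h.full i j)
    have := Finset.single_le_sum (f := fun k : Fin (w j).length => if (w j)[k] = i then (1 : ℝ) else 0)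
      (fun k _ => by positivity) (Finset.mem_univ ⟨k, hk⟩)
    simpa [e] using this
  -- The matrix counts the visits of the return path of `j` to the atom `i`; it is positive since
  -- every path visits every atom.
  obtain ⟨v, r, hv, hv1, hr, hvr⟩ := exists_pos_eigenvector
    (M := fun i j => ∑ k : Fin (w j).length, if (w j)[k] = i then (1 : ℝ) else 0)
    fun i j => one_pos.trans_le (hcard i j)
  refine ⟨v, r, hv, hv1, ?_, fun i => ?_⟩
  -- All entries are at least one, so r·v₀ is at least the total mass 1, whereas v₀ < 1 because
  -- there is a second atom.
  · have h0 : v 0 < 1 := by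
      rw [← hv1, ← Finset.add_sum_erase _ _ (Finset.mem_univ (0 : Fin m))]
      have : 0 < ∑ j ∈ Finset.univ.erase (0 : Fin m), v j := by
        refine Finset.sum_pos (fun j _ => hv j) ⟨⟨1, by omega⟩, ?_⟩
        simp [Fin.ext_iff]
      linarith
    have h1 : 1 ≤ r * v 0 := by
      rw [← hvr]
      have := Finset.sum_le_sum fun j (_ : j ∈ Finset.univ) =>
        le_mul_of_one_le_left (hv j).le (hcard 0 j)
      rwa [hv1] at this
    by_contra! hr1
    nlinarith [hv 0]
  · rw [← Finset.sum_div, div_eq_one_iff_eq (mul_pos hr (hv i)).ne', ← hvr, Finset.sum_filter,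
      Fintype.sum_sigma]
    refine Finset.sum_congr rfl fun j _ => ?_
    rw [Finset.sum_mul]
    refine Finset.sum_congr rfl fun k _ => ?_
    rw [ite_mul, one_mul, zero_mul]; rfl

/-- The measure is a mixture of the laws of random addresses in the atoms. Its self-similarity
relates the defect of invariance on a set to the defect on its pull-back by `G`; constancy of
averages and the zero-one law give ergodicity, and halving of periods excludes the periodic points.
-/
theorem exists_ergodic (h : SelfInduced X G w) : ∃ ν : Measure Plane, IsProbabilityMeasure ν ∧
    Ergodic X.map ν ∧ ν X.domainᶜ = 0 ∧ ν (Function.periodicPts X.map) = 0 := by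
  classical
  have hm := h.two_le
  have : NeZero m := ⟨by omega⟩
  obtain ⟨v, r, hv, hv1, hr, hsum⟩ := h.exists_weights
  have hr0 : 0 < r := one_pos.trans hr
  have hf := measurable_map h.disjoint
  have hG := G.continuous_apply.measurable
  set p : (Σ j : Fin m, Fin (w j).length) → ℝ := fun e => v e.1 / (r * v (target w e)) with hp
  have hp0 : ∀ e, 0 < p e := fun e => div_pos (hv _) (mul_pos hr0 (hv _))
  have hp1 : ∀ i, ∑ e with target w e = i, p e = 1 := by
    intro i
    rw [← hsum i]
    refine Finset.sum_congr rfl fun e he => ?_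
    rw [Finset.mem_filter] at he
    rw [hp, ← he.2]
  obtain ⟨μ, hμ, hcl, hself, h01⟩ := exists_graph_measure (src := fun e => e.1) (tgt := target w)
    (φ := edgeMap X G w) continuous_edgeMap G.η_pos.le h.contract dist_le_qdist
    (fun e x y => by rw [edgeMap, edgeMap, qdist_pathMap, G.qdist_apply]) h.nonempty
    h.edgeMap_mem hp0 hp1
  -- the measures live on the atoms
  have hA : ∀ i, μ i (X.tile i).regionᶜ = 0 := by
    obtain ⟨i₀, -, hi₀⟩ := Finset.exists_max_image Finset.univ
      (fun i => μ i (X.tile i).regionᶜ) Finset.univ_nonempty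
    set q := μ i₀ (X.tile i₀).regionᶜ with hq
    suffices q = 0 from fun i => le_antisymm ((hi₀ i (Finset.mem_univ i)).trans this.le) bot_le
    -- One of the edges into the atom maps a closure into it, hence contributes no mass outside.
    -- With p the probability of this edge, the maximal escaping mass satisfies q ≤ (1 − p)q.
    obtain ⟨j, k, hk, e, hs⟩ := h.strict i₀
    set e₀ : Σ j : Fin m, Fin (w j).length := ⟨j, ⟨k, hk⟩⟩
    have he₀ : target w e₀ = i₀ := e
    have hz : μ j (edgeMap X G w e₀ ⁻¹' (X.tile i₀).regionᶜ) = 0 :=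
      measure_mono_null (fun x hx hx' => hx (hs x hx')) (hcl j)
    have hmem : e₀ ∈ Finset.univ.filter fun e => target w e = i₀ :=
      Finset.mem_filter.2 ⟨Finset.mem_univ e₀, he₀⟩
    have h1 : q = ∑ e ∈ (Finset.univ.filter fun e => target w e = i₀).erase e₀,
        ENNReal.ofReal (p e) * μ e.1 (edgeMap X G w e ⁻¹' (X.tile i₀).regionᶜ) := by
      rw [hq, hself i₀ _ (Tile.measurableSet_region _).compl, ← Finset.add_sum_erase _ _ hmem, hz,
        mul_zero, zero_add]
    have h2 : q ≤ ∑ e ∈ (Finset.univ.filter fun e => target w e = i₀).erase e₀,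
        ENNReal.ofReal (p e) * q := by
      refine h1.le.trans (Finset.sum_le_sum fun e he => mul_le_mul_right ?_ _)
      have he : target w e = i₀ := (Finset.mem_filter.1 (Finset.mem_of_mem_erase he)).2
      have hsub : edgeMap X G w e ⁻¹' (X.tile i₀).regionᶜ ⊆ (X.tile e.1).regionᶜ := by
        intro x hx hx'
        have := h.edgeMap_mem e hx'
        rw [he] at this
        exact hx this
      exact (measure_mono hsub).trans (hi₀ e.1 (Finset.mem_univ _))
    have h3 : ∑ e with target w e = i₀, ENNReal.ofReal (p e) * q = q := by
      rw [← Finset.sum_mul, ← ENNReal.ofReal_sum_of_nonneg fun e _ => (hp0 e).le, hp1,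
        ENNReal.ofReal_one, one_mul]
    have hle : q + ENNReal.ofReal (p e₀) * q ≤ q := by
      conv_rhs => rw [← h3, ← Finset.add_sum_erase _ _ hmem, add_comm]
      exact add_le_add_left h2 _
    have hqt : q ≠ ⊤ := measure_ne_top _ _
    have : ENNReal.ofReal (p e₀) * q = 0 := by
      by_contra hne
      exact absurd hle (not_le.2 (ENNReal.lt_add_right hqt hne))
    exact (mul_eq_zero.1 this).resolve_left (by simpa using hp0 e₀)
  have hae : ∀ i, ∀ᵐ x ∂μ i, x ∈ (X.tile i).region := fun i => hA i
  -- the measure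
  set ν : Measure Plane := ∑ i, ENNReal.ofReal (v i) • μ i with hν
  have hνB : ∀ B, ν B = ∑ i, ENNReal.ofReal (v i) * μ i B := fun B => by
    simp [hν, Measure.finsetSum_apply]
  have hνp : IsProbabilityMeasure ν := ⟨by
    simp only [hνB, measure_univ, mul_one]
    rw [← ENNReal.ofReal_sum_of_nonneg fun e _ => (hv e).le, hv1, ENNReal.ofReal_one]⟩
  have hνae : ν X.domainᶜ = 0 := by
    rw [hνB]
    refine Finset.sum_eq_zero fun i _ => ?_
    have : X.domainᶜ ⊆ (X.tile i).regionᶜ := fun x hx hx' => hx (mem_domain hx')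
    rw [measure_mono_null this (hA i), mul_zero]
  -- The weights are chosen so that v_i·p_e = v_j / r for an edge e from j to i; the sum over all
  -- edges then runs along the return orbits.
  have hνself : ∀ B, MeasurableSet B → ν B = ENNReal.ofReal (1 / r) * ∑ j, ENNReal.ofReal (v j) *
      ∑ k ∈ Finset.range (w j).length, μ j ((fun x => X.map^[k] (G.apply x)) ⁻¹' B) := by
    intro B hB
    have h1 : ∀ i, ENNReal.ofReal (v i) * μ i B = ∑ e with target w e = i,
        ENNReal.ofReal (1 / r) * (ENNReal.ofReal (v e.1) * μ e.1 (edgeMap X G w e ⁻¹' B)) := by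
      intro i
      rw [hself i B hB, Finset.mul_sum]
      refine Finset.sum_congr rfl fun e he => ?_
      rw [← mul_assoc, ← mul_assoc, ← ENNReal.ofReal_mul (hv i).le,
        ← ENNReal.ofReal_mul (by positivity), hp, ← (Finset.mem_filter.1 he).2]
      congr 2
      have := hv (target w e)
      field_simp
    rw [hνB, Finset.sum_congr rfl fun i _ => h1 i, Finset.sum_fiberwise, ← Finset.mul_sum,
      Fintype.sum_sigma]
    congr 1
    refine Finset.sum_congr rfl fun j _ => ?_
    rw [Finset.mul_sum, Finset.sum_range]
    refine Finset.sum_congr rfl fun k _ => congrArg _ (measure_congr ?_)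
    filter_upwards [hae j] with x hx
    exact congrArg B (h.edgeMap_eq ⟨j, k⟩ hx)
  have hgm : ∀ k, Measurable fun x => X.map^[k] (G.apply x) := fun k => (hf.iterate k).comp hG
  -- invariance
  have hinv1 : ∀ B, MeasurableSet B → ν (X.map ⁻¹' B) + ENNReal.ofReal (1 / r) * ν (G.apply ⁻¹' B) =
      ν B + ENNReal.ofReal (1 / r) * ν (X.map ⁻¹' (G.apply ⁻¹' B)) := by
    intro B hB
    rw [hνself B hB, hνself _ (hf hB), hνB (G.apply ⁻¹' B), hνB (X.map ⁻¹' (G.apply ⁻¹' B)),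
      ← mul_add, ← mul_add, ← Finset.sum_add_distrib, ← Finset.sum_add_distrib]
    congr 1
    refine Finset.sum_congr rfl fun j _ => ?_
    rw [← mul_add, ← mul_add]
    congr 1
    have h1 : ∀ k, (fun x => X.map^[k] (G.apply x)) ⁻¹' (X.map ⁻¹' B) =
        (fun x => X.map^[k + 1] (G.apply x)) ⁻¹' B := by
      intro k; ext x; simp only [Set.mem_preimage, Function.iterate_succ_apply']
    have h2 : μ j (X.map ⁻¹' (G.apply ⁻¹' B)) =
        μ j ((fun x => X.map^[(w j).length] (G.apply x)) ⁻¹' B) := by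
      refine measure_congr ?_
      filter_upwards [hae j] with x hx
      exact congrArg B (h.return_eq hx).symm
    simp only [h1]
    rw [h2, ← Finset.sum_range_succ (fun k => μ j ((fun x => X.map^[k] (G.apply x)) ⁻¹' B)),
      Finset.sum_range_succ' (fun k => μ j ((fun x => X.map^[k] (G.apply x)) ⁻¹' B))]
    rfl
  -- The defect of invariance is multiplied by 1/r when `B` is replaced by its pull-back, and no
  -- defect exceeds one.
  have hinv2 : ∀ n B, MeasurableSet B → |ν.real (X.map ⁻¹' B) - ν.real B| ≤ (1 / r) ^ n := by
    intro n
    induction n with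
    | zero =>
      intro B _
      have h1 := measureReal_nonneg (μ := ν) (s := X.map ⁻¹' B)
      have h2 := measureReal_nonneg (μ := ν) (s := B)
      have h3 := measureReal_le_one (μ := ν) (s := X.map ⁻¹' B)
      have h4 := measureReal_le_one (μ := ν) (s := B)
      rw [pow_zero, abs_le]; constructor <;> linarith
    | succ n ih =>
      intro B hB
      have h1 := congrArg ENNReal.toReal (hinv1 B hB)
      rw [ENNReal.toReal_add (measure_ne_top _ _) (by finiteness), ENNReal.toReal_add
        (measure_ne_top _ _) (by finiteness), ENNReal.toReal_mul, ENNReal.toReal_mul,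
        ENNReal.toReal_ofReal (by positivity)] at h1
      have h2 : ν.real (X.map ⁻¹' B) - ν.real B =
          1 / r * (ν.real (X.map ⁻¹' (G.apply ⁻¹' B)) - ν.real (G.apply ⁻¹' B)) := by
        simp only [Measure.real]; linarith
      rw [h2, abs_mul, abs_of_pos (by positivity), pow_succ']
      exact mul_le_mul_of_nonneg_left (ih _ (hG hB)) (by positivity)
  have hpres : MeasurePreserving X.map ν ν := by
    refine ⟨hf, Measure.ext fun B hB => ?_⟩
    rw [Measure.map_apply hf hB, ← ENNReal.toReal_eq_toReal_iff' (measure_ne_top _ _) (measure_ne_top _ _)]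
    have h1 : Filter.Tendsto (fun n : ℕ => (1 / r) ^ n) Filter.atTop (nhds 0) :=
      tendsto_pow_atTop_nhds_zero_of_lt_one (by positivity) (by rw [div_lt_one hr0]; exact hr)
    have h2 := ge_of_tendsto' h1 fun n => hinv2 n B hB
    exact sub_eq_zero.1 (abs_eq_zero.1 (le_antisymm h2 (abs_nonneg _)))
  -- ergodicity
  have herg : ∀ B, MeasurableSet B → X.map ⁻¹' B = B → ν B = 0 ∨ ν B = 1 := by
    intro B hB hfB
    set Bn : ℕ → Set Plane := fun n => G.apply^[n] ⁻¹' B with hBn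
    have hBm : ∀ n, MeasurableSet (Bn n) := fun n => (hG.iterate n) hB
    have hBsucc : ∀ n, Bn (n + 1) = G.apply ⁻¹' Bn n := fun n => by
      ext x; simp only [hBn, Set.mem_preimage, Function.iterate_succ_apply]
    have hBi : ∀ n, ∀ x ∈ X.domain, (X.map x ∈ Bn n ↔ x ∈ Bn n) := by
      intro n
      induction n with
      | zero => intro x _; exact Set.ext_iff.1 hfB x
      | succ n ih => rw [hBsucc]; exact h.invariant_preimage ih
    have hBe : ∀ n e, edgeMap X G w e ⁻¹' Bn n =ᵐ[μ e.1] Bn (n + 1) := by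
      intro n e
      filter_upwards [hae e.1] with x hx
      refine propext ?_
      change edgeMap X G w e x ∈ Bn n ↔ x ∈ Bn (n + 1)
      rw [h.edgeMap_eq e hx, h.iterate_mem_iff (hBi n) hx e.2.2.le, hBsucc]; rfl
    -- The self-similarity expresses the masses of `Bn n` as averages, by a positive stochastic
    -- matrix, of those of `Bn (n + 1)`.
    have hconst : ∀ n i n' i', (μ i).real (Bn n) = (μ i').real (Bn n') := by
      refine eq_of_averages (P := fun i j => ∑ e with target w e = i, if e.1 = j then p e else 0)
        (r := fun n i => (μ i).real (Bn n)) ?_ ?_ (fun _ _ => measureReal_nonneg)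
        (fun _ _ => measureReal_le_one) ?_
      · intro i j
        obtain ⟨k, hk, e⟩ := List.getElem_of_mem (h.full i j)
        refine Finset.sum_pos' (fun e _ => by split_ifs; exacts [(hp0 e).le, le_rfl])
          ⟨⟨j, ⟨k, hk⟩⟩, Finset.mem_filter.2 ⟨Finset.mem_univ _, e⟩, ?_⟩
        rw [if_pos rfl]; exact hp0 _
      · intro i
        rw [Finset.sum_comm, ← hp1 i]
        refine Finset.sum_congr rfl fun e _ => ?_
        simp
      · intro n i
        simp only [Measure.real, Finset.sum_mul]
        rw [Finset.sum_comm, hself i _ (hBm n), ENNReal.toReal_sum fun e _ => by finiteness]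
        refine Finset.sum_congr rfl fun e _ => ?_
        rw [ENNReal.toReal_mul, ENNReal.toReal_ofReal (hp0 e).le, measure_congr (hBe n e)]
        simp
    have hc : ∀ n i, μ i (Bn n) = μ 0 B := by
      intro n i
      rw [← ENNReal.toReal_eq_toReal_iff' (measure_ne_top _ _) (measure_ne_top _ _)]
      exact hconst n i 0 0
    have hνc : ν B = μ 0 B := by
      rw [hνB, Finset.sum_congr rfl fun i _ => by rw [show μ i B = μ 0 B from hc 0 i],
        ← Finset.sum_mul, ← ENNReal.ofReal_sum_of_nonneg fun e _ => (hv e).le, hv1,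
        ENNReal.ofReal_one, one_mul]
    rw [hνc]
    exact h01 Bn _ hBm hc hBe
  refine ⟨ν, hνp, ⟨hpres, ⟨fun B hB hfB => ?_⟩⟩, hνae, ?_⟩
  · rw [Filter.eventuallyConst_set']
    rcases herg B hB hfB with h0 | h1
    · exact .inl (ae_eq_empty.2 h0)
    · exact .inr (ae_eq_univ.2 ((prob_compl_eq_zero_iff hB).2 h1))
  -- periodic points
  have hper : ∀ q, ν (shortPeriodic X q) = 0 := by
    intro q
    induction q using Nat.strong_induction_on with
    | _ q ih =>
      rcases Nat.eq_zero_or_pos q with rfl | hq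
      · convert measure_empty (μ := ν)
        ext x
        simp only [shortPeriodic, Set.mem_ofPred_eq, Set.mem_empty_iff_false, iff_false]
        rintro ⟨q, h1, h2, -⟩
        omega
      -- By `shortPeriodic_half`, periodic points of period at most q on a return orbit come from
      -- points whose image has period at most q/2; the image set is null by induction and its
      -- preimage by invariance.
      · have h1 : ν (X.map ⁻¹' shortPeriodic X (q / 2)) = 0 := by
          rw [hpres.measure_preimage (measurableSet_shortPeriodic h.disjoint _).nullMeasurableSet]
          exact ih _ (by omega)
        rw [hνB, Finset.sum_eq_zero_iff] at h1
        rw [hνself _ (measurableSet_shortPeriodic h.disjoint _)]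
        refine mul_eq_zero.2 (.inr (Finset.sum_eq_zero fun j _ => mul_eq_zero.2 (.inr
          (Finset.sum_eq_zero fun k hk => ?_))))
        have h2 : μ j (X.map ⁻¹' shortPeriodic X (q / 2)) = 0 :=
          (mul_eq_zero.1 (h1 j (Finset.mem_univ j))).resolve_left (by simpa using hv j)
        refine measure_mono_null ?_ (measure_union_null h2 (hA j))
        intro x hx
        by_cases hxA : x ∈ (X.tile j).region
        · exact .inl (h.shortPeriodic_half hxA (Finset.mem_range.1 hk) hx)
        · exact .inr hxA
  refine measure_mono_null (fun x hx => ?_) (measure_iUnion_null hper)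
  obtain ⟨q, hq, e⟩ := hx
  exact mem_iUnion.2 ⟨q, q, hq, le_rfl, e⟩

end SelfInduced

/-! ### Composition of inductions -/

section composition

variable {n m : ℕ} {X : DressedDomain n}

theorem DressedDomain.followsPath_append {S : Set Plane} {a b : List (Fin n)} :
    X.FollowsPath S (a ++ b) ↔ X.FollowsPath S a ∧ X.FollowsPath (X.pathMap a '' S) b := by
  induction a generalizing S with
  | nil => simp [FollowsPath, pathMap]
  | cons i a ih =>
    simp only [List.cons_append, FollowsPath, ih, and_assoc, Set.image_image]
    rfl

theorem DressedDomain.pathMap_append {a b : List (Fin n)} (x : Plane) :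
    X.pathMap (a ++ b) x = X.pathMap b (X.pathMap a x) := by
  induction a generalizing x with
  | nil => rfl
  | cons i a ih => exact ih _

variable {Y : DressedDomain m} {p : Fin m → List (Fin n)}

theorem SubDomain.IsInduced.pathMap_eq (hX : X.AtomsDisjoint)
    (h : SubDomain.IsInduced X ⟨m, Y, p⟩) {i : Fin m} {x : Plane} (hx : x ∈ (Y.tile i).region) :
    X.pathMap (p i) x = (Y.iso i).apply x := by
  rw [← ((h.2.2 i).2 x hx).2, FollowsPath.iterate hX (h.2.2 i).1 hx le_rfl, List.take_length]

theorem SubDomain.IsInduced.followsPath_flatMap (hX : X.AtomsDisjoint)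
    (h : SubDomain.IsInduced X ⟨m, Y, p⟩) {S : Set Plane} {q : List (Fin m)}
    (hq : Y.FollowsPath S q) : X.FollowsPath S (q.flatMap p) := by
  induction q generalizing S with
  | nil => trivial
  | cons i q ih =>
    rw [List.flatMap_cons, followsPath_append]
    refine ⟨FollowsPath.mono hq.1 (h.2.2 i).1, ?_⟩
    rw [Set.image_congr fun x hx => h.pathMap_eq hX (hq.1 hx)]
    exact ih hq.2

theorem SubDomain.IsInduced.iterate_flatMap (h : SubDomain.IsInduced X ⟨m, Y, p⟩) {S : Set Plane}
    {q : List (Fin m)} (hq : Y.FollowsPath S q) {x : Plane} (hx : x ∈ S) :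
    X.map^[(q.flatMap p).length] x = Y.map^[q.length] x := by
  induction q generalizing S x with
  | nil => rfl
  | cons i q ih =>
    have hi := ((h.2.2 i).2 x (hq.1 hx)).2
    change X.map^[(p i).length] x = _ at hi
    rw [List.flatMap_cons, List.length_append, add_comm, Function.iterate_add_apply, hi,
      List.length_cons, Function.iterate_succ_apply, map_of_mem h.1 (hq.1 hx)]
    exact ih hq.2 (mem_image_of_mem _ hx)

/-- Within a block of the composed path no time after the first belongs to `Y`, so a visit of `Y`
occurs at the beginning of a block, that is, after whole returns. -/
theorem SubDomain.IsInduced.exists_iterate_lt (h : SubDomain.IsInduced X ⟨m, Y, p⟩) {S : Set Plane}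
    {q : List (Fin m)} (hq : Y.FollowsPath S q) {x : Plane} (hx : x ∈ S) {k : ℕ}
    (hk : k < (q.flatMap p).length) (hY : X.map^[k] x ∈ Y.domain) :
    ∃ r < q.length, X.map^[k] x = Y.map^[r] x ∧ (0 < k → 0 < r) := by
  induction q generalizing S x k with
  | nil => simp at hk
  | cons i q ih =>
    obtain ⟨⟨-, -, hfirst⟩, hi⟩ := (h.2.2 i).2 x (hq.1 hx)
    change ∀ j, 0 < j → j < (p i).length → _ at hfirst
    change X.map^[(p i).length] x = _ at hi
    by_cases hlt : k < (p i).length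
    · obtain rfl : k = 0 := by
        by_contra hk0
        exact hfirst k (Nat.pos_of_ne_zero hk0) hlt hY
      exact ⟨0, by simp, rfl, fun h => h⟩
    · obtain ⟨k', rfl⟩ := Nat.exists_eq_add_of_le' (not_lt.1 hlt)
      rw [Function.iterate_add_apply, hi] at hY ⊢
      rw [List.flatMap_cons, List.length_append] at hk
      obtain ⟨r, hr, e, -⟩ := ih hq.2 (mem_image_of_mem _ hx) (by omega) hY
      refine ⟨r + 1, by simpa using hr, ?_, fun _ => Nat.succ_pos r⟩
      rw [e, Function.iterate_succ_apply, map_of_mem h.1 (hq.1 hx)]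

/-- Return paths compose by substitution. A visit of `Z` is in particular a visit of `Y`, so an
early return under `X` would be an early return under `Y`. -/
theorem SubDomain.IsInduced.comp (hX : X.AtomsDisjoint) (h : SubDomain.IsInduced X ⟨m, Y, p⟩)
    {l : ℕ} {Z : DressedDomain l} {q : Fin l → List (Fin m)}
    (h' : SubDomain.IsInduced Y ⟨l, Z, q⟩) :
    SubDomain.IsInduced X ⟨l, Z, fun j => (q j).flatMap p⟩ := by
  refine ⟨h'.1, h'.2.1.trans h.2.1, fun (j : Fin l) => ?_⟩
  obtain ⟨hf, hr⟩ := h'.2.2 j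
  refine ⟨h.followsPath_flatMap hX hf, fun x hx => ?_⟩
  obtain ⟨⟨hpos, hmem, hfirst⟩, e⟩ := hr x hx
  have e' : X.map^[((q j).flatMap p).length] x = Y.map^[(q j).length] x :=
    h.iterate_flatMap hf hx
  refine ⟨⟨?_, ?_, fun k hk0 hk hmem' => ?_⟩, e'.trans e⟩
  · change 0 < (q j).length at hpos
    change 0 < ((q j).flatMap p).length
    obtain ⟨i, hi⟩ := List.exists_mem_of_length_pos hpos
    obtain ⟨k, hk, rfl⟩ := List.getElem_of_mem hi
    have hk' := ((h.2.2 (q j)[k]).2 _ (FollowsPath.iterate_mem h.1 hf hx hk)).1.1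
    change 0 < (p (q j)[k]).length at hk'
    obtain ⟨c, hc⟩ := List.exists_mem_of_length_pos hk'
    exact List.length_pos_of_mem (List.mem_flatMap.2 ⟨_, hi, hc⟩)
  · change X.map^[((q j).flatMap p).length] x ∈ _
    rw [e']; exact hmem
  · obtain ⟨r, hr, er, hr0⟩ := h.exists_iterate_lt hf hx hk (h'.2.1 hmem')
    rw [er] at hmem'
    exact hfirst r (hr0 hk0) hr hmem'

end composition

/-! ### Lifting ergodic measures -/

theorem measurableSet_periodicPts {n : ℕ} {X : DressedDomain n} (hX : X.AtomsDisjoint) :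
    MeasurableSet (Function.periodicPts X.map) := by
  have : Function.periodicPts X.map = ⋃ q ∈ {q | 0 < q}, {x | X.map^[q] x = x} := by
    ext x; simp [Function.periodicPts, Function.IsPeriodicPt, Function.IsFixedPt]
  rw [this]
  exact MeasurableSet.biUnion (Set.to_countable _) fun q _ =>
    measurableSet_eq_fun ((measurable_map hX).iterate q) measurable_id

theorem measurableSet_component {n : ℕ} {X : DressedDomain n} (hX : X.AtomsDisjoint)
    {D : Set Plane} (hD : MeasurableSet D) : MeasurableSet (component X D) := by
  have : component X D =
      (X.domain \ Function.periodicPts X.map) ∩ ⋃ k, X.map^[k] ⁻¹' D := by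
    ext x; simp [component, exceptionalSet]
  rw [this]
  exact (measurableSet_domain.diff (measurableSet_periodicPts hX)).inter
    (MeasurableSet.iUnion fun k => (measurable_map hX).iterate k hD)

/-- Kakutani's tower: the base measure is copied to all elements of the return orbits and
normalized. -/
theorem exists_ergodic_lift {n : ℕ} {X : DressedDomain n} (hX : X.AtomsDisjoint)
    (hb : Set.BijOn X.map X.domain X.domain) {Y : SubDomain n} (h : Y.IsInduced X)
    {ν : Measure Plane} [IsProbabilityMeasure ν] (hν : Ergodic Y.dd.map ν)
    (hdom : ν Y.dd.domainᶜ = 0) (hper : ν (Function.periodicPts Y.dd.map) = 0) :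
    ∃ μ : Measure Plane, IsProbabilityMeasure μ ∧ Ergodic X.map μ ∧
      μ (component X Y.dd.domain)ᶜ = 0 := by
  have hf := measurable_map hX
  have hA : ∀ j, MeasurableSet (Y.dd.tile j).region := fun j => Tile.measurableSet_region _
  set μ₀ : Measure Plane := ∑ j, ∑ k ∈ Finset.range (Y.path j).length,
    (ν.restrict (Y.dd.tile j).region).map X.map^[k] with hμ₀
  have happ : ∀ B, MeasurableSet B → μ₀ B = ∑ j, ∑ k ∈ Finset.range (Y.path j).length,
      ν (X.map^[k] ⁻¹' B ∩ (Y.dd.tile j).region) := by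
    intro B hB
    rw [hμ₀, Measure.finsetSum_apply]
    refine Finset.sum_congr rfl fun j _ => ?_
    rw [Measure.finsetSum_apply]
    refine Finset.sum_congr rfl fun k _ => ?_
    rw [Measure.map_apply (hf.iterate k) hB, Measure.restrict_apply (hf.iterate k hB)]
  have hsum : ∀ B, MeasurableSet B → ∑ j, ν (B ∩ (Y.dd.tile j).region) = ν B := by
    intro B hB
    rw [← measure_biUnion_finset]
    · rw [← measure_inter_add_sdiff B (measurableSet_domain (X := Y.dd)),
        measure_mono_null (fun x hx => hx.2 : B \ Y.dd.domain ⊆ Y.dd.domainᶜ) hdom, add_zero]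
      congr 1
      ext x; simp [DressedDomain.domain]
    · intro i _ j _ hij
      exact (h.1 hij).mono inter_subset_right inter_subset_right
    · exact fun j _ => hB.inter (hA j)
  have hfin : μ₀ univ ≠ ⊤ := by
    rw [happ _ MeasurableSet.univ]
    exact (ENNReal.sum_lt_top.2 fun j _ => ENNReal.sum_lt_top.2 fun k _ => measure_lt_top _ _).ne
  have hne : μ₀ univ ≠ 0 := by
    intro h0
    rw [happ _ MeasurableSet.univ, Finset.sum_eq_zero_iff] at h0
    have : ν univ = 0 := by
      rw [← hsum _ MeasurableSet.univ]
      refine Finset.sum_eq_zero fun j hj => ?_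
      by_cases hemp : (Y.dd.tile j).region = ∅
      · simp [hemp]
      · obtain ⟨x, hx⟩ := Set.nonempty_iff_ne_empty.2 hemp
        have hpos := ((h.2.2 j).2 x hx).1.1
        have := Finset.sum_eq_zero_iff.1 (h0 j hj) 0 (Finset.mem_range.2 hpos)
        exact this
    simp at this
  have hinv : ∀ B, MeasurableSet B → μ₀ (X.map ⁻¹' B) = μ₀ B := by
    intro B hB
    -- Moving up one level changes only the bottom and the top of the tower, and the top is sent
    -- back to the base by the return map.
    have h1 : μ₀ (X.map ⁻¹' B) + ν B = μ₀ B + ν (Y.dd.map ⁻¹' B) := by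
      rw [happ _ (hf hB), happ _ hB, ← hsum B hB,
        ← hsum (Y.dd.map ⁻¹' B) (hν.measurable hB), ← Finset.sum_add_distrib,
        ← Finset.sum_add_distrib]
      refine Finset.sum_congr rfl fun j _ => ?_
      have h2 : Y.dd.map ⁻¹' B ∩ (Y.dd.tile j).region =
          X.map^[(Y.path j).length] ⁻¹' B ∩ (Y.dd.tile j).region := by
        ext x
        simp only [Set.mem_inter_iff, Set.mem_preimage]
        exact and_congr_left fun hx => by rw [h.map_eq hx]
      have h3 : ∀ k, X.map^[k] ⁻¹' (X.map ⁻¹' B) = X.map^[k + 1] ⁻¹' B := fun k => by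
        ext x; simp only [Set.mem_preimage, Function.iterate_succ_apply']
      simp only [h3]
      rw [h2, ← Finset.sum_range_succ fun k => ν (X.map^[k] ⁻¹' B ∩ (Y.dd.tile j).region),
        Finset.sum_range_succ' fun k => ν (X.map^[k] ⁻¹' B ∩ (Y.dd.tile j).region)]
      rfl
    rw [hν.measure_preimage hB.nullMeasurableSet] at h1
    exact (ENNReal.add_left_inj (measure_ne_top _ _)).1 h1
  have hnull : ∀ B, MeasurableSet B →
      (∀ j k, ν (X.map^[k] ⁻¹' B ∩ (Y.dd.tile j).region) = 0) → μ₀ B = 0 := fun B hB h0 => by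
    rw [happ _ hB]
    exact Finset.sum_eq_zero fun j _ => Finset.sum_eq_zero fun k _ => h0 j k
  set μ := (μ₀ univ)⁻¹ • μ₀ with hμ
  have hμ0 : ∀ B, μ₀ B = 0 → μ B = 0 := fun B hB => by simp [hμ, hB]
  refine ⟨μ, ⟨?_⟩, ⟨⟨hf, Measure.ext fun B hB => ?_⟩, ⟨fun B hB hfB => ?_⟩⟩, hμ0 _ (hnull _ ?_ ?_)⟩
  · simp [hμ, ENNReal.inv_mul_cancel hne hfin]
  · rw [Measure.map_apply hf hB, hμ, Measure.smul_apply, Measure.smul_apply, hinv B hB]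
  · have hD := measurableSet_domain (X := Y.dd)
    have hk : ∀ k, X.map^[k] ⁻¹' B = B := by
      intro k
      induction k with
      | zero => rfl
      | succ k ih => rw [Function.iterate_succ, Set.preimage_comp, ih, hfB]
    -- The trace of an invariant set on the base is invariant under the return map. Off the base
    -- that map is the identity, so the equality of sets is exact.
    have hB' : Y.dd.map ⁻¹' (B ∩ Y.dd.domain) = B ∩ Y.dd.domain := by
      ext x
      by_cases hx : x ∈ Y.dd.domain
      · obtain ⟨j, hj⟩ := mem_iUnion.1 hx
        have : x ∈ X.map^[(Y.path j).length] ⁻¹' B ↔ x ∈ B := by rw [hk]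
        simp only [Set.mem_preimage, Set.mem_inter_iff, hx, h.map_mem hx, and_true]
        rw [h.map_eq hj]; exact this
      · simp only [Set.mem_preimage, map_of_notMem hx]
    rw [Filter.eventuallyConst_set']
    rcases Filter.eventuallyConst_set'.1 (hν.aeconst_set (hB.inter hD) hB') with h0 | h1
    · refine .inl (ae_eq_empty.2 (hμ0 _ (hnull B hB fun j k => ?_)))
      rw [hk]
      exact measure_mono_null (inter_subset_inter_right _ fun x hx => mem_domain hx)
        (ae_eq_empty.1 h0)
    · refine .inr (ae_eq_univ.2 (hμ0 _ (hnull _ hB.compl fun j k => ?_)))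
      rw [Set.preimage_compl, hk]
      have hsub : Bᶜ ∩ (Y.dd.tile j).region ⊆ (B ∩ Y.dd.domain)ᶜ := fun x hx hx' => hx.1 hx'.1
      exact measure_mono_null hsub (ae_eq_univ.1 h1)
  · exact (measurableSet_component hX measurableSet_domain).compl
  -- A non-periodic base point stays non-periodic along its orbit and comes back to the base later,
  -- so only periodic points can leave the component.
  · intro j k
    refine measure_mono_null (fun x hx => ?_) hper
    by_contra hxp
    have hxY : x ∈ Y.dd.domain := mem_domain hx.2
    refine hx.1 ⟨⟨(hb.iterate k).mapsTo (h.2.1 hxY), fun hp => hxp ((h.periodic hxY).2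
      (mem_periodicPts_of_iterate hb (h.2.1 hxY) hp))⟩, ?_⟩
    obtain ⟨k', hk', hmem⟩ := h.exists_return hxY k
    refine ⟨k' - k, ?_⟩
    rw [← Function.iterate_add_apply, Nat.sub_add_cancel hk']
    exact hmem

/-! ### Chains of inductions -/

section links

variable {n m l : ℕ}

/-- `Y` is induced by `X` with non-empty return paths `w`, and these paths visit every atom. -/
structure Link (X : DressedDomain n) (Y : DressedDomain m) (w : Fin m → List (Fin n)) : Prop where
  disjoint : X.AtomsDisjoint
  induced : SubDomain.IsInduced X ⟨m, Y, w⟩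
  ne_nil : ∀ j, w j ≠ []
  hit : ∀ i, ∃ j, i ∈ w j

/-- The closure of some atom of `Y` visits the atom `i` of `X` along its return path. -/
def StrictAt (X : DressedDomain n) (Y : DressedDomain m) (w : Fin m → List (Fin n)) (i : Fin n) :
    Prop :=
  ∃ j k, ∃ hk : k < (w j).length, (w j)[k] = i ∧
    ∀ x ∈ closure (Y.tile j).region, X.pathMap ((w j).take k) x ∈ (X.tile i).region

variable {X : DressedDomain n} {Y : DressedDomain m} {Z : DressedDomain l}
  {p : Fin m → List (Fin n)} {q : Fin l → List (Fin m)}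

/-- Addresses a letter of a composed path by its block and its place in the block. -/
theorem List.take_flatMap_append {α β : Type*} (f : α → List β) (L : List α) {k k' : ℕ}
    (hk : k < L.length) (hk' : k' < (f L[k]).length) :
    (L.flatMap f).take (((L.take k).flatMap f).length + k') =
      (L.take k).flatMap f ++ (f L[k]).take k' ∧
    ∃ h : ((L.take k).flatMap f).length + k' < (L.flatMap f).length,
      (L.flatMap f)[((L.take k).flatMap f).length + k'] = (f L[k])[k'] := by
  have e : L.flatMap f = (L.take k).flatMap f ++ (f L[k] ++ (L.drop (k + 1)).flatMap f) := by
    conv_lhs => rw [← List.take_append_drop k L, List.flatMap_append,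
      List.drop_eq_getElem_cons hk, List.flatMap_cons]
  refine ⟨?_, ?_, ?_⟩
  · rw [e, List.take_length_add_append, List.take_append_of_le_length hk'.le]
  · rw [e]; simp only [List.length_append]; omega
  · simp only [e]
    rw [List.getElem_append_right (by omega), List.getElem_append_left (by omega)]
    simp

theorem Link.comp (h : Link X Y p) (h' : Link Y Z q) : Link X Z fun j => (q j).flatMap p where
  disjoint := h.disjoint
  induced := h.induced.comp h.disjoint h'.induced
  ne_nil j := by
    obtain ⟨i, hi⟩ := List.exists_mem_of_ne_nil _ (h'.ne_nil j)
    obtain ⟨c, hc⟩ := List.exists_mem_of_ne_nil _ (h.ne_nil i)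
    exact List.ne_nil_of_mem (List.mem_flatMap.2 ⟨i, hi, hc⟩)
  hit i := by
    obtain ⟨j, hj⟩ := h.hit i
    obtain ⟨k, hk⟩ := h'.hit j
    exact ⟨k, List.mem_flatMap.2 ⟨j, hk, hj⟩⟩

theorem Link.sim (h : Link X Y p) (S : Sim) : Link (X.sim S) (Y.sim S) p where
  disjoint := (conj_sim S X).atomsDisjoint h.disjoint
  induced := (conj_sim S X).isInduced (conj_sim S Y) h.induced
  ne_nil := h.ne_nil
  hit := h.hit

theorem Link.full_comp_left (hp : ∀ i j, i ∈ p j) (h' : Link Y Z q) :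
    ∀ i j, i ∈ (q j).flatMap p := fun i j => by
  obtain ⟨a, ha⟩ := List.exists_mem_of_ne_nil _ (h'.ne_nil j)
  exact List.mem_flatMap.2 ⟨a, ha, hp i a⟩

theorem pathMap_sim (S : Sim) (w : List (Fin n)) (x : Plane) :
    (X.sim S).pathMap w (S.apply x) = S.apply (X.pathMap w x) := by
  induction w generalizing x with
  | nil => rfl
  | cons i w ih =>
    change (X.sim S).pathMap w (((X.sim S).iso i).apply (S.apply x)) = _
    rw [← (conj_sim S X).iso, ih]
    rfl

theorem Sim.image_closure_subset (S : Sim) (A : Set Plane) :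
    closure (S.apply '' A) ⊆ S.apply '' closure A := by
  intro x hx
  refine ⟨S.inv x, ?_, S.apply_inv x⟩
  rw [← S.symm_apply]
  refine map_mem_closure S.symm.continuous_apply hx ?_
  rintro _ ⟨y, hy, rfl⟩
  rwa [S.symm_apply, S.inv_apply]

theorem StrictAt.sim {i : Fin n} (h : StrictAt X Y p i) (S : Sim) :
    StrictAt (X.sim S) (Y.sim S) p i := by
  obtain ⟨j, k, hk, e, hs⟩ := h
  refine ⟨j, k, hk, e, fun x hx => ?_⟩
  rw [(conj_sim S Y).region] at hx
  obtain ⟨y, hy, rfl⟩ := S.image_closure_subset _ hx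
  rw [pathMap_sim, (conj_sim S X).mem]
  exact hs y hy

theorem Link.pathMap_flatMap (h : Link X Y p) {w : List (Fin m)} {S : Set Plane}
    (hw : Y.FollowsPath S w) {x : Plane} (hx : x ∈ S) :
    X.pathMap (w.flatMap p) x = Y.pathMap w x := by
  induction w generalizing S x with
  | nil => rfl
  | cons i w ih =>
    rw [List.flatMap_cons, pathMap_append, h.induced.pathMap_eq h.disjoint (hw.1 hx)]
    exact ih hw.2 (mem_image_of_mem _ hx)

/-- The two maps agree on the tile; continuity extends this to the closure, where strictness is
formulated. -/
theorem Link.pathMap_take (h : Link X Y p) (h' : Link Y Z q) (j : Fin l) (k : ℕ) :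
    ∀ x ∈ closure (Z.tile j).region,
      X.pathMap (((q j).take k).flatMap p) x = Y.pathMap ((q j).take k) x := by
  have hf : Y.FollowsPath (Z.tile j).region ((q j).take k ++ (q j).drop k) := by
    rw [List.take_append_drop]; exact (h'.induced.2.2 j).1
  have : EqOn (X.pathMap (((q j).take k).flatMap p)) (Y.pathMap ((q j).take k))
      (Z.tile j).region := fun x hx => h.pathMap_flatMap (followsPath_append.1 hf).1 hx
  exact this.closure (continuous_pathMap _) (continuous_pathMap _)

/-- A closure that lands in one atom of `Y` follows its return path through `X`, which visits all
atoms. Strictness at one atom thus spreads to every atom. -/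
theorem Link.strictAt_of_full (h : Link X Y p) (h' : Link Y Z q) (hp : ∀ i j, i ∈ p j) {a : Fin m}
    (ha : StrictAt Y Z q a) (i : Fin n) : StrictAt X Z (fun j => (q j).flatMap p) i := by
  obtain ⟨j, k, hk, rfl, hs⟩ := ha
  obtain ⟨k', hk', rfl⟩ := List.getElem_of_mem (hp i (q j)[k])
  obtain ⟨e1, e2, e3⟩ := List.take_flatMap_append p (q j) hk hk'
  refine ⟨j, _, e2, e3, fun x hx => ?_⟩
  rw [e1, pathMap_append, h.pathMap_take h' j k x hx,
    ← FollowsPath.iterate h.disjoint (h.induced.2.2 (q j)[k]).1 (hs x hx) hk'.le]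
  exact FollowsPath.iterate_mem h.disjoint (h.induced.2.2 (q j)[k]).1 (hs x hx) hk'

theorem Link.closure_subset (h : Link Y Z q) {j : Fin l} {k : ℕ} (hk : k < (q j).length) {x : Plane}
    (hx : x ∈ closure (Z.tile j).region) :
    Y.pathMap ((q j).take k) x ∈ closure (Y.tile (q j)[k]).region := by
  refine map_mem_closure (continuous_pathMap _) hx fun y hy => ?_
  rw [← FollowsPath.iterate h.disjoint (h.induced.2.2 j).1 hy hk.le]
  exact FollowsPath.iterate_mem h.disjoint (h.induced.2.2 j).1 hy hk

/-- Further induction preserves strictness: some path of `Z` passes through the relevant atom of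
`Y`, and its closed tile arrives inside the closure of that atom. -/
theorem Link.strictAt_comp (h : Link X Y p) (h' : Link Y Z q) {i : Fin n} (hi : StrictAt X Y p i) :
    StrictAt X Z (fun j => (q j).flatMap p) i := by
  obtain ⟨a, k', hk', rfl, hs⟩ := hi
  obtain ⟨j, hj⟩ := h'.hit a
  obtain ⟨k, hk, rfl⟩ := List.getElem_of_mem hj
  obtain ⟨e1, e2, e3⟩ := List.take_flatMap_append p (q j) hk hk'
  refine ⟨j, _, e2, e3, fun x hx => ?_⟩
  rw [e1, pathMap_append, h.pathMap_take h' j k x hx]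
  exact hs _ (h'.closure_subset hk hx)

theorem Sim.ext_apply {S T : Sim} (hη : S.η = T.η) (hk : S.k = T.k) (hf : S.flip = T.flip)
    (h0 : S.apply 0 = T.apply 0) : S = T := by
  have hl : ∀ S : Sim, S.apply 0 = S.d := fun S => by
    have := S.lin_smul 0 0
    simp only [zero_smul] at this
    rw [Sim.apply, this, smul_zero, zero_add]
  rw [hl, hl] at h0
  cases S; cases T
  simp_all

theorem Sim.comp_symm_comp (S T : Sim) : (T.comp S.symm).comp S = T := by
  refine Sim.ext_apply ?_ ?_ ?_ ?_
  · change T.η * S.η⁻¹ * S.η = T.η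
    rw [mul_assoc, inv_mul_cancel₀ S.η_pos.ne', mul_one]
  · simp only [comp, symm]
    by_cases h1 : S.flip = true <;> by_cases h2 : T.flip = true <;> simp [h1, h2]
  · simp only [comp, symm]
    rcases h1 : S.flip <;> rcases h2 : T.flip <;> rfl
  · rw [comp_apply, comp_apply, symm_apply, inv_apply]

/-- Closing up a chain of inductions. -/
theorem Link.selfInduced {X : DressedDomain n} {S T : Sim} {w : Fin n → List (Fin n)}
    (h : Link (X.sim S) (X.sim T) w) (hn : 2 ≤ n) (hη : T.η < S.η) (hX : X.domain.Nonempty)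
    (hw : ∀ i j, i ∈ w j) (hs : ∀ i, StrictAt (X.sim S) (X.sim T) w i) :
    SelfInduced (X.sim S) (T.comp S.symm) w := by
  have e : (X.sim S).sim (T.comp S.symm) = X.sim T := by
    rw [sim_sim, Sim.comp_symm_comp]
  refine ⟨hn, h.disjoint, fun i => ?_, by rw [e]; exact h.induced, ?_, hw, fun i => ?_⟩
  · obtain ⟨x, hx⟩ := hX
    obtain ⟨j, hj⟩ := mem_iUnion.1 hx
    obtain ⟨k, hk, rfl⟩ := List.getElem_of_mem (hw i j)
    exact ⟨_, FollowsPath.iterate_mem h.disjoint (h.induced.2.2 j).1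
      ((conj_sim T X).mem.2 hj) hk⟩
  · change T.η * S.η⁻¹ < 1
    rwa [← div_eq_mul_inv, div_lt_one S.η_pos]
  · obtain ⟨j, k, hk, e', hs⟩ := hs i
    refine ⟨j, k, hk, e', fun x hx => hs _ ?_⟩
    rw [← e, (conj_sim _ _).region]
    exact image_closure_subset_closure_image (Sim.continuous_apply _) (mem_image_of_mem _ hx)

end links

/-! ### Checking strictness -/

def Con.close (e : Con) : Con := ⟨e.j, false, e.c⟩

theorem continuous_sform (j : Fin 10) : Continuous (sform j) := by
  unfold sform; fun_prop

/-- Relaxing all constraints may give more than the closure, but an upper bound is all that is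
needed. -/
theorem closure_reg_subset (w : Wt) (T : List Con) : closure (reg w T) ⊆ reg w (T.map Con.close) := by
  refine closure_minimal (fun x hx e' he' => ?_) ?_
  · obtain ⟨e, he, rfl⟩ := List.mem_map.1 he'
    simpa [Con.close, Con.Holds] using (hx e he).le
  · have : reg w (T.map Con.close) = ⋂ e ∈ T, {x | sform e.j x ≤ e.c.ev w} := by
      ext x; simp [reg, Con.close, Con.Holds]
    rw [this]
    exact isClosed_biInter fun e _ => isClosed_le (continuous_sform _) continuous_const

theorem pathMap_reg {n : ℕ} (X : DDom Vec n) (w : Wt) :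
    ∀ (p : List (Fin n)) (T : List Con) (x : Plane), x ∈ reg w T →
      (X.real (Vec.ev w)).pathMap p x ∈ reg w (final X p T)
  | [], _, _, hx => hx
  | i :: p, T, x, hx => by
    refine pathMap_reg X w p _ _ ?_
    rw [real_iso, ← image_reg]; exact mem_image_of_mem _ hx

def chkStrict {n : ℕ} (X : DDom Vec n) (Y : DSub n) (i : Fin n) : Bool :=
  (List.finRange Y.m).any fun j => (List.finRange (Y.path j).length).any fun k =>
    decide ((Y.path j)[k] = i) &&
      sub (final X ((Y.path j).take k) ((cons (Y.dd.tile j)).map Con.close)) (cons (X.tile i))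

theorem chkStrict_spec {n : ℕ} {X : DDom Vec n} {Y : DSub n} {i : Fin n} {w : Wt}
    (h : chkStrict X Y i = true) :
    StrictAt (X.real (Vec.ev w)) (Y.dd.real (Vec.ev w)) Y.path i := by
  simp only [chkStrict, List.any_eq_true, Bool.and_eq_true, decide_eq_true_iff] at h
  obtain ⟨j, -, k, -, e, hs⟩ := h
  refine ⟨j, k, k.2, e, fun x hx => ?_⟩
  rw [real_tile_region] at hx ⊢
  exact subset_of_sub hs (pathMap_reg X w _ _ _ (closure_reg_subset w _ hx))

/-! ### Inductions of the base triangles, with their return paths -/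

/-- The two-step induction of the degenerate base triangle. -/
def S11 : DSim := ⟨⟨5, -3⟩, 0, false, (.K 0 0, .K 0 0), rfl⟩

/-- One atom is enough, since `Link.strictAt_of_full` passes strictness on to the others. -/
theorem strict2 : ∀ σ, ∃ i, chkStrict (baseV (seg rB2 rB) σ)
    (stepSub (seg rB2 rB) (!σ) (S2.sg σ) T2 w2) i = true := by
  decide +kernel

theorem strict3 : ∀ σ, ∃ i, chkStrict (baseV (seg rB ⟨1, 0⟩) σ)
    (stepSub (seg rB ⟨1, 0⟩) (!σ) (S3.sg σ) T3 w3) i = true := by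
  decide +kernel

theorem sub00 : chkSub (vecDom (seg ⟨0, 0⟩ ⟨0, 0⟩) zeroD)
    (zeroSub (seg ⟨0, 0⟩ ⟨0, 0⟩) S11 fun j => (w0 j).flatMap w0) = true := by
  decide +kernel

theorem strict00 : chkStrict (vecDom (seg ⟨0, 0⟩ ⟨0, 0⟩) zeroD)
    (zeroSub (seg ⟨0, 0⟩ ⟨0, 0⟩) S11 fun j => (w0 j).flatMap w0) 1 = true := by
  decide +kernel

theorem link_of_rtOK {V : Verts} {w : Wt} {σ σ' : Bool} {τ : ℝ} (h : V.Rep w τ 0)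
    (hd : (baseS σ τ).AtomsDisjoint) {S : DSim} {T : Aff} {p : Fin 3 → List (Fin 3)}
    {Qs : List PerData} (hY : rtOK V σ (stepSub V σ' S T p) Qs = true) (hn : ∀ j, p j ≠ [])
    (hp : ∀ i, ∃ j, i ∈ p j) :
    Link (baseS σ τ) ((baseS σ' (T.eval τ 0)).sim (S.real τ 0)) p := by
  have := (tiles_of_rtOK h hd hY).1 _ (List.mem_singleton_self _)
  rw [real_stepSub h] at this
  exact ⟨hd, this, hn, hp⟩

theorem strictAt_of_chkStrict {V : Verts} {w : Wt} {σ σ' : Bool} {τ : ℝ} (h : V.Rep w τ 0)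
    {S : DSim} {T : Aff} {p : Fin 3 → List (Fin 3)} {i : Fin 3}
    (hi : chkStrict (baseV V σ) (stepSub V σ' S T p) i = true) :
    StrictAt (baseS σ τ) ((baseS σ' (T.eval τ 0)).sim (S.real τ 0)) p i := by
  have := chkStrict_spec (w := w) hi
  rw [real_baseV h] at this
  change StrictAt _ ((vecDom V (S.dom (sgD σ' (baseD T)))).real (Vec.ev w)) p i at this
  rwa [h.real, DSim.real_dom, real_sgD] at this

theorem beta_sq_lt_beta : β ^ 2 < β := by
  have := beta_pos; have := beta_lt_one; nlinarith

theorem link₁ (σ : Bool) {τ : ℝ} (h0 : 0 < τ) (h1 : τ < β ^ 2) :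
    ∃ S : Sim, S.η < 1 ∧ Link (baseS σ τ) ((baseS σ (renorm τ)).sim S) w1 := by
  obtain ⟨w, hw⟩ := seg_rep (τ := τ) (a := ⟨0, 0⟩) (b := rB2) (by rwa [val_zero]) (by rwa [val_rB2])
  have := link_of_rtOK hw (base_disjoint h0 (h1.trans (beta_sq_lt_beta.trans beta_lt_one))) (rt1 σ)
    (by decide) (by decide)
  have hT : T1.eval τ 0 = renorm τ := by
    unfold renorm; rw [if_pos h1]; simp [T1, omegaA, eval_tau, ZW.val]; ring
  rw [hT] at this
  refine ⟨_, ?_, this⟩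
  change rB2.val < 1
  rw [val_rB2]; exact pow_lt_one₀ beta_pos.le beta_lt_one (by norm_num)

theorem link₂ (σ : Bool) {τ : ℝ} (h0 : β ^ 2 < τ) (h1 : τ < β) :
    ∃ S : Sim, S.η < 1 ∧ Link (baseS σ τ) ((baseS (!σ) (renorm τ)).sim S) w2 ∧
      ∃ i, StrictAt (baseS σ τ) ((baseS (!σ) (renorm τ)).sim S) w2 i := by
  obtain ⟨w, hw⟩ := seg_rep (τ := τ) (a := rB2) (b := rB) (by rwa [val_rB2]) (by rwa [val_rB])
  obtain ⟨i, hi⟩ := strict2 σ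
  have hl := link_of_rtOK hw (base_disjoint ((pow_pos beta_pos 2).trans h0) (h1.trans beta_lt_one))
    (rt2 σ) (by decide) (by decide)
  have hs := strictAt_of_chkStrict hw hi
  have hT : T2.eval τ 0 = renorm τ := by
    unfold renorm; rw [if_neg h0.not_gt, if_pos ⟨h0, h1⟩]
    simp [T2, eval_tau, ZW.val]; rw [beta_eq]
    linear_combination (-(ω - 1 - τ) * (ω + 1)) * omega_sq
  rw [hT] at hl hs
  refine ⟨_, ?_, hl, i, hs⟩
  have : ((S2.sg σ).real τ 0).η = β ^ 3 := val_beta_cube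
  rw [this]; exact pow_lt_one₀ beta_pos.le beta_lt_one (by norm_num)

theorem link₃ (σ : Bool) {τ : ℝ} (h0 : β < τ) (h1 : τ < 1) :
    ∃ S : Sim, S.η < 1 ∧ Link (baseS σ τ) ((baseS (!σ) (renorm τ)).sim S) w3 ∧
      ∃ i, StrictAt (baseS σ τ) ((baseS (!σ) (renorm τ)).sim S) w3 i := by
  obtain ⟨w, hw⟩ := seg_rep (τ := τ) (a := rB) (b := ⟨1, 0⟩) (by rwa [val_rB]) (by rwa [val_one])
  obtain ⟨i, hi⟩ := strict3 σ
  have hl := link_of_rtOK hw (base_disjoint (beta_pos.trans h0) h1) (rt3 σ) (by decide) (by decide)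
  have hs := strictAt_of_chkStrict hw hi
  have hT : T3.eval τ 0 = renorm τ := by
    unfold renorm
    rw [if_neg (beta_sq_lt_beta.trans h0).not_gt, if_neg (fun h => absurd h.2 h0.not_gt),
      if_pos ⟨h0, h1⟩]
    simp [T3, eval_tau, ZW.val]; linear_combination (-(1 - τ)) * omega_sq
  rw [hT] at hl hs
  refine ⟨_, ?_, hl, i, hs⟩
  have : ((S3.sg σ).real τ 0).η = β ^ 2 := val_rB2
  rw [this]; exact pow_lt_one₀ beta_pos.le beta_lt_one (by norm_num)

/-- If the next shape is zero, the data are placeholders. Otherwise either the shape increases, on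
the first branch, or the step is strict at some atom; a cycle must therefore contain a strict step.
-/
theorem base_link (x : BaseState) : ∃ (y : BaseState) (S : Sim) (w : Fin 3 → List (Fin 3)),
    y.1.2 = renorm x.1.2 ∧ (y.1.2 ≠ 0 → S.η < 1 ∧
      Link (baseS x.1.1 x.1.2) ((baseS y.1.1 y.1.2).sim S) w ∧
      (w = w1 ∧ x.1.2 < y.1.2 ∨ (w = w2 ∨ w = w3) ∧
        ∃ i, StrictAt (baseS x.1.1 x.1.2) ((baseS y.1.1 y.1.2).sim S) w i)) := by
  obtain ⟨⟨σ, τ⟩, h0, h1, hσ⟩ := x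
  simp only at h0 h1 hσ
  by_cases hr : renorm τ = 0
  · refine ⟨⟨(false, 0), le_rfl, one_pos, fun _ => rfl⟩, ⟨1, 0, false, 0, one_pos⟩, w1, hr.symm,
      fun h => absurd rfl h⟩
  obtain ⟨r0, r1⟩ := renorm_mem h0 h1
  have good : ∀ σ', Good σ' (renorm τ) := fun σ' => ⟨r0, r1, fun h => absurd h hr⟩
  have hb := beta_sq_lt_beta
  have h0' : 0 < τ := h0.lt_of_ne' fun h => hr (by
    subst h; unfold renorm; rw [if_pos (pow_pos beta_pos 2), mul_zero])
  rcases lt_trichotomy τ (β ^ 2) with h2 | rfl | h2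
  · obtain ⟨S, hS, hl⟩ := link₁ σ h0' h2
    refine ⟨⟨(σ, renorm τ), good σ⟩, S, w1, rfl, fun _ => ⟨hS, hl, .inl ⟨rfl, ?_⟩⟩⟩
    change τ < renorm τ
    unfold renorm
    rw [if_pos h2]
    exact lt_mul_of_one_lt_left h0' (one_lt_pow₀ omega_gt_one (by norm_num))
  · refine absurd ?_ hr
    unfold renorm
    rw [if_neg (lt_irrefl _), if_neg (fun h => lt_irrefl _ h.1), if_neg fun h => h.1.not_gt hb]
  rcases lt_trichotomy τ β with h3 | rfl | h3
  · obtain ⟨S, hS, hl, hs⟩ := link₂ σ h2 h3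
    exact ⟨⟨(!σ, renorm τ), good _⟩, S, w2, rfl, fun _ => ⟨hS, hl, .inr ⟨.inl rfl, hs⟩⟩⟩
  · refine absurd ?_ hr
    unfold renorm
    rw [if_neg hb.not_gt, if_neg (fun h => lt_irrefl _ h.2), if_neg (fun h => lt_irrefl _ h.1)]
  · obtain ⟨S, hS, hl, hs⟩ := link₃ σ h3 h1
    exact ⟨⟨(!σ, renorm τ), good _⟩, S, w3, rfl, fun _ => ⟨hS, hl, .inr ⟨.inr rfl, hs⟩⟩⟩

/-- None of the three path systems visits all atoms from every start, but any of them followed by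
the second or third one does. -/
theorem full_comp : ∀ a ∈ [w1, w2, w3], ∀ b ∈ [w2, w3], ∀ i j, i ∈ (b j).flatMap a := by
  decide +kernel

/-- On the open branches `renorm` is positive, so only β² and β have to be considered. -/
theorem induced_zero_of_renorm {σ : Bool} {τ : ℝ} (h0 : 0 < τ) (h1 : τ < 1) (h : renorm τ = 0) :
    ∃ (S : Sim) (w : Fin 2 → List (Fin 3)),
      SubDomain.IsInduced (baseS σ τ) ⟨2, zeroT.sim S, w⟩ := by
  have hω := omega_gt_one
  rcases lt_trichotomy τ (β ^ 2) with h2 | rfl | h2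
  · unfold renorm at h
    rw [if_pos h2] at h
    exact absurd h (mul_pos (by positivity) h0).ne'
  · obtain ⟨S, Qs, -, hQ⟩ := tiles_betaSq σ
    exact ⟨S, _, hQ.1 _ (List.mem_singleton_self _)⟩
  rcases lt_trichotomy τ β with h3 | rfl | h3
  · unfold renorm at h
    rw [if_neg h2.not_gt, if_pos ⟨h2, h3⟩] at h
    exact absurd h (mul_pos (by positivity) (by linarith)).ne'
  · obtain ⟨S, Qs, -, hQ⟩ := tiles_beta σ
    exact ⟨S, _, hQ.1 _ (List.mem_singleton_self _)⟩
  · unfold renorm at h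
    rw [if_neg h2.not_gt, if_neg (fun h => absurd h.2 h3.not_gt), if_pos ⟨h3, h1⟩] at h
    exact absurd h (mul_pos (by positivity) (by linarith)).ne'

/-- One induction of the two-atom triangle visits every atom, and a further double induction is
strict at one atom; the composite has both properties. -/
theorem selfInduced_zero (S : Sim) : ∃ G w, SelfInduced (zeroT.sim S) G w := by
  obtain ⟨w, hw⟩ := zero_rep
  have hz : (vecDom (seg ⟨0, 0⟩ ⟨0, 0⟩) zeroD).real (Vec.ev w) = zeroT := by
    rw [hw.real, real_zeroD]
  obtain ⟨G, hG, h1⟩ := induced_zero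
  have hd := zeroT_disjoint
  rw [← hz] at hd
  have h2 := chkSub_spec hd sub00
  have hs := chkStrict_spec (w := w) strict00
  rw [real_zeroSub hw, hz] at h2
  rw [hz] at hs
  change StrictAt zeroT ((vecDom (seg ⟨0, 0⟩ ⟨0, 0⟩) (S11.dom zeroD)).real (Vec.ev w))
    (fun j => (w0 j).flatMap w0) 1 at hs
  rw [hw.real, DSim.real_dom, real_zeroD] at hs
  set G' := S11.real 0 0 with hG'
  have l1 : Link zeroT (zeroT.sim G) w0 := ⟨zeroT_disjoint, h1, by decide, by decide⟩
  have l2 : Link zeroT (zeroT.sim G') fun j => (w0 j).flatMap w0 :=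
    ⟨zeroT_disjoint, h2, by decide, by decide⟩
  have f1 : ∀ i j, i ∈ w0 j := by decide
  have l := (l1.comp (l2.sim G)).sim S
  have hst : ∀ i, StrictAt zeroT ((zeroT.sim G').sim G) _ i :=
    l1.strictAt_of_full (l2.sim G) f1 (hs.sim G)
  have hst' := fun i => (hst i).sim S
  rw [sim_sim, sim_sim] at l hst'
  refine ⟨_, _, l.selfInduced le_rfl ?_ zeroT_domain_nonempty
    (Link.full_comp_left f1 (l2.sim G)) hst'⟩
  have e1 : G'.η = β ^ 4 := by
    change (ZW.mk 5 (-3)).val = _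
    rw [show β ^ 4 = (β ^ 2) ^ 2 by ring, beta_sq, beta_eq]; simp [ZW.val]
    linear_combination -omega_sq
  change S.η * G.η * G'.η < S.η
  rw [mul_assoc, hG, e1, ← pow_add]
  exact mul_lt_of_lt_one_right S.η_pos (pow_lt_one₀ beta_pos.le beta_lt_one (by norm_num))

/-! ### Self-induced dressed domains inside base triangles -/

theorem exists_selfInduced {σ : Bool} {τ : ℝ} (h : Good σ τ) (h0 : 0 < τ)
    (hτ : EventuallyPeriodic renorm τ) (S : Sim) :
    ∃ (m : ℕ) (Z : DressedDomain m) (w : Fin m → List (Fin 3)) (G : Sim)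
      (v : Fin m → List (Fin m)),
      SubDomain.IsInduced ((baseS σ τ).sim S) ⟨m, Z, w⟩ ∧ SelfInduced Z G v := by
  choose next T W hn hT using base_link
  let x : ℕ → BaseState := fun i => next^[i] ⟨(σ, τ), h⟩
  have hx : ∀ i, x (i + 1) = next (x i) := fun i => Function.iterate_succ_apply' _ _ _
  let G : ℕ → Sim := fun i => Nat.rec S (fun i g => g.comp (T (x i))) i
  have hG : ∀ i, G (i + 1) = (G i).comp (T (x i)) := fun i => rfl
  let t : ℕ → ℝ := fun i => (x i).1.2
  let X : ℕ → DressedDomain 3 := fun i => (baseS (x i).1.1 (x i).1.2).sim (G i)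
  have hX : ∀ i, ((baseS (x (i + 1)).1.1 (x (i + 1)).1.2).sim (T (x i))).sim (G i) = X (i + 1) :=
    fun i => by rw [sim_sim, ← hG]
  have hstep : ∀ i, t (i + 1) ≠ 0 → (T (x i)).η < 1 ∧ Link (X i) (X (i + 1)) (W (x i)) ∧
      (W (x i) = w1 ∧ t i < t (i + 1) ∨ (W (x i) = w2 ∨ W (x i) = w3) ∧
        ∃ a, StrictAt (X i) (X (i + 1)) (W (x i)) a) := by
    intro i hi
    simp only [t, hx] at hi ⊢
    obtain ⟨h1, h2, h3⟩ := hT (x i) hi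
    rw [← hX, hx]
    exact ⟨h1, h2.sim _, h3.imp_right fun h => ⟨h.1, h.2.imp fun a ha => ha.sim _⟩⟩
  have reach : ∀ i, (∀ j ≤ i, t j ≠ 0) → ∀ (m : ℕ) (Z : DressedDomain m) (w : Fin m → List (Fin 3)),
      SubDomain.IsInduced (X i) ⟨m, Z, w⟩ → ∃ w', SubDomain.IsInduced (X 0) ⟨m, Z, w'⟩ := by
    intro i
    induction i with
    | zero => exact fun _ m Z w hw => ⟨w, hw⟩
    | succ i ih =>
      intro hi m Z w hw
      obtain ⟨-, hl, -⟩ := hstep i (hi _ le_rfl)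
      exact ih (fun j hj => hi j (by omega)) m Z _ (hl.induced.comp hl.disjoint hw)
  by_cases hz : ∃ i, t i = 0
  · classical
    -- Just before the first zero the shape is β² or β, and the triangle there induces the two-atom
    -- triangle.
    set i := Nat.find hz with hi
    have hi0 : t i = 0 := Nat.find_spec hz
    have hpos : i ≠ 0 := by
      intro e
      rw [e] at hi0
      exact h0.ne' hi0
    obtain ⟨j, hj⟩ := Nat.exists_eq_succ_of_ne_zero hpos
    have hlt : ∀ k ≤ j, t k ≠ 0 := fun k hk => Nat.find_min hz (by omega)
    have hr : renorm (t j) = 0 := by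
      rw [← hi0, hj]
      change _ = (x (j + 1)).1.2
      rw [hx, hn]
    obtain ⟨R, w, hw⟩ := induced_zero_of_renorm (σ := (x j).1.1)
      ((x j).2.1.lt_of_ne' (hlt j le_rfl)) (x j).2.2.1 hr
    have hw' : SubDomain.IsInduced (X j) ⟨2, (zeroT.sim R).sim (G j), w⟩ :=
      (conj_sim _ _).isInduced (conj_sim _ _) hw
    rw [sim_sim] at hw'
    obtain ⟨w', hw'⟩ := reach j hlt _ _ _ hw'
    obtain ⟨F, v, hF⟩ := selfInduced_zero ((G j).comp R)
    exact ⟨2, _, w', F, v, hw', hF⟩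
  push Not at hz
  obtain ⟨k, N, hkN, hper⟩ := exists_iterate_eq (f := renorm) (g := next) (t := fun x => x.1.2)
    (s := fun x => x.1.1) (fun x y h1 h2 => Subtype.ext (Prod.ext h2 h1)) hn
    (x := ⟨(σ, τ), h⟩) hτ
  obtain ⟨d, hd, rfl⟩ : ∃ d, 0 < d ∧ N = d + k := ⟨N - k, by omega, by omega⟩
  have hper1 : ∀ i, k ≤ i → x (i + d) = x i := by
    intro i hi
    obtain ⟨j, rfl⟩ := Nat.exists_eq_add_of_le hi
    change next^[k + j + d] _ = next^[k + j] _
    rw [show k + j + d = j + (d + k) by ring, show k + j = j + k by ring,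
      Function.iterate_add_apply, ← hper, ← Function.iterate_add_apply]
  have hper : ∀ c i, k ≤ i → x (i + c * d) = x i := by
    intro c i hi
    induction c with
    | zero => simp
    | succ c ih => rw [← ih, add_mul, one_mul, ← add_assoc, hper1 _ (by omega)]
  have links : ∀ i j, i < j → ∃ w, Link (X i) (X j) w := by
    intro i j hij
    induction j, hij using Nat.le_induction with
    | base => exact ⟨_, (hstep i (hz _)).2.1⟩
    | succ j _ ih =>
      obtain ⟨w, hw⟩ := ih
      exact ⟨_, hw.comp (hstep j (hz _)).2.1⟩
  have hη : ∀ i j, i < j → (G j).η < (G i).η := by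
    intro i j hij
    refine strictAnti_nat_of_succ_lt (f := fun i => (G i).η) (fun n => ?_) hij
    change (G n).η * (T (x n)).η < (G n).η
    exact mul_lt_of_lt_one_right (G n).η_pos (hstep n (hz _)).1
  -- A cycle consisting of first branches only would make the shape parameter strictly increase.
  obtain ⟨q, hq, hqs⟩ : ∃ q, k ≤ q ∧ W (x q) ≠ w1 := by
    by_contra! hall
    have hmono : ∀ j, t k < t (k + (j + 1)) := by
      have h1 : ∀ j, t (k + j) < t (k + j + 1) := fun j => by
        rcases (hstep (k + j) (hz _)).2.2 with h | ⟨h, -⟩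
        · exact h.2
        · rw [hall _ (by omega)] at h
          exact absurd h (by decide)
      intro j
      induction j with
      | zero => exact h1 0
      | succ j ih => exact ih.trans (h1 (j + 1))
    have := hmono (d - 1)
    rw [Nat.sub_add_cancel hd] at this
    simp only [t, hper1 k le_rfl, lt_irrefl] at this
  have hqc : ∀ c, W (x (q + c * d)) ≠ w1 := fun c => by rwa [hper c q hq]
  -- The steps p and p + 1 = q + 2d give paths that visit every atom, step q + 4d is strict, and
  -- stage p + 6d has the same state as stage p. The multiples of d leave room for the connecting
  -- links.
  obtain ⟨p, hp⟩ : ∃ p, q + 2 * d = p + 1 := ⟨q + 2 * d - 1, by omega⟩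
  have hstrict : ∀ c, 2 ≤ c → (W (x (q + c * d)) = w2 ∨ W (x (q + c * d)) = w3) ∧
      ∃ a, StrictAt (X (q + c * d)) (X (q + c * d + 1)) (W (x (q + c * d))) a := fun c _ =>
    (hstep _ (hz _)).2.2.resolve_left fun h => hqc c h.1
  have hmem : ∀ i, W (x i) ∈ [w1, w2, w3] := fun i => by
    rcases (hstep i (hz _)).2.2 with h | ⟨h | h, -⟩ <;> simp [h]
  have l1 := (hstep p (hz _)).2.1.comp (hstep (p + 1) (hz _)).2.1
  have f1 : ∀ i j, i ∈ (W (x (p + 1)) j).flatMap (W (x p)) :=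
    full_comp _ (hmem p) _ (by rw [← hp]; rcases (hstrict 2 le_rfl).1 with h | h <;> simp [h])
  obtain ⟨v2, l2⟩ := links (p + 2) (q + 4 * d) (by omega)
  obtain ⟨-, a, ha⟩ := hstrict 4 (by norm_num)
  have l3 := (hstep (q + 4 * d) (hz _)).2.1
  obtain ⟨v4, l4⟩ := links (q + 4 * d + 1) (p + 6 * d) (by omega)
  have l12 := l1.comp l2
  have f12 := Link.full_comp_left f1 l2
  have s123 := l12.strictAt_of_full l3 f12 ha
  have l123 := l12.comp l3
  have f123 := Link.full_comp_left f12 l3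
  have s := fun i => l123.strictAt_comp l4 (s123 i)
  have l := l123.comp l4
  have f := Link.full_comp_left f123 l4
  have hpk : k ≤ p := by omega
  have hX6 : X (p + 6 * d) = (baseS (x p).1.1 (x p).1.2).sim (G (p + 6 * d)) := by
    simp only [X, hper 6 p hpk]
  rw [hX6] at l s
  obtain ⟨w, hw⟩ := links 0 p (by omega)
  exact ⟨3, X p, w, _, _, hw.induced, l.selfInduced (by norm_num) (hη _ _ (by omega))
    (base_domain_nonempty (x p).2) f s⟩

theorem exists_ergodic_base {τ : ℝ} (h0 : 0 < τ) (h1 : τ < 1) (hτ : EventuallyPeriodic renorm τ)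
    (S : Sim) : ∃ ν : Measure Plane, IsProbabilityMeasure ν ∧
      Ergodic ((baseS false τ).sim S).map ν ∧ ν ((baseS false τ).sim S).domainᶜ = 0 ∧
      ν (Function.periodicPts ((baseS false τ).sim S).map) = 0 := by
  obtain ⟨m, Z, w, G, v, hZ, hG⟩ := exists_selfInduced ⟨h0.le, h1, fun _ => rfl⟩ h0 hτ S
  obtain ⟨ν, hν, herg, hdom, hper⟩ := hG.exists_ergodic
  have hc := conj_sim S (baseS false τ)
  obtain ⟨μ, hμ, hμe, hμ0⟩ := exists_ergodic_lift (hc.atomsDisjoint (base_disjoint h0 h1))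
    (hc.bijOn (base_bijOn h0 h1)) hZ herg hdom hper
  exact ⟨μ, hμ, hμe, measure_mono_null (Set.compl_subset_compl.2 fun x hx => hx.1.1) hμ0,
    measure_mono_null (fun x hx => fun hx' => hx'.1.2 hx) hμ0⟩

theorem DressedDomain.IsMerger.map_eq {n m : ℕ} {Z : DressedDomain m} {X : DressedDomain n}
    (h : Z.IsMerger X) (hX : X.AtomsDisjoint) : Z.map = X.map := by
  funext x
  by_cases hx : x ∈ X.domain
  · obtain ⟨i, hi⟩ := mem_iUnion.1 hx
    obtain ⟨j, hj, e⟩ := h.2.2 i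
    rw [map_of_mem h.1 (hj hi), map_of_mem hX hi, e]
  · rw [map_of_notMem hx, map_of_notMem (by rwa [h.2.1])]

theorem exists_ergodic_rhombus {s t : ℝ} (h : (s, t) ∈ PiStar) {m : ℕ} {F : DressedDomain m}
    {w : Fin m → List (Fin 8)} (hF : SubDomain.IsInduced (mapF s t) ⟨m, F, w⟩)
    (hν : ∃ ν : Measure Plane, IsProbabilityMeasure ν ∧ Ergodic F.map ν ∧ ν F.domainᶜ = 0 ∧
      ν (Function.periodicPts F.map) = 0) :
    (component (rhombusβ s t) F.domain).Nonempty ∧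
      ∃ μ : Measure (ℝ × ℝ), IsProbabilityMeasure μ ∧ Ergodic (rhombusβ s t).map μ ∧
        μ (component (rhombusβ s t) F.domain)ᶜ = 0 := by
  obtain ⟨ν, hν, he, hd, hp⟩ := hν
  have hR := (rhombus_tiled h).1
  have hX := ((rhombus_recursivelyTiles h).1 _ (List.mem_singleton_self _)).comp hR hF
  obtain ⟨μ, hμ, hμe, hμ0⟩ := exists_ergodic_lift hR (rhombus_bijOn h) hX he hd hp
  refine ⟨?_, μ, hμ, hμe, hμ0⟩
  by_contra! hemp
  change μ (component (rhombusβ s t) F.domain)ᶜ = 0 at hμ0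
  rw [hemp, Set.compl_empty, measure_univ] at hμ0
  exact one_ne_zero hμ0

theorem ergodic_components {s t : ℝ} (h : (s, t) ∈ PiStar) (hs : s ∈ Q5) (ht : t ∈ Q5)
    (E : Fin 3 → Set Plane) (hE : E = ![component (rhombusβ s t) (mapF₁ s t).domain,
      component (rhombusβ s t) (mapF₂ s t).domain, component (rhombusβ s t) (mapF₃ s t).domain]) :
    ∀ i, (E i).Nonempty ∧ ∃ μ : Measure (ℝ × ℝ), IsProbabilityMeasure μ ∧
      Ergodic (rhombusβ s t).map μ ∧ μ (E i)ᶜ = 0 := by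
  subst hE
  obtain ⟨⟨a1, b1⟩, ⟨a2, b2⟩, a3, b3'⟩ := tau_bounds h
  have b3 := b3'.trans (pow_lt_one₀ beta_pos.le beta_lt_one two_ne_zero)
  have hp := Q5_sub hs (Q5_pow beta_mem_Q5 2)
  have hq : ∀ k, ω ^ k * √5 ∈ Q5 := fun k => Q5_mul (Q5_pow omega_mem_Q5 k) sqrt5_mem_Q5
  have key : ∀ τ, 0 < τ → τ < 1 → τ ∈ Q5 → ∀ S, _ := fun τ h0 h1 hτ S =>
    exists_ergodic_base h0 h1 (eventuallyPeriodic_of_mem_Q5 h0.le h1 hτ) S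
  have hind := (mapF_recursivelyTiles h).1
  have i3 := hind ⟨4, mapF₃ s t, path₃⟩ (by simp)
  have k1 := exists_ergodic_rhombus h (hind ⟨3, mapF₁ s t, path₁⟩ (by simp))
    (by rw [mapF₁_eq]; exact key _ a1 b1 (Q5_mul (hq 6) hp) _)
  have k2 := exists_ergodic_rhombus h (hind ⟨3, mapF₂ s t, path₂⟩ (by simp))
    (by rw [mapF₂_eq]; exact key _ a2 b2 (Q5_mul (hq 4) ht) _)
  -- Merging changes neither the map nor the domain, so the measure found for the merged domain
  -- serves the four-atom one.
  have k3 := exists_ergodic_rhombus h i3 (by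
    rw [← (merger_mapC₃ h).map_eq i3.1, ← (merger_mapC₃ h).2.1, mapC₃_eq]
    exact key _ a3 b3 (Q5_mul (hq 4) hp) _)
  intro i
  fin_cases i
  exacts [k1, k2, k3]

end RhombusPWI

/-! ### Assembly of the theorem -/

theorem mainTheorem3 :
    ∃ (F : ℝ → ℝ → RhombusPWI.DressedDomain 8) (w : Fin 8 → List (Fin 4))
      (F₁ : ℝ → ℝ → RhombusPWI.DressedDomain 3) (w₁ : Fin 3 → List (Fin 8))
      (F₂ : ℝ → ℝ → RhombusPWI.DressedDomain 3) (w₂ : Fin 3 → List (Fin 8))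
      (F₃ : ℝ → ℝ → RhombusPWI.DressedDomain 4) (w₃ : Fin 4 → List (Fin 8))
      (C₃ : ℝ → ℝ → RhombusPWI.DressedDomain 3)
      (P : Fin 7 → ℝ → ℝ → RhombusPWI.Tile) (v : Fin 7 → List (Fin 8)),
      -- parametric dressed domains and parametric tiles
      RhombusPWI.IsParametric F ∧ RhombusPWI.IsParametric F₁ ∧ RhombusPWI.IsParametric F₂ ∧
      RhombusPWI.IsParametric F₃ ∧ RhombusPWI.IsParametric C₃ ∧
      (∀ i, RhombusPWI.IsParametricTile (P i)) ∧
      -- the parameter domain is the quadrilateral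
      RhombusPWI.bifurcationFreeSub F F₁ w₁ ∩ RhombusPWI.bifurcationFreeSub F F₂ w₂ ∩
        RhombusPWI.bifurcationFreeSub F F₃ w₃ ∩
        (⋂ i, RhombusPWI.bifurcationFreeTile F (P i) (v i)) = RhombusPWI.PiStar ∧
      RhombusPWI.PiStar ⊆ RhombusPWI.bifurcationFreeSub RhombusPWI.rhombusβ F w ∧
      RhombusPWI.PiStar ⊆ RhombusPWI.bifurcationFree RhombusPWI.rhombusβ ∧
      -- the eight atoms of `F` are distinguished by their return paths
      Function.Injective w ∧
      -- two atoms of `F₃`, with different return paths and different return times on the rhombus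
      w₃ 1 ≠ w₃ 3 ∧
      ((w₃ 1).map fun i => (w i).length).sum ≠ ((w₃ 3).map fun i => (w i).length).sum ∧
      (∀ s t : ℝ, (s, t) ∈ RhombusPWI.PiStar →
        -- the four atoms tile the rhombus
        (RhombusPWI.rhombusβ s t).AtomsDisjoint ∧
        (RhombusPWI.rhombusβ s t).domain = (RhombusPWI.rhombusTile s t).region ∧
        -- `F` is induced on the atom `R₁`, and the return orbits of its atoms tile the rhombus
        (F s t).domain = ((RhombusPWI.rhombusβ s t).tile 0).region ∧
        RhombusPWI.RecursivelyTiles (RhombusPWI.rhombusβ s t) [⟨8, F s t, w⟩] [] ∧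
        -- `F₁`, `F₂`, `F₃` and the seven periodic tiles recursively tile `F`
        RhombusPWI.RecursivelyTiles (F s t)
          [⟨3, F₁ s t, w₁⟩, ⟨3, F₂ s t, w₂⟩, ⟨4, F₃ s t, w₃⟩]
          (List.ofFn fun i => ⟨P i s t, v i⟩) ∧
        (P 0 s t).IsRegularPentagon ∧ (P 1 s t).IsRegularPentagon ∧
        (P 2 s t).IsRegularPentagon ∧ (P 3 s t).IsRegularPentagon ∧
        (P 4 s t).IsRegularPentagon ∧ (P 5 s t).IsTrapezoid ∧ (P 6 s t).IsRhombus ∧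
        -- shape parameters
        (∃ η, RhombusPWI.DressedDomain.IsSimilar η
          (RhombusPWI.baseTriangle (RhombusPWI.ω ^ 6 * √5 * (s - RhombusPWI.β ^ 2))) (F₁ s t)) ∧
        (∃ η, RhombusPWI.DressedDomain.IsSimilar η
          (RhombusPWI.baseTriangle (RhombusPWI.ω ^ 4 * √5 * t)) (F₂ s t)) ∧
        ((F₃ s t).tile 1).length = 5 ∧ ((F₃ s t).tile 3).length = 4 ∧
        (F₃ s t).iso 1 = (F₃ s t).iso 3 ∧
        (C₃ s t).IsMerger (F₃ s t) ∧
        (∃ η, RhombusPWI.DressedDomain.IsSimilar η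
          (RhombusPWI.baseTriangle (RhombusPWI.ω ^ 4 * √5 * (s - RhombusPWI.β ^ 2))) (C₃ s t)) ∧
        -- one further induction on `F₃`
        (∃ Z : RhombusPWI.DressedDomain 3, RhombusPWI.Induces (C₃ s t) Z ∧
          ∃ η, RhombusPWI.DressedDomain.IsSimilar η
            (RhombusPWI.baseTriangle (RhombusPWI.ω ^ 6 * √5 * (s - RhombusPWI.β ^ 2))) Z) ∧
        -- both parameters are in the field iff the shape parameters are eventually periodic
        ((s ∈ RhombusPWI.Q5 ∧ t ∈ RhombusPWI.Q5) ↔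
          RhombusPWI.EventuallyPeriodic RhombusPWI.renorm
            (RhombusPWI.ω ^ 6 * √5 * (s - RhombusPWI.β ^ 2)) ∧
          RhombusPWI.EventuallyPeriodic RhombusPWI.renorm (RhombusPWI.ω ^ 4 * √5 * t) ∧
          RhombusPWI.EventuallyPeriodic RhombusPWI.renorm
            (RhombusPWI.ω ^ 4 * √5 * (s - RhombusPWI.β ^ 2))) ∧
        -- renormalizability
        (s ∈ RhombusPWI.Q5 → t ∈ RhombusPWI.Q5 →
          RhombusPWI.SelfSimilar (F₁ s t) ∧ RhombusPWI.SelfSimilar (F₂ s t) ∧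
          RhombusPWI.SelfSimilar (C₃ s t) ∧ RhombusPWI.Renormalizable (F s t) ∧
          RhombusPWI.Renormalizable (RhombusPWI.rhombusβ s t)) ∧
        -- three disjoint invariant components of the exceptional set
        (∀ E : Fin 3 → Set (ℝ × ℝ),
          E = ![RhombusPWI.component (RhombusPWI.rhombusβ s t) (F₁ s t).domain,
            RhombusPWI.component (RhombusPWI.rhombusβ s t) (F₂ s t).domain,
            RhombusPWI.component (RhombusPWI.rhombusβ s t) (F₃ s t).domain] →
          (⋃ i, E i) = RhombusPWI.exceptionalSet (RhombusPWI.rhombusβ s t) ∧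
          Pairwise (fun i j => Disjoint (E i) (E j)) ∧
          (∀ i, (RhombusPWI.rhombusβ s t).map '' E i = E i) ∧
          (s ∈ RhombusPWI.Q5 → t ∈ RhombusPWI.Q5 →
            ∀ i, (E i).Nonempty ∧ ∃ μ : MeasureTheory.Measure (ℝ × ℝ),
              MeasureTheory.IsProbabilityMeasure μ ∧
              Ergodic (RhombusPWI.rhombusβ s t).map μ ∧ μ (E i)ᶜ = 0))) ∧
      -- the renormalization function of the base triangles
      (∀ τ : ℝ, 0 ≤ τ → τ < 1 →
        (0 ≤ RhombusPWI.renorm τ ∧ RhombusPWI.renorm τ < 1) ∧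
        RhombusPWI.InducesBase (RhombusPWI.baseTriangle τ) (RhombusPWI.renorm τ) ∧
        (0 < τ → RhombusPWI.InducesBase
          (RhombusPWI.opposite (RhombusPWI.baseTriangle τ)) (RhombusPWI.renorm τ))) := by
  refine ⟨RhombusPWI.mapF, RhombusPWI.returnPath, RhombusPWI.mapF₁, RhombusPWI.path₁,
    RhombusPWI.mapF₂, RhombusPWI.path₂, RhombusPWI.mapF₃, RhombusPWI.path₃, RhombusPWI.mapC₃,
    RhombusPWI.tileP, RhombusPWI.perPath, RhombusPWI.isParametric_real _,
    RhombusPWI.isParametric_real _, RhombusPWI.isParametric_real _,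
    RhombusPWI.isParametric_real _, RhombusPWI.isParametric_real _,
    fun i => RhombusPWI.isParametricTile_real _, RhombusPWI.bifurcation_eq,
    RhombusPWI.piStar_subset_mapF, RhombusPWI.piStar_subset_rhombus, by decide, by decide,
    by decide, fun s t h => ?_, fun τ h0 h1 => ⟨RhombusPWI.renorm_mem h0 h1,
      RhombusPWI.inducesBase (σ := false) ⟨h0, h1, fun _ => rfl⟩,
      fun h => RhombusPWI.inducesBase (σ := true) ⟨h0, h1, fun e => absurd e h.ne'⟩⟩⟩
  refine ⟨(RhombusPWI.rhombus_tiled h).1, (RhombusPWI.rhombus_tiled h).2, RhombusPWI.mapF_domain h,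
    RhombusPWI.rhombus_recursivelyTiles h, RhombusPWI.mapF_recursivelyTiles h,
    RhombusPWI.tileP_pentagon h 0 (by decide), RhombusPWI.tileP_pentagon h 1 (by decide),
    RhombusPWI.tileP_pentagon h 2 (by decide), RhombusPWI.tileP_pentagon h 3 (by decide),
    RhombusPWI.tileP_pentagon h 4 (by decide), RhombusPWI.tileP_trapezoid h,
    RhombusPWI.tileP_rhombus h, (RhombusPWI.isSimilar_maps s t).1,
    (RhombusPWI.isSimilar_maps s t).2.1, rfl, rfl, RhombusPWI.mapF₃_iso s t,
    RhombusPWI.merger_mapC₃ h, (RhombusPWI.isSimilar_maps s t).2.2,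
    RhombusPWI.induces_mapC₃ h, RhombusPWI.mem_Q5_iff h, fun hs ht => ?_, fun E hE => ?_⟩
  · obtain ⟨h1, h2, h3⟩ := RhombusPWI.selfSimilar_maps h hs ht
    exact ⟨h1, h2, h3, RhombusPWI.renormalizable_maps h hs ht⟩
  · obtain ⟨h1, h2, h3⟩ := RhombusPWI.rhombus_components h E hE
    exact ⟨h1, h2, h3, fun hs ht => RhombusPWI.ergodic_components h hs ht E hE⟩
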